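/- Let $f:\mathbb R\to\mathbb R$ be odd and holomorphic (it suffices: real analytic near $0$) with $f'(0)=0$, $f'''(0)>0$. **Spaces.** Let $X=\mathbb R^2$, and let $Y$ be the space of pairs $W^c=(w^c,w_1^c)$ of $L^2(-\pi,\pi)$ sine series $\sum_{k\ge2}a_k\sin kx$, with the $L^2$ norm. Put $A=\begin{pmatrix}0&1\\1&0\end{pmatrix}$ on $X$, with eigenspaces $X^s$ (eigenvalue $-1$) and $X^u$ (eigenvalue $1$). Put $L=(-1-\partial_{xx})^{1/2}$ and $J=\begin{pmatrix}0&L\\-L&0\end{pmatrix}$, and let $Y_1=D(J)$ with the graph norm. For $\rho>0$ let $B_\rho=\{(W^h,W^c)\in X\times Y_1:|W^h|+|W^c|<\rho\}$. **The rescaled Klein–Gordon system.** For $W=(W^h,W^c)=(w^h,w^h_1,w^c,w^c_1)$ and $g=f(\varepsilon w^h\sin x+\varepsilon w^c)$ write $P_hg=\frac1\pi\int_{-\pi}^{\pi}g\sin x\,dx$ and $P_cg=g-(P_hg)\sin x$, and let $$W^h_\tau=AW^h+F(W,\varepsilon),\qquad W^c_\tau=\tfrac1\varepsilon JW^c+\varepsilon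 G(W,\varepsilon),\tag{S}$$ $$F=\Big(\tfrac1{\sqrt{1-\varepsilon^2}}-1\Big)AW^h+\Big(0,\,-\tfrac{1}{\sqrt{1-\varepsilon^2}\,\varepsilon^3}P_hg\Big),\qquad G=\tfrac{1}{1-\varepsilon^2}L^{-1}\big(0,\;w^c-\varepsilon^{-3}P_cg\big).$$ For a nonlinearity $N=(N^h,N^c)$, "the system with nonlinearity $N$" is $W^h_\tau=AW^h+N^h(W)$, $W^c_\tau=\frac1\varepsilon JW^c+N^c(W)$. Solutions are continuous with values in $X\times Y_1$ and differentiable with values in $X\times Y$. **Normal form steps.** Let $N_1=(F,\varepsilon G)$ and, for constants $K,K_1>0$, $\rho_k=2K-(k-1)K_1\varepsilon$. For $k\ge1$, $N_{k+1}$ arises from $N_k$ as follows. Let $\gamma=(\gamma_0,\gamma_1)=N_k^c(\cdot,0):X\to Y_1$. Let $\Phi_k:(z,z_1,\zeta,\zeta_1)\mapsto(z^+,z_1^+,\zeta^+,\zeta_1^+)$ satisfy the following implicit equations, in which $\gamma$ and its partial derivatives are evaluated at $(z,z_1^+)$ and $\langle u,v\rangle=\int_{-\pi}^{\pi}(uv+u_xv_x)\,dx$: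 $$z^+=z-\varepsilon^2\big(\langle L^{-1}D_2\gamma_1,\zeta_1^+\rangle+\langle L^{-1}D_2\gamma_0,\zeta\rangle\big),\qquad z_1^+=z_1+\varepsilon^2\big(\langle L^{-1}D_1\gamma_1,\zeta_1^+\rangle+\langle L^{-1}D_1\gamma_0,\zeta\rangle\big),$$ $$\zeta^+=\zeta-\varepsilon L^{-1}\gamma_1,\qquad \zeta_1^+=\zeta_1+\varepsilon L^{-1}\gamma_0 .$$ Here $N_k$ is analytic on $B_{\rho_k}$ and $\Phi_k$ is an analytic diffeomorphism from $B_{\rho_k-K_1\varepsilon/2}$ onto a set containing $B_{\rho_{k+1}}$, with $\Phi_k(Z)-Z\in B_{K_1\varepsilon/2}$. The map $N_{k+1}$, analytic on $B_{\rho_{k+1}}$, is the nonlinearity of the transformed system: $\Phi_k$ maps solutions for $N_k$ in its domain to solutions for $N_{k+1}$, as long as the images lie in $B_{\rho_{k+1}}$. **Local manifolds.** A set is locally invariant in $U$ if a solution that starts on it and lies in $U$ on an interval containing $0$ stays on it. Consider a system on $B_K$. - A $C^2$ map $h_u:\{|W_s|+|W_c|<r'\}\subset X^s\times Y_1\to X^u$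 with $h_u(0)=0$ and graph in $B_K$ defines a *local center-stable manifold* $\mathcal M_{cs}$ (its graph) if the graph is locally invariant in the part of $B_K$ over the domain of $h_u$ and contains $W(0)$ for every solution $W$ on $[0,\infty)$ staying in $B_{r'}$. - *Local center-unstable manifolds* $\mathcal M_{cu}$, the graphs of maps $h_s$ from $\{|W_u|+|W_c|<r'\}\subset X^u\times Y_1$ to $X^s$, are defined in the same way with solutions on $(-\infty,0]$. - *Local center manifolds*, the graphs of maps $\Psi=(\Psi_s,\Psi_u):\{|W_c|<r\}\subset Y_1\to X^s\times X^u$, are defined in the same way with solutions on $\mathbb R$ staying in $B_r$. **Theorem.** For every $K>0$ there are $K_1,c,C>0$, $0<r\le r'$ and $0<\varepsilon_0\le c/2$ such that for every $\varepsilon\in(0,\varepsilon_0)$, with $m=[c/\varepsilon]$, the normal form steps can be carried out for $1\le k<m$, one has $\rho_m>K$, and the following hold. 1. On $B_K$ the resulting system (with nonlinearity $N_m$) has the form $$W^h_\tau=AW^h+\tilde F(W,\varepsilon),\qquad W^c_\tau=\tfrac J\varepsilon W^c+\bar G(W,\varepsilon)W^c+e^{\alpha(\varepsilon)}\tilde G(W,\varepsilon),\qquad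 \alpha(\varepsilon)=-\tfrac{c\log\sqrt2}{\varepsilon},\tag{3.14}$$ with $\tilde F,\bar G,\tilde G$ of class $C^2$, $|\tilde F|_{C^2}\le C$, $|\bar G|_{C^2}\le C$, $|\tilde G|_{C^2}\le C\varepsilon$, $\tilde F(0)=0$, $\tilde G(0)=0$, $|D\tilde F(0)|\le C\varepsilon$, $|\bar G(0)|\le C\varepsilon$. 2. System (3.14) has a local center-stable manifold $\mathcal M_{cs}^\varepsilon$, the graph of a map $h_u(\cdot,\varepsilon)$, and a local center-unstable manifold $\mathcal M_{cu}^\varepsilon$, the graph of a map $h_s(\cdot,\varepsilon)$, both of radius $r'$. The maps $h_u,h_s$ and their derivatives of order $\le2$ are bounded by $C$, and $|Dh_u(0,\varepsilon)|,|Dh_s(0,\varepsilon)|\le C\varepsilon$. 3. System (3.14) has a local center manifold $\mathcal M_c^\varepsilon$, the graph of a map $\Psi(\cdot,\varepsilon)=(\Psi_s,\Psi_u):B_r(0,Y_1)\to X^s\times X^u$. This map is $C^2$ in $W_c$, it and its derivatives of order $\le2$ are bounded by $C$ (independently of $\varepsilon$), and $$\Psi(0,\varepsilon)=0,\qquad|D\Psi(0,\varepsilon)|\le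 C\varepsilon .$$ 4. $\mathcal M_c^\varepsilon$ is the intersection of $\mathcal M_{cs}^\varepsilon$ and $\mathcal M_{cu}^\varepsilon$ in the region $|W_c|<r$: $\mathcal M_c^\varepsilon=\{W\in\mathcal M_{cs}^\varepsilon\cap\mathcal M_{cu}^\varepsilon:|W_c|<r\}$. -/

import Mathlib

open Set
open scoped ENNReal

namespace KleinGordon

noncomputable section

/-! ### Phase spaces -/

/-- The hyperbolic space `X = ℝ²`, with points `W^h = (w^h, w₁^h)`. -/
abbrev X : Type := EuclideanSpace ℝ (Fin 2)

/-- The space `Y` of pairs `(w^c, w₁^c)` of odd `2π`-periodic `L²` functions without `sin x`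
component.  An element is stored through its coordinates in the orthonormal system
`sin (k x) / √π`, `k = n + 2`, `n : ℕ`; its norm is the `L²(-π, π)` norm. -/
abbrev Y : Type := lp (fun _ : ℕ => EuclideanSpace ℝ (Fin 2)) 2

/-- The domain `Y₁` of `J` with the graph norm `(‖y‖² + ‖J y‖²)^(1/2)`.  Since `J` multiplies the
`k`-th mode by a rotation and `√(k² - 1)`, the graph norm of `∑ aₖ sin (k x)` is
`(π ∑ k² |aₖ|²)^(1/2)`.  An element is stored through its coordinates in the system
`sin (k x) / (√π k)`, `k = n + 2`, which is orthonormal for the graph norm. -/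
abbrev Y₁ : Type := lp (fun _ : ℕ => EuclideanSpace ℝ (Fin 2)) 2

/-- The phase space `X × Y₁`. -/
abbrev Phase : Type := X × Y₁

/-- The open ball `|W^h| + |W^c| < ρ` of `X × Y₁`. -/
def phaseBall (ρ : ℝ) : Set Phase := {Z | ‖Z.1‖ + ‖Z.2‖ < ρ}

/-- The wave number `k = n + 2` of the `n`-th elliptic mode. -/
def waveNumber (n : ℕ) : ℝ := (n : ℝ) + 2

/-- The `n`-th eigenvalue `√(k² - 1)` of `L = (-1 - ∂ₓₓ)^(1/2)`. -/
def symbolL (n : ℕ) : ℝ := √(waveNumber n ^ 2 - 1)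

/-- The coefficient of `sin (k x)`, `k = n + 2`, in the `i`-th component of `y ∈ Y₁`. -/
def coef (y : Y₁) (i : Fin 2) (n : ℕ) : ℝ := y n i / (√Real.pi * waveNumber n)

/-- The element of `Y₁` whose `i`-th component is `∑ₙ a i n sin ((n + 2) x)`.
(By convention `0` if this series does not define an element of `Y₁`.) -/
def ofCoef (a : Fin 2 → ℕ → ℝ) : Y₁ :=
  open Classical in
  if h : Memℓp (fun n : ℕ =>
      (WithLp.toLp 2 (fun i => √Real.pi * waveNumber n * a i n) : EuclideanSpace ℝ (Fin 2))) 2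
  then ⟨_, h⟩ else 0

theorem one_le_waveNumber (n : ℕ) : 1 ≤ waveNumber n := by
  unfold waveNumber
  have : (0 : ℝ) ≤ n := Nat.cast_nonneg n
  linarith

theorem symbolL_div_le (n : ℕ) : |symbolL n / waveNumber n| ≤ 1 := by
  have h := one_le_waveNumber n
  have h0 : 0 < waveNumber n := by linarith
  have hs : 0 ≤ symbolL n := Real.sqrt_nonneg _
  rw [abs_of_nonneg (div_nonneg hs h0.le), div_le_one h0]
  exact Real.sqrt_le_iff.mpr ⟨h0.le, by linarith⟩

theorem inv_waveNumber_le (n : ℕ) : |(waveNumber n)⁻¹| ≤ 1 := by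
  have h := one_le_waveNumber n
  rw [abs_of_nonneg (by positivity)]
  exact inv_le_one_of_one_le₀ h

theorem norm_smul_clm_le {V : Type*} [NormedAddCommGroup V] [NormedSpace ℝ V] (R : V →L[ℝ] V)
    (a : ℝ) (ha : |a| ≤ 1) : ‖a • R‖ ≤ ‖R‖ := by
  rw [norm_smul, Real.norm_eq_abs]
  exact mul_le_of_le_one_left (norm_nonneg _) ha

/-- The inclusion `Y₁ ⊂ Y`. -/
def incl : Y₁ →L[ℝ] Y :=
  lp.mapCLM 2 (fun n => (waveNumber n)⁻¹ • ContinuousLinearMap.id ℝ (EuclideanSpace ℝ (Fin 2)))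
    (norm_nonneg (ContinuousLinearMap.id ℝ (EuclideanSpace ℝ (Fin 2))))
    (fun n => norm_smul_clm_le _ _ (inv_waveNumber_le n))

/-- The matrix `(0, 1; -1, 0)` on `ℝ²`. -/
def rot : EuclideanSpace ℝ (Fin 2) →L[ℝ] EuclideanSpace ℝ (Fin 2) :=
  Matrix.toEuclideanCLM (n := Fin 2) (𝕜 := ℝ) !![0, 1; -1, 0]

/-- The operator `J = (0, L; -L, 0)`, as a bounded operator from its domain `Y₁` to `Y`. -/
def J : Y₁ →L[ℝ] Y :=
  lp.mapCLM 2 (fun n => (symbolL n / waveNumber n) • rot) (norm_nonneg rot)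
    (fun n => norm_smul_clm_le _ _ (symbolL_div_le n))

/-- The matrix `A = (0, 1; 1, 0)` on `X`. -/
def A : X →L[ℝ] X := Matrix.toEuclideanCLM (n := Fin 2) (𝕜 := ℝ) !![0, 1; 1, 0]

/-- The stable eigenspace of `A` (eigenvalue `-1`). -/
abbrev Xs : Submodule ℝ X := Module.End.eigenspace (A : X →ₗ[ℝ] X) (-1)

/-- The unstable eigenspace of `A` (eigenvalue `1`). -/
abbrev Xu : Submodule ℝ X := Module.End.eigenspace (A : X →ₗ[ℝ] X) 1

/-! ### The rescaled Klein-Gordon system -/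

/-- The function `w^h sin x + w^c(x)`. -/
def profile (Z : Phase) (x : ℝ) : ℝ :=
  Z.1 0 * Real.sin x + ∑' n, coef Z.2 0 n * Real.sin (waveNumber n * x)

/-- The coefficient of `sin (k x)` of `f (ε w^h sin x + ε w^c)`. -/
def sineCoef (f : ℝ → ℝ) (ε : ℝ) (Z : Phase) (k : ℝ) : ℝ :=
  (1 / Real.pi) * ∫ x in (-Real.pi)..Real.pi, f (ε * profile Z x) * Real.sin (k * x)

/-- The nonlinearity `F(W^h, W^c, ε)` of the hyperbolic equation. -/
def F (f : ℝ → ℝ) (ε : ℝ) (Z : Phase) : X :=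
  (1 / √(1 - ε ^ 2) - 1) • A Z.1 + !₂[0, -(1 / (√(1 - ε ^ 2) * ε ^ 3)) * sineCoef f ε Z 1]

/-- The nonlinearity
`G(W^h, W^c, ε) = (1 - ε²)⁻¹ L⁻¹ (0, w^c - ε⁻³ P_c f(ε w^h sin x + ε w^c))`
of the elliptic equation. -/
def G (f : ℝ → ℝ) (ε : ℝ) (Z : Phase) : Y₁ :=
  ofCoef ![fun _ => 0, fun n =>
    1 / ((1 - ε ^ 2) * symbolL n) *
      (coef Z.2 0 n - 1 / ε ^ 3 * sineCoef f ε Z (waveNumber n))]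

/-- The pair `(F, ε G)` of the rescaled Klein-Gordon system
`W^h' = A W^h + F(W^h, W^c, ε)`, `W^c' = ε⁻¹ J W^c + ε G(W^h, W^c, ε)`. -/
def kgNonlinearity (f : ℝ → ℝ) (ε : ℝ) (Z : Phase) : Phase := (F f ε Z, ε • G f ε Z)

/-- For `N = (N^h, N^c) : X × Y₁ → X × Y₁`, the curve `u` is a solution on the interval `I` of
`W^h' = A W^h + N^h(W)`, `W^c' = ε⁻¹ J W^c + N^c(W)`: it is continuous with values in `X × Y₁`,
differentiable with values in `X × Y`, and satisfies the equation in `X × Y`. -/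
def IsSolution (ε : ℝ) (N : Phase → Phase) (I : Set ℝ) (u : ℝ → Phase) : Prop :=
  ContinuousOn u I ∧
    ∀ t ∈ I,
      HasDerivWithinAt (fun s => (((u s).1, incl (u s).2) : X × Y))
        (A (u t).1 + (N (u t)).1, ε⁻¹ • J (u t).2 + incl (N (u t)).2) I t

/-! ### The partial normal form transformations -/

/-- The pairing `⟨L⁻¹ y_i, z_j⟩` in `H¹(-π, π)` of the `i`-th component of `y` and the `j`-th
component of `z`, where `⟨u, v⟩ = ∫ (u v + u_x v_x) dx`. -/
def pairLinv (y : Y₁) (i : Fin 2) (z : Y₁) (j : Fin 2) : ℝ :=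
  Real.pi * ∑' n, (1 + waveNumber n ^ 2) * (coef y i n / symbolL n) * coef z j n

/-- `Z⁺ = (z⁺, z₁⁺, ζ⁺, ζ₁⁺)` is obtained from `Z = (z, z₁, ζ, ζ₁)` by the
transformation with the generating function
`⟨ζ, ζ₁⁺⟩ - ε⟨L⁻¹ γ₁(q), ζ₁⁺⟩ + ε⁻¹ z z₁⁺ - ε⟨L⁻¹ γ₀(q), ζ⟩`,
where `q = (z, z₁⁺)` and `γ = (γ₀, γ₁) = N^c(·, 0) : X → Y₁` is the part of the elliptic
equation that does not vanish at `W^c = 0`.  These are the (implicit) equations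
`z⁺ = z - ε² (⟨D₂ L⁻¹ γ₁(q), ζ₁⁺⟩ + ⟨D₂ L⁻¹ γ₀(q), ζ⟩)`,
`z₁⁺ = z₁ + ε² (⟨D₁ L⁻¹ γ₁(q), ζ₁⁺⟩ + ⟨D₁ L⁻¹ γ₀(q), ζ⟩)`,
`ζ⁺ = ζ - ε L⁻¹ γ₁(q)`, `ζ₁⁺ = ζ₁ + ε L⁻¹ γ₀(q)`. -/
def GeneratingRelation (ε : ℝ) (N : Phase → Phase) (Z Z' : Phase) : Prop :=
  let γ : X → Y₁ := fun v => (N (v, 0)).2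
  let q : X := !₂[Z.1 0, Z'.1 1]
  let d : Fin 2 → Y₁ := fun i => fderiv ℝ γ q (EuclideanSpace.single i 1)
  Z'.1 0 = Z.1 0 - ε ^ 2 * (pairLinv (d 1) 1 Z'.2 1 + pairLinv (d 1) 0 Z.2 0) ∧
  Z'.1 1 = Z.1 1 + ε ^ 2 * (pairLinv (d 0) 1 Z'.2 1 + pairLinv (d 0) 0 Z.2 0) ∧
  (∀ n, coef Z'.2 0 n = coef Z.2 0 n - ε * (coef (γ q) 1 n / symbolL n)) ∧
  (∀ n, coef Z'.2 1 n = coef Z.2 1 n + ε * (coef (γ q) 0 n / symbolL n))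

/-- One normal form step.  The system with nonlinearity `N`, analytic on the ball of radius `ρ`, is
transformed into the system with nonlinearity `N'`, analytic on the ball of radius `ρ - δ`, by the
near-identity analytic diffeomorphism `Φ` given by the generating function. -/
structure IsNormalFormStep (ε ρ δ : ℝ) (N N' Φ : Phase → Phase) : Prop where
  analytic_source : AnalyticOnNhd ℝ N (phaseBall ρ)
  analytic_target : AnalyticOnNhd ℝ N' (phaseBall (ρ - δ))
  analytic_map : AnalyticOnNhd ℝ Φ (phaseBall (ρ - δ / 2))
  injOn : InjOn Φ (phaseBall (ρ - δ / 2))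
  local_diffeo : ∀ Z ∈ phaseBall (ρ - δ / 2),
    ∃ e : Phase ≃L[ℝ] Phase, HasFDerivAt Φ (e : Phase →L[ℝ] Phase) Z
  near_id : ∀ Z ∈ phaseBall (ρ - δ / 2), Φ Z - Z ∈ phaseBall (δ / 2)
  covers : phaseBall (ρ - δ) ⊆ Φ '' phaseBall (ρ - δ / 2)
  generating : ∀ Z ∈ phaseBall (ρ - δ / 2), GeneratingRelation ε N Z (Φ Z)
  /-- `Φ` maps solutions of the old system to solutions of the new system. -/
  conjugates : ∀ (I : Set ℝ) (u : ℝ → Phase), I.OrdConnected → IsSolution ε N I u →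
    (∀ t ∈ I, u t ∈ phaseBall (ρ - δ / 2) ∧ Φ (u t) ∈ phaseBall (ρ - δ)) →
    IsSolution ε N' I (fun t => Φ (u t))

/-- The radius `2K - (k - 1) K₁ ε` of the domain of the `k`-th system. -/
def nfRadius (K K₁ ε : ℝ) (k : ℕ) : ℝ := 2 * K - ((k : ℝ) - 1) * K₁ * ε

/-- `N k`, `1 ≤ k ≤ m`, are the nonlinearities of the systems obtained from the rescaled
Klein-Gordon system (`k = 1`) by the successive normal form transformations `Φ k`. -/
structure IsNormalFormChain (f : ℝ → ℝ) (K K₁ ε : ℝ) (m : ℕ) (N Φ : ℕ → Phase → Phase) :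
    Prop where
  init : N 1 = kgNonlinearity f ε
  step : ∀ k, 1 ≤ k → k < m →
    IsNormalFormStep ε (nfRadius K K₁ ε k) (K₁ * ε) (N k) (N (k + 1)) (Φ k)

/-- `φ` is `C²` on the open set `s` and its derivatives of order `0, 1, 2` are bounded by `C`. -/
def C2BoundedOn {V W : Type*} [NormedAddCommGroup V] [NormedSpace ℝ V] [NormedAddCommGroup W]
    [NormedSpace ℝ W] (φ : V → W) (s : Set V) (C : ℝ) : Prop :=
  ContDiffOn ℝ 2 φ s ∧ ∀ x ∈ s, ∀ i : ℕ, i ≤ 2 → ‖iteratedFDeriv ℝ i φ x‖ ≤ C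

/-- On the ball of radius `K` the system with nonlinearity `N` has the form
`W^h' = A W^h + F̃(W)`, `W^c' = ε⁻¹ J W^c + Ḡ(W) W^c + e^α G̃(W)` with
`|F̃|_{C²} ≤ C`, `|Ḡ|_{C²} ≤ C`, `|G̃|_{C²} ≤ C ε`, `F̃(0) = 0`, `G̃(0) = 0`,
`|D F̃(0)| ≤ C ε`, `|Ḡ(0)| ≤ C ε`. -/
def HasAlmostInvariantForm (K C ε α : ℝ) (N : Phase → Phase) : Prop :=
  ∃ (Ft : Phase → X) (Gbar : Phase → Y₁ →L[ℝ] Y₁) (Gt : Phase → Y₁),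
    (∀ Z ∈ phaseBall K, N Z = (Ft Z, Gbar Z Z.2 + Real.exp α • Gt Z)) ∧
    C2BoundedOn Ft (phaseBall K) C ∧ C2BoundedOn Gbar (phaseBall K) C ∧
    C2BoundedOn Gt (phaseBall K) (C * ε) ∧
    Ft 0 = 0 ∧ Gt 0 = 0 ∧ ‖fderiv ℝ Ft 0‖ ≤ C * ε ∧ ‖Gbar 0‖ ≤ C * ε

/-! ### Local invariant manifolds -/

/-- The point of the phase space with stable, unstable and elliptic parts `a`, `b`, `y`. -/
def pt (a : Xs) (b : Xu) (y : Y₁) : Phase := ((a : X) + (b : X), y)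

/-- `M` is locally invariant in `U`: a solution that lies in `U` on an interval containing `0` and
starts on `M` lies on `M` on the whole interval. -/
def LocallyInvariant (ε : ℝ) (N : Phase → Phase) (U M : Set Phase) : Prop :=
  ∀ (I : Set ℝ) (u : ℝ → Phase), I.OrdConnected → (0 : ℝ) ∈ I → IsSolution ε N I u →
    (∀ t ∈ I, u t ∈ U) → u 0 ∈ M → ∀ t ∈ I, u t ∈ M

/-- The graph of `h : B_r(0, Xˢ × Y₁) → Xᵘ`. -/
def graphCS (r : ℝ) (h : Xs × Y₁ → Xu) : Set Phase :=
  {Z | ∃ (a : Xs) (y : Y₁), ‖a‖ + ‖y‖ < r ∧ Z = pt a (h (a, y)) y}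

/-- The graph of `h : B_r(0, Xᵘ × Y₁) → Xˢ`. -/
def graphCU (r : ℝ) (h : Xu × Y₁ → Xs) : Set Phase :=
  {Z | ∃ (b : Xu) (y : Y₁), ‖b‖ + ‖y‖ < r ∧ Z = pt (h (b, y)) b y}

/-- The graph of `Ψ = (Ψ_s, Ψ_u) : B_r(0, Y₁) → Xˢ × Xᵘ`. -/
def graphC (r : ℝ) (Ψ : Y₁ → Xs × Xu) : Set Phase :=
  {Z | ∃ y : Y₁, ‖y‖ < r ∧ Z = pt (Ψ y).1 (Ψ y).2 y}

/-- The graph of `h` over `B_r(0, Xˢ × Y₁)` is a local center-stable manifold of the origin for the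
system with nonlinearity `N`, considered on the ball of radius `K`: it is a locally invariant `C²`
graph through the origin that contains all forward orbits staying in the ball of radius `r`. -/
structure IsLocalCenterStable (K ε : ℝ) (N : Phase → Phase) (r : ℝ) (h : Xs × Y₁ → Xu) :
    Prop where
  zero : h 0 = 0
  contDiffOn : ContDiffOn ℝ 2 h {p | ‖p.1‖ + ‖p.2‖ < r}
  subset : graphCS r h ⊆ phaseBall K
  invariant : LocallyInvariant ε N
    (phaseBall K ∩ {Z | ∃ a b y, Z = pt a b y ∧ ‖a‖ + ‖y‖ < r}) (graphCS r h)
  contains : ∀ u : ℝ → Phase, IsSolution ε N (Ici 0) u →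
    (∀ t ∈ Ici (0 : ℝ), u t ∈ phaseBall r) → u 0 ∈ graphCS r h

/-- The same notion for center-unstable manifolds, with backward orbits. -/
structure IsLocalCenterUnstable (K ε : ℝ) (N : Phase → Phase) (r : ℝ) (h : Xu × Y₁ → Xs) :
    Prop where
  zero : h 0 = 0
  contDiffOn : ContDiffOn ℝ 2 h {p | ‖p.1‖ + ‖p.2‖ < r}
  subset : graphCU r h ⊆ phaseBall K
  invariant : LocallyInvariant ε N
    (phaseBall K ∩ {Z | ∃ a b y, Z = pt a b y ∧ ‖b‖ + ‖y‖ < r}) (graphCU r h)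
  contains : ∀ u : ℝ → Phase, IsSolution ε N (Iic 0) u →
    (∀ t ∈ Iic (0 : ℝ), u t ∈ phaseBall r) → u 0 ∈ graphCU r h

/-- The graph of `Ψ` over `B_r(0, Y₁)` is a local center manifold of the origin: a locally invariant
`C²` graph through the origin that contains all complete orbits staying in the ball of radius
`r`. -/
structure IsLocalCenter (K ε : ℝ) (N : Phase → Phase) (r : ℝ) (Ψ : Y₁ → Xs × Xu) : Prop where
  zero : Ψ 0 = 0
  contDiffOn : ContDiffOn ℝ 2 Ψ (Metric.ball 0 r)
  subset : graphC r Ψ ⊆ phaseBall K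
  invariant : LocallyInvariant ε N (phaseBall K ∩ {Z | ‖Z.2‖ < r}) (graphC r Ψ)
  contains : ∀ u : ℝ → Phase, IsSolution ε N univ u →
    (∀ t, u t ∈ phaseBall r) → u 0 ∈ graphC r Ψ

end

end KleinGordon

/-! The proof has two independent mechanisms: exponentially many halvings of the coupling term, and
a uniform center manifold theorem.

Normal form. The subspace `W^c = 0` fails to be invariant only because of `γ = N^c(·, 0)`. Since
`ε⁻¹ J` is large, a shift of `W^c` by `ε S γ`, where `J S` is the inclusion of `Y₁` into `Y`,
cancels `γ` exactly. What remains of it on the new subspace `W^c = 0` is the drift `ε S Dγ(q) q'`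
and the change of `N^c` under a displacement of size `ε |γ|`. Cauchy's estimate on a ball of radius
comparable to `K₁ ε` bounds each derivative at the cost of a factor `1 / (K₁ ε)`; the factor `ε`
compensates for it, and for large `K₁` the remainder is at most `|γ| / 2`
(`NFData.StepHyp.norm_gam_newNonlinearity_le`). A step thus halves `γ` and shrinks the radius by `K₁
ε`, so about `c / ε` steps fit into a fixed radius and leave `2^(-c/ε)` (`stepHyp_nfSeq`,
`exists_normalFormChain`).

The transformation is symplectic and implicit. It is handled in mixed coordinates `Q = (z, z₁⁺, ζ,
ζ₁)`, from which the old and the new point are explicit near-identity maps `oldCoord` and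
`newCoord`. The hyperbolic corrections are `ε²` times a pairing `lam`, which is affine in the
elliptic variable and continuous for the weak norm of `Y`. It can therefore be differentiated along
solutions, whose elliptic velocity exists only in `Y` and has size `1 / ε`
(`NFData.StepHyp.norm_dlam_apply_le`).

Cauchy estimates need holomorphic maps, so each step is carried out on the complexified phase space.
There `ε⁻³ f(ε p) = p³ ∑ cₙ (ε p)ⁿ` is a power series in the Banach algebra of bounded continuous
functions, bounded uniformly in `ε` (`exists_kg_extension`). All maps commute with complex
conjugation and hence restrict to real maps (`isNormalFormStep_realMap`). The remaining room `K / 2`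
in the radius turns sup bounds into `C²` bounds, and the mean value formula in `W^c` splits off the
factor `W^c` (`IsAlmostInvariant.hasAlmostInvariantForm`).

Manifolds. The group generated by `ε⁻¹ J` is isometric on `Y₁`, so `1 / ε` never enters the
estimates. With a cutoff at radius `R` the nonlinearity has Lipschitz constant of order `ε + R`,
against a spectral gap of size one. The center-stable graph consists of the initial values of the
slowly growing solutions, found as fixed points of the Lyapunov-Perron operator
(`exists_centerStable_graph`). Its regularity is read off from first, second and third finite
differences in the weights `e^{t/4}`, `e^{t/2}`, `e^{3t/4}`; bounded third differences give a `C²`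
map with bounded derivatives (`c2BoundedOn_of_diffBound`). Time reversal, encoded by a sign `σ`,
gives the center-unstable graph (`exists_isGlobalGraph`). Both graphs have slope at most `1 / 4`, so
their intersection is a graph over `Y₁` by the contraction principle (`exists_implicit`,
`exists_isLocalCenter`). -/

namespace KleinGordon
noncomputable section

/-! ### Finite differences -/

section Differences

set_option linter.unusedSectionVars false

variable {E F G : Type*} [NormedAddCommGroup E] [NormedSpace ℝ E]
  [NormedAddCommGroup F] [NormedSpace ℝ F] [NormedAddCommGroup G] [NormedSpace ℝ G]

/-- First differences of `f` are bounded by `C ‖a‖`. -/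
def DiffBound₁ (C : ℝ) (f : E → F) : Prop := ∀ x a, ‖f (x + a) - f x‖ ≤ C * ‖a‖

/-- Mixed second differences of `f` are bounded by `C ‖a‖ ‖b‖`. -/
def DiffBound₂ (C : ℝ) (f : E → F) : Prop :=
  ∀ x a b, ‖f (x + a + b) - f (x + a) - f (x + b) + f x‖ ≤ C * ‖a‖ * ‖b‖

/-- Mixed third differences of `f` are bounded by `C ‖a‖ ‖b‖ ‖c‖`. -/
def DiffBound₃ (C : ℝ) (f : E → F) : Prop :=
  ∀ x a b c, ‖f (x + a + b + c) - f (x + a + b) - f (x + a + c) - f (x + b + c) + f (x + a)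
    + f (x + b) + f (x + c) - f x‖ ≤ C * ‖a‖ * ‖b‖ * ‖c‖

theorem DiffBound₁.continuous {C : ℝ} {f : E → F} (h : DiffBound₁ C f) : Continuous f := by
  have : LipschitzWith (Real.toNNReal C) f := by
    refine LipschitzWith.of_dist_le_mul fun x y => ?_
    have h1 := h y (x - y)
    rw [add_sub_cancel] at h1
    rw [dist_eq_norm, dist_eq_norm]
    exact h1.trans (mul_le_mul_of_nonneg_right (Real.le_coe_toNNReal C) (norm_nonneg _))
  exact this.continuous

theorem diffBound₁_of_fderiv {C : ℝ} {f : E → F} (hf : Differentiable ℝ f)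
    (h : ∀ x, ‖fderiv ℝ f x‖ ≤ C) : DiffBound₁ C f := by
  intro x a
  have := convex_univ.norm_image_sub_le_of_norm_fderiv_le (𝕜 := ℝ) (f := f) (C := C)
    (fun y _ => hf y) (fun y _ => h y) (mem_univ x) (mem_univ (x + a))
  simpa using this

theorem hasFDerivAt_translate {f : E → F} (hf : Differentiable ℝ f) (y a : E) :
    HasFDerivAt (fun y => f (y + a)) (fderiv ℝ f (y + a)) y := by
  have := (hf (y + a)).hasFDerivAt.comp y ((hasFDerivAt_id y).add_const a)
  rwa [ContinuousLinearMap.comp_id] at this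

/-- The increment `y ↦ f (y + a) - f y` has derivative bounded by `C ‖a‖`; the mean value inequality
in the direction `b` does the rest. The third order version has the same proof. -/
theorem diffBound₂_of_fderiv {C : ℝ} {f : E → F} (hf : Differentiable ℝ f)
    (h : DiffBound₁ C (fderiv ℝ f)) : DiffBound₂ C f := by
  intro x a b
  have hd : ∀ y, HasFDerivAt (fun y => f (y + a) - f y) (fderiv ℝ f (y + a) - fderiv ℝ f y) y :=
    fun y => (hasFDerivAt_translate hf y a).sub (hf y).hasFDerivAt
  have h1 := diffBound₁_of_fderiv (f := fun y => f (y + a) - f y) (C := C * ‖a‖)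
    (fun y => (hd y).differentiableAt) (fun y => by rw [(hd y).fderiv]; exact h y a) x b
  rw [show f (x + a + b) - f (x + a) - f (x + b) + f x
    = f (x + b + a) - f (x + b) - (f (x + a) - f x) by rw [add_right_comm x a b]; abel]
  exact h1

theorem diffBound₃_of_fderiv {C : ℝ} {f : E → F} (hf : Differentiable ℝ f)
    (h : DiffBound₂ C (fderiv ℝ f)) : DiffBound₃ C f := by
  intro x a b c
  have hd : ∀ y, HasFDerivAt (fun y => f (y + a + b) - f (y + a) - f (y + b) + f y)
      (fderiv ℝ f (y + a + b) - fderiv ℝ f (y + a) - fderiv ℝ f (y + b) + fderiv ℝ f y) y := by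
    intro y
    have e : ∀ y, y + a + b = y + (a + b) := fun y => add_assoc _ _ _
    simp only [e]
    exact (((hasFDerivAt_translate hf y (a + b)).sub (hasFDerivAt_translate hf y a)).sub
      (hasFDerivAt_translate hf y b)).add (hf y).hasFDerivAt
  have h1 := diffBound₁_of_fderiv (C := C * ‖a‖ * ‖b‖)
    (fun y => (hd y).differentiableAt) (fun y => by rw [(hd y).fderiv]; exact h y a b) x c
  refine le_of_eq_of_le (congrArg _ ?_) h1
  rw [add_right_comm x c a, add_right_comm x c b, add_right_comm (x + a) c b]
  abel

/-- Discrete chain rule, second order. -/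
theorem norm_secondDiff_comp_le {L₁ L₂ : ℝ} {g : E → F} (h₁ : DiffBound₁ L₁ g)
    (h₂ : DiffBound₂ L₂ g) (u₀ u₁ u₂ u₁₂ : E) :
    ‖g u₁₂ - g u₁ - g u₂ + g u₀‖
      ≤ L₁ * ‖u₁₂ - u₁ - u₂ + u₀‖ + L₂ * ‖u₁ - u₀‖ * ‖u₂ - u₀‖ := by
  -- The four points need not form a parallelogram: `e2` treats the parallelogram spanned at `u₀`,
  -- and `e1` moves its fourth vertex to `u₁₂`.
  have e1 := h₁ (u₀ + (u₁ - u₀) + (u₂ - u₀)) (u₁₂ - u₁ - u₂ + u₀)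
  have e2 := h₂ u₀ (u₁ - u₀) (u₂ - u₀)
  have i1 : u₀ + (u₁ - u₀) + (u₂ - u₀) + (u₁₂ - u₁ - u₂ + u₀) = u₁₂ := by abel
  have i2 : u₀ + (u₁ - u₀) = u₁ := by abel
  have i3 : u₀ + (u₂ - u₀) = u₂ := by abel
  rw [i1] at e1
  rw [i3] at e2
  refine le_trans (le_of_eq_of_le (congrArg _ ?_) (norm_add_le _ _)) (add_le_add e1 e2)
  rw [i2]; abel

/-- Discrete chain rule, third order. -/
theorem norm_thirdDiff_comp_le {L₁ L₂ L₃ : ℝ} (hL₂ : 0 ≤ L₂) (hL₃ : 0 ≤ L₃) {g : E → F}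
    (h₁ : DiffBound₁ L₁ g) (h₂ : DiffBound₂ L₂ g) (h₃ : DiffBound₃ L₃ g)
    (u₀ u₁ u₂ u₃ u₁₂ u₁₃ u₂₃ u₁₂₃ : E) {α₁ α₂ α₃ β₁₂ β₁₃ β₂₃ : ℝ}
    (a₁ : ‖u₁ - u₀‖ ≤ α₁) (a₂ : ‖u₂ - u₀‖ ≤ α₂) (a₃ : ‖u₃ - u₀‖ ≤ α₃)
    (a₃' : ‖u₂₃ - u₂‖ ≤ α₃) (a₃'' : ‖u₁₃ - u₁‖ ≤ α₃) (a₂' : ‖u₂₃ - u₃‖ ≤ α₂)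
    (b₁₂ : ‖u₁₂ - u₁ - u₂ + u₀‖ ≤ β₁₂) (b₁₃ : ‖u₁₃ - u₁ - u₃ + u₀‖ ≤ β₁₃)
    (b₂₃ : ‖u₂₃ - u₂ - u₃ + u₀‖ ≤ β₂₃) :
    ‖g u₁₂₃ - g u₁₂ - g u₁₃ - g u₂₃ + g u₁ + g u₂ + g u₃ - g u₀‖
      ≤ L₁ * ‖u₁₂₃ - u₁₂ - u₁₃ - u₂₃ + u₁ + u₂ + u₃ - u₀‖
        + 3 * L₂ * (β₁₂ * α₃ + β₁₃ * α₂ + β₂₃ * α₁) + L₃ * α₁ * α₂ * α₃ := by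
  set p := u₁ - u₀ with hp
  set q := u₂ - u₀ with hq
  set r := u₃ - u₀ with hr
  set c := u₁₂ - u₁ - u₂ + u₀ with hc
  set c' := u₁₃ - u₁ - u₃ + u₀ with hc'
  set c'' := u₂₃ - u₂ - u₃ + u₀ with hc''
  set d := u₁₂₃ - u₁₂ - u₁₃ - u₂₃ + u₁ + u₂ + u₃ - u₀ with hd
  have hα₁ := (norm_nonneg _).trans a₁
  have hα₂ := (norm_nonneg _).trans a₂
  have hα₃ := (norm_nonneg _).trans a₃
  have hβ := (norm_nonneg _).trans b₁₂
  have hβ' := (norm_nonneg _).trans b₁₃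
  have hβ'' := (norm_nonneg _).trans b₂₃
  -- The parallelepiped spanned by `p, q, r` is deformed into the given points: the corrections
  -- `c''`, `c'`, `c`, `d` are added to its last vertex one after another. Each of the first three
  -- costs a second difference of `g`, the last one a first difference.
  have e3 := h₃ u₀ p q r
  have ed := h₁ (u₀ + p + q + r + c'' + c' + c) d
  have ec := h₂ (u₀ + p + q) c (r + c'' + c')
  have ec' := h₂ (u₀ + p + r) c' (q + c'')
  have ec'' := h₂ (u₀ + q + r) c'' p
  have n1 : ‖r + c'' + c'‖ ≤ 3 * α₃ := by
    have : r + c'' + c' = (u₂₃ - u₂) + (u₁₃ - u₁) - (u₃ - u₀) := by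
      rw [hr, hc', hc'']; abel
    rw [this]
    calc _ ≤ ‖u₂₃ - u₂‖ + ‖u₁₃ - u₁‖ + ‖u₃ - u₀‖ :=
          (norm_sub_le _ _).trans (add_le_add_left (norm_add_le _ _) _)
      _ ≤ _ := by linarith
  have n2 : ‖q + c''‖ ≤ 3 * α₂ := by
    have : q + c'' = u₂₃ - u₃ := by rw [hq, hc'']; abel
    rw [this]; linarith
  have n3 : ‖p‖ ≤ 3 * α₁ := by linarith
  have t3 : L₃ * ‖p‖ * ‖q‖ * ‖r‖ ≤ L₃ * α₁ * α₂ * α₃ := by gcongr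
  have t1 : L₂ * ‖c‖ * ‖r + c'' + c'‖ ≤ L₂ * β₁₂ * (3 * α₃) := by gcongr
  have t2 : L₂ * ‖c'‖ * ‖q + c''‖ ≤ L₂ * β₁₃ * (3 * α₂) := by gcongr
  have t4 : L₂ * ‖c''‖ * ‖p‖ ≤ L₂ * β₂₃ * (3 * α₁) := by gcongr
  have i1 : u₀ + p + q + r + c'' + c' + c + d = u₁₂₃ := by
    simp only [hp, hq, hr, hc, hc', hc'', hd]; abel
  have i2 : u₀ + p + q + c = u₁₂ := by simp only [hp, hq, hc]; abel
  have i3 : u₀ + p + r + c' = u₁₃ := by simp only [hp, hr, hc']; abel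
  have i4 : u₀ + q + r + c'' = u₂₃ := by simp only [hq, hr, hc'']; abel
  have i5 : u₀ + p = u₁ := by simp only [hp]; abel
  have i6 : u₀ + q = u₂ := by simp only [hq]; abel
  have i7 : u₀ + r = u₃ := by simp only [hr]; abel
  have j1 : u₀ + p + q + c + (r + c'' + c') = u₀ + p + q + r + c'' + c' + c := by abel
  have j2 : u₀ + p + q + (r + c'' + c') = u₀ + p + q + r + c'' + c' := by abel
  have j3 : u₀ + p + r + c' + (q + c'') = u₀ + p + q + r + c'' + c' := by abel
  have j4 : u₀ + p + r + (q + c'') = u₀ + p + q + r + c'' := by abel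
  have j5 : u₀ + q + r + c'' + p = u₀ + p + q + r + c'' := by abel
  have j6 : u₀ + q + r + p = u₀ + p + q + r := by abel
  rw [i1] at ed
  rw [j1, j2, i2] at ec
  rw [j3, j4, i3] at ec'
  rw [j5, j6, i4] at ec''
  rw [i7, i6] at e3
  rw [i5] at ed ec ec' ec'' e3
  have key : g u₁₂₃ - g u₁₂ - g u₁₃ - g u₂₃ + g u₁ + g u₂ + g u₃ - g u₀
      = (g u₁₂₃ - g (u₁ + q + r + c'' + c' + c))
      + (g (u₁ + q + r + c'' + c' + c) - g u₁₂ - g (u₁ + q + r + c'' + c') + g (u₁ + q))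
      + (g (u₁ + q + r + c'' + c') - g u₁₃ - g (u₁ + q + r + c'') + g (u₁ + r))
      + (g (u₁ + q + r + c'') - g u₂₃ - g (u₁ + q + r) + g (u₀ + q + r))
      + (g (u₁ + q + r) - g (u₁ + q) - g (u₁ + r) - g (u₀ + q + r) + g u₁ + g u₂ + g u₃ - g u₀) := by
    abel
  rw [key]
  calc _ ≤ _ := norm_add_le _ _
    _ ≤ _ := add_le_add_left (norm_add₄_le) _
    _ ≤ _ := by rw [i6] at ec'' ⊢; linarith

-- The dyadic difference quotients form a Cauchy sequence, because consecutive ones differ by a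
-- rescaled second difference. Second differences also show that the limit is additive, first
-- differences that it is bounded, and the sum of the geometric series is the quadratic remainder.
open Filter Topology in
theorem exists_hasFDerivAt_of_diffBound [CompleteSpace F] {L C : ℝ} {f : E → F} (hC : 0 ≤ C)
    (hL : 0 ≤ L) (h₁ : DiffBound₁ L f) (h₂ : DiffBound₂ C f) (x : E) :
    ∃ f' : E →L[ℝ] F, (∀ v, Tendsto (fun n : ℕ => (2 : ℝ) ^ n • (f (x + ((2 : ℝ) ^ n)⁻¹ • v) - f x))
      atTop (𝓝 (f' v))) ∧ ‖f'‖ ≤ L ∧ ∀ v, ‖f (x + v) - f x - f' v‖ ≤ C * ‖v‖ ^ 2 := by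
  set s : ℕ → E → F := fun n v => (2 : ℝ) ^ n • (f (x + ((2 : ℝ) ^ n)⁻¹ • v) - f x) with hs
  -- The second difference with both increments `2^(-n-1) v` compares two consecutive quotients; it
  -- gives a quarter, weakened to `/ 2 / 2 ^ n` to fit the lemma on geometric sequences.
  have hstep : ∀ v n, dist (s n v) (s (n + 1) v) ≤ C * ‖v‖ ^ 2 / 2 / 2 ^ n := by
    intro v n
    have e := h₂ x (((2 : ℝ) ^ (n + 1))⁻¹ • v) (((2 : ℝ) ^ (n + 1))⁻¹ • v)
    have e1 : x + ((2 : ℝ) ^ (n + 1))⁻¹ • v + ((2 : ℝ) ^ (n + 1))⁻¹ • v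
        = x + ((2 : ℝ) ^ n)⁻¹ • v := by
      rw [add_assoc, ← add_smul]; congr 2; field_simp; ring
    rw [e1, norm_smul, Real.norm_eq_abs, abs_of_pos (by positivity)] at e
    have e2 : s n v - s (n + 1) v = (2 : ℝ) ^ n • (f (x + ((2 : ℝ) ^ n)⁻¹ • v)
        - f (x + ((2 : ℝ) ^ (n + 1))⁻¹ • v) - f (x + ((2 : ℝ) ^ (n + 1))⁻¹ • v) + f x) := by
      simp only [hs, pow_succ]
      module
    rw [dist_eq_norm, e2, norm_smul, Real.norm_eq_abs, abs_of_pos (by positivity)]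
    calc _ ≤ (2 : ℝ) ^ n * _ := mul_le_mul_of_nonneg_left e (by positivity)
      _ = C * ‖v‖ ^ 2 / 4 / 2 ^ n := by field_simp; ring
      _ ≤ _ := by
        have : 0 ≤ C * ‖v‖ ^ 2 := by positivity
        gcongr
        norm_num
  have hlim : ∀ v, ∃ l, Tendsto (fun n => s n v) atTop (𝓝 l) := fun v =>
    cauchySeq_tendsto_of_complete (cauchySeq_of_le_geometric_two (hstep v))
  choose d hd using hlim
  have hbound : ∀ v, ‖d v‖ ≤ L * ‖v‖ := by
    intro v
    refine le_of_tendsto (hd v).norm (Eventually.of_forall fun n => ?_)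
    have e := h₁ x (((2 : ℝ) ^ n)⁻¹ • v)
    rw [norm_smul, Real.norm_eq_abs, abs_of_pos (by positivity)] at e
    simp only [hs]
    rw [norm_smul, Real.norm_eq_abs, abs_of_pos (by positivity)]
    calc _ ≤ (2 : ℝ) ^ n * _ := mul_le_mul_of_nonneg_left e (by positivity)
      _ = _ := by field_simp
  have hadd : ∀ v w, d (v + w) = d v + d w := by
    intro v w
    have e : ∀ n, ‖s n (v + w) - (s n v + s n w)‖ ≤ C * ‖v‖ * ‖w‖ * (1 / 2) ^ n := by
      intro n
      have e := h₂ x (((2 : ℝ) ^ n)⁻¹ • v) (((2 : ℝ) ^ n)⁻¹ • w)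
      have e2 : s n (v + w) - (s n v + s n w) = (2 : ℝ) ^ n • (f (x + ((2 : ℝ) ^ n)⁻¹ • v
          + ((2 : ℝ) ^ n)⁻¹ • w) - f (x + ((2 : ℝ) ^ n)⁻¹ • v) - f (x + ((2 : ℝ) ^ n)⁻¹ • w) + f x) := by
        simp only [hs, smul_add, ← add_assoc]
        module
      rw [norm_smul, norm_smul, Real.norm_eq_abs, abs_of_pos (by positivity)] at e
      rw [e2, norm_smul, Real.norm_eq_abs, abs_of_pos (by positivity)]
      calc _ ≤ (2 : ℝ) ^ n * _ := mul_le_mul_of_nonneg_left e (by positivity)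
        _ = _ := by rw [one_div, inv_pow]; field_simp
    have t0 : Tendsto (fun n : ℕ => C * ‖v‖ * ‖w‖ * (1 / 2 : ℝ) ^ n) atTop (𝓝 0) := by
      simpa using (tendsto_pow_atTop_nhds_zero_of_lt_one (r := (1 / 2 : ℝ)) (by norm_num)
        (by norm_num)).const_mul (C * ‖v‖ * ‖w‖)
    have t1 := squeeze_zero_norm e t0
    exact sub_eq_zero.mp (tendsto_nhds_unique ((hd (v + w)).sub ((hd v).add (hd w))) t1)
  -- An additive map which is bounded, hence continuous, is automatically real linear.
  let D : E →+ F := AddMonoidHom.mk' d hadd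
  let D' : E →L[ℝ] F := D.toRealLinearMap (AddMonoidHomClass.continuous_of_bound D L hbound)
  have hD' : ∀ v, D' v = d v := fun v => rfl
  refine ⟨D', fun v => hd v, D'.opNorm_le_bound hL hbound, fun v => ?_⟩
  have e := dist_le_of_le_geometric_two_of_tendsto₀ (hstep v) (hd v)
  rw [dist_eq_norm] at e
  have e0 : s 0 v = f (x + v) - f x := by simp [hs]
  rw [e0] at e
  rw [hD']
  have : 0 ≤ C * ‖v‖ ^ 2 := by positivity
  linarith

open Filter Topology Asymptotics in
theorem hasFDerivAt_of_quadratic {f : E → F} {f' : E →L[ℝ] F} {x : E} {C : ℝ}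
    (h : ∀ v, ‖f (x + v) - f x - f' v‖ ≤ C * ‖v‖ ^ 2) : HasFDerivAt f f' x := by
  rw [hasFDerivAt_iff_isLittleO_nhds_zero]
  refine IsBigO.trans_isLittleO (g := fun v : E => ‖v‖ ^ 2) ?_ ?_
  · exact IsBigO.of_bound C (Eventually.of_forall fun v => by simpa using h v)
  · simpa using (isLittleO_norm_pow_id (E' := E) (n := 2) (by norm_num))

theorem c2BoundedOn_of_hasFDerivAt {f : E → F} {f' : E → E →L[ℝ] F} {f'' : E → E →L[ℝ] E →L[ℝ] F}
    {s : Set E} {C : ℝ} (hs : IsOpen s) (h₁ : ∀ x ∈ s, HasFDerivAt f (f' x) x)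
    (h₂ : ∀ x ∈ s, HasFDerivAt f' (f'' x) x) (h₃ : ContinuousOn f'' s)
    (b₀ : ∀ x ∈ s, ‖f x‖ ≤ C) (b₁ : ∀ x ∈ s, ‖f' x‖ ≤ C) (b₂ : ∀ x ∈ s, ‖f'' x‖ ≤ C) :
    C2BoundedOn f s C := by
  have e1 : ∀ x ∈ s, fderiv ℝ f x = f' x := fun x hx => (h₁ x hx).fderiv
  have e2 : ∀ x ∈ s, fderiv ℝ (fderiv ℝ f) x = f'' x := fun x hx =>
    ((h₂ x hx).congr_of_eventuallyEq (Filter.eventuallyEq_of_mem (hs.mem_nhds hx) e1)).fderiv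
  refine ⟨?_, fun x hx i hi => ?_⟩
  · rw [show (2 : WithTop ℕ∞) = 1 + 1 by norm_num, contDiffOn_succ_iff_fderiv_of_isOpen hs]
    refine ⟨fun x hx => (h₁ x hx).differentiableAt.differentiableWithinAt, by simp, ?_⟩
    rw [show (1 : WithTop ℕ∞) = 0 + 1 by norm_num, contDiffOn_succ_iff_fderiv_of_isOpen hs]
    refine ⟨fun x hx => ?_, by simp, ?_⟩
    · exact ((h₂ x hx).congr_of_eventuallyEq (Filter.eventuallyEq_of_mem (hs.mem_nhds hx)
        e1)).differentiableAt.differentiableWithinAt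
    · rw [contDiffOn_zero]
      exact h₃.congr e2
  · interval_cases i
    · simpa using b₀ x hx
    · rw [← norm_iteratedFDeriv_fderiv, norm_iteratedFDeriv_zero, e1 x hx]; exact b₁ x hx
    · rw [← norm_iteratedFDeriv_fderiv, ← norm_iteratedFDeriv_fderiv, norm_iteratedFDeriv_zero,
        e2 x hx]; exact b₂ x hx

open Filter Topology in
/-- A bounded map with bounded mixed differences up to order three is `C²`. -/
theorem c2BoundedOn_of_diffBound [CompleteSpace F] {C : ℝ} {f : E → F} {s : Set E} (hs : IsOpen s)
    (hC : 0 ≤ C) (h₀ : ∀ x ∈ s, ‖f x‖ ≤ C) (h₁ : DiffBound₁ C f) (h₂ : DiffBound₂ C f)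
    (h₃ : DiffBound₃ C f) : C2BoundedOn f s C := by
  choose f' hlim hb hq using exists_hasFDerivAt_of_diffBound hC hC h₁ h₂
  -- Differences of `f'` are limits of difference quotients of differences of `f`, so each bound
  -- passes from one order for `f` to the order below for `f'`.
  have k₁ : DiffBound₁ C f' := by
    intro x a
    refine ContinuousLinearMap.opNorm_le_bound _ (by positivity) fun v => ?_
    refine le_of_tendsto ((hlim (x + a) v).sub (hlim x v)).norm (Eventually.of_forall fun n => ?_)
    have e := h₂ x a (((2 : ℝ) ^ n)⁻¹ • v)
    rw [norm_smul, Real.norm_eq_abs, abs_of_pos (by positivity)] at e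
    rw [← smul_sub, norm_smul, Real.norm_eq_abs, abs_of_pos (by positivity)]
    rw [show ∀ p q r t : F, p - q - (r - t) = p - q - r + t by intros; abel]
    calc _ ≤ (2 : ℝ) ^ n * _ := mul_le_mul_of_nonneg_left e (by positivity)
      _ = _ := by field_simp
  have k₂ : DiffBound₂ C f' := by
    intro x a b
    refine ContinuousLinearMap.opNorm_le_bound _ (by positivity) fun v => ?_
    refine le_of_tendsto ((((hlim (x + a + b) v).sub (hlim (x + a) v)).sub
      (hlim (x + b) v)).add (hlim x v)).norm (Eventually.of_forall fun n => ?_)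
    have e := h₃ x a b (((2 : ℝ) ^ n)⁻¹ • v)
    rw [norm_smul, Real.norm_eq_abs, abs_of_pos (by positivity)] at e
    rw [← smul_sub, ← smul_sub, ← smul_add, norm_smul, Real.norm_eq_abs, abs_of_pos (by positivity)]
    rw [show ∀ p q r t p' q' r' t' : F, p - p' - (q - q') - (r - r') + (t - t')
      = p - p' - q - r + q' + r' + t - t' by intros; abel]
    calc _ ≤ (2 : ℝ) ^ n * _ := mul_le_mul_of_nonneg_left e (by positivity)
      _ = _ := by field_simp
  have d₁ : ∀ x, HasFDerivAt f (f' x) x := fun x => hasFDerivAt_of_quadratic (hq x)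
  choose f'' hlim' hb' hq' using exists_hasFDerivAt_of_diffBound hC hC k₁ k₂
  have d₂ : ∀ x, HasFDerivAt f' (f'' x) x := fun x => hasFDerivAt_of_quadratic (hq' x)
  have k₃ : DiffBound₁ C f'' := by
    intro x a
    refine ContinuousLinearMap.opNorm_le_bound _ (by positivity) fun v => ?_
    refine le_of_tendsto ((hlim' (x + a) v).sub (hlim' x v)).norm (Eventually.of_forall fun n => ?_)
    have e := k₂ x a (((2 : ℝ) ^ n)⁻¹ • v)
    rw [norm_smul, Real.norm_eq_abs, abs_of_pos (by positivity)] at e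
    rw [← smul_sub, norm_smul, Real.norm_eq_abs, abs_of_pos (by positivity)]
    rw [show ∀ p q r t : E →L[ℝ] F, p - q - (r - t) = p - q - r + t by intros; abel]
    calc _ ≤ (2 : ℝ) ^ n * _ := mul_le_mul_of_nonneg_left e (by positivity)
      _ = _ := by field_simp
  exact c2BoundedOn_of_hasFDerivAt hs (fun x _ => d₁ x) (fun x _ => d₂ x) k₃.continuous.continuousOn
    h₀ (fun x _ => hb x) (fun x _ => hb' x)

theorem diffBound₁_of_iteratedFDeriv {C : ℝ} {f : E → F} (hf : ContDiff ℝ 1 f)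
    (h : ∀ x, ‖iteratedFDeriv ℝ 1 f x‖ ≤ C) : DiffBound₁ C f :=
  diffBound₁_of_fderiv (hf.differentiable one_ne_zero) fun x => by
    have := h x
    rwa [← norm_iteratedFDeriv_fderiv, norm_iteratedFDeriv_zero] at this

theorem diffBound₂_of_iteratedFDeriv {C : ℝ} {f : E → F} (hf : ContDiff ℝ 2 f)
    (h : ∀ x, ‖iteratedFDeriv ℝ 2 f x‖ ≤ C) : DiffBound₂ C f :=
  diffBound₂_of_fderiv (hf.differentiable two_ne_zero)
    (diffBound₁_of_iteratedFDeriv (hf.fderiv_right (by norm_num)) fun x => by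
      rw [norm_iteratedFDeriv_fderiv]; exact h x)

theorem diffBound₃_of_iteratedFDeriv {C : ℝ} {f : E → F} (hf : ContDiff ℝ 3 f)
    (h : ∀ x, ‖iteratedFDeriv ℝ 3 f x‖ ≤ C) : DiffBound₃ C f :=
  diffBound₃_of_fderiv (hf.differentiable three_ne_zero)
    (diffBound₂_of_iteratedFDeriv (hf.fderiv_right (by norm_num)) fun x => by
      rw [norm_iteratedFDeriv_fderiv]; exact h x)

end Differences

open Filter Topology in
/-- If every bound `B` for `D` in the weight `w` improves to `B / 2 + C`, then `2 C` is a bound. -/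
theorem le_of_bound_improves {ι : Type*} {D w : ι → ℝ} {B C : ℝ} (hB : ∀ t, D t ≤ B * w t)
    (h : ∀ B, (∀ t, D t ≤ B * w t) → ∀ t, D t ≤ (B / 2 + C) * w t) (t : ι) : D t ≤ 2 * C * w t := by
  -- The map `B ↦ B / 2 + C` has the fixed point `2 C`, and its iterates approach it geometrically.
  have hn : ∀ n : ℕ, ∀ t, D t ≤ (2 * C + (B - 2 * C) * (1 / 2) ^ n) * w t := by
    intro n
    induction n with
    | zero => simpa using hB
    | succ n ih =>
      intro t
      convert h _ ih t using 2
      ring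
  have t0 : Tendsto (fun n : ℕ => (2 * C + (B - 2 * C) * (1 / 2 : ℝ) ^ n) * w t) atTop
      (𝓝 ((2 * C + (B - 2 * C) * 0) * w t)) :=
    (((tendsto_pow_atTop_nhds_zero_of_lt_one (by norm_num) (by norm_num)).const_mul _).const_add
      _).mul_const _
  have := ge_of_tendsto t0 (Eventually.of_forall fun n => hn n t)
  simpa using this
end
end KleinGordon

namespace KleinGordon
noncomputable section

/-! ### The Lyapunov-Perron construction of a center-stable manifold -/

section LyapunovPerron

set_option linter.unusedSectionVars false

variable {E : Type*} [NormedAddCommGroup E] [NormedSpace ℝ E]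

/-- A jointly continuous one-parameter group which is contractive for positive times. -/
structure IsContractiveGroup (T : ℝ → E →L[ℝ] E) : Prop where
  zero : ∀ x, T 0 x = x
  add : ∀ s t x, T (s + t) x = T s (T t x)
  cont : Continuous fun p : ℝ × E => T p.1 p.2
  norm_le : ∀ t, 0 ≤ t → ∀ x, ‖T t x‖ ≤ ‖x‖

/-- The integral operator of the Lyapunov-Perron equation. -/
def lpOp (T : ℝ → E →L[ℝ] E) (w : ℝ → E × ℝ) (t : ℝ) : E × ℝ :=
  (T t (∫ s in (0 : ℝ)..t, T (-s) (w s).1), -(Real.exp t * ∫ s in Ioi t, Real.exp (-s) * (w s).2))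

/-- Continuous curves which grow at most like `e^{t/4}`. -/
def SlowGrowth (w : ℝ → E × ℝ) : Prop :=
  Continuous w ∧ ∃ W, ∀ t, 0 ≤ t → ‖w t‖ ≤ W * Real.exp (1 / 4 * t)

theorem SlowGrowth.add {w w' : ℝ → E × ℝ} (h : SlowGrowth w) (h' : SlowGrowth w') :
    SlowGrowth (w + w') := by
  obtain ⟨c, W, hW⟩ := h
  obtain ⟨c', W', hW'⟩ := h'
  refine ⟨c.add c', W + W', fun t ht => (norm_add_le _ _).trans ?_⟩
  rw [add_mul]
  exact add_le_add (hW t ht) (hW' t ht)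

theorem SlowGrowth.neg {w : ℝ → E × ℝ} (h : SlowGrowth w) : SlowGrowth (-w) :=
  ⟨h.1.neg, h.2.imp fun W hW t ht => by simpa using hW t ht⟩

theorem SlowGrowth.sub {w w' : ℝ → E × ℝ} (h : SlowGrowth w) (h' : SlowGrowth w') :
    SlowGrowth (w - w') := by
  rw [sub_eq_add_neg]; exact h.add h'.neg

theorem integrableOn_of_growth {w : ℝ → E × ℝ} (hw : Continuous w) {W μ : ℝ} (hμ : μ < 1)
    {t : ℝ} (ht : 0 ≤ t) (h : ∀ s, 0 ≤ s → ‖w s‖ ≤ W * Real.exp (μ * s)) :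
    MeasureTheory.IntegrableOn (fun s => Real.exp (-s) * (w s).2) (Ioi t) := by
  have h1 : MeasureTheory.IntegrableOn (fun s => W * Real.exp ((μ - 1) * s)) (Ioi t) :=
    (integrableOn_exp_mul_Ioi (by linarith) t).const_mul W
  refine MeasureTheory.Integrable.mono' h1
    (by fun_prop : Continuous fun s => Real.exp (-s) * (w s).2).aestronglyMeasurable ?_
  refine (MeasureTheory.ae_restrict_iff' measurableSet_Ioi).mpr (Filter.Eventually.of_forall ?_)
  intro s hs
  have hs0 : 0 ≤ s := ht.trans (le_of_lt hs)
  rw [norm_mul, Real.norm_eq_abs, abs_of_pos (Real.exp_pos _)]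
  calc _ ≤ Real.exp (-s) * (W * Real.exp (μ * s)) :=
        mul_le_mul_of_nonneg_left ((norm_snd_le _).trans (h s hs0)) (Real.exp_pos _).le
    _ = _ := by rw [show (μ - 1) * s = -s + μ * s by ring, Real.exp_add]; ring

theorem SlowGrowth.integrableOn {w : ℝ → E × ℝ} (h : SlowGrowth w) {t : ℝ} (ht : 0 ≤ t) :
    MeasureTheory.IntegrableOn (fun s => Real.exp (-s) * (w s).2) (Ioi t) := by
  obtain ⟨c, W, hW⟩ := h
  exact integrableOn_of_growth c (by norm_num) ht hW

theorem IsContractiveGroup.continuous_comp {T : ℝ → E →L[ℝ] E} (hT : IsContractiveGroup T)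
    {α : Type*} [TopologicalSpace α] {a : α → ℝ} {x : α → E} (ha : Continuous a)
    (hx : Continuous x) : Continuous fun s => T (a s) (x s) :=
  hT.cont.comp (ha.prodMk hx)

theorem lpOp_add {T : ℝ → E →L[ℝ] E} (hT : IsContractiveGroup T) {w w' : ℝ → E × ℝ}
    (h : SlowGrowth w) (h' : SlowGrowth w') {t : ℝ} (ht : 0 ≤ t) :
    lpOp T (w + w') t = lpOp T w t + lpOp T w' t := by
  have c := h.1
  have c' := h'.1
  have e1 : ∫ s in (0 : ℝ)..t, T (-s) ((w + w') s).1
      = (∫ s in (0 : ℝ)..t, T (-s) (w s).1) + ∫ s in (0 : ℝ)..t, T (-s) (w' s).1 := by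
    rw [← intervalIntegral.integral_add]
    · simp
    · exact (hT.continuous_comp continuous_neg c.fst).intervalIntegrable _ _
    · exact (hT.continuous_comp continuous_neg c'.fst).intervalIntegrable _ _
  have e2 : ∫ s in Ioi t, Real.exp (-s) * ((w + w') s).2
      = (∫ s in Ioi t, Real.exp (-s) * (w s).2) + ∫ s in Ioi t, Real.exp (-s) * (w' s).2 := by
    rw [← MeasureTheory.integral_add (h.integrableOn ht) (h'.integrableOn ht)]
    simp [mul_add]
  ext1
  · simp only [lpOp, e1, Prod.fst_add, map_add]
  · simp only [lpOp, e2, Prod.snd_add]; ring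

theorem lpOp_neg {T : ℝ → E →L[ℝ] E} {w : ℝ → E × ℝ} {t : ℝ} :
    lpOp T (-w) t = -lpOp T w t := by
  ext1
  · simp [lpOp]
  · simp [lpOp, MeasureTheory.integral_neg]

theorem lpOp_sub {T : ℝ → E →L[ℝ] E} (hT : IsContractiveGroup T) {w w' : ℝ → E × ℝ}
    (h : SlowGrowth w) (h' : SlowGrowth w') {t : ℝ} (ht : 0 ≤ t) :
    lpOp T (w - w') t = lpOp T w t - lpOp T w' t := by
  rw [sub_eq_add_neg, lpOp_add hT h h'.neg ht, lpOp_neg, sub_eq_add_neg]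

theorem IsContractiveGroup.apply_integral [CompleteSpace E] {T : ℝ → E →L[ℝ] E}
    (hT : IsContractiveGroup T) {w : ℝ → E} {a b : ℝ}
    (hw : IntervalIntegrable (fun s => T (-s) (w s)) MeasureTheory.volume a b) (t : ℝ) :
    T t (∫ s in a..b, T (-s) (w s)) = ∫ s in a..b, T (t - s) (w s) := by
  rw [← (T t).intervalIntegral_comp_comm hw]
  simp only [← hT.add, ← sub_eq_add_neg]

theorem integral_exp_mul_interval {μ : ℝ} (hμ : μ ≠ 0) (a b : ℝ) :
    ∫ s in a..b, Real.exp (μ * s) = (Real.exp (μ * b) - Real.exp (μ * a)) / μ := by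
  rw [intervalIntegral.integral_comp_mul_left (fun s => Real.exp s) hμ, integral_exp, smul_eq_mul]
  ring

/-- In the weight `e^{μ t}` the center-stable integral gains `1 / μ` and the unstable one `1 / (1 -
μ)`. Both are at most `4` on the window `1/4 ≤ μ ≤ 3/4`, which has room for the weights of the
first, second and third differences. -/
theorem norm_lpOp_le [CompleteSpace E] {T : ℝ → E →L[ℝ] E} (hT : IsContractiveGroup T)
    {w : ℝ → E × ℝ} (hw : Continuous w) {W μ : ℝ} (hμ : 1 / 4 ≤ μ) (hμ' : μ ≤ 3 / 4)
    (h : ∀ s, 0 ≤ s → ‖w s‖ ≤ W * Real.exp (μ * s)) {t : ℝ} (ht : 0 ≤ t) :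
    ‖lpOp T w t‖ ≤ 4 * W * Real.exp (μ * t) := by
  have hW : 0 ≤ W := by simpa using (norm_nonneg _).trans (h 0 le_rfl)
  have hμ0 : 0 < μ := by linarith
  refine max_le ?_ ?_
  · simp only [lpOp]
    rw [hT.apply_integral ((hT.continuous_comp continuous_neg hw.fst).intervalIntegrable _ _)]
    have e := intervalIntegral.norm_integral_le_of_norm_le (f := fun s => T (t - s) (w s).1)
      (g := fun s => W * Real.exp (μ * s)) (μ := MeasureTheory.volume) ht
      (Filter.Eventually.of_forall fun s hs => (hT.norm_le _ (by linarith [hs.2]) _).trans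
        ((norm_fst_le _).trans (h s hs.1.le)))
      (by apply Continuous.intervalIntegrable; fun_prop)
    refine e.trans ?_
    rw [intervalIntegral.integral_const_mul, integral_exp_mul_interval hμ0.ne']
    simp only [mul_zero, Real.exp_zero]
    have hx := Real.exp_pos (μ * t)
    rw [mul_comm 4 W, mul_assoc]
    refine mul_le_mul_of_nonneg_left ?_ hW
    rw [div_le_iff₀ hμ0]
    nlinarith
  · simp only [lpOp]
    rw [norm_neg, norm_mul, Real.norm_eq_abs, abs_of_pos (Real.exp_pos _)]
    have e := MeasureTheory.norm_integral_le_of_norm_le (μ := MeasureTheory.volume.restrict (Ioi t))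
      (f := fun s => Real.exp (-s) * (w s).2) (g := fun s => W * Real.exp ((μ - 1) * s))
      ((integrableOn_exp_mul_Ioi (by linarith) t).const_mul W)
      ((MeasureTheory.ae_restrict_iff' measurableSet_Ioi).mpr (Filter.Eventually.of_forall
        fun s hs => ?_))
    · rw [MeasureTheory.integral_const_mul, integral_exp_mul_Ioi (by linarith)] at e
      calc _ ≤ Real.exp t * _ := mul_le_mul_of_nonneg_left e (Real.exp_pos _).le
        _ = W / (1 - μ) * Real.exp (μ * t) := by
          rw [show μ * t = t + (μ - 1) * t by ring, Real.exp_add]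
          have : μ - 1 ≠ 0 := by linarith
          have : 1 - μ ≠ 0 := by linarith
          field_simp
          ring
        _ ≤ _ := by
          refine mul_le_mul_of_nonneg_right ?_ (Real.exp_pos _).le
          rw [div_le_iff₀ (by linarith)]
          nlinarith
    · have hs0 : 0 ≤ s := ht.trans (le_of_lt hs)
      rw [norm_mul, Real.norm_eq_abs, abs_of_pos (Real.exp_pos _)]
      calc _ ≤ Real.exp (-s) * (W * Real.exp (μ * s)) :=
            mul_le_mul_of_nonneg_left ((norm_snd_le _).trans (h s hs0)) (Real.exp_pos _).le
        _ = _ := by rw [show (μ - 1) * s = -s + μ * s by ring, Real.exp_add]; ring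

theorem integral_Ioi_eq_sub {w : ℝ → E × ℝ} (h : SlowGrowth w) {t : ℝ} (ht : 0 ≤ t) :
    ∫ s in Ioi t, Real.exp (-s) * (w s).2 = (∫ s in Ioi (0 : ℝ), Real.exp (-s) * (w s).2)
      - ∫ s in (0 : ℝ)..t, Real.exp (-s) * (w s).2 := by
  rw [← intervalIntegral.integral_interval_add_Ioi (h.integrableOn le_rfl) (h.integrableOn ht)]
  ring

/-- Growth is controlled only for nonnegative times, so the curve is frozen at its value at `0`
before that. The tail integral is a constant minus a primitive. -/
theorem continuous_lpOp [CompleteSpace E] {T : ℝ → E →L[ℝ] E} (hT : IsContractiveGroup T)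
    {w : ℝ → E × ℝ} (h : SlowGrowth w) : Continuous fun t => lpOp T w (max t 0) := by
  have c := h.1
  have hm : Continuous fun t : ℝ => max t 0 := by fun_prop
  have e : (fun t => lpOp T w (max t 0)) = fun t =>
      (T (max t 0) (∫ s in (0 : ℝ)..(max t 0), T (-s) (w s).1), -(Real.exp (max t 0) *
        ((∫ s in Ioi (0 : ℝ), Real.exp (-s) * (w s).2)
          - ∫ s in (0 : ℝ)..(max t 0), Real.exp (-s) * (w s).2))) := by
    funext t
    rw [lpOp, integral_Ioi_eq_sub h (le_max_right _ _)]
  rw [e]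
  have c1 : Continuous fun t => ∫ s in (0 : ℝ)..t, T (-s) (w s).1 :=
    intervalIntegral.continuous_primitive
      (fun a b => (hT.continuous_comp continuous_neg c.fst).intervalIntegrable a b) 0
  have c2 : Continuous fun t => ∫ s in (0 : ℝ)..t, Real.exp (-s) * (w s).2 :=
    intervalIntegral.continuous_primitive
      (fun a b => (by fun_prop : Continuous fun s => Real.exp (-s) * (w s).2).intervalIntegrable a b) 0
  exact (hT.continuous_comp hm (c1.comp hm)).prodMk
    ((Real.continuous_exp.comp hm).mul (continuous_const.sub (c2.comp hm))).neg

/-- `u` solves the Lyapunov-Perron equation with initial value `x` of the center-stable part. -/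
structure IsLPSolution (T : ℝ → E →L[ℝ] E) (g : E × ℝ → E × ℝ) (x : E) (u : ℝ → E × ℝ) : Prop where
  growth : SlowGrowth u
  eq : ∀ t, 0 ≤ t → u t = (T t x, 0) + lpOp T (g ∘ u) t

theorem SlowGrowth.comp {g : E × ℝ → E × ℝ} {L : ℝ} (h₀ : g 0 = 0)
    (h₁ : DiffBound₁ L g) (hL : 0 ≤ L) {u : ℝ → E × ℝ} (hu : SlowGrowth u) : SlowGrowth (g ∘ u) := by
  obtain ⟨c, W, hW⟩ := hu
  refine ⟨h₁.continuous.comp c, L * W, fun t ht => ?_⟩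
  have e := h₁ 0 (u t)
  rw [h₀, zero_add, sub_zero] at e
  rw [mul_assoc]
  exact e.trans (mul_le_mul_of_nonneg_left (hW t ht) hL)

theorem IsLPSolution.fst_zero {T : ℝ → E →L[ℝ] E} (hT : IsContractiveGroup T) {g : E × ℝ → E × ℝ}
    {x : E} {u : ℝ → E × ℝ} (h : IsLPSolution T g x u) : (u 0).1 = x := by
  rw [h.eq 0 le_rfl]; simp [lpOp, hT.zero]

/-- A priori estimate for linear Lyapunov-Perron equations in the weight `e^{μ t}`. -/
theorem norm_le_of_lp_eq [CompleteSpace E] {T : ℝ → E →L[ℝ] E} (hT : IsContractiveGroup T)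
    {D w : ℝ → E × ℝ} {a : E} {L C μ : ℝ} (hμ : 1 / 4 ≤ μ) (hμ' : μ ≤ 3 / 4)
    (hL' : L ≤ 1 / 8) (hw : Continuous w) (hD : ∀ t, 0 ≤ t → D t = (T t a, 0) + lpOp T w t)
    (hg : SlowGrowth D) (hwD : ∀ t, 0 ≤ t → ‖w t‖ ≤ L * ‖D t‖ + C * Real.exp (μ * t))
    {t : ℝ} (ht : 0 ≤ t) : ‖D t‖ ≤ 2 * (‖a‖ + 4 * C) * Real.exp (μ * t) := by
  obtain ⟨-, W, hW⟩ := hg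
  have hW0 : 0 ≤ W := by simpa using (norm_nonneg _).trans (hW 0 le_rfl)
  refine le_of_bound_improves (ι := Ici (0 : ℝ)) (D := fun t => ‖D t‖)
    (w := fun t => Real.exp (μ * t)) (B := W) (C := ‖a‖ + 4 * C) ?_ ?_ ⟨t, ht⟩
  · rintro ⟨s, hs⟩
    refine (hW s hs).trans (mul_le_mul_of_nonneg_left (Real.exp_le_exp.mpr ?_) hW0)
    exact mul_le_mul_of_nonneg_right hμ hs
  -- A bound `B` for `D` bounds `w` by `B / 8 + C`; the factor `4` of the integral operator turns
  -- this into `B / 2 + 4 C`, and the initial value adds `‖a‖`.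
  · rintro B hB ⟨s, hs⟩
    have hs0 : (0 : ℝ) ≤ s := hs
    have hB0 : 0 ≤ B := by simpa using (norm_nonneg _).trans (hB ⟨0, self_mem_Ici⟩)
    have h1 : ∀ r, 0 ≤ r → ‖w r‖ ≤ (B / 8 + C) * Real.exp (μ * r) := by
      intro r hr
      refine (hwD r hr).trans ?_
      have e1 := hB ⟨r, hr⟩
      have e2 : L * ‖D r‖ ≤ 1 / 8 * (B * Real.exp (μ * r)) :=
        mul_le_mul hL' e1 (norm_nonneg _) (by norm_num)
      linarith
    have e := norm_lpOp_le hT hw hμ hμ' h1 hs0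
    have e2 : ‖((T s a, 0) : E × ℝ)‖ ≤ ‖a‖ * Real.exp (μ * s) := by
      rw [Prod.norm_mk, norm_zero, max_eq_left (norm_nonneg _)]
      refine (hT.norm_le s hs a).trans (le_mul_of_one_le_right (norm_nonneg _) ?_)
      exact Real.one_le_exp (mul_nonneg (by linarith) hs0)
    change ‖D s‖ ≤ _
    rw [hD s hs]
    refine (norm_add_le _ _).trans ((add_le_add e2 e).trans (le_of_eq (by ring)))

/-- Contraction principle for curves `e^{t/4} φ` with `φ` bounded and continuous: the operator norm
`4` times the Lipschitz constant `1 / 8` is `1 / 2`. -/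
theorem exists_isLPSolution [CompleteSpace E] {T : ℝ → E →L[ℝ] E} (hT : IsContractiveGroup T)
    {g : E × ℝ → E × ℝ} {L : ℝ} (h₀ : g 0 = 0) (h₁ : DiffBound₁ L g) (hL : 0 ≤ L) (hL' : L ≤ 1 / 8)
    (x : E) : ∃ u, IsLPSolution T g x u := by
  let ex : BoundedContinuousFunction ℝ (E × ℝ) → ℝ → E × ℝ :=
    fun φ t => Real.exp (1 / 4 * max t 0) • φ t
  have hex : ∀ φ, SlowGrowth (ex φ) := by
    intro φ
    refine ⟨by fun_prop, ‖φ‖, fun t ht => ?_⟩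
    simp only [ex]
    rw [norm_smul, Real.norm_eq_abs, abs_of_pos (Real.exp_pos _), max_eq_left ht, mul_comm]
    exact mul_le_mul_of_nonneg_right (φ.norm_coe_le_norm t) (Real.exp_pos _).le
  have hgex : ∀ φ, SlowGrowth (g ∘ ex φ) := fun φ => (hex φ).comp h₀ h₁ hL
  let R : BoundedContinuousFunction ℝ (E × ℝ) → ℝ → E × ℝ := fun φ t =>
    Real.exp (-(1 / 4 * max t 0)) • ((T (max t 0) x, 0) + lpOp T (g ∘ ex φ) (max t 0))
  have hRc : ∀ φ, Continuous (R φ) := by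
    intro φ
    have c1 : Continuous fun t : ℝ => T (max t 0) x :=
      hT.continuous_comp (by fun_prop) continuous_const
    have c2 := continuous_lpOp hT (hgex φ)
    exact (by fun_prop : Continuous fun t : ℝ => Real.exp (-(1 / 4 * max t 0))).smul
      ((c1.prodMk continuous_const).add c2)
  have hRb : ∀ φ, ∃ B, ∀ t, ‖R φ t‖ ≤ B := by
    intro φ
    obtain ⟨c, W, hW⟩ := hgex φ
    refine ⟨‖x‖ + 4 * W, fun t => ?_⟩
    have hm : (0 : ℝ) ≤ max t 0 := le_max_right _ _
    have e := norm_lpOp_le hT c (le_refl (1 / 4 : ℝ)) (by norm_num) hW hm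
    have e1 : ‖((T (max t 0) x, 0) : E × ℝ)‖ ≤ ‖x‖ * Real.exp (1 / 4 * max t 0) := by
      rw [Prod.norm_mk, norm_zero, max_eq_left (norm_nonneg _)]
      refine (hT.norm_le _ hm x).trans (le_mul_of_one_le_right (norm_nonneg _) ?_)
      exact Real.one_le_exp (mul_nonneg (by norm_num) hm)
    simp only [R]
    rw [norm_smul, Real.norm_eq_abs, abs_of_pos (Real.exp_pos _), Real.exp_neg,
      inv_mul_le_iff₀ (Real.exp_pos _)]
    refine (norm_add_le _ _).trans ((add_le_add e1 e).trans (le_of_eq (by ring)))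
  choose B hB using hRb
  let Θ : BoundedContinuousFunction ℝ (E × ℝ) → BoundedContinuousFunction ℝ (E × ℝ) := fun φ =>
    BoundedContinuousFunction.ofNormedAddCommGroup (R φ) (hRc φ) (B φ) (hB φ)
  have hΘ : ContractingWith (1 / 2) Θ := by
    refine ⟨by rw [← NNReal.coe_lt_coe]; norm_num, LipschitzWith.of_dist_le_mul fun φ ψ => ?_⟩
    rw [BoundedContinuousFunction.dist_le (by positivity)]
    intro t
    have hm : (0 : ℝ) ≤ max t 0 := le_max_right _ _
    have e0 : Θ φ t - Θ ψ t
        = Real.exp (-(1 / 4 * max t 0)) • lpOp T (g ∘ ex φ - g ∘ ex ψ) (max t 0) := by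
      rw [lpOp_sub hT (hgex φ) (hgex ψ) hm]
      change R φ t - R ψ t = _
      simp only [R]
      rw [← smul_sub, add_sub_add_left_eq_sub]
    rw [dist_eq_norm, e0, norm_smul, Real.norm_eq_abs, abs_of_pos (Real.exp_pos _), Real.exp_neg,
      inv_mul_le_iff₀ (Real.exp_pos _)]
    have h2 : ∀ s, 0 ≤ s →
        ‖(g ∘ ex φ - g ∘ ex ψ) s‖ ≤ (1 / 8 * dist φ ψ) * Real.exp (1 / 4 * s) := by
      intro s hs
      have e := h₁ (ex ψ s) (ex φ s - ex ψ s)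
      rw [add_sub_cancel] at e
      refine e.trans ?_
      have e2 : ex φ s - ex ψ s = Real.exp (1 / 4 * s) • (φ s - ψ s) := by
        simp only [ex]; rw [max_eq_left hs, smul_sub]
      rw [e2, norm_smul, Real.norm_eq_abs, abs_of_pos (Real.exp_pos _), ← dist_eq_norm]
      calc _ ≤ 1 / 8 * (Real.exp (1 / 4 * s) * dist φ ψ) :=
            mul_le_mul hL' (mul_le_mul_of_nonneg_left (φ.dist_coe_le_dist s) (Real.exp_pos _).le)
              (by positivity) (by norm_num)
        _ = _ := by ring
    have e := norm_lpOp_le hT (((hgex φ).sub (hgex ψ)).1) (le_refl (1 / 4 : ℝ)) (by norm_num) h2 hm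
    refine e.trans (le_of_eq ?_)
    have : (((1 / 2 : NNReal)) : ℝ) = 1 / 2 := by norm_num
    rw [this]
    ring
  have : Nonempty (BoundedContinuousFunction ℝ (E × ℝ)) := ⟨0⟩
  let φ := ContractingWith.fixedPoint Θ hΘ
  have hφ : Θ φ = φ := hΘ.fixedPoint_isFixedPt
  refine ⟨ex φ, hex φ, fun t ht => ?_⟩
  have e : ex φ t = Real.exp (1 / 4 * max t 0) • Θ φ t := by rw [hφ]
  rw [e]
  change Real.exp (1 / 4 * max t 0) • R φ t = _
  simp only [R]
  rw [smul_smul, ← Real.exp_add, add_neg_cancel, Real.exp_zero, one_smul, max_eq_left ht]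

end LyapunovPerron
end
end KleinGordon

/-! ### Mild solutions and the center-stable graph. -/

namespace KleinGordon
noncomputable section

section CenterStable

set_option linter.unusedSectionVars false

variable {E : Type*} [NormedAddCommGroup E] [NormedSpace ℝ E]

/-- The linear flow on `E × ℝ` with the unstable rate `1` on `ℝ`. -/
def linFlow (T : ℝ → E →L[ℝ] E) (t : ℝ) : E × ℝ →L[ℝ] E × ℝ :=
  (T t).prodMap (Real.exp t • ContinuousLinearMap.id ℝ ℝ)

theorem linFlow_apply (T : ℝ → E →L[ℝ] E) (t : ℝ) (z : E × ℝ) :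
    linFlow T t z = (T t z.1, Real.exp t * z.2) := by
  rfl

/-- Mild solutions on `J` of `u' = B u + g u`, where `B` generates `linFlow T`. -/
def IsMild (T : ℝ → E →L[ℝ] E) (g : E × ℝ → E × ℝ) (J : Set ℝ) (u : ℝ → E × ℝ) : Prop :=
  ContinuousOn u J ∧ ∀ s ∈ J, ∀ t ∈ J,
    linFlow T (-t) (u t) - linFlow T (-s) (u s) = ∫ τ in s..t, linFlow T (-τ) (g (u τ))

variable {T : ℝ → E →L[ℝ] E}

theorem linFlow_zero (hT : IsContractiveGroup T) (z : E × ℝ) : linFlow T 0 z = z := by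
  simp [linFlow_apply, hT.zero]

theorem linFlow_add (hT : IsContractiveGroup T) (s t : ℝ) (z : E × ℝ) :
    linFlow T (s + t) z = linFlow T s (linFlow T t z) := by
  simp [linFlow_apply, hT.add, Real.exp_add, mul_assoc]

theorem norm_linFlow_le (hT : IsContractiveGroup T) {t : ℝ} (ht : 0 ≤ t) (z : E × ℝ) :
    ‖linFlow T t z‖ ≤ Real.exp t * ‖z‖ := by
  have h1 : 1 ≤ Real.exp t := Real.one_le_exp ht
  rw [linFlow_apply]
  refine max_le ?_ ?_
  · exact ((hT.norm_le t ht _).trans (norm_fst_le z)).trans (le_mul_of_one_le_left (norm_nonneg _) h1)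
  · rw [norm_mul, Real.norm_eq_abs, abs_of_pos (Real.exp_pos _)]
    exact mul_le_mul_of_nonneg_left (norm_snd_le z) (Real.exp_pos _).le

theorem continuousOn_linFlow (hT : IsContractiveGroup T) {J : Set ℝ} {w : ℝ → E × ℝ}
    (hw : ContinuousOn w J) : ContinuousOn (fun s => linFlow T (-s) (w s)) J := by
  simp only [linFlow_apply]
  refine ContinuousOn.prodMk ?_ ?_
  · exact hT.cont.comp_continuousOn (continuousOn_neg.prodMk hw.fst)
  · exact (by fun_prop : Continuous fun s : ℝ => Real.exp (-s)).continuousOn.mul hw.snd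

theorem continuous_linFlow (hT : IsContractiveGroup T) {w : ℝ → E × ℝ}
    (hw : Continuous w) : Continuous fun s => linFlow T (-s) (w s) :=
  continuousOn_univ.mp (continuousOn_linFlow hT hw.continuousOn)

variable {g : E × ℝ → E × ℝ}

theorem IsMild.mono {J J' : Set ℝ} {u : ℝ → E × ℝ} (h : IsMild T g J u) (hJ : J' ⊆ J) :
    IsMild T g J' u :=
  ⟨h.1.mono hJ, fun s hs t ht => h.2 s (hJ hs) t (hJ ht)⟩

theorem IsMild.congr {J : Set ℝ} (hJ : J.OrdConnected) {u u' : ℝ → E × ℝ} (h : IsMild T g J u)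
    (e : EqOn u' u J) : IsMild T g J u' := by
  refine ⟨h.1.congr e, fun s hs t ht => ?_⟩
  rw [e hs, e ht, h.2 s hs t ht]
  refine intervalIntegral.integral_congr fun τ hτ => ?_
  simp only [e (hJ.uIcc_subset hs ht hτ)]

theorem IsMild.shift [CompleteSpace E] (hT : IsContractiveGroup T) (hg : Continuous g) {J : Set ℝ}
    (hJ : J.OrdConnected) {u : ℝ → E × ℝ} (h : IsMild T g J u) (σ : ℝ) :
    IsMild T g {t | t + σ ∈ J} (fun t => u (t + σ)) := by
  refine ⟨h.1.comp (by fun_prop) fun t ht => ht, fun s hs t ht => ?_⟩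
  have e := congrArg (linFlow T σ) (h.2 _ hs _ ht)
  have hc : ContinuousOn (fun τ => linFlow T (-τ) (g (u τ))) (uIcc (s + σ) (t + σ)) :=
    continuousOn_linFlow hT (hg.comp_continuousOn (h.1.mono (hJ.uIcc_subset hs ht)))
  rw [map_sub, ← linFlow_add hT, ← linFlow_add hT,
    ← (linFlow T σ).intervalIntegral_comp_comm hc.intervalIntegrable] at e
  simp only [← linFlow_add hT] at e
  rw [show σ + -(t + σ) = -t by ring, show σ + -(s + σ) = -s by ring,
    ← intervalIntegral.integral_comp_add_right] at e
  rw [e]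
  refine intervalIntegral.integral_congr fun τ _ => ?_
  simp only
  rw [show σ + -(τ + σ) = -τ by ring]

/-- Needed to glue a backward piece of a solution to a slowly growing forward solution; integrals
over the union are split at the common point `m`. -/
theorem IsMild.union [CompleteSpace E] (hT : IsContractiveGroup T) (hg : Continuous g)
    {J J' : Set ℝ} (hJ : J.OrdConnected) (hJ' : J'.OrdConnected) {u : ℝ → E × ℝ} {m : ℝ}
    (hm : m ∈ J) (hm' : m ∈ J') (h : IsMild T g J u) (h' : IsMild T g J' u)
    (hc : ContinuousOn u (J ∪ J')) : IsMild T g (J ∪ J') u := by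
  have key : ∀ {K : Set ℝ}, K.OrdConnected → IsMild T g K u → ∀ {a b}, a ∈ K → b ∈ K →
      IntervalIntegrable (fun τ => linFlow T (-τ) (g (u τ))) MeasureTheory.volume a b :=
    fun hK h a b ha hb => (continuousOn_linFlow hT
      (hg.comp_continuousOn (h.1.mono (hK.uIcc_subset ha hb)))).intervalIntegrable
  have toM : ∀ s ∈ J ∪ J',
      linFlow T (-m) (u m) - linFlow T (-s) (u s) = (∫ τ in s..m, linFlow T (-τ) (g (u τ))) ∧
      IntervalIntegrable (fun τ => linFlow T (-τ) (g (u τ))) MeasureTheory.volume s m := by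
    rintro s (hs | hs)
    · exact ⟨h.2 s hs m hm, key hJ h hs hm⟩
    · exact ⟨h'.2 s hs m hm', key hJ' h' hs hm'⟩
  refine ⟨hc, fun s hs t ht => ?_⟩
  obtain ⟨e1, i1⟩ := toM s hs
  obtain ⟨e2, i2⟩ := toM t ht
  rw [← intervalIntegral.integral_add_adjacent_intervals i1 i2.symm,
    intervalIntegral.integral_symm t m, ← e1, ← e2]
  abel

theorem IsLPSolution.isMild [CompleteSpace E] (hT : IsContractiveGroup T) {x : E} {L : ℝ}
    (h₀ : g 0 = 0) (h₁ : DiffBound₁ L g) (hL : 0 ≤ L) {u : ℝ → E × ℝ}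
    (h : IsLPSolution T g x u) : IsMild T g (Ici 0) u := by
  have hc := h.growth.1
  have hw := h.growth.comp h₀ h₁ hL
  have key : ∀ t, 0 ≤ t → linFlow T (-t) (u t) = linFlow T (-0) (u 0)
      + ∫ τ in (0 : ℝ)..t, linFlow T (-τ) (g (u τ)) := by
    intro t ht
    have i1 := (hT.continuous_comp continuous_neg hw.1.fst).intervalIntegrable
      (μ := MeasureTheory.volume) 0 t
    have i2 := ((Real.continuous_exp.comp continuous_neg).mul hw.1.snd).intervalIntegrable (μ := MeasureTheory.volume) 0 t
    have i := (continuous_linFlow hT hw.1).intervalIntegrable (μ := MeasureTheory.volume) 0 t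
    have hf : (∫ τ in (0 : ℝ)..t, linFlow T (-τ) (g (u τ))).1
        = ∫ τ in (0 : ℝ)..t, T (-τ) ((g ∘ u) τ).1 := by
      have := (ContinuousLinearMap.fst ℝ E ℝ).intervalIntegral_comp_comm i
      simpa [linFlow_apply] using this.symm
    have hs : (∫ τ in (0 : ℝ)..t, linFlow T (-τ) (g (u τ))).2
        = ∫ τ in (0 : ℝ)..t, Real.exp (-τ) * ((g ∘ u) τ).2 := by
      have := (ContinuousLinearMap.snd ℝ E ℝ).intervalIntegral_comp_comm i
      simpa [linFlow_apply] using this.symm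
    have e0 := h.eq 0 le_rfl
    have e := h.eq t ht
    have hinv : ∀ y, T (-t) (T t y) = y := fun y => by rw [← hT.add, neg_add_cancel, hT.zero]
    ext1
    · rw [Prod.fst_add, hf, linFlow_apply, linFlow_apply]
      simp only [neg_zero, hT.zero]
      rw [h.fst_zero hT, e]
      simp only [lpOp, Prod.mk_add_mk, map_add, hinv]
    · rw [Prod.snd_add, hs, linFlow_apply, linFlow_apply, e, e0]
      simp only [lpOp, neg_zero, Real.exp_zero, one_mul, Prod.mk_add_mk, zero_add]
      rw [integral_Ioi_eq_sub hw ht, mul_neg, ← mul_assoc, ← Real.exp_add, neg_add_cancel,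
        Real.exp_zero]
      ring
  refine ⟨hc.continuousOn, fun s hs t ht => ?_⟩
  have i := fun a b => (continuous_linFlow hT hw.1).intervalIntegrable
    (μ := MeasureTheory.volume) a b
  rw [key t ht, key s hs, add_sub_add_left_eq_sub]
  exact intervalIntegral.integral_interval_sub_left (i 0 t) (i 0 s)

/-- A slowly growing mild solution on `[0, ∞)` solves the Lyapunov-Perron equation. -/
theorem IsMild.isLPSolution [CompleteSpace E] (hT : IsContractiveGroup T) {L : ℝ}
    (h₀ : g 0 = 0) (h₁ : DiffBound₁ L g) (hL : 0 ≤ L) {u : ℝ → E × ℝ} (h : IsMild T g (Ici 0) u)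
    {B : ℝ} (hB : ∀ t, 0 ≤ t → ‖u t‖ ≤ B * Real.exp (1 / 4 * t)) :
    IsLPSolution T g (u 0).1 (fun t => u (max t 0)) := by
  have hc : Continuous fun t => u (max t 0) :=
    h.1.comp_continuous (by fun_prop) fun t => mem_Ici.mpr (le_max_right _ _)
  have hgr : SlowGrowth fun t => u (max t 0) :=
    ⟨hc, B, fun t ht => by simpa only [max_eq_left ht] using hB t ht⟩
  have h' : IsMild T g (Ici 0) (fun t => u (max t 0)) :=
    h.congr ordConnected_Ici fun t ht => congrArg u (max_eq_left ht)
  have hu0 : (fun t => u (max t 0)) 0 = u 0 := by simp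
  set v := fun t => u (max t 0) with hv
  have hw := hgr.comp h₀ h₁ hL
  refine ⟨hgr, ?_⟩
  have i := fun t => (continuous_linFlow hT hw.1).intervalIntegrable
    (μ := MeasureTheory.volume) 0 t
  have key := fun t (ht : 0 ≤ t) => h'.2 0 self_mem_Ici t ht
  have hs : ∀ t, (∫ τ in (0 : ℝ)..t, linFlow T (-τ) (g (v τ))).2
      = ∫ τ in (0 : ℝ)..t, Real.exp (-τ) * ((g ∘ v) τ).2 := by
    intro t
    have := (ContinuousLinearMap.snd ℝ E ℝ).intervalIntegral_comp_comm (i t)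
    simpa [linFlow_apply] using this.symm
  have hf : ∀ t, (∫ τ in (0 : ℝ)..t, linFlow T (-τ) (g (v τ))).1
      = ∫ τ in (0 : ℝ)..t, T (-τ) ((g ∘ v) τ).1 := by
    intro t
    have := (ContinuousLinearMap.fst ℝ E ℝ).intervalIntegral_comp_comm (i t)
    simpa [linFlow_apply] using this.symm
  have k2 : ∀ t, 0 ≤ t → Real.exp (-t) * (v t).2
      = (v 0).2 + ∫ τ in (0 : ℝ)..t, Real.exp (-τ) * ((g ∘ v) τ).2 := by
    intro t ht
    have := congrArg Prod.snd (key t ht)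
    rw [hs] at this
    simp only [linFlow_apply, Prod.snd_sub, neg_zero, Real.exp_zero, one_mul] at this
    linarith
  have k1 : ∀ t, 0 ≤ t → T (-t) (v t).1
      = (v 0).1 + ∫ τ in (0 : ℝ)..t, T (-τ) ((g ∘ v) τ).1 := by
    intro t ht
    have := congrArg Prod.fst (key t ht)
    rw [hf] at this
    simp only [linFlow_apply, Prod.fst_sub, neg_zero, hT.zero] at this
    rw [← this]; abel
  -- Growth like `e^{t/4}` forces `e^{-t}` times the unstable coordinate to vanish at infinity. The
  -- limit of the variation of constants formula therefore determines the initial unstable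
  -- coordinate.
  have hlim : (v 0).2 = -∫ s in Ioi (0 : ℝ), Real.exp (-s) * ((g ∘ v) s).2 := by
    have l1 := MeasureTheory.intervalIntegral_tendsto_integral_Ioi 0
      (hw.integrableOn (le_refl (0 : ℝ))) Filter.tendsto_id
    have l2 : Filter.Tendsto (fun t => Real.exp (-t) * (v t).2) Filter.atTop (nhds 0) := by
      have l3 : Filter.Tendsto (fun t : ℝ => B * Real.exp (-(3 / 4 * t))) Filter.atTop
          (nhds (B * 0)) := by
        refine Filter.Tendsto.const_mul _ (Real.tendsto_exp_neg_atTop_nhds_zero.comp ?_)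
        exact Filter.tendsto_id.const_mul_atTop (by norm_num)
      rw [mul_zero] at l3
      refine squeeze_zero_norm' ?_ l3
      filter_upwards [Filter.eventually_ge_atTop (0 : ℝ)] with t ht
      rw [norm_mul, Real.norm_eq_abs, abs_of_pos (Real.exp_pos _)]
      have hb : ‖v t‖ ≤ B * Real.exp (1 / 4 * t) := by
        have := hB t ht
        simpa [hv, max_eq_left ht] using this
      calc _ ≤ Real.exp (-t) * (B * Real.exp (1 / 4 * t)) :=
            mul_le_mul_of_nonneg_left ((norm_snd_le _).trans hb) (Real.exp_pos _).le
        _ = _ := by rw [show -(3 / 4 * t) = -t + 1 / 4 * t by ring, Real.exp_add]; ring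
    have l4 := l2.congr' (f₂ := fun t => (v 0).2
        + ∫ τ in (0 : ℝ)..t, Real.exp (-τ) * ((g ∘ v) τ).2) (by
      filter_upwards [Filter.eventually_ge_atTop (0 : ℝ)] with t ht using k2 t ht)
    have := tendsto_nhds_unique l4 (l1.const_add (v 0).2)
    linarith
  intro t ht
  have hinv : ∀ y, T t (T (-t) y) = y := fun y => by rw [← hT.add, add_neg_cancel, hT.zero]
  ext1
  · simp only [lpOp, Prod.fst_add]
    rw [← map_add, ← hu0, ← k1 t ht, hinv]
  · simp only [lpOp, Prod.snd_add, zero_add]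
    rw [integral_Ioi_eq_sub hw ht]
    have e := k2 t ht
    rw [hlim] at e
    have e3 : ((∫ s in Ioi (0 : ℝ), Real.exp (-s) * ((g ∘ v) s).2)
        - ∫ τ in (0 : ℝ)..t, Real.exp (-τ) * ((g ∘ v) τ).2) = -(Real.exp (-t) * (v t).2) := by
      linarith
    rw [e3, mul_neg, neg_neg, ← mul_assoc, ← Real.exp_add, add_neg_cancel, Real.exp_zero, one_mul]

/-- Mild solutions on a compact interval are determined by their initial value. -/
theorem IsMild.eq_of_eq [CompleteSpace E] (hT : IsContractiveGroup T) {L : ℝ}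
    (h₁ : DiffBound₁ L g) (hL' : L ≤ 1 / 8) {u v : ℝ → E × ℝ} {b : ℝ}
    (hu : IsMild T g (Icc 0 b) u) (hv : IsMild T g (Icc 0 b) v) (h : u 0 = v 0) :
    EqOn u v (Icc 0 b) := by
  obtain ⟨W, hW⟩ := isCompact_Icc.exists_bound_of_continuousOn (hu.1.sub hv.1)
  intro t ht
  have hb : (0 : ℝ) ≤ b := ht.1.trans ht.2
  have h0 : (0 : ℝ) ∈ Icc 0 b := ⟨le_rfl, hb⟩
  have hW0 : 0 ≤ W := (norm_nonneg _).trans (hW 0 h0)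
  -- A Gronwall argument in the weight `e^{2t}`: each bound for the difference improves at least by
  -- half with no inhomogeneous term, so the difference vanishes.
  have key := le_of_bound_improves (ι := Icc (0 : ℝ) b) (D := fun t => ‖u t - v t‖)
    (w := fun t => Real.exp (2 * t)) (B := W) (C := 0) ?_ ?_ ⟨t, ht⟩
  · simp only [mul_zero, zero_mul] at key
    exact sub_eq_zero.mp (norm_le_zero_iff.mp key)
  · rintro ⟨s, hs⟩
    exact (hW s hs).trans (le_mul_of_one_le_right hW0 (Real.one_le_exp (by linarith [hs.1])))
  · rintro B hB ⟨s, hs⟩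
    have hB0 : 0 ≤ B := by
      have := hB ⟨0, h0⟩
      simpa using (norm_nonneg _).trans this
    have hsub : uIcc 0 s ⊆ Icc 0 b := by
      rw [uIcc_of_le hs.1]; exact Icc_subset_Icc le_rfl hs.2
    have iu : IntervalIntegrable (fun τ => linFlow T (-τ) (g (u τ))) MeasureTheory.volume 0 s :=
      (continuousOn_linFlow hT (h₁.continuous.comp_continuousOn
      (hu.1.mono hsub))).intervalIntegrable
    have iv : IntervalIntegrable (fun τ => linFlow T (-τ) (g (v τ))) MeasureTheory.volume 0 s :=
      (continuousOn_linFlow hT (h₁.continuous.comp_continuousOn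
      (hv.1.mono hsub))).intervalIntegrable
    have e1 : u s - v s = ∫ τ in (0 : ℝ)..s, linFlow T (s - τ) (g (u τ) - g (v τ)) := by
      have a1 := hu.2 0 h0 s hs
      have a2 := hv.2 0 h0 s hs
      have a3 : linFlow T (-s) (u s - v s)
          = ∫ τ in (0 : ℝ)..s, linFlow T (-τ) (g (u τ) - g (v τ)) := by
        simp only [map_sub]
        rw [intervalIntegral.integral_sub iu iv]
        rw [← a1, ← a2, h]; abel
      have a4 := congrArg (linFlow T s) a3
      rw [← linFlow_add hT, add_neg_cancel, linFlow_zero hT] at a4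
      rw [a4, ← (linFlow T s).intervalIntegral_comp_comm]
      · simp only [← linFlow_add hT, ← sub_eq_add_neg]
      · simp only [map_sub]; exact iu.sub iv
    have e2 := intervalIntegral.norm_integral_le_of_norm_le (a := 0) (b := s)
      (f := fun τ => linFlow T (s - τ) (g (u τ) - g (v τ)))
      (g := fun τ => B / 8 * Real.exp s * Real.exp (1 * τ)) (μ := MeasureTheory.volume) hs.1
      (Filter.Eventually.of_forall fun τ hτ => ?_)
      (by apply Continuous.intervalIntegrable; fun_prop)
    · simp only
      rw [e1]
      refine e2.trans ?_
      rw [intervalIntegral.integral_const_mul, integral_exp_mul_interval one_ne_zero]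
      have hx := Real.exp_pos s
      rw [show 2 * s = s + s by ring, Real.exp_add]
      simp only [one_mul, Real.exp_zero, mul_zero, div_one, add_zero]
      have : 0 ≤ B * Real.exp s := by positivity
      nlinarith [mul_nonneg this hx.le]
    · have hτ' : τ ∈ Icc 0 b := ⟨hτ.1.le, hτ.2.trans hs.2⟩
      refine (norm_linFlow_le hT (by linarith [hτ.2]) _).trans ?_
      have a1 := h₁ (v τ) (u τ - v τ)
      rw [add_sub_cancel] at a1
      have a2 := hB ⟨τ, hτ'⟩
      simp only at a2
      have a3 : L * ‖u τ - v τ‖ ≤ 1 / 8 * (B * Real.exp (2 * τ)) :=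
        mul_le_mul hL' a2 (norm_nonneg _) (by norm_num)
      calc _ ≤ Real.exp (s - τ) * (1 / 8 * (B * Real.exp (2 * τ))) :=
            mul_le_mul_of_nonneg_left (a1.trans a3) (Real.exp_pos _).le
        _ = _ := by
          rw [show (2 : ℝ) * τ = τ + τ by ring, Real.exp_add, Real.exp_sub, one_mul]
          have := (Real.exp_pos τ).ne'
          field_simp

theorem IsLPSolution.norm_sub_le [CompleteSpace E] (hT : IsContractiveGroup T) {L : ℝ}
    (h₀ : g 0 = 0) (h₁ : DiffBound₁ L g) (hL : 0 ≤ L) (hL' : L ≤ 1 / 8) {x y : E}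
    {u v : ℝ → E × ℝ} (hu : IsLPSolution T g x u) (hv : IsLPSolution T g y v) {t : ℝ} (ht : 0 ≤ t) :
    ‖u t - v t‖ ≤ 2 * ‖x - y‖ * Real.exp (1 / 4 * t) := by
  have wu := hu.growth.comp h₀ h₁ hL
  have wv := hv.growth.comp h₀ h₁ hL
  have := norm_le_of_lp_eq hT (D := u - v) (w := g ∘ u - g ∘ v) (a := x - y) (C := 0)
    (le_refl (1 / 4 : ℝ)) (by norm_num) hL' (wu.sub wv).1 (fun t ht => ?_)
    (hu.growth.sub hv.growth) (fun t ht => ?_) ht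
  · simpa using this
  · rw [Pi.sub_apply, hu.eq t ht, hv.eq t ht, lpOp_sub hT wu wv ht, map_sub, add_sub_add_comm,
      Prod.mk_sub_mk, sub_zero]
  · have e := h₁ (v t) (u t - v t)
    rw [add_sub_cancel] at e
    simpa using e

/-- The center-stable graph of `u' = B u + g u`. -/
theorem exists_centerStable_graph [CompleteSpace E] (hT : IsContractiveGroup T)
    {L L₂ L₃ a₀ b₀ : ℝ} (h₀ : g 0 = 0) (h₁ : DiffBound₁ L g) (hL : 0 ≤ L) (hL' : L ≤ 1 / 32)
    (h₂ : DiffBound₂ L₂ g) (hL₂ : 0 ≤ L₂) (h₃ : DiffBound₃ L₃ g) (hL₃ : 0 ≤ L₃) (ha₀ : 0 ≤ a₀)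
    (hb₀ : 0 ≤ b₀) (hq : ∀ z, ‖g z‖ ≤ a₀ * ‖z‖ + b₀ * ‖z‖ ^ 2) :
    ∃ h : E → ℝ, h 0 = 0 ∧ DiffBound₁ (1 / 4) h ∧ DiffBound₂ (32 * L₂) h ∧
      DiffBound₃ (8 * (576 * L₂ ^ 2 + 8 * L₃)) h ∧
      (∀ x, |h x| ≤ 8 * a₀ * ‖x‖ + 16 * b₀ * ‖x‖ ^ 2) ∧
      (∀ u, IsMild T g (Ici 0) u → (∃ B, ∀ t, 0 ≤ t → ‖u t‖ ≤ B) → (u 0).2 = h (u 0).1) ∧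
      (∀ J u, J.OrdConnected → IsMild T g J u → ∀ s ∈ J, (u s).2 = h (u s).1 →
        ∀ t ∈ J, (u t).2 = h (u t).1) := by
  have hL8 : L ≤ 1 / 8 := by linarith
  -- `U x` is the slowly growing solution with center-stable initial value `x`. Its unstable
  -- coordinate at time `0` will be the graph function.
  choose U hU using exists_isLPSolution hT h₀ h₁ hL hL8
  have hG : ∀ x, SlowGrowth (g ∘ U x) := fun x => (hU x).growth.comp h₀ h₁ hL
  have hΔ : ∀ x y t, 0 ≤ t → ‖U x t - U y t‖ ≤ 2 * ‖x - y‖ * Real.exp (1 / 4 * t) :=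
    fun x y t ht => (hU x).norm_sub_le hT h₀ h₁ hL hL8 (hU y) ht
  have hU0 : ∀ t, 0 ≤ t → U 0 t = 0 := by
    intro t ht
    have hz : IsLPSolution T g 0 (fun _ => 0) := by
      refine ⟨⟨continuous_const, 0, fun t _ => by simp⟩, fun t _ => ?_⟩
      have : g ∘ (fun _ : ℝ => (0 : E × ℝ)) = fun _ => 0 := by funext t; simp [h₀]
      rw [this]
      simp [lpOp]
      rfl
    have := (hU 0).norm_sub_le hT h₀ h₁ hL hL8 hz ht
    simpa using this
  have hsnd : ∀ x y, (U x 0).2 - (U y 0).2 = (lpOp T (g ∘ U x - g ∘ U y) 0).2 := by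
    intro x y
    rw [lpOp_sub hT (hG x) (hG y) le_rfl, (hU x).eq 0 le_rfl, (hU y).eq 0 le_rfl]
    simp
  -- The inhomogeneity is a product of two first differences, each growing like `e^{t/4}`, which
  -- dictates the weight `e^{t/2}`. The constant is `2 · 4 · L₂ · 2 · 2`.
  have hΔ₂ : ∀ x a b t, 0 ≤ t → ‖U (x + a + b) t - U (x + a) t - U (x + b) t + U x t‖
      ≤ 32 * L₂ * ‖a‖ * ‖b‖ * Real.exp (1 / 2 * t) := by
    intro x a b t ht
    have := norm_le_of_lp_eq hT (D := U (x + a + b) - U (x + a) - U (x + b) + U x)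
      (w := g ∘ U (x + a + b) - g ∘ U (x + a) - g ∘ U (x + b) + g ∘ U x) (a := 0)
      (C := L₂ * (2 * ‖a‖) * (2 * ‖b‖)) (μ := 1 / 2) (by norm_num) (by norm_num) hL8
      ((((hG _).sub (hG _)).sub (hG _)).add (hG _)).1 (fun t ht => ?_)
      ((((hU _).growth.sub (hU _).growth).sub (hU _).growth).add (hU _).growth) (fun t ht => ?_) ht
    · refine this.trans (le_of_eq ?_)
      rw [norm_zero]; ring
    · rw [lpOp_add hT (((hG _).sub (hG _)).sub (hG _)) (hG _) ht,
        lpOp_sub hT ((hG _).sub (hG _)) (hG _) ht, lpOp_sub hT (hG _) (hG _) ht]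
      simp only [Pi.add_apply, Pi.sub_apply]
      rw [(hU (x + a + b)).eq t ht, (hU (x + a)).eq t ht, (hU (x + b)).eq t ht, (hU x).eq t ht]
      have e : ((T t 0, 0) : E × ℝ) = (T t (x + a + b), 0) - (T t (x + a), 0) - (T t (x + b), 0)
          + (T t x, 0) := by
        ext1
        · simp only [Prod.fst_add, Prod.fst_sub, ← map_sub, ← map_add]; congr 1; abel
        · simp
      rw [e]; abel
    · have e := norm_secondDiff_comp_le h₁ h₂ (U x t) (U (x + a) t) (U (x + b) t) (U (x + a + b) t)
      refine e.trans (add_le_add le_rfl ?_)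
      have e1 := hΔ (x + a) x t ht
      have e2 := hΔ (x + b) x t ht
      rw [add_sub_cancel_left] at e1 e2
      calc _ ≤ L₂ * (2 * ‖a‖ * Real.exp (1 / 4 * t)) * (2 * ‖b‖ * Real.exp (1 / 4 * t)) := by gcongr
        _ = _ := by
          rw [show (1 / 2 : ℝ) * t = 1 / 4 * t + 1 / 4 * t by ring, Real.exp_add]; ring
  -- Weight `e^{3t/4}`: products of a second with a first difference, or of three first differences.
  -- `576` is `3 · 3 · 32 · 2`, and `8` in front of `L₃` is `2 ^ 3`.
  have hΔ₃ : ∀ x a b c t, 0 ≤ t → ‖U (x + a + b + c) t - U (x + a + b) t - U (x + a + c) t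
      - U (x + b + c) t + U (x + a) t + U (x + b) t + U (x + c) t - U x t‖
      ≤ 8 * (576 * L₂ ^ 2 + 8 * L₃) * ‖a‖ * ‖b‖ * ‖c‖ * Real.exp (3 / 4 * t) := by
    intro x a b c t ht
    have := norm_le_of_lp_eq hT (D := U (x + a + b + c) - U (x + a + b) - U (x + a + c)
        - U (x + b + c) + U (x + a) + U (x + b) + U (x + c) - U x)
      (w := g ∘ U (x + a + b + c) - g ∘ U (x + a + b) - g ∘ U (x + a + c) - g ∘ U (x + b + c)
        + g ∘ U (x + a) + g ∘ U (x + b) + g ∘ U (x + c) - g ∘ U x) (a := 0)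
      (C := (576 * L₂ ^ 2 + 8 * L₃) * ‖a‖ * ‖b‖ * ‖c‖) (μ := 3 / 4) (by norm_num) le_rfl hL8
      ((((((((hG _).sub (hG _)).sub (hG _)).sub (hG _)).add (hG _)).add (hG _)).add (hG _)).sub
        (hG _)).1 (fun t ht => ?_)
      ((((((((hU _).growth.sub (hU _).growth).sub (hU _).growth).sub (hU _).growth).add
        (hU _).growth).add (hU _).growth).add (hU _).growth).sub (hU _).growth) (fun t ht => ?_) ht
    · refine this.trans (le_of_eq ?_)
      rw [norm_zero]; ring
    · have s1 := (hG (x + a + b + c)).sub (hG (x + a + b))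
      have s2 := s1.sub (hG (x + a + c))
      have s3 := s2.sub (hG (x + b + c))
      have s4 := s3.add (hG (x + a))
      have s5 := s4.add (hG (x + b))
      have s6 := s5.add (hG (x + c))
      rw [lpOp_sub hT s6 (hG _) ht, lpOp_add hT s5 (hG _) ht, lpOp_add hT s4 (hG _) ht,
        lpOp_add hT s3 (hG _) ht, lpOp_sub hT s2 (hG _) ht, lpOp_sub hT s1 (hG _) ht,
        lpOp_sub hT (hG _) (hG _) ht]
      simp only [Pi.add_apply, Pi.sub_apply]
      rw [(hU (x + a + b + c)).eq t ht, (hU (x + a + b)).eq t ht, (hU (x + a + c)).eq t ht,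
        (hU (x + b + c)).eq t ht, (hU (x + a)).eq t ht, (hU (x + b)).eq t ht,
        (hU (x + c)).eq t ht, (hU x).eq t ht]
      have e : ((T t 0, 0) : E × ℝ) = (T t (x + a + b + c), 0) - (T t (x + a + b), 0)
          - (T t (x + a + c), 0) - (T t (x + b + c), 0) + (T t (x + a), 0) + (T t (x + b), 0)
          + (T t (x + c), 0) - (T t x, 0) := by
        ext1
        · simp only [Prod.fst_add, Prod.fst_sub, ← map_sub, ← map_add]; congr 1; abel
        · simp
      rw [e]; abel
    · have A := fun y d => hΔ (y + d) y t ht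
      simp only [add_sub_cancel_left] at A
      have B := fun y d d' => hΔ₂ y d d' t ht
      have e := norm_thirdDiff_comp_le hL₂ hL₃ h₁ h₂ h₃ (U x t) (U (x + a) t) (U (x + b) t)
        (U (x + c) t) (U (x + a + b) t) (U (x + a + c) t) (U (x + b + c) t) (U (x + a + b + c) t)
        (A x a) (A x b) (A x c) (A (x + b) c) (A (x + a) c)
        (by have := A (x + c) b; rwa [add_right_comm x c b] at this) (B x a b) (B x a c) (B x b c)
      simp only [Pi.add_apply, Pi.sub_apply, Function.comp_apply]
      refine e.trans (le_of_eq ?_)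
      rw [show (1 / 2 : ℝ) * t = 1 / 4 * t + 1 / 4 * t by ring,
        show (3 / 4 : ℝ) * t = 1 / 4 * t + 1 / 4 * t + 1 / 4 * t by ring]
      simp only [Real.exp_add]
      ring
  -- A slowly growing mild solution solves the Lyapunov-Perron equation and is thus determined by
  -- its center-stable initial value. This characterises the graph.
  have hunique : ∀ u, IsMild T g (Ici 0) u → (∃ B, ∀ t, 0 ≤ t → ‖u t‖ ≤ B * Real.exp (1 / 4 * t)) →
      (u 0).2 = (U (u 0).1 0).2 := by
    rintro u hu ⟨B, hB⟩
    have := (hu.isLPSolution hT h₀ h₁ hL hB).norm_sub_le hT h₀ h₁ hL hL8 (hU (u 0).1) le_rfl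
    simp only [max_self, sub_self, norm_zero, mul_zero, zero_mul] at this
    rw [← sub_eq_zero.mp (norm_le_zero_iff.mp this)]
  refine ⟨fun x => (U x 0).2, by simp [hU0 0 le_rfl], fun x a => ?_, fun x a b => ?_,
    fun x a b c => ?_, fun x => ?_, ?_, ?_⟩
  · rw [hsnd]
    have e := norm_lpOp_le hT ((hG (x + a)).sub (hG x)).1 (le_refl (1 / 4 : ℝ)) (by norm_num)
      (W := L * (2 * ‖a‖)) (fun s hs => ?_) le_rfl
    · refine (norm_snd_le _).trans (e.trans ?_)
      simp only [mul_zero, Real.exp_zero, mul_one]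
      nlinarith [norm_nonneg a]
    · have e := h₁ (U x s) (U (x + a) s - U x s)
      rw [add_sub_cancel] at e
      have e1 := hΔ (x + a) x s hs
      rw [add_sub_cancel_left] at e1
      rw [mul_assoc]
      exact e.trans (mul_le_mul_of_nonneg_left e1 hL)
  · have e := hΔ₂ x a b 0 le_rfl
    simp only [mul_zero, Real.exp_zero, mul_one] at e
    exact (norm_snd_le _).trans e
  · have e := hΔ₃ x a b c 0 le_rfl
    simp only [mul_zero, Real.exp_zero, mul_one] at e
    exact (norm_snd_le _).trans e
  -- The square of a curve growing like `e^{s/4}` grows like `e^{s/2}`, so `μ = 1 / 2` accommodates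
  -- the linear and the quadratic term of `hq` together.
  · have e := norm_lpOp_le hT (hG x).1 (μ := 1 / 2) (by norm_num) (by norm_num)
      (W := a₀ * (2 * ‖x‖) + b₀ * (2 * ‖x‖) ^ 2) (fun s hs => ?_) le_rfl
    · have e0 : (U x 0).2 = (lpOp T (g ∘ U x) 0).2 := by rw [(hU x).eq 0 le_rfl]; simp
      simp only [mul_zero, Real.exp_zero, mul_one] at e
      change |(U x 0).2| ≤ _
      rw [← Real.norm_eq_abs, e0]
      refine (norm_snd_le _).trans (e.trans (le_of_eq ?_))
      ring
    · have e1 := hΔ x 0 s hs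
      rw [hU0 s hs, sub_zero, sub_zero] at e1
      refine (hq _).trans ?_
      have e2 : ‖U x s‖ ≤ 2 * ‖x‖ * Real.exp (1 / 2 * s) := by
        refine e1.trans (mul_le_mul_of_nonneg_left (Real.exp_le_exp.mpr ?_) (by positivity))
        linarith
      have e3 : ‖U x s‖ ^ 2 ≤ (2 * ‖x‖) ^ 2 * Real.exp (1 / 2 * s) := by
        calc _ ≤ (2 * ‖x‖ * Real.exp (1 / 4 * s)) ^ 2 := by gcongr
          _ = _ := by
            rw [show (1 / 2 : ℝ) * s = 1 / 4 * s + 1 / 4 * s by ring, Real.exp_add]; ring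
      have e4 := mul_le_mul_of_nonneg_left e2 ha₀
      have e5 := mul_le_mul_of_nonneg_left e3 hb₀
      linarith
  · rintro u hu ⟨B, hB⟩
    refine hunique u hu ⟨B, fun t ht => (hB t ht).trans ?_⟩
    have hB0 : 0 ≤ B := (norm_nonneg _).trans (hB 0 le_rfl)
    exact le_mul_of_one_le_right hB0 (Real.one_le_exp (by linarith))
  · intro J u hJ hu s hs hus t ht
    simp only at hus ⊢
    set u' := fun τ => u (τ + s) with hu'
    have hg := h₁.continuous
    have hm' : IsMild T g {τ | τ + s ∈ J} u' := hu.shift hT hg hJ s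
    have hJ' : {τ | τ + s ∈ J}.OrdConnected :=
      ⟨fun x hx y hy z hz => hJ.out hx hy ⟨by linarith [hz.1], by linarith [hz.2]⟩⟩
    set w := U (u s).1 with hw
    have hwm : IsMild T g (Ici 0) w := (hU _).isMild hT h₀ h₁ hL
    obtain ⟨-, W, hW⟩ := (hU (u s).1).growth
    have hW0 : 0 ≤ W := by simpa using (norm_nonneg _).trans (hW 0 le_rfl)
    have hw0 : u' 0 = w 0 := by
      ext1
      · rw [(hU (u s).1).fst_zero hT]; simp [hu']
      · simp only [hu', zero_add]; exact hus
    have h0 : (0 : ℝ) ∈ {τ | τ + s ∈ J} := by simpa using hs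
    suffices H : ∀ r, r + s ∈ J → (u' r).2 = (U (u' r).1 0).2 by
      have := H (t - s) (by simpa using ht)
      simpa [hu'] using this
    intro r hr
    -- Forward in time the solution coincides with `w` by uniqueness, and a shifted slowly growing
    -- solution is again slowly growing.
    rcases le_total 0 r with h0r | hr0
    · have e : u' r = w r := (hm'.mono (hJ'.out h0 hr)).eq_of_eq hT h₁ hL8
        (hwm.mono Icc_subset_Ici_self) hw0 ⟨h0r, le_rfl⟩
      rw [e]
      have := hunique (fun τ => w (τ + r)) ((hwm.shift hT hg ordConnected_Ici r).mono
        fun τ hτ => mem_Ici.mpr (add_nonneg (mem_Ici.mp hτ) h0r))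
        ⟨W * Real.exp (1 / 4 * r), fun τ hτ => ?_⟩
      · simpa using this
      · refine (hW _ (add_nonneg hτ h0r)).trans (le_of_eq ?_)
        rw [mul_add, Real.exp_add]; ring
    -- Backward in time the given solution on `[r, 0]` is continued by `w`. The result is a slowly
    -- growing solution starting at `u' r`, which puts that point on the graph.
    · set v : ℝ → E × ℝ := fun τ => if τ ≤ 0 then u' τ else w τ with hv
      have e1 : EqOn v u' (Icc r 0) := fun τ hτ => if_pos hτ.2
      have e2 : EqOn v w (Ici 0) := by
        intro τ hτ
        rcases eq_or_lt_of_le (mem_Ici.mp hτ) with rfl | h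
        · simp only [hv, le_refl, if_true]; exact hw0
        · exact if_neg (not_le.mpr h)
      have m1 : IsMild T g (Icc r 0) v :=
        (hm'.mono (hJ'.out hr h0)).congr ordConnected_Icc e1
      have m2 : IsMild T g (Ici 0) v := hwm.congr ordConnected_Ici e2
      have m := m1.union hT hg ordConnected_Icc ordConnected_Ici (right_mem_Icc.mpr hr0)
        self_mem_Ici m2 (m1.1.union_of_isClosed m2.1 isClosed_Icc isClosed_Ici)
      rw [Icc_union_Ici_eq_Ici hr0] at m
      obtain ⟨B, hB⟩ := isCompact_Icc.exists_bound_of_continuousOn m1.1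
      have hB0 : 0 ≤ B := (norm_nonneg _).trans (hB 0 (right_mem_Icc.mpr hr0))
      have := hunique (fun τ => v (τ + r)) ((m.shift hT hg ordConnected_Ici r).mono
        fun τ hτ => show r ≤ τ + r from le_add_of_nonneg_left hτ) ⟨B + W, fun τ hτ => ?_⟩
      · simp only [zero_add] at this
        rwa [e1 (left_mem_Icc.mpr hr0)] at this
      · have hx : 1 ≤ Real.exp (1 / 4 * τ) := Real.one_le_exp (mul_nonneg (by norm_num) hτ)
        rcases le_total (τ + r) 0 with h | h
        · refine (hB _ ⟨le_add_of_nonneg_left hτ, h⟩).trans ?_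
          nlinarith
        · rw [e2 h]
          refine (hW _ h).trans ?_
          have : Real.exp (1 / 4 * (τ + r)) ≤ Real.exp (1 / 4 * τ) :=
            Real.exp_le_exp.mpr (by linarith)
          nlinarith

end CenterStable
end
end KleinGordon

namespace KleinGordon
noncomputable section

/-! ### Holomorphic maps: Cauchy estimates and near-identity inverses -/

section Holomorphic

variable {E F : Type*} [NormedAddCommGroup E] [NormedSpace ℂ E] [NormedAddCommGroup F]
  [NormedSpace ℂ F]

/-- Cauchy's estimate along a complex line. -/
theorem norm_fderiv_apply_le {f : E → F} {x v : E} {τ C : ℝ} (hτ : 0 < τ)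
    (hd : ∀ t : ℂ, ‖t‖ ≤ τ → DifferentiableAt ℂ f (x + t • v))
    (hC : ∀ t : ℂ, ‖t‖ ≤ τ → ‖f (x + t • v)‖ ≤ C) : ‖fderiv ℂ f x v‖ ≤ C / τ := by
  have hl : ∀ t : ℂ, HasDerivAt (fun t : ℂ => x + t • v) v t := fun t => by
    simpa using ((hasDerivAt_id t).smul_const v).const_add x
  have hg : ∀ t : ℂ, ‖t‖ ≤ τ → HasDerivAt (fun t : ℂ => f (x + t • v))
      (fderiv ℂ f (x + t • v) v) t := fun t ht => (hd t ht).hasFDerivAt.comp_hasDerivAt t (hl t)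
  have h0 := hg 0 (by simpa using hτ.le)
  simp only [zero_smul, add_zero] at h0
  rw [← h0.deriv]
  refine Complex.norm_deriv_le_of_forall_mem_sphere_norm_le hτ ?_ fun z hz => hC z ?_
  · refine DifferentiableOn.diffContOnCl fun t ht => ?_
    rw [closure_ball _ hτ.ne'] at ht
    exact (hg t (by simpa using ht)).differentiableAt.differentiableWithinAt
  · exact le_of_eq (by simpa using hz)

theorem norm_fderiv_le_of_closedBall {f : E → F} {x : E} {τ C : ℝ} (hτ : 0 < τ)
    (hd : ∀ y ∈ Metric.closedBall x τ, DifferentiableAt ℂ f y)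
    (hC : ∀ y ∈ Metric.closedBall x τ, ‖f y‖ ≤ C) : ‖fderiv ℂ f x‖ ≤ C / τ := by
  have hC0 : 0 ≤ C := (norm_nonneg _).trans (hC x (Metric.mem_closedBall_self hτ.le))
  refine ContinuousLinearMap.opNorm_le_bound _ (by positivity) fun v => ?_
  rcases eq_or_ne v 0 with rfl | hv
  · simp
  have hv' : 0 < ‖v‖ := norm_pos_iff.mpr hv
  have hm : ∀ t : ℂ, ‖t‖ ≤ τ / ‖v‖ → x + t • v ∈ Metric.closedBall x τ := by
    intro t ht
    rw [mem_closedBall_iff_norm, add_sub_cancel_left, norm_smul]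
    rwa [le_div_iff₀ hv'] at ht
  have := norm_fderiv_apply_le (τ := τ / ‖v‖) (by positivity) (fun t ht => hd _ (hm t ht))
    (fun t ht => hC _ (hm t ht))
  rwa [div_div_eq_mul_div, mul_div_right_comm] at this

open scoped ContDiff in
/-- A map whose derivative is close to the identity on a convex open set has an analytic inverse. -/
theorem near_identity_inverse [CompleteSpace E] [NormedSpace ℝ E] [Nontrivial E] {f : E → E}
    {D : Set E} (hD : IsOpen D) (hconv : Convex ℝ D) (hf : ∀ x ∈ D, ContDiffAt ℂ ω f x)
    (hb : ∀ x ∈ D, ‖fderiv ℂ f x - ContinuousLinearMap.id ℂ E‖ ≤ 1 / 4) :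
    InjOn f D ∧ (∀ x ∈ D, ContDiffAt ℂ ω (Function.invFunOn f D) (f x)) ∧
    (∀ W η, 0 ≤ η → Metric.closedBall W (4 * η) ⊆ D → ‖f W - W‖ ≤ η → ∃ x ∈ D, f x = W) := by
  have hd : ∀ x ∈ D, DifferentiableAt ℂ f x := fun x hx => (hf x hx).differentiableAt (by simp)
  have ha : ApproximatesLinearOn f ((ContinuousLinearEquiv.refl ℂ E : E ≃L[ℂ] E) : E →L[ℂ] E) D
      (1 / 4 : NNReal) := by
    intro x hx y hy
    have := hconv.norm_image_sub_le_of_norm_fderiv_le' hd hb hy hx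
    simpa using this
  have hN : ‖(((ContinuousLinearEquiv.refl ℂ E).symm : E ≃L[ℂ] E) : E →L[ℂ] E)‖₊ = 1 :=
    ContinuousLinearMap.nnnorm_id
  have hc : Subsingleton E ∨
      (1 / 4 : NNReal) < ‖(((ContinuousLinearEquiv.refl ℂ E).symm : E ≃L[ℂ] E) : E →L[ℂ] E)‖₊⁻¹ := by
    right; rw [hN]; rw [← NNReal.coe_lt_coe]; norm_num
  have hinj := ha.injOn hc
  set e := ha.toOpenPartialHomeomorph f D hc hD with he
  have hsymm : ∀ W ∈ f '' D, Function.invFunOn f D W = e.symm W := by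
    intro W hW
    refine hinj (Function.invFunOn_mem hW) (e.map_target (x := W) hW) ?_
    rw [Function.invFunOn_eq hW]
    exact (e.right_inv (x := W) hW).symm
  refine ⟨hinj, fun x hx => ?_, fun W η hη hW hWη => ?_⟩
  · have hx' : e.symm (f x) = x := e.left_inv (x := x) hx
    have hu : IsUnit (fderiv ℂ f x) := by
      have h1 : ‖ContinuousLinearMap.id ℂ E - fderiv ℂ f x‖ < 1 := by
        rw [norm_sub_rev]; exact (hb x hx).trans_lt (by norm_num)
      have := (Units.oneSub (ContinuousLinearMap.id ℂ E - fderiv ℂ f x) h1).isUnit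
      rw [Units.val_oneSub] at this
      convert this using 1
      exact (sub_sub_cancel _ _).symm
    obtain ⟨u, hu⟩ := hu
    have hfd : HasFDerivAt f ((ContinuousLinearEquiv.ofUnit u : E ≃L[ℂ] E) : E →L[ℂ] E)
        (e.symm (f x)) := by
      rw [hx']
      have := (hd x hx).hasFDerivAt
      rw [← hu] at this
      exact this
    have key := e.contDiffAt_symm (a := f x) (mem_image_of_mem f hx) hfd (by rw [hx']; exact hf x hx)
    refine key.congr_of_eventuallyEq ?_
    filter_upwards [e.open_target.mem_nhds (mem_image_of_mem f hx)] with W hW using hsymm W hW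
  -- The image of the ball of radius `4 η` about `W` contains the ball of radius `(1 - 1/4) · 4 η =
  -- 3 η` about `f W`, and `W` is within `η` of `f W`.
  · have := ha.closedBall_subset_target hc hD (b := W) (ε := 4 * η) (by positivity) hW
    have hm : W ∈ Metric.closedBall (f W) (((‖(((ContinuousLinearEquiv.refl ℂ E).symm : E ≃L[ℂ] E) :
        E →L[ℂ] E)‖₊⁻¹ : NNReal) - (1 / 4 : NNReal)) * (4 * η)) := by
      rw [hN, mem_closedBall_iff_norm, norm_sub_rev]
      refine hWη.trans ?_
      have : (((1 : NNReal)⁻¹ : NNReal) : ℝ) - ((1 / 4 : NNReal) : ℝ) = 3 / 4 := by norm_num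
      rw [this]; linarith
    exact this hm

end Holomorphic

/-! ### One normal form step over complex Banach spaces -/

/-- The ball `|W^h| + |W^c| < ρ`. -/
def sumBall (X V : Type*) [NormedAddCommGroup X] [NormedAddCommGroup V] (ρ : ℝ) : Set (X × V) :=
  {Z | ‖Z.1‖ + ‖Z.2‖ < ρ}

theorem isOpen_sumBall (X V : Type*) [NormedAddCommGroup X] [NormedAddCommGroup V] (ρ : ℝ) :
    IsOpen (sumBall X V ρ) :=
  isOpen_lt (by fun_prop) continuous_const

theorem convex_sumBall (X V : Type*) [NormedAddCommGroup X] [NormedSpace ℝ X]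
    [NormedAddCommGroup V] [NormedSpace ℝ V] (ρ : ℝ) : Convex ℝ (sumBall X V ρ) := by
  have h : ConvexOn ℝ univ fun Z : X × V => ‖Z.1‖ + ‖Z.2‖ :=
    ((convexOn_univ_norm (E := X)).comp_linearMap (LinearMap.fst ℝ X V)).add
      ((convexOn_univ_norm (E := V)).comp_linearMap (LinearMap.snd ℝ X V))
  simpa [sumBall] using h.convex_lt ρ

theorem mem_sumBall_of_norm_sub_le {X V : Type*} [NormedAddCommGroup X] [NormedAddCommGroup V]
    {ρ a b c : ℝ} {Z W : X × V} (hZ : Z ∈ sumBall X V a) (h₁ : ‖W.1 - Z.1‖ ≤ b)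
    (h₂ : ‖W.2 - Z.2‖ ≤ c) (h : a + b + c ≤ ρ) : W ∈ sumBall X V ρ := by
  have hZ' : ‖Z.1‖ + ‖Z.2‖ < a := hZ
  have e1 : ‖W.1‖ ≤ ‖Z.1‖ + ‖W.1 - Z.1‖ := by
    simpa using norm_add_le Z.1 (W.1 - Z.1)
  have e2 : ‖W.2‖ ≤ ‖Z.2‖ + ‖W.2 - Z.2‖ := by
    simpa using norm_add_le Z.2 (W.2 - Z.2)
  change ‖W.1‖ + ‖W.2‖ < ρ
  linarith

/-- The constant operators of a normal form step. -/
structure NFData (X V U : Type*) [NormedAddCommGroup X] [NormedSpace ℂ X] [NormedAddCommGroup V]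
    [NormedSpace ℂ V] [NormedAddCommGroup U] [NormedSpace ℂ U] where
  A : X →L[ℂ] X
  J : V →L[ℂ] U
  inc : V →L[ℂ] U
  S : V →L[ℂ] V
  S₁ : V →L[ℂ] V
  b : V →L[ℂ] U →L[ℂ] ℂ
  e₁ : X
  e₂ : X
  J_S : ∀ v, J (S v) = inc v

namespace NFData

variable {X V U : Type*} [NormedAddCommGroup X] [NormedSpace ℂ X] [NormedAddCommGroup V]
  [NormedSpace ℂ V] [NormedAddCommGroup U] [NormedSpace ℂ U] (d : NFData X V U)
  (ε : ℝ) (N : X × V → X × V)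

/-- The part of the elliptic nonlinearity that does not vanish on `W^c = 0`. -/
def gam (N : X × V → X × V) (q : X) : V := (N (q, 0)).2

/-- The functions `⟨L⁻¹ D_i γ₁(q), ζ₁⁺⟩ + ⟨L⁻¹ D_i γ₀(q), ζ⟩` of the mixed coordinates. -/
def lam (e : X) (Q : X × U) : ℂ :=
  d.b (fderiv ℂ (gam N) Q.1 e) (Q.2 + (ε : ℂ) • d.inc (d.S₁ (gam N Q.1)))

/-- Solutions are differentiable only after inclusion into the weaker space `U`, so velocities are
computed for `hat` of a curve. -/
def hat (Q : X × V) : X × U := (Q.1, d.inc Q.2)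

/-- The old coordinates in terms of the mixed coordinates `(z, z₁⁺, ζ, ζ₁)`. -/
def oldCoord (Q : X × V) : X × V :=
  Q - (((ε : ℂ) ^ 2 * d.lam ε N d.e₁ (d.hat Q)) • d.e₂, 0)

/-- The new coordinates in terms of the mixed coordinates `(z, z₁⁺, ζ, ζ₁)`. -/
def newCoord (Q : X × V) : X × V :=
  Q - (((ε : ℂ) ^ 2 * d.lam ε N d.e₂ (d.hat Q)) • d.e₁, 0) + (0, (ε : ℂ) • d.S (gam N Q.1))

/-- The vector field of the system with nonlinearity `N`. -/
def vel (Z : X × V) : X × U :=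
  (d.A Z.1 + (N Z).1, ((ε : ℂ)⁻¹) • d.J Z.2 + d.inc (N Z).2)

/-- The derivative is taken on `X × U`, so that it can be applied to velocities, whose elliptic part
need not lie in `V`. -/
def dlam (e : X) (Q : X × V) : X × U →L[ℂ] ℂ := ((ε : ℂ) ^ 2) • fderiv ℂ (d.lam ε N e) (d.hat Q)

/-- The velocity of the mixed coordinates. -/
def mixedVel (Q : X × V) : X × U :=
  d.vel ε N (d.oldCoord ε N Q)
    + ((d.dlam ε N d.e₁ Q (d.vel ε N (d.oldCoord ε N Q))) * (1 - d.dlam ε N d.e₁ Q (d.e₂, 0))⁻¹)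
      • (d.e₂, 0)

/-- The new nonlinearity as a function of the mixed coordinates. -/
def mixedNonlinearity (Q : X × V) : X × V :=
  ((d.mixedVel ε N Q).1 - (d.dlam ε N d.e₂ Q (d.mixedVel ε N Q)) • d.e₁
      - d.A (d.newCoord ε N Q).1,
    (N (d.oldCoord ε N Q)).2 - gam N Q.1
      + (ε : ℂ) • d.S (fderiv ℂ (gam N) Q.1 (d.mixedVel ε N Q).1))

/-- The domain of the mixed coordinates. -/
def dom (X V : Type*) [NormedAddCommGroup X] [NormedAddCommGroup V] (ρ δ : ℝ) : Set (X × V) :=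
  sumBall X V (ρ - δ / 8)

/-- The normal form transformation. -/
def trans (ρ δ : ℝ) (Z : X × V) : X × V :=
  d.newCoord ε N (Function.invFunOn (d.oldCoord ε N) (dom X V ρ δ) Z)

/-- The nonlinearity of the transformed system. -/
def newNonlinearity (ρ δ : ℝ) (Z : X × V) : X × V :=
  d.mixedNonlinearity ε N (Function.invFunOn (d.newCoord ε N) (dom X V ρ δ) Z)

/-- `M` bounds the constant operators. -/
structure BoundedBy (M : ℝ) : Prop where
  A : ‖d.A‖ ≤ M
  J : ‖d.J‖ ≤ M
  inc : ‖d.inc‖ ≤ M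
  S : ‖d.S‖ ≤ M
  S₁ : ‖d.S₁‖ ≤ M
  b : ‖d.b‖ ≤ M
  e₁ : ‖d.e₁‖ ≤ M
  e₂ : ‖d.e₂‖ ≤ M

open scoped ContDiff in
/-- The hypotheses of a normal form step. -/
structure StepHyp (M K₁ ε ρ Γ : ℝ) (N : X × V → X × V) : Prop where
  bdd : d.BoundedBy M
  one_le_M : 1 ≤ M
  le_K₁ : 2 ^ 14 * M ^ 5 ≤ K₁
  ε_pos : 0 < ε
  ε_le : ε ≤ 1
  ρ_le : ρ ≤ M
  Γ_nonneg : 0 ≤ Γ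
  Γ_le : Γ ≤ 1
  smooth : ∀ Z ∈ sumBall X V ρ, ContDiffAt ℂ ω N Z
  le_M : ∀ Z ∈ sumBall X V ρ, ‖N Z‖ ≤ M
  le_Γ : ∀ q : X, ‖q‖ < ρ → ‖gam N q‖ ≤ Γ

end NFData

end
end KleinGordon

/-! ### One normal form step: size and invertibility of the coordinate changes. -/

namespace KleinGordon
noncomputable section

namespace NFData.StepHyp

section Estimates

set_option linter.unusedSectionVars false

open scoped ContDiff

variable {X V U : Type*} [NormedAddCommGroup X] [NormedSpace ℂ X] [NormedAddCommGroup V]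
  [NormedSpace ℂ V] [NormedAddCommGroup U] [NormedSpace ℂ U] {d : NFData X V U}
  {M K₁ ε ρ Γ : ℝ} {N : X × V → X × V}

theorem norm_ε (h : d.StepHyp M K₁ ε ρ Γ N) : ‖(ε : ℂ)‖ = ε := by
  rw [Complex.norm_real, Real.norm_eq_abs, abs_of_pos h.ε_pos]

theorem M_le_pow (h : d.StepHyp M K₁ ε ρ Γ N) (n : ℕ) (hn : n ≤ 5) : M ^ n ≤ M ^ 5 :=
  pow_le_pow_right₀ h.one_le_M hn

theorem K₁_pos (h : d.StepHyp M K₁ ε ρ Γ N) : 0 < K₁ := by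
  have := h.le_K₁
  have := one_le_pow₀ h.one_le_M (n := 5)
  linarith

theorem δ_pos (h : d.StepHyp M K₁ ε ρ Γ N) : 0 < K₁ * ε := mul_pos h.K₁_pos h.ε_pos

theorem contDiffAt_gam (h : d.StepHyp M K₁ ε ρ Γ N) {q : X} (hq : ‖q‖ < ρ) :
    ContDiffAt ℂ ω (gam N) q := by
  have h1 : ContDiffAt ℂ ω N (q, 0) := h.smooth _ (by simpa [sumBall] using hq)
  have h2 : ContDiffAt ℂ ω (fun q : X => ((q, 0) : X × V)) q := by fun_prop
  exact (h1.comp q h2).snd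

/-- Cauchy's estimate on a ball of radius `K₁ ε / 16`: a derivative of `γ` costs one factor `1 / (K₁
ε)`. -/
theorem norm_fderiv_gam_le (h : d.StepHyp M K₁ ε ρ Γ N) {q : X} (hq : ‖q‖ < ρ - K₁ * ε / 16) :
    ‖fderiv ℂ (gam N) q‖ ≤ 16 * Γ / (K₁ * ε) := by
  have hδ := h.δ_pos
  have hm : ∀ y ∈ Metric.closedBall q (K₁ * ε / 16), ‖y‖ < ρ := by
    intro y hy
    rw [mem_closedBall_iff_norm] at hy
    have := norm_add_le q (y - q)
    rw [add_sub_cancel] at this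
    linarith
  have := norm_fderiv_le_of_closedBall (f := gam N) (x := q) (τ := K₁ * ε / 16) (C := Γ)
    (by positivity) (fun y hy => (h.contDiffAt_gam (hm y hy)).differentiableAt (by simp))
    (fun y hy => h.le_Γ y (hm y hy))
  refine this.trans (le_of_eq ?_)
  field_simp

theorem contDiffAt_fderiv_gam [CompleteSpace V] (h : d.StepHyp M K₁ ε ρ Γ N) {q : X} (hq : ‖q‖ < ρ) :
    ContDiffAt ℂ ω (fderiv ℂ (gam N)) q :=
  (h.contDiffAt_gam hq).fderiv_right (by simp)

theorem contDiffAt_lam [CompleteSpace V] (h : d.StepHyp M K₁ ε ρ Γ N) (e : X) {Q : X × U}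
    (hq : ‖Q.1‖ < ρ) : ContDiffAt ℂ ω (d.lam ε N e) Q := by
  have h1 : ContDiffAt ℂ ω (fun Q : X × U => fderiv ℂ (gam N) Q.1) Q :=
    (h.contDiffAt_fderiv_gam hq).comp Q contDiffAt_fst
  have h2 : ContDiffAt ℂ ω (fun Q : X × U => gam N Q.1) Q :=
    (h.contDiffAt_gam hq).comp Q contDiffAt_fst
  unfold lam
  have h3 : ContDiffAt ℂ ω (fun Q : X × U => d.b (fderiv ℂ (gam N) Q.1 e)) Q :=
    d.b.contDiff.contDiffAt.comp Q (h1.clm_apply contDiffAt_const)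
  refine h3.clm_apply (contDiffAt_snd.add (contDiffAt_const.smul ?_))
  exact d.inc.contDiff.contDiffAt.comp Q (d.S₁.contDiff.contDiffAt.comp Q h2)

theorem norm_clm_le {E F : Type*} [NormedAddCommGroup E] [NormedSpace ℂ E] [NormedAddCommGroup F]
    [NormedSpace ℂ F] {T : E →L[ℂ] F} {x : E} {a c : ℝ} (hT : ‖T‖ ≤ a) (hx : ‖x‖ ≤ c) :
    ‖T x‖ ≤ a * c :=
  (T.le_opNorm x).trans (mul_le_mul hT hx (norm_nonneg _) ((norm_nonneg _).trans hT))

/-- The pairing is affine in the elliptic variable, hence no restriction on `Q.2`. This lets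
`norm_dlam_apply_le` follow long complex lines in that direction. -/
theorem norm_lam_le (h : d.StepHyp M K₁ ε ρ Γ N) {e : X} (he : ‖e‖ ≤ M) {Q : X × U}
    (hq : ‖Q.1‖ < ρ - K₁ * ε / 16) :
    ‖d.lam ε N e Q‖ ≤ 16 * M ^ 2 * Γ / (K₁ * ε) * (‖Q.2‖ + M ^ 2) := by
  have hM := h.one_le_M
  have hδ := h.δ_pos
  have hΓ := h.Γ_nonneg
  have h1 : ‖fderiv ℂ (gam N) Q.1 e‖ ≤ 16 * Γ / (K₁ * ε) * M :=
    norm_clm_le (h.norm_fderiv_gam_le hq) he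
  have h2 : ‖gam N Q.1‖ ≤ Γ := h.le_Γ _ (by linarith)
  have h3 : ‖d.inc (d.S₁ (gam N Q.1))‖ ≤ M * (M * Γ) :=
    norm_clm_le h.bdd.inc (norm_clm_le h.bdd.S₁ h2)
  have h4 : ‖Q.2 + (ε : ℂ) • d.inc (d.S₁ (gam N Q.1))‖ ≤ ‖Q.2‖ + M ^ 2 := by
    refine (norm_add_le _ _).trans (add_le_add_right ?_ _)
    rw [norm_smul, h.norm_ε]
    calc _ ≤ 1 * (M * (M * 1)) := by
          refine mul_le_mul h.ε_le (h3.trans ?_) (norm_nonneg _) zero_le_one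
          have := h.Γ_le
          gcongr
      _ = _ := by ring
  have h5 := norm_clm_le (norm_clm_le h.bdd.b h1) h4
  refine h5.trans (le_of_eq ?_)
  ring

theorem norm_hat_snd_le (h : d.StepHyp M K₁ ε ρ Γ N) {Q : X × V} (hQ : Q ∈ sumBall X V ρ) :
    ‖(d.hat Q).2‖ ≤ M ^ 2 := by
  have hQ' : ‖Q.1‖ + ‖Q.2‖ < ρ := hQ
  have h1 : ‖Q.2‖ ≤ M := by linarith [norm_nonneg Q.1, h.ρ_le]
  have := norm_clm_le h.bdd.inc h1
  rw [pow_two]; exact this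

theorem sumBall_mono {a b : ℝ} (hab : a ≤ b) : sumBall X V a ⊆ sumBall X V b :=
  fun _ hZ => lt_of_lt_of_le hZ hab

theorem norm_fst_lt {a : ℝ} {Z : X × V} (hZ : Z ∈ sumBall X V a) : ‖Z.1‖ < a := by
  have : ‖Z.1‖ + ‖Z.2‖ < a := hZ
  linarith [norm_nonneg Z.2]

/-- One power of `ε²` absorbs the `1 / ε` of Cauchy's estimate, the other remains; the leftover `32
M⁵ / K₁` is at most one. -/
theorem norm_coord_term_le (h : d.StepHyp M K₁ ε ρ Γ N) {e e' : X} (he : ‖e‖ ≤ M) (he' : ‖e'‖ ≤ M)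
    {Q : X × V} (hQ : Q ∈ sumBall X V (ρ - K₁ * ε / 16)) :
    ‖((ε : ℂ) ^ 2 * d.lam ε N e (d.hat Q)) • e'‖ ≤ ε * Γ := by
  have hM := h.one_le_M
  have hδ := h.δ_pos
  have hΓ := h.Γ_nonneg
  have hε := h.ε_pos
  have hK := h.K₁_pos
  have h1 := h.norm_lam_le he (Q := d.hat Q) (norm_fst_lt hQ : ‖Q.1‖ < _)
  have h2 := h.norm_hat_snd_le (sumBall_mono (by linarith) hQ)
  have h3 : ‖d.lam ε N e (d.hat Q)‖ ≤ 16 * M ^ 2 * Γ / (K₁ * ε) * (M ^ 2 + M ^ 2) :=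
    h1.trans (by gcongr)
  rw [norm_smul, norm_mul, norm_pow, h.norm_ε]
  calc _ ≤ ε ^ 2 * (16 * M ^ 2 * Γ / (K₁ * ε) * (M ^ 2 + M ^ 2)) * M := by gcongr
    _ = ε * Γ * (32 * M ^ 5 / K₁) := by field_simp; ring
    _ ≤ ε * Γ * 1 := by
      gcongr
      rw [div_le_one hK]
      have := h.le_K₁
      have : 0 ≤ M ^ 5 := by positivity
      linarith
    _ = _ := mul_one _

theorem oldCoord_snd (Q : X × V) : (d.oldCoord ε N Q).2 = Q.2 := by simp [oldCoord]

theorem norm_oldCoord_sub_fst_le (h : d.StepHyp M K₁ ε ρ Γ N) {Q : X × V}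
    (hQ : Q ∈ sumBall X V (ρ - K₁ * ε / 16)) : ‖(d.oldCoord ε N Q).1 - Q.1‖ ≤ ε * Γ := by
  have := h.norm_coord_term_le h.bdd.e₁ h.bdd.e₂ hQ
  simpa [oldCoord] using this

theorem norm_newCoord_sub_fst_le (h : d.StepHyp M K₁ ε ρ Γ N) {Q : X × V}
    (hQ : Q ∈ sumBall X V (ρ - K₁ * ε / 16)) : ‖(d.newCoord ε N Q).1 - Q.1‖ ≤ ε * Γ := by
  have := h.norm_coord_term_le h.bdd.e₂ h.bdd.e₁ hQ
  simpa [newCoord] using this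

theorem norm_newCoord_sub_snd_le (h : d.StepHyp M K₁ ε ρ Γ N) {Q : X × V} (hQ : ‖Q.1‖ < ρ) :
    ‖(d.newCoord ε N Q).2 - Q.2‖ ≤ M * ε * Γ := by
  have h1 := norm_clm_le h.bdd.S (h.le_Γ _ hQ)
  have : (d.newCoord ε N Q).2 - Q.2 = (ε : ℂ) • d.S (gam N Q.1) := by simp [newCoord]
  rw [this, norm_smul, h.norm_ε]
  have hε := h.ε_pos
  calc _ ≤ ε * (M * Γ) := by gcongr
    _ = _ := by ring

theorem M_mul_ε_le (h : d.StepHyp M K₁ ε ρ Γ N) : 2 ^ 14 * (M * ε) ≤ K₁ * ε := by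
  have h1 := h.M_le_pow 1 (by norm_num)
  have h2 := h.le_K₁
  have hε := h.ε_pos
  nlinarith

/-- The points moved by a step travel a tiny fraction of the lost radius `K₁ ε`. All inclusions
between nested balls below rest on this. -/
theorem shift_le (h : d.StepHyp M K₁ ε ρ Γ N) : 2 * (M * ε * Γ) ≤ K₁ * ε / 1024 := by
  have h1 := h.M_mul_ε_le
  have hM := h.one_le_M
  have hε := h.ε_pos
  have h2 : M * ε * Γ ≤ M * ε := mul_le_of_le_one_right (by positivity) h.Γ_le
  have : 0 ≤ M * ε := by positivity
  linarith

theorem εΓ_le (h : d.StepHyp M K₁ ε ρ Γ N) : ε * Γ ≤ M * ε * Γ := by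
  have hM := h.one_le_M
  have hε := h.ε_pos
  have hΓ := h.Γ_nonneg
  have : 0 ≤ ε * Γ := by positivity
  nlinarith

theorem MεΓ_nonneg (h : d.StepHyp M K₁ ε ρ Γ N) : 0 ≤ M * ε * Γ := by
  have hM := h.one_le_M
  have hε := h.ε_pos
  have hΓ := h.Γ_nonneg
  positivity

theorem oldCoord_mem (h : d.StepHyp M K₁ ε ρ Γ N) {a b : ℝ} {Q : X × V} (hQ : Q ∈ sumBall X V a)
    (ha : a ≤ ρ - K₁ * ε / 16) (hab : a + K₁ * ε / 1024 ≤ b) :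
    d.oldCoord ε N Q ∈ sumBall X V b := by
  have := h.shift_le
  have := h.MεΓ_nonneg
  refine mem_sumBall_of_norm_sub_le hQ
    ((h.norm_oldCoord_sub_fst_le (sumBall_mono ha hQ)).trans h.εΓ_le) (c := 0) ?_ ?_
  · simp [oldCoord_snd]
  · linarith

theorem mem_of_oldCoord_mem (h : d.StepHyp M K₁ ε ρ Γ N) {a b : ℝ} {Q : X × V}
    (hQ : Q ∈ sumBall X V (ρ - K₁ * ε / 16)) (hP : d.oldCoord ε N Q ∈ sumBall X V a)
    (hab : a + K₁ * ε / 1024 ≤ b) : Q ∈ sumBall X V b := by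
  have := h.shift_le
  have := h.MεΓ_nonneg
  refine mem_sumBall_of_norm_sub_le hP (b := M * ε * Γ) (c := 0) ?_ ?_ ?_
  · rw [norm_sub_rev]; exact (h.norm_oldCoord_sub_fst_le hQ).trans h.εΓ_le
  · simp [oldCoord_snd]
  · linarith

theorem mem_of_newCoord_mem (h : d.StepHyp M K₁ ε ρ Γ N) {a b : ℝ} {Q : X × V}
    (hQ : Q ∈ sumBall X V (ρ - K₁ * ε / 16)) (hP : d.newCoord ε N Q ∈ sumBall X V a)
    (hab : a + K₁ * ε / 1024 ≤ b) : Q ∈ sumBall X V b := by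
  have := h.shift_le
  have hδ := h.δ_pos
  refine mem_sumBall_of_norm_sub_le hP (b := M * ε * Γ) (c := M * ε * Γ) ?_ ?_ ?_
  · rw [norm_sub_rev]; exact (h.norm_newCoord_sub_fst_le hQ).trans h.εΓ_le
  · rw [norm_sub_rev]
    exact h.norm_newCoord_sub_snd_le ((norm_fst_lt hQ).trans_le (by linarith))
  · linarith

theorem contDiffAt_hat (Q : X × V) : ContDiffAt ℂ ω d.hat Q :=
  contDiffAt_fst.prodMk (d.inc.contDiff.contDiffAt.comp Q contDiffAt_snd)

theorem contDiffAt_oldCoord [CompleteSpace V] (h : d.StepHyp M K₁ ε ρ Γ N) {Q : X × V}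
    (hQ : ‖Q.1‖ < ρ) : ContDiffAt ℂ ω (d.oldCoord ε N) Q := by
  have h1 : ContDiffAt ℂ ω (fun Q => d.lam ε N d.e₁ (d.hat Q)) Q :=
    (h.contDiffAt_lam d.e₁ (Q := d.hat Q) hQ).comp Q (contDiffAt_hat Q)
  unfold oldCoord
  exact contDiffAt_id.sub (((contDiffAt_const.mul h1).smul contDiffAt_const).prodMk contDiffAt_const)

theorem contDiffAt_newCoord [CompleteSpace V] (h : d.StepHyp M K₁ ε ρ Γ N) {Q : X × V}
    (hQ : ‖Q.1‖ < ρ) : ContDiffAt ℂ ω (d.newCoord ε N) Q := by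
  have h1 : ContDiffAt ℂ ω (fun Q => d.lam ε N d.e₂ (d.hat Q)) Q :=
    (h.contDiffAt_lam d.e₂ (Q := d.hat Q) hQ).comp Q (contDiffAt_hat Q)
  have h2 : ContDiffAt ℂ ω (fun Q : X × V => gam N Q.1) Q :=
    (h.contDiffAt_gam hQ).comp Q contDiffAt_fst
  unfold newCoord
  exact (contDiffAt_id.sub (((contDiffAt_const.mul h1).smul contDiffAt_const).prodMk
    contDiffAt_const)).add (contDiffAt_const.prodMk (contDiffAt_const.smul
      (d.S.contDiff.contDiffAt.comp Q h2)))

theorem closedBall_subset_sumBall {a b τ : ℝ} {Q : X × V} (hQ : Q ∈ sumBall X V a)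
    (h : a + 2 * τ ≤ b) : Metric.closedBall Q τ ⊆ sumBall X V b := by
  intro W hW
  rw [mem_closedBall_iff_norm] at hW
  exact mem_sumBall_of_norm_sub_le hQ ((norm_fst_le (W - Q)).trans hW)
    ((norm_snd_le (W - Q)).trans hW) (by linarith)

/-- The displacement is at most `M ε Γ` on a neighbourhood of radius `K₁ ε / 32`; Cauchy's estimate
divides one by the other. -/
theorem norm_fderiv_oldCoord_sub_le [CompleteSpace V] (h : d.StepHyp M K₁ ε ρ Γ N) {Q : X × V}
    (hQ : Q ∈ dom X V ρ (K₁ * ε)) :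
    ‖fderiv ℂ (d.oldCoord ε N) Q - ContinuousLinearMap.id ℂ (X × V)‖ ≤ 1 / 4 := by
  have hδ := h.δ_pos
  have hsub := closedBall_subset_sumBall (τ := K₁ * ε / 32) (b := ρ - K₁ * ε / 16) hQ (by linarith)
  have hd : ∀ y ∈ Metric.closedBall Q (K₁ * ε / 32), DifferentiableAt ℂ (d.oldCoord ε N) y :=
    fun y hy => (h.contDiffAt_oldCoord ((norm_fst_lt (hsub hy)).trans_le
      (by linarith))).differentiableAt (by simp)
  have := norm_fderiv_le_of_closedBall (f := fun Z => d.oldCoord ε N Z - Z) (x := Q)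
    (τ := K₁ * ε / 32) (C := M * ε * Γ) (by positivity)
    (fun y hy => (hd y hy).sub differentiableAt_id) (fun y hy => ?_)
  · rw [fderiv_fun_sub (hd Q (Metric.mem_closedBall_self (by positivity))) differentiableAt_fun_id,
      fderiv_fun_id] at this
    refine this.trans ?_
    rw [div_le_iff₀ (by positivity)]
    linarith [h.shift_le]
  · refine max_le ((h.norm_oldCoord_sub_fst_le (hsub hy)).trans h.εΓ_le) ?_
    simpa [oldCoord_snd] using h.MεΓ_nonneg

theorem norm_fderiv_newCoord_sub_le [CompleteSpace V] (h : d.StepHyp M K₁ ε ρ Γ N) {Q : X × V}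
    (hQ : Q ∈ dom X V ρ (K₁ * ε)) :
    ‖fderiv ℂ (d.newCoord ε N) Q - ContinuousLinearMap.id ℂ (X × V)‖ ≤ 1 / 4 := by
  have hδ := h.δ_pos
  have hsub := closedBall_subset_sumBall (τ := K₁ * ε / 32) (b := ρ - K₁ * ε / 16) hQ (by linarith)
  have hlt : ∀ y ∈ Metric.closedBall Q (K₁ * ε / 32), ‖y.1‖ < ρ := fun y hy =>
    (norm_fst_lt (hsub hy)).trans_le (by linarith)
  have hd : ∀ y ∈ Metric.closedBall Q (K₁ * ε / 32), DifferentiableAt ℂ (d.newCoord ε N) y :=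
    fun y hy => (h.contDiffAt_newCoord (hlt y hy)).differentiableAt (by simp)
  have := norm_fderiv_le_of_closedBall (f := fun Z => d.newCoord ε N Z - Z) (x := Q)
    (τ := K₁ * ε / 32) (C := M * ε * Γ) (by positivity)
    (fun y hy => (hd y hy).sub differentiableAt_id) (fun y hy => ?_)
  · rw [fderiv_fun_sub (hd Q (Metric.mem_closedBall_self (by positivity))) differentiableAt_fun_id,
      fderiv_fun_id] at this
    refine this.trans ?_
    rw [div_le_iff₀ (by positivity)]
    linarith [h.shift_le]
  · exact max_le ((h.norm_newCoord_sub_fst_le (hsub hy)).trans h.εΓ_le)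
      (h.norm_newCoord_sub_snd_le (hlt y hy))

theorem dom_fst_lt (h : d.StepHyp M K₁ ε ρ Γ N) {Q : X × V} (hQ : Q ∈ dom X V ρ (K₁ * ε)) :
    ‖Q.1‖ < ρ := (norm_fst_lt hQ).trans_le (by linarith [h.δ_pos])

theorem dom_subset (h : d.StepHyp M K₁ ε ρ Γ N) :
    dom X V ρ (K₁ * ε) ⊆ sumBall X V (ρ - K₁ * ε / 16) :=
  sumBall_mono (by linarith [h.δ_pos])

section Inverse

variable [CompleteSpace X] [CompleteSpace V] [Nontrivial X] [NormedSpace ℝ X] [NormedSpace ℝ V]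

/-- `near_identity_inverse` applies with `η = M ε Γ`, since `4 η` is far smaller than the gap
between the radii `ρ - K₁ ε / 4` and `ρ - K₁ ε / 8`. -/
theorem oldCoord_inverse (h : d.StepHyp M K₁ ε ρ Γ N) :
    InjOn (d.oldCoord ε N) (dom X V ρ (K₁ * ε)) ∧
    (∀ Q ∈ dom X V ρ (K₁ * ε), ContDiffAt ℂ ω (Function.invFunOn (d.oldCoord ε N)
      (dom X V ρ (K₁ * ε))) (d.oldCoord ε N Q)) ∧
    (∀ W ∈ sumBall X V (ρ - K₁ * ε / 4), ∃ Q ∈ dom X V ρ (K₁ * ε), d.oldCoord ε N Q = W) := by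
  obtain ⟨h1, h2, h3⟩ := near_identity_inverse (isOpen_sumBall X V _)
    (convex_sumBall X V (ρ - K₁ * ε / 8)) (fun _ hQ => h.contDiffAt_oldCoord (h.dom_fst_lt hQ))
    (fun _ hQ => h.norm_fderiv_oldCoord_sub_le hQ)
  have hδ := h.δ_pos
  refine ⟨h1, h2, fun W hW => h3 W (M * ε * Γ) h.MεΓ_nonneg
    (closedBall_subset_sumBall hW (by linarith [h.shift_le])) ?_⟩
  refine max_le ((h.norm_oldCoord_sub_fst_le (sumBall_mono (by linarith) hW)).trans h.εΓ_le) ?_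
  simpa [oldCoord_snd] using h.MεΓ_nonneg

theorem newCoord_inverse (h : d.StepHyp M K₁ ε ρ Γ N) :
    InjOn (d.newCoord ε N) (dom X V ρ (K₁ * ε)) ∧
    (∀ Q ∈ dom X V ρ (K₁ * ε), ContDiffAt ℂ ω (Function.invFunOn (d.newCoord ε N)
      (dom X V ρ (K₁ * ε))) (d.newCoord ε N Q)) ∧
    (∀ W ∈ sumBall X V (ρ - K₁ * ε / 4), ∃ Q ∈ dom X V ρ (K₁ * ε), d.newCoord ε N Q = W) := by
  obtain ⟨h1, h2, h3⟩ := near_identity_inverse (isOpen_sumBall X V _)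
    (convex_sumBall X V (ρ - K₁ * ε / 8)) (fun _ hQ => h.contDiffAt_newCoord (h.dom_fst_lt hQ))
    (fun _ hQ => h.norm_fderiv_newCoord_sub_le hQ)
  have hδ := h.δ_pos
  refine ⟨h1, h2, fun W hW => h3 W (M * ε * Γ) h.MεΓ_nonneg
    (closedBall_subset_sumBall hW (by linarith [h.shift_le])) ?_⟩
  exact max_le ((h.norm_newCoord_sub_fst_le (sumBall_mono (by linarith) hW)).trans h.εΓ_le)
    (h.norm_newCoord_sub_snd_le ((norm_fst_lt hW).trans_le (by linarith)))

end Inverse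

end Estimates

end NFData.StepHyp

end
end KleinGordon

/-! ### One normal form step: velocities and the nonlinearity in mixed coordinates. -/

namespace KleinGordon
noncomputable section

namespace NFData.StepHyp

section Velocities

set_option linter.unusedSectionVars false

open scoped ContDiff

variable {X V U : Type*} [NormedAddCommGroup X] [NormedSpace ℂ X] [NormedAddCommGroup V]
  [NormedSpace ℂ V] [NormedAddCommGroup U] [NormedSpace ℂ U] {d : NFData X V U}
  {M K₁ ε ρ Γ : ℝ} {N : X × V → X × V} [CompleteSpace V]

/-- A velocity has an `X` part of order one but a `U` part of order `1 / ε`. Cauchy's estimate is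
used along the complex line in its direction, with times up to `K₁ ε / (128 M²)`: the `X` variable
moves by at most `K₁ ε / 32`, and the `U` variable may move by `K₁ / 32`, which is harmless as `lam`
is affine there. The factors `1 / ε` from `lam` and from the line cancel against `ε²`. The condition
`2 ^ 14 * M ^ 5 ≤ K₁` is what this estimate needs. -/
theorem norm_dlam_apply_le (h : d.StepHyp M K₁ ε ρ Γ N) {e : X} (he : ‖e‖ ≤ M) {Q : X × V}
    (hQ : Q ∈ dom X V ρ (K₁ * ε)) {v : X × U} (h₁ : ‖v.1‖ ≤ 4 * M ^ 2)
    (h₂ : ‖v.2‖ ≤ 4 * M ^ 2 / ε) : ‖d.dlam ε N e Q v‖ ≤ Γ / (8 * M) := by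
  have hM := h.one_le_M
  have hM0 : 0 < M := by linarith
  have hδ := h.δ_pos
  have hΓ := h.Γ_nonneg
  have hε := h.ε_pos
  have hK := h.K₁_pos
  have hK' := h.le_K₁
  have hp2 := h.M_le_pow 2 (by norm_num)
  have hp0 : 0 ≤ M ^ 5 := by positivity
  have hτ : 0 < K₁ * ε / (128 * M ^ 2) := by positivity
  have hfst : ∀ t : ℂ, ‖t‖ ≤ K₁ * ε / (128 * M ^ 2) →
      ‖(d.hat Q + t • v).1‖ < ρ - K₁ * ε / 16 := by
    intro t ht
    have e1 : ‖t • v.1‖ ≤ K₁ * ε / (128 * M ^ 2) * (4 * M ^ 2) := by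
      rw [norm_smul]; gcongr
    have e2 : K₁ * ε / (128 * M ^ 2) * (4 * M ^ 2) = K₁ * ε / 32 := by field_simp; norm_num
    have e3 := norm_add_le Q.1 (t • v.1)
    have e4 : ‖Q.1‖ < ρ - K₁ * ε / 8 := norm_fst_lt hQ
    change ‖Q.1 + t • v.1‖ < _
    linarith
  have hsnd : ∀ t : ℂ, ‖t‖ ≤ K₁ * ε / (128 * M ^ 2) → ‖(d.hat Q + t • v).2‖ + M ^ 2 ≤ K₁ := by
    intro t ht
    have e1 : ‖t • v.2‖ ≤ K₁ * ε / (128 * M ^ 2) * (4 * M ^ 2 / ε) := by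
      rw [norm_smul]; gcongr
    have e2 : K₁ * ε / (128 * M ^ 2) * (4 * M ^ 2 / ε) = K₁ / 32 := by field_simp; norm_num
    have e3 := norm_add_le (d.hat Q).2 (t • v.2)
    have e4 := h.norm_hat_snd_le (sumBall_mono (by linarith) hQ)
    change ‖(d.hat Q).2 + t • v.2‖ + M ^ 2 ≤ _
    linarith
  have key := norm_fderiv_apply_le (f := d.lam ε N e) (x := d.hat Q) (v := v) hτ
    (fun t ht => (h.contDiffAt_lam e ((hfst t ht).trans (by linarith))).differentiableAt (by simp))
    (C := 16 * M ^ 2 * Γ / (K₁ * ε) * K₁)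
    (fun t ht => (h.norm_lam_le he (hfst t ht)).trans (by have := hsnd t ht; gcongr))
  simp only [dlam, smul_apply, norm_smul, norm_pow, h.norm_ε]
  calc _ ≤ ε ^ 2 * (16 * M ^ 2 * Γ / (K₁ * ε) * K₁ / (K₁ * ε / (128 * M ^ 2))) := by gcongr
    _ = Γ * (2048 * M ^ 4 / K₁) := by field_simp; ring
    _ ≤ Γ * (1 / (8 * M)) := by
      refine mul_le_mul_of_nonneg_left ?_ hΓ
      rw [div_le_div_iff₀ hK (by positivity)]
      calc 2048 * M ^ 4 * (8 * M) = 2 ^ 14 * M ^ 5 := by ring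
        _ ≤ 1 * K₁ := by linarith
    _ = _ := by ring

theorem Γ_div_le (h : d.StepHyp M K₁ ε ρ Γ N) : Γ / (8 * M) ≤ Γ / 8 := by
  have hM := h.one_le_M
  have hΓ := h.Γ_nonneg
  gcongr
  linarith

theorem norm_vel_le (h : d.StepHyp M K₁ ε ρ Γ N) {Z : X × V} (hZ : Z ∈ sumBall X V ρ) :
    ‖(d.vel ε N Z).1‖ ≤ 2 * M ^ 2 ∧ ‖(d.vel ε N Z).2‖ ≤ 2 * M ^ 2 / ε := by
  have hM := h.one_le_M
  have hε := h.ε_pos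
  have hZ' : ‖Z.1‖ + ‖Z.2‖ < ρ := hZ
  have hρ := h.ρ_le
  have z1 : ‖Z.1‖ ≤ M := by linarith [norm_nonneg Z.2]
  have z2 : ‖Z.2‖ ≤ M := by linarith [norm_nonneg Z.1]
  have n1 := (norm_fst_le _).trans (h.le_M Z hZ)
  have n2 := (norm_snd_le _).trans (h.le_M Z hZ)
  have a1 := norm_clm_le h.bdd.A z1
  have a2 := norm_clm_le h.bdd.J z2
  have a3 := norm_clm_le h.bdd.inc n2
  constructor
  · refine (norm_add_le _ _).trans ?_
    nlinarith
  · refine (norm_add_le _ _).trans ?_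
    rw [norm_smul, norm_inv, h.norm_ε]
    have : M * M ≤ M ^ 2 / ε := by
      rw [le_div_iff₀ hε, pow_two]
      exact mul_le_of_le_one_right (by positivity) h.ε_le
    calc _ ≤ ε⁻¹ * (M * M) + M ^ 2 / ε := by gcongr; exact a3.trans this
      _ = _ := by field_simp; ring

theorem norm_dlam_e₂_le (h : d.StepHyp M K₁ ε ρ Γ N) {Q : X × V} (hQ : Q ∈ dom X V ρ (K₁ * ε)) :
    ‖d.dlam ε N d.e₁ Q (d.e₂, 0)‖ ≤ 1 / 8 := by
  have hM := h.one_le_M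
  have hε := h.ε_pos
  refine (h.norm_dlam_apply_le h.bdd.e₁ hQ ?_ ?_).trans ?_
  · refine h.bdd.e₂.trans ?_; nlinarith
  · simp only [norm_zero]; positivity
  · linarith [h.Γ_div_le, h.Γ_le]

theorem one_sub_ne_zero (h : d.StepHyp M K₁ ε ρ Γ N) {Q : X × V} (hQ : Q ∈ dom X V ρ (K₁ * ε)) :
    1 - d.dlam ε N d.e₁ Q (d.e₂, 0) ≠ 0 := by
  intro h0
  have := h.norm_dlam_e₂_le hQ
  rw [← sub_eq_zero.mp h0] at this
  norm_num at this

/-- The derivative of `oldCoord` differs from the identity by a rank one map with range spanned by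
`(e₂, 0)`. Inverting it changes only the hyperbolic velocity. -/
theorem norm_mixedVel_sub_le (h : d.StepHyp M K₁ ε ρ Γ N) {Q : X × V}
    (hQ : Q ∈ dom X V ρ (K₁ * ε)) :
    ‖(d.mixedVel ε N Q).1 - (d.vel ε N (d.oldCoord ε N Q)).1‖ ≤ Γ / 4 ∧
    (d.mixedVel ε N Q).2 = (d.vel ε N (d.oldCoord ε N Q)).2 := by
  have hM := h.one_le_M
  have hM0 : 0 < M := by linarith
  have hε := h.ε_pos
  have hΓ := h.Γ_nonneg
  have hP : d.oldCoord ε N Q ∈ sumBall X V ρ :=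
    h.oldCoord_mem hQ (by linarith [h.δ_pos]) (by linarith [h.δ_pos])
  obtain ⟨v1, v2⟩ := h.norm_vel_le hP
  have l1 := h.norm_dlam_apply_le h.bdd.e₁ hQ (v1.trans (by nlinarith)) (v2.trans (by gcongr; norm_num))
  have l2 := h.norm_dlam_e₂_le hQ
  constructor
  · simp only [mixedVel, Prod.fst_add, Prod.smul_fst, add_sub_cancel_left]
    rw [norm_smul, norm_mul, norm_inv]
    have l3 : 7 / 8 ≤ ‖1 - d.dlam ε N d.e₁ Q (d.e₂, 0)‖ := by
      have := norm_sub_norm_le (1 : ℂ) (d.dlam ε N d.e₁ Q (d.e₂, 0))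
      rw [norm_one] at this
      linarith
    have l4 : ‖1 - d.dlam ε N d.e₁ Q (d.e₂, 0)‖⁻¹ ≤ 2 := by
      rw [inv_le_comm₀ (by linarith) (by norm_num)]; linarith
    calc _ ≤ Γ / (8 * M) * 2 * M := by
          have := h.bdd.e₂
          gcongr
      _ = _ := by field_simp; ring
  · simp [mixedVel]

theorem norm_mixedVel_le (h : d.StepHyp M K₁ ε ρ Γ N) {Q : X × V} (hQ : Q ∈ dom X V ρ (K₁ * ε)) :
    ‖(d.mixedVel ε N Q).1‖ ≤ 4 * M ^ 2 ∧ ‖(d.mixedVel ε N Q).2‖ ≤ 4 * M ^ 2 / ε := by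
  have hM := h.one_le_M
  have hε := h.ε_pos
  have hP : d.oldCoord ε N Q ∈ sumBall X V ρ :=
    h.oldCoord_mem hQ (by linarith [h.δ_pos]) (by linarith [h.δ_pos])
  obtain ⟨v1, v2⟩ := h.norm_vel_le hP
  obtain ⟨m1, m2⟩ := h.norm_mixedVel_sub_le hQ
  constructor
  · have := norm_add_le (d.vel ε N (d.oldCoord ε N Q)).1
      ((d.mixedVel ε N Q).1 - (d.vel ε N (d.oldCoord ε N Q)).1)
    rw [add_sub_cancel] at this
    have := h.Γ_le
    nlinarith
  · rw [m2]; exact v2.trans (by gcongr; norm_num)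

/-- `γ` depends only on the hyperbolic variables, so only their velocity, of order one, enters its
drift. The prefactor `ε` cancels the `1 / ε` of Cauchy's estimate, and `K₁` makes the rest small. -/
theorem norm_S_fderiv_le (h : d.StepHyp M K₁ ε ρ Γ N) {Q : X × V} (hQ : Q ∈ dom X V ρ (K₁ * ε)) :
    ‖(ε : ℂ) • d.S (fderiv ℂ (gam N) Q.1 (d.mixedVel ε N Q).1)‖ ≤ Γ / 128 := by
  have hM := h.one_le_M
  have hε := h.ε_pos
  have hΓ := h.Γ_nonneg
  have hK := h.K₁_pos
  have hK' := h.le_K₁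
  have hp := h.M_le_pow 3 (by norm_num)
  have hp0 : 0 ≤ M ^ 5 := by positivity
  have hq : ‖Q.1‖ < ρ - K₁ * ε / 16 := norm_fst_lt (h.dom_subset hQ)
  have := norm_clm_le h.bdd.S (norm_clm_le (h.norm_fderiv_gam_le hq) (h.norm_mixedVel_le hQ).1)
  rw [norm_smul, h.norm_ε]
  calc _ ≤ ε * (M * (16 * Γ / (K₁ * ε) * (4 * M ^ 2))) := by gcongr
    _ = Γ * (64 * M ^ 3 / K₁) := by field_simp; ring
    _ ≤ Γ * (1 / 128) := by
      refine mul_le_mul_of_nonneg_left ?_ hΓ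
      rw [div_le_div_iff₀ hK (by norm_num)]
      linarith
    _ = _ := by ring

theorem norm_mixedNonlinearity_sub_le (h : d.StepHyp M K₁ ε ρ Γ N) {Q : X × V}
    (hQ : Q ∈ dom X V ρ (K₁ * ε)) :
    ‖d.mixedNonlinearity ε N Q - N (d.oldCoord ε N Q)‖ ≤ 5 * M ^ 2 * Γ := by
  have hM := h.one_le_M
  have hM0 : 0 < M := by linarith
  have hε := h.ε_pos
  have hΓ := h.Γ_nonneg
  have hQ' := h.dom_subset hQ
  have hMΓ : Γ ≤ M ^ 2 * Γ := le_mul_of_one_le_left hΓ (one_le_pow₀ hM)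
  obtain ⟨m1, m2⟩ := h.norm_mixedVel_sub_le hQ
  obtain ⟨w1, w2⟩ := h.norm_mixedVel_le hQ
  refine max_le ?_ ?_
  -- `A Q.1` is added and subtracted, so that the linear term contributes only through the
  -- displacements of the old and the new point from `Q`.
  · have e : (d.mixedNonlinearity ε N Q - N (d.oldCoord ε N Q)).1
        = ((d.mixedVel ε N Q).1 - (d.vel ε N (d.oldCoord ε N Q)).1)
          - (d.dlam ε N d.e₂ Q (d.mixedVel ε N Q)) • d.e₁
          + d.A (((d.oldCoord ε N Q).1 - Q.1) - ((d.newCoord ε N Q).1 - Q.1)) := by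
      simp only [mixedNonlinearity, vel, Prod.fst_sub, map_sub]
      abel
    rw [e]
    have a1 : ‖(d.dlam ε N d.e₂ Q (d.mixedVel ε N Q)) • d.e₁‖ ≤ Γ / 8 := by
      rw [norm_smul]
      calc _ ≤ Γ / (8 * M) * M := by
            have := h.norm_dlam_apply_le h.bdd.e₂ hQ w1 w2
            have := h.bdd.e₁
            gcongr
        _ = _ := by field_simp
    have a2 := norm_clm_le h.bdd.A ((norm_sub_le ((d.oldCoord ε N Q).1 - Q.1)
      ((d.newCoord ε N Q).1 - Q.1)).trans (add_le_add (h.norm_oldCoord_sub_fst_le hQ')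
        (h.norm_newCoord_sub_fst_le hQ')))
    have a3 : M * (ε * Γ + ε * Γ) ≤ 2 * (M ^ 2 * Γ) := by
      have : ε * Γ ≤ 1 * Γ := mul_le_mul_of_nonneg_right h.ε_le hΓ
      have : M * Γ ≤ M ^ 2 * Γ := by
        rw [pow_two]; exact mul_le_mul_of_nonneg_right (le_mul_of_one_le_left hM0.le hM) hΓ
      nlinarith
    calc _ ≤ Γ / 4 + Γ / 8 + M * (ε * Γ + ε * Γ) :=
          (norm_add_le _ _).trans (add_le_add ((norm_sub_le _ _).trans (add_le_add m1 a1)) a2)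
      _ ≤ _ := by linarith
  · have e : (d.mixedNonlinearity ε N Q - N (d.oldCoord ε N Q)).2
        = - gam N Q.1 + (ε : ℂ) • d.S (fderiv ℂ (gam N) Q.1 (d.mixedVel ε N Q).1) := by
      simp only [mixedNonlinearity, Prod.snd_sub]
      abel
    rw [e]
    have := h.le_Γ Q.1 (h.dom_fst_lt hQ)
    calc _ ≤ Γ + Γ / 128 := (norm_add_le _ _).trans
          (add_le_add (by rwa [norm_neg]) (h.norm_S_fderiv_le hQ))
      _ ≤ _ := by linarith

/-- The Lipschitz constant is only of order `1 / ε`, which suffices because it is applied to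
displacements of order `ε Γ`. -/
theorem norm_sub_nonlinearity_le (h : d.StepHyp M K₁ ε ρ Γ N) [NormedSpace ℝ X] [NormedSpace ℝ V]
    {Z W : X × V}
    (hZ : Z ∈ sumBall X V (ρ - K₁ * ε / 8)) (hW : W ∈ sumBall X V (ρ - K₁ * ε / 8)) :
    ‖N Z - N W‖ ≤ 32 * M / (K₁ * ε) * ‖Z - W‖ := by
  have hδ := h.δ_pos
  refine (convex_sumBall X V _).norm_image_sub_le_of_norm_fderiv_le (𝕜 := ℂ) (f := N)
    (fun y hy => (h.smooth y (sumBall_mono (by linarith) hy)).differentiableAt (by simp))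
    (fun y hy => ?_) hW hZ
  have hsub := closedBall_subset_sumBall (τ := K₁ * ε / 32) (b := ρ) hy (by linarith)
  have := norm_fderiv_le_of_closedBall (f := N) (x := y) (τ := K₁ * ε / 32) (C := M)
    (by positivity) (fun z hz => (h.smooth z (hsub hz)).differentiableAt (by simp))
    (fun z hz => h.le_M z (hsub hz))
  refine this.trans (le_of_eq ?_)
  field_simp

theorem contDiffAt_mixedNonlinearity [CompleteSpace X] [CompleteSpace U]
    (h : d.StepHyp M K₁ ε ρ Γ N) {Q : X × V} (hQ : Q ∈ dom X V ρ (K₁ * ε)) :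
    ContDiffAt ℂ ω (d.mixedNonlinearity ε N) Q := by
  have hq : ‖Q.1‖ < ρ := h.dom_fst_lt hQ
  have hP : d.oldCoord ε N Q ∈ sumBall X V ρ :=
    h.oldCoord_mem hQ (by linarith [h.δ_pos]) (by linarith [h.δ_pos])
  have cP := h.contDiffAt_oldCoord hq
  have cR := h.contDiffAt_newCoord hq
  have cN : ContDiffAt ℂ ω (fun Q => N (d.oldCoord ε N Q)) Q := (h.smooth _ hP).comp Q cP
  have cV : ContDiffAt ℂ ω (fun Q => d.vel ε N (d.oldCoord ε N Q)) Q := by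
    unfold vel
    refine ContDiffAt.prodMk ?_ ?_
    · exact (d.A.contDiff.contDiffAt.comp Q cP.fst).add cN.fst
    · exact (contDiffAt_const.smul (d.J.contDiff.contDiffAt.comp Q cP.snd)).add
        (d.inc.contDiff.contDiffAt.comp Q cN.snd)
  have cl : ∀ e, ContDiffAt ℂ ω (d.dlam ε N e) Q := by
    intro e
    have c1 : ContDiffAt ℂ ω (fderiv ℂ (d.lam ε N e)) (d.hat Q) :=
      (h.contDiffAt_lam e (Q := d.hat Q) hq).fderiv_right (by simp)
    have c2 : ContDiffAt ℂ ω (fun Q => fderiv ℂ (d.lam ε N e) (d.hat Q)) Q :=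
      c1.comp Q (contDiffAt_hat Q)
    exact c2.const_smul _
  have cM : ContDiffAt ℂ ω (d.mixedVel ε N) Q := by
    unfold mixedVel
    exact cV.add (((((cl d.e₁).clm_apply cV)).mul
      ((contDiffAt_const.sub ((cl d.e₁).clm_apply contDiffAt_const)).inv
        (h.one_sub_ne_zero hQ))).smul contDiffAt_const)
  have cg : ContDiffAt ℂ ω (fun Q : X × V => gam N Q.1) Q :=
    (h.contDiffAt_gam hq).comp Q contDiffAt_fst
  have cdg : ContDiffAt ℂ ω (fun Q : X × V => fderiv ℂ (gam N) Q.1) Q :=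
    (h.contDiffAt_fderiv_gam hq).comp Q contDiffAt_fst
  unfold mixedNonlinearity
  refine ContDiffAt.prodMk ?_ ?_
  · exact (cM.fst.sub (((cl d.e₂).clm_apply cM).smul contDiffAt_const)).sub
      (d.A.contDiff.contDiffAt.comp Q cR.fst)
  · exact (cN.snd.sub cg).add (contDiffAt_const.smul
      (d.S.contDiff.contDiffAt.comp Q (cdg.clm_apply cM.fst)))

end Velocities

/-! ### One normal form step: the transformation and the transformed nonlinearity. -/

section Step

set_option linter.unusedSectionVars false

open scoped ContDiff

variable {X V U : Type*} [NormedAddCommGroup X] [NormedSpace ℂ X] [NormedAddCommGroup V]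
  [NormedSpace ℂ V] [NormedAddCommGroup U] [NormedSpace ℂ U] {d : NFData X V U}
  {M K₁ ε ρ Γ : ℝ} {N : X × V → X × V} [CompleteSpace X] [CompleteSpace V] [CompleteSpace U]
  [Nontrivial X] [NormedSpace ℝ X] [NormedSpace ℝ V]

/-- The mixed coordinates of a point in old coordinates. -/
theorem exists_mixed_of_old (h : d.StepHyp M K₁ ε ρ Γ N) {a : ℝ} (ha : a ≤ ρ - K₁ * ε / 4)
    {Z : X × V} (hZ : Z ∈ sumBall X V a) :
    ∃ Q ∈ dom X V ρ (K₁ * ε), Q ∈ sumBall X V (a + K₁ * ε / 1024) ∧ d.oldCoord ε N Q = Z ∧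
      Function.invFunOn (d.oldCoord ε N) (dom X V ρ (K₁ * ε)) Z = Q := by
  obtain ⟨h1, -, h3⟩ := h.oldCoord_inverse
  obtain ⟨Q, hQ, hQZ⟩ := h3 Z (sumBall_mono ha hZ)
  refine ⟨Q, hQ, h.mem_of_oldCoord_mem (h.dom_subset hQ) (hQZ.symm ▸ hZ) le_rfl, hQZ, ?_⟩
  have hex : ∃ a ∈ dom X V ρ (K₁ * ε), d.oldCoord ε N a = Z := ⟨Q, hQ, hQZ⟩
  exact h1 (Function.invFunOn_mem hex) hQ ((Function.invFunOn_eq hex).trans hQZ.symm)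

/-- The mixed coordinates of a point in new coordinates. -/
theorem exists_mixed_of_new (h : d.StepHyp M K₁ ε ρ Γ N) {a : ℝ} (ha : a ≤ ρ - K₁ * ε / 4)
    {Z : X × V} (hZ : Z ∈ sumBall X V a) :
    ∃ Q ∈ dom X V ρ (K₁ * ε), Q ∈ sumBall X V (a + K₁ * ε / 1024) ∧ d.newCoord ε N Q = Z ∧
      Function.invFunOn (d.newCoord ε N) (dom X V ρ (K₁ * ε)) Z = Q := by
  obtain ⟨h1, -, h3⟩ := h.newCoord_inverse
  obtain ⟨Q, hQ, hQZ⟩ := h3 Z (sumBall_mono ha hZ)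
  refine ⟨Q, hQ, h.mem_of_newCoord_mem (h.dom_subset hQ) (hQZ.symm ▸ hZ) le_rfl, hQZ, ?_⟩
  have hex : ∃ a ∈ dom X V ρ (K₁ * ε), d.newCoord ε N a = Z := ⟨Q, hQ, hQZ⟩
  exact h1 (Function.invFunOn_mem hex) hQ ((Function.invFunOn_eq hex).trans hQZ.symm)

theorem contDiffAt_trans (h : d.StepHyp M K₁ ε ρ Γ N) {Z : X × V}
    (hZ : Z ∈ sumBall X V (ρ - K₁ * ε / 4)) : ContDiffAt ℂ ω (d.trans ε N ρ (K₁ * ε)) Z := by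
  obtain ⟨Q, hQ, -, hQZ, hinv⟩ := h.exists_mixed_of_old le_rfl hZ
  have h2 := h.oldCoord_inverse.2.1 Q hQ
  rw [hQZ] at h2
  refine ContDiffAt.comp Z ?_ h2
  rw [hinv]
  exact h.contDiffAt_newCoord (h.dom_fst_lt hQ)

theorem norm_trans_sub_le (h : d.StepHyp M K₁ ε ρ Γ N) {Z : X × V}
    (hZ : Z ∈ sumBall X V (ρ - K₁ * ε / 4)) :
    ‖(d.trans ε N ρ (K₁ * ε) Z - Z).1‖ ≤ K₁ * ε / 1024 ∧
      ‖(d.trans ε N ρ (K₁ * ε) Z - Z).2‖ ≤ K₁ * ε / 1024 := by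
  obtain ⟨Q, hQ, -, hQZ, hinv⟩ := h.exists_mixed_of_old le_rfl hZ
  have e : d.trans ε N ρ (K₁ * ε) Z = d.newCoord ε N Q := by simp only [trans, hinv]
  have hQ' := h.dom_subset hQ
  have s := h.shift_le
  have s0 := h.MεΓ_nonneg
  rw [e, ← hQZ]
  constructor
  · rw [Prod.fst_sub, ← sub_sub_sub_cancel_right _ _ Q.1]
    refine (norm_sub_le _ _).trans ?_
    linarith [h.norm_newCoord_sub_fst_le hQ', h.norm_oldCoord_sub_fst_le hQ', h.εΓ_le]
  · rw [Prod.snd_sub, oldCoord_snd]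
    linarith [h.norm_newCoord_sub_snd_le (h.dom_fst_lt hQ)]

theorem norm_fderiv_trans_sub_lt (h : d.StepHyp M K₁ ε ρ Γ N) {Z : X × V}
    (hZ : Z ∈ sumBall X V (ρ - K₁ * ε / 2)) :
    ‖fderiv ℂ (d.trans ε N ρ (K₁ * ε)) Z - ContinuousLinearMap.id ℂ (X × V)‖ ≤ 1 / 2 := by
  have hδ := h.δ_pos
  have hsub := closedBall_subset_sumBall (τ := K₁ * ε / 8) (b := ρ - K₁ * ε / 4) hZ (by linarith)
  have hd : ∀ y ∈ Metric.closedBall Z (K₁ * ε / 8),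
      DifferentiableAt ℂ (d.trans ε N ρ (K₁ * ε)) y :=
    fun y hy => (h.contDiffAt_trans (hsub hy)).differentiableAt (by simp)
  have := norm_fderiv_le_of_closedBall (f := fun Z => d.trans ε N ρ (K₁ * ε) Z - Z) (x := Z)
    (τ := K₁ * ε / 8) (C := K₁ * ε / 1024) (by positivity)
    (fun y hy => (hd y hy).sub differentiableAt_id) (fun y hy => ?_)
  · rw [fderiv_fun_sub (hd Z (Metric.mem_closedBall_self (by positivity))) differentiableAt_fun_id,
      fderiv_fun_id] at this
    refine this.trans ?_
    rw [div_le_iff₀ (by positivity)]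
    linarith
  · exact max_le (h.norm_trans_sub_le (hsub hy)).1 (h.norm_trans_sub_le (hsub hy)).2

theorem injOn_trans (h : d.StepHyp M K₁ ε ρ Γ N) :
    InjOn (d.trans ε N ρ (K₁ * ε)) (sumBall X V (ρ - K₁ * ε / 4)) := by
  intro Z hZ W hW e
  obtain ⟨Q, hQ, -, hQZ, hinv⟩ := h.exists_mixed_of_old le_rfl hZ
  obtain ⟨Q', hQ', -, hQZ', hinv'⟩ := h.exists_mixed_of_old le_rfl hW
  simp only [trans, hinv, hinv'] at e
  rw [← hQZ, ← hQZ', h.newCoord_inverse.1 hQ hQ' e]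

/-- The mixed coordinates relate a point to its image. -/
theorem exists_mixed_of_new_old (h : d.StepHyp M K₁ ε ρ Γ N) {W : X × V}
    (hW : W ∈ sumBall X V (ρ - K₁ * ε)) : ∃ Q ∈ dom X V ρ (K₁ * ε),
      Q ∈ sumBall X V (ρ - K₁ * ε / 2) ∧ d.newCoord ε N Q = W ∧
      d.oldCoord ε N Q ∈ sumBall X V (ρ - K₁ * ε / 2) ∧
      d.trans ε N ρ (K₁ * ε) (d.oldCoord ε N Q) = W ∧
      d.newNonlinearity ε N ρ (K₁ * ε) W = d.mixedNonlinearity ε N Q := by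
  have hδ := h.δ_pos
  obtain ⟨Q, hQ, hQ', hQW, hinv⟩ := h.exists_mixed_of_new (by linarith) hW
  have hP : d.oldCoord ε N Q ∈ sumBall X V (ρ - K₁ * ε / 2) :=
    h.oldCoord_mem hQ' (by linarith) (by linarith)
  refine ⟨Q, hQ, sumBall_mono (by linarith) hQ', hQW, hP, ?_, by simp only [newNonlinearity, hinv]⟩
  obtain ⟨Q₁, hQ₁, -, hQZ, hinv'⟩ := h.exists_mixed_of_old (by linarith) hP
  rw [h.oldCoord_inverse.1 hQ₁ hQ hQZ] at hinv'
  simp only [trans, hinv', hQW]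

theorem contDiffAt_newNonlinearity (h : d.StepHyp M K₁ ε ρ Γ N) {W : X × V}
    (hW : W ∈ sumBall X V (ρ - K₁ * ε)) :
    ContDiffAt ℂ ω (d.newNonlinearity ε N ρ (K₁ * ε)) W := by
  obtain ⟨Q, hQ, -, hQZ, hinv⟩ := h.exists_mixed_of_new (by linarith [h.δ_pos]) hW
  have h2 := h.newCoord_inverse.2.1 Q hQ
  rw [hQZ] at h2
  refine ContDiffAt.comp W ?_ h2
  rw [hinv]
  exact h.contDiffAt_mixedNonlinearity hQ

/-- Two contributions: `5 M² Γ` from the mixed coordinates, and at most `Γ` because `N` is evaluated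
at the old instead of the new point, at distance at most `2 M ε Γ`. -/
theorem norm_newNonlinearity_sub_le (h : d.StepHyp M K₁ ε ρ Γ N) {W : X × V}
    (hW : W ∈ sumBall X V (ρ - K₁ * ε)) :
    ‖d.newNonlinearity ε N ρ (K₁ * ε) W - N W‖ ≤ 6 * M ^ 2 * Γ := by
  have hδ := h.δ_pos
  have hM := h.one_le_M
  have hΓ := h.Γ_nonneg
  have hε := h.ε_pos
  have hK := h.K₁_pos
  obtain ⟨Q, hQ, hQ', hQW, hP, hPW, hN⟩ := h.exists_mixed_of_new_old hW
  have e1 := h.norm_mixedNonlinearity_sub_le hQ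
  have e2 := h.norm_sub_nonlinearity_le (sumBall_mono (by linarith) hP)
    (sumBall_mono (by linarith) hW)
  have hPW : ‖d.oldCoord ε N Q - W‖ ≤ 2 * (M * ε * Γ) := by
    have hQ'' := h.dom_subset hQ
    rw [← hQW, ← sub_sub_sub_cancel_right _ _ Q]
    refine (norm_sub_le _ _).trans ?_
    rw [two_mul]
    refine add_le_add (max_le ((h.norm_oldCoord_sub_fst_le hQ'').trans h.εΓ_le) ?_)
      (max_le ((h.norm_newCoord_sub_fst_le hQ'').trans h.εΓ_le)
        (h.norm_newCoord_sub_snd_le (h.dom_fst_lt hQ)))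
    rw [Prod.snd_sub, oldCoord_snd, sub_self, norm_zero]
    exact h.MεΓ_nonneg
  have e3 : 32 * M / (K₁ * ε) * ‖d.oldCoord ε N Q - W‖ ≤ Γ := by
    calc _ ≤ 32 * M / (K₁ * ε) * (2 * (M * ε * Γ)) := by gcongr
      _ = Γ * (64 * M ^ 2 / K₁) := by field_simp; ring
      _ ≤ Γ * 1 := by
        refine mul_le_mul_of_nonneg_left ?_ hΓ
        rw [div_le_one hK]
        have := h.le_K₁
        have := h.M_le_pow 2 (by norm_num)
        have : 0 ≤ M ^ 5 := by positivity
        linarith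
      _ = Γ := mul_one Γ
  have e4 : Γ ≤ M ^ 2 * Γ := le_mul_of_one_le_left hΓ (one_le_pow₀ hM)
  rw [hN, ← sub_add_sub_cancel _ (N (d.oldCoord ε N Q))]
  refine (norm_add_le _ _).trans ?_
  linarith

/-- The heart of the iteration. On the new subspace `W^c = 0` the old `γ` has been cancelled. What
survives is the increment of `N^c` between `(Q.1, 0)` and the old point, at most `Γ / 4`, and the
drift of `γ`, at most `Γ / 128`. -/
theorem norm_gam_newNonlinearity_le (h : d.StepHyp M K₁ ε ρ Γ N) {q : X} (hq : ‖q‖ < ρ - K₁ * ε) :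
    ‖gam (d.newNonlinearity ε N ρ (K₁ * ε)) q‖ ≤ Γ / 2 := by
  have hδ := h.δ_pos
  have hM := h.one_le_M
  have hΓ := h.Γ_nonneg
  have hε := h.ε_pos
  have hK := h.K₁_pos
  have hW : ((q, 0) : X × V) ∈ sumBall X V (ρ - K₁ * ε) := by simpa [sumBall] using hq
  obtain ⟨Q, hQ, hQ', hQW, hP, -, hN⟩ := h.exists_mixed_of_new_old hW
  have hQ'' := h.dom_subset hQ
  -- The new elliptic coordinate vanishes, so the old one is minus the shift `ε S γ`.
  have hb : ‖Q.2‖ ≤ M * ε * Γ := by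
    have := h.norm_newCoord_sub_snd_le (h.dom_fst_lt hQ)
    rw [hQW] at this
    simpa using this
  have hm : ((Q.1, 0) : X × V) ∈ sumBall X V (ρ - K₁ * ε / 8) := by
    have := norm_fst_lt hQ'
    change ‖Q.1‖ + ‖(0 : V)‖ < _
    rw [norm_zero]; linarith
  have e2 := h.norm_sub_nonlinearity_le (sumBall_mono (by linarith) hP) hm
  have e3 : ‖d.oldCoord ε N Q - (Q.1, 0)‖ ≤ M * ε * Γ := by
    refine max_le ((h.norm_oldCoord_sub_fst_le hQ'').trans h.εΓ_le) ?_
    simpa [oldCoord_snd] using hb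
  have e4 : 32 * M / (K₁ * ε) * ‖d.oldCoord ε N Q - (Q.1, 0)‖ ≤ Γ / 4 := by
    calc _ ≤ 32 * M / (K₁ * ε) * (M * ε * Γ) := by gcongr
      _ = Γ * (32 * M ^ 2 / K₁) := by field_simp
      _ ≤ Γ * (1 / 4) := by
        refine mul_le_mul_of_nonneg_left ?_ hΓ
        rw [div_le_div_iff₀ hK (by norm_num)]
        have := h.le_K₁
        have := h.M_le_pow 2 (by norm_num)
        have : 0 ≤ M ^ 5 := by positivity
        linarith
      _ = _ := by ring
  -- The subtracted `gam N Q.1` is `N^c` at `(Q.1, 0)`, so the two combine into an increment.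
  have e5 : gam (d.newNonlinearity ε N ρ (K₁ * ε)) q
      = (N (d.oldCoord ε N Q) - N (Q.1, 0)).2
        + (ε : ℂ) • d.S (fderiv ℂ (gam N) Q.1 (d.mixedVel ε N Q).1) := by
    simp only [gam, hN]
    rfl
  rw [e5]
  refine (norm_add_le _ _).trans ?_
  have := h.norm_S_fderiv_le hQ
  have := (norm_snd_le (N (d.oldCoord ε N Q) - N (Q.1, 0))).trans (e2.trans e4)
  linarith

end Step

end NFData.StepHyp

end
end KleinGordon

namespace KleinGordon
noncomputable section

/-! ### The transformation conjugates the systems -/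

section RankOne

variable {E : Type*} [NormedAddCommGroup E] [NormedSpace ℂ E]

/-- The inverse of a rank one perturbation of the identity. -/
def rankOneEquiv (l : E →L[ℂ] ℂ) (e : E) (h : 1 - l e ≠ 0) : E ≃L[ℂ] E :=
  ContinuousLinearEquiv.equivOfInverse (ContinuousLinearMap.id ℂ E - l.smulRight e)
    (ContinuousLinearMap.id ℂ E + ((1 - l e)⁻¹ • l).smulRight e)
    (fun v => by
      have : (1 - l e)⁻¹ * (1 - l e) = 1 := inv_mul_cancel₀ h
      simp only [add_apply, sub_apply, ContinuousLinearMap.id_apply,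
        ContinuousLinearMap.smulRight_apply, smul_apply, map_sub, map_smul, smul_eq_mul]
      match_scalars
      · ring
      · linear_combination l v * this)
    (fun v => by
      have : (1 - l e)⁻¹ * (1 - l e) = 1 := inv_mul_cancel₀ h
      simp only [add_apply, sub_apply, ContinuousLinearMap.id_apply,
        ContinuousLinearMap.smulRight_apply, smul_apply, map_add, map_smul, smul_eq_mul]
      match_scalars
      · ring
      · linear_combination l v * this)

theorem rankOneEquiv_symm_apply (l : E →L[ℂ] ℂ) (e : E) (h : 1 - l e ≠ 0) (v : E) :
    (rankOneEquiv l e h).symm v = v + (l v * (1 - l e)⁻¹) • e := by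
  rw [mul_comm]; rfl

end RankOne

namespace NFData.StepHyp

set_option linter.unusedSectionVars false

open scoped ContDiff Topology

variable {X V U : Type*} [NormedAddCommGroup X] [NormedSpace ℂ X] [NormedAddCommGroup V]
  [NormedSpace ℂ V] [NormedAddCommGroup U] [NormedSpace ℂ U] {d : NFData X V U}
  {M K₁ ε ρ Γ : ℝ} {N : X × V → X × V} [CompleteSpace X] [CompleteSpace V] [CompleteSpace U]
  [Nontrivial X] [NormedSpace ℝ X] [NormedSpace ℝ V] [NormedSpace ℝ U]
  [IsScalarTower ℝ ℂ X] [IsScalarTower ℝ ℂ V] [IsScalarTower ℝ ℂ U]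

theorem hasStrictFDerivAt_lam (h : d.StepHyp M K₁ ε ρ Γ N) (e : X) {Q : X × V}
    (hQ : ‖Q.1‖ < ρ) :
    HasStrictFDerivAt (fun w => (ε : ℂ) ^ 2 * d.lam ε N e w) (d.dlam ε N e Q) (d.hat Q) :=
  ((h.contDiffAt_lam e (Q := d.hat Q) hQ).hasStrictFDerivAt (by simp)).const_smul ((ε : ℂ) ^ 2)

/-- The velocity of the mixed coordinates along a solution. -/
theorem hasDerivWithinAt_mixed (h : d.StepHyp M K₁ ε ρ Γ N) {I : Set ℝ} {u Q : ℝ → X × V} {t : ℝ}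
    (hQc : ContinuousWithinAt Q I t) (hQ : Q t ∈ dom X V ρ (K₁ * ε))
    (hu : ∀ s ∈ I, d.oldCoord ε N (Q s) = u s) (ht : t ∈ I)
    (hd : HasDerivWithinAt (fun s => d.hat (u s)) (d.vel ε N (u t)) I t) :
    HasDerivWithinAt (fun s => d.hat (Q s)) (d.mixedVel ε N (Q t)) I t := by
  set l := d.dlam ε N d.e₁ (Q t) with hl
  have hne : 1 - l (d.e₂, 0) ≠ 0 := h.one_sub_ne_zero hQ
  -- `P` is `oldCoord` read in the weaker space. Its derivative is a rank one perturbation of the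
  -- identity, and its local inverse recovers `hat (Q s)` from `hat (u s)`, the only curve known to
  -- be differentiable.
  let P : X × U → X × U := fun w => w - ((ε : ℂ) ^ 2 * d.lam ε N d.e₁ w) • (d.e₂, (0 : U))
  have hP : HasStrictFDerivAt P (rankOneEquiv l (d.e₂, 0) hne : X × U →L[ℂ] X × U)
      (d.hat (Q t)) := by
    have := (hasStrictFDerivAt_id (𝕜 := ℂ) (d.hat (Q t))).sub
      ((h.hasStrictFDerivAt_lam d.e₁ (h.dom_fst_lt hQ)).smul_const ((d.e₂, 0) : X × U))
    exact this
  have hPu : ∀ s ∈ I, P (d.hat (Q s)) = d.hat (u s) := by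
    intro s hs
    rw [← hu s hs]
    simp [P, hat, oldCoord]
  have hcont : ContinuousWithinAt (fun s => d.hat (Q s)) I t :=
    (contDiffAt_hat (d := d) (Q t)).continuousAt.comp_continuousWithinAt hQc
  have hev : ∀ᶠ s in 𝓝[I] t, d.hat (Q s) = HasStrictFDerivAt.localInverse P _ _ hP (d.hat (u s)) := by
    filter_upwards [hcont.eventually hP.eventually_left_inverse, self_mem_nhdsWithin] with s hs hs'
    rw [← hPu s hs', hs]
  have hL := hP.to_localInverse.hasFDerivAt.restrictScalars ℝ
  rw [hPu t ht] at hL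
  have key := hL.comp_hasDerivWithinAt t hd
  have e : ((rankOneEquiv l (d.e₂, 0) hne).symm : X × U →L[ℂ] X × U) (d.vel ε N (u t))
      = d.mixedVel ε N (Q t) := by
    rw [← hu t ht]
    exact rankOneEquiv_symm_apply l _ hne _
  have key' := key.congr_of_eventuallyEq hev (hev.self_of_nhdsWithin ht)
  rw [← e]
  exact key'

theorem newNonlinearity_newCoord (h : d.StepHyp M K₁ ε ρ Γ N) {Q : X × V}
    (hQ : Q ∈ dom X V ρ (K₁ * ε)) :
    d.newNonlinearity ε N ρ (K₁ * ε) (d.newCoord ε N Q) = d.mixedNonlinearity ε N Q := by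
  have hex : ∃ a ∈ dom X V ρ (K₁ * ε), d.newCoord ε N a = d.newCoord ε N Q := ⟨Q, hQ, rfl⟩
  simp only [newNonlinearity]
  rw [h.newCoord_inverse.1 (Function.invFunOn_mem hex) hQ (Function.invFunOn_eq hex)]

theorem trans_oldCoord (h : d.StepHyp M K₁ ε ρ Γ N) {Q : X × V}
    (hQ : Q ∈ dom X V ρ (K₁ * ε)) :
    d.trans ε N ρ (K₁ * ε) (d.oldCoord ε N Q) = d.newCoord ε N Q := by
  have hex : ∃ a ∈ dom X V ρ (K₁ * ε), d.oldCoord ε N a = d.oldCoord ε N Q := ⟨Q, hQ, rfl⟩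
  simp only [trans]
  rw [h.oldCoord_inverse.1 (Function.invFunOn_mem hex) hQ (Function.invFunOn_eq hex)]

/-- The transformation maps solutions to solutions of the transformed system. -/
theorem hasDerivWithinAt_trans (h : d.StepHyp M K₁ ε ρ Γ N) {I : Set ℝ} {u : ℝ → X × V} {t : ℝ}
    (hu : ∀ s ∈ I, u s ∈ sumBall X V (ρ - K₁ * ε / 2)) (ht : t ∈ I)
    (hc : ContinuousWithinAt u I t)
    (hd : HasDerivWithinAt (fun s => d.hat (u s)) (d.vel ε N (u t)) I t) :
    HasDerivWithinAt (fun s => d.hat (d.trans ε N ρ (K₁ * ε) (u s)))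
      (d.vel ε (d.newNonlinearity ε N ρ (K₁ * ε)) (d.trans ε N ρ (K₁ * ε) (u t))) I t := by
  have hδ := h.δ_pos
  have hε : (ε : ℂ) ≠ 0 := by exact_mod_cast h.ε_pos.ne'
  set Q : ℝ → X × V := fun s => Function.invFunOn (d.oldCoord ε N) (dom X V ρ (K₁ * ε)) (u s)
  have hQ : ∀ s ∈ I, Q s ∈ dom X V ρ (K₁ * ε) ∧ d.oldCoord ε N (Q s) = u s := by
    intro s hs
    obtain ⟨q, hq, -, h1, h2⟩ := h.exists_mixed_of_old (by linarith) (hu s hs)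
    have : Q s = q := h2
    rw [this]; exact ⟨hq, h1⟩
  have hQc : ContinuousWithinAt Q I t := by
    have := (h.oldCoord_inverse.2.1 (Q t) (hQ t ht).1).continuousAt
    rw [(hQ t ht).2] at this
    exact this.comp_continuousWithinAt hc
  have hm := h.hasDerivWithinAt_mixed hQc (hQ t ht).1 (fun s hs => (hQ s hs).2) ht hd
  have hq := h.dom_fst_lt (hQ t ht).1
  have hg : HasFDerivAt (fun w : X × U => d.inc (d.S (gam N w.1)))
      (d.inc ∘L d.S ∘L (fderiv ℂ (gam N) (Q t).1) ∘L ContinuousLinearMap.fst ℂ X U)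
      (d.hat (Q t)) := by
    have h1 : HasFDerivAt (gam N) (fderiv ℂ (gam N) (Q t).1) (d.hat (Q t)).1 :=
      ((h.contDiffAt_gam hq).differentiableAt (by simp)).hasFDerivAt
    exact d.inc.hasFDerivAt.comp _ (d.S.hasFDerivAt.comp _ (h1.comp (d.hat (Q t)) hasFDerivAt_fst))
  have hR := ((hasFDerivAt_id (𝕜 := ℂ) (d.hat (Q t))).sub
      (((h.hasStrictFDerivAt_lam d.e₂ hq).hasFDerivAt).smul_const ((d.e₁, 0) : X × U))).add
      ((hasFDerivAt_const (0 : X) (d.hat (Q t))).prodMk (hg.const_smul (ε : ℂ)))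
  have key := (hR.restrictScalars ℝ).comp_hasDerivWithinAt t hm
  have e1 : ∀ s ∈ I, d.hat (d.trans ε N ρ (K₁ * ε) (u s))
      = d.hat (Q s) - ((ε : ℂ) ^ 2 * d.lam ε N d.e₂ (d.hat (Q s))) • ((d.e₁, 0) : X × U)
        + (0, (ε : ℂ) • d.inc (d.S (gam N (d.hat (Q s)).1))) := by
    intro s hs
    rw [← (hQ s hs).2, h.trans_oldCoord (hQ s hs).1]
    simp [newCoord, hat, -Complex.coe_smul]
  have e2 : d.trans ε N ρ (K₁ * ε) (u t) = d.newCoord ε N (Q t) := by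
    rw [← (hQ t ht).2, h.trans_oldCoord (hQ t ht).1]
  rw [e2]
  refine (key.congr_of_mem e1 ht).congr_deriv ?_
  simp only [vel, h.newNonlinearity_newCoord (hQ t ht).1]
  -- The shift `ε S γ` fed into `ε⁻¹ J` produces exactly `γ`. This is the term removed in
  -- `mixedNonlinearity`.
  have hJ : (ε : ℂ)⁻¹ • d.J ((ε : ℂ) • d.S (gam N (Q t).1)) = d.inc (gam N (Q t).1) := by
    rw [map_smul, smul_smul, inv_mul_cancel₀ hε, one_smul, d.J_S]
  have e3 : (d.newCoord ε N (Q t)).2 = (Q t).2 + (ε : ℂ) • d.S (gam N (Q t).1) := by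
    simp [newCoord]
  refine Prod.ext ?_ ?_
  · simp [mixedNonlinearity]
  · rw [e3, map_add, smul_add, hJ]
    simp [mixedNonlinearity, mixedVel, vel, oldCoord_snd, -Complex.coe_smul]
    abel

/-- At the origin `γ` vanishes and with it the second argument of the pairing, although `Dγ` need
not vanish; the velocity vanishes as well, so every correction does. -/
theorem map_zero' (h : d.StepHyp M K₁ ε ρ Γ N) (hρ : K₁ * ε < ρ) (h0 : N 0 = 0) :
    d.trans ε N ρ (K₁ * ε) 0 = 0 ∧ d.newNonlinearity ε N ρ (K₁ * ε) 0 = 0 := by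
  have hδ := h.δ_pos
  have hg : gam N 0 = 0 := by change (N 0).2 = 0; rw [h0]; rfl
  have hl : ∀ e, d.lam ε N e (d.hat 0) = 0 := by
    intro e; simp [lam, hat, hg]
  have hP : d.oldCoord ε N 0 = 0 := by simp [oldCoord, hl]
  have hR : d.newCoord ε N 0 = 0 := by simp [newCoord, hl, hg]
  have hv : d.vel ε N 0 = 0 := by simp [vel, h0]
  have hm : d.mixedVel ε N 0 = 0 := by simp [mixedVel, hP, hv]
  have hn : d.mixedNonlinearity ε N 0 = 0 := by
    simp [mixedNonlinearity, hP, hR, hm, h0, hg]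
  have hQ : (0 : X × V) ∈ dom X V ρ (K₁ * ε) := by
    simp only [dom, sumBall, mem_ofPred_eq, Prod.fst_zero, Prod.snd_zero, norm_zero]
    linarith
  constructor
  · have := h.trans_oldCoord hQ
    rwa [hP, hR] at this
  · have := h.newNonlinearity_newCoord hQ
    rwa [hR, hn] at this

end NFData.StepHyp

/-! ### Conjugations -/

/-- Complex conjugations that commute with the constant operators of a normal form step. -/
structure NFData.Conj {X V U : Type*} [NormedAddCommGroup X] [NormedSpace ℂ X]
    [NormedAddCommGroup V] [NormedSpace ℂ V] [NormedAddCommGroup U] [NormedSpace ℂ U]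
    [NormedSpace ℝ X] [NormedSpace ℝ V] [NormedSpace ℝ U] (d : NFData X V U) where
  cX : X →L[ℝ] X
  cV : V →L[ℝ] V
  cU : U →L[ℝ] U
  smul_X : ∀ (a : ℂ) x, cX (a • x) = star a • cX x
  smul_V : ∀ (a : ℂ) x, cV (a • x) = star a • cV x
  smul_U : ∀ (a : ℂ) x, cU (a • x) = star a • cU x
  norm_X : ∀ x, ‖cX x‖ = ‖x‖
  norm_V : ∀ x, ‖cV x‖ = ‖x‖
  A : ∀ x, cX (d.A x) = d.A (cX x)
  J : ∀ v, cU (d.J v) = d.J (cV v)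
  inc : ∀ v, cU (d.inc v) = d.inc (cV v)
  S : ∀ v, cV (d.S v) = d.S (cV v)
  S₁ : ∀ v, cV (d.S₁ v) = d.S₁ (cV v)
  b : ∀ v w, d.b (cV v) (cU w) = star (d.b v w)
  e₁ : cX d.e₁ = d.e₁
  e₂ : cX d.e₂ = d.e₂

/-- The derivative of a map that commutes with conjugations. -/
theorem fderiv_of_equivariant {E F : Type*} [NormedAddCommGroup E] [NormedSpace ℂ E]
    [NormedAddCommGroup F] [NormedSpace ℂ F] [NormedSpace ℝ E] [NormedSpace ℝ F]
    [IsScalarTower ℝ ℂ E] [IsScalarTower ℝ ℂ F] {f : E → F} (c : E →L[ℝ] E) (c' : F →L[ℝ] F)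
    {x : E} (h : DifferentiableAt ℂ f x) (h' : DifferentiableAt ℂ f (c x))
    (hc : ∀ᶠ y in nhds x, f (c y) = c' (f y)) (v : E) :
    fderiv ℂ f (c x) (c v) = c' (fderiv ℂ f x v) := by
  have h1 := (h'.hasFDerivAt.restrictScalars ℝ).comp x c.hasFDerivAt
  have h2 := c'.hasFDerivAt.comp x (h.hasFDerivAt.restrictScalars ℝ)
  have h3 := h2.congr_of_eventuallyEq (f₁ := f ∘ c) hc
  have := congrArg (fun T : E →L[ℝ] F => T v) (h1.unique h3)
  exact this

namespace NFData.Conj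

set_option linter.unusedSectionVars false

open scoped ContDiff Topology

variable {X V U : Type*} [NormedAddCommGroup X] [NormedSpace ℂ X] [NormedAddCommGroup V]
  [NormedSpace ℂ V] [NormedAddCommGroup U] [NormedSpace ℂ U] {d : NFData X V U}
  {M K₁ ε ρ Γ : ℝ} {N : X × V → X × V} [CompleteSpace X] [CompleteSpace V] [CompleteSpace U]
  [Nontrivial X] [NormedSpace ℝ X] [NormedSpace ℝ V] [NormedSpace ℝ U]
  [IsScalarTower ℝ ℂ X] [IsScalarTower ℝ ℂ V] [IsScalarTower ℝ ℂ U] (c : d.Conj)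

/-- The conjugation on the phase space. -/
def conj : X × V →L[ℝ] X × V := c.cX.prodMap c.cV

def conjHat : X × U →L[ℝ] X × U := c.cX.prodMap c.cU

theorem conj_mem {ρ : ℝ} {Z : X × V} (hZ : Z ∈ sumBall X V ρ) : c.conj Z ∈ sumBall X V ρ := by
  change ‖c.cX Z.1‖ + ‖c.cV Z.2‖ < ρ
  rw [c.norm_X, c.norm_V]; exact hZ

variable (h : d.StepHyp M K₁ ε ρ Γ N) (hN : ∀ Z ∈ sumBall X V ρ, N (c.conj Z) = c.conj (N Z))

include hN in
theorem gam_conj {q : X} (hq : ‖q‖ < ρ) : gam N (c.cX q) = c.cV (gam N q) := by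
  have := hN (q, 0) (by simpa [sumBall] using hq)
  have e : c.conj (q, (0 : V)) = (c.cX q, 0) := by simp [conj]
  rw [e] at this
  simp only [gam, this]
  rfl

include h hN in
theorem fderiv_gam_conj {q : X} (hq : ‖q‖ < ρ) (v : X) :
    fderiv ℂ (gam N) (c.cX q) (c.cX v) = c.cV (fderiv ℂ (gam N) q v) := by
  refine fderiv_of_equivariant c.cX c.cV ((h.contDiffAt_gam hq).differentiableAt (by simp))
    ((h.contDiffAt_gam (by rwa [c.norm_X])).differentiableAt (by simp)) ?_ v
  filter_upwards [(isOpen_lt continuous_norm continuous_const).mem_nhds hq] with y hy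
    using c.gam_conj hN hy

theorem ofReal_smul_V (v : V) : c.cV ((ε : ℂ) • v) = (ε : ℂ) • c.cV v := by
  rw [c.smul_V]; simp

theorem ofReal_smul_U (v : U) : c.cU ((ε : ℂ) • v) = (ε : ℂ) • c.cU v := by
  rw [c.smul_U]; simp

include h hN in
theorem lam_conj {e : X} (he : c.cX e = e) {Q : X × U} (hQ : ‖Q.1‖ < ρ) :
    d.lam ε N e (c.conjHat Q) = star (d.lam ε N e Q) := by
  have q1 : (c.conjHat Q).1 = c.cX Q.1 := rfl
  have q2 : (c.conjHat Q).2 = c.cU Q.2 := rfl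
  simp only [lam, q1, q2]
  have h1 := c.fderiv_gam_conj h hN hQ e
  rw [he] at h1
  rw [h1, c.gam_conj hN hQ, ← c.S₁, ← c.inc, ← c.ofReal_smul_U, ← map_add, c.b]

include h hN in
theorem dlam_conj {e : X} (he : c.cX e = e) {Q : X × V} (hQ : ‖Q.1‖ < ρ) (v : X × U) :
    d.dlam ε N e (c.conj Q) (c.conjHat v) = star (d.dlam ε N e Q v) := by
  have e1 : d.hat (c.conj Q) = c.conjHat (d.hat Q) := by
    refine Prod.ext rfl ?_
    exact (c.inc Q.2).symm
  have hQ' : ‖(d.hat Q).1‖ < ρ := hQ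
  have := fderiv_of_equivariant (f := d.lam ε N e) c.conjHat (Complex.conjCLE : ℂ →L[ℝ] ℂ)
    (x := d.hat Q) ((h.contDiffAt_lam e hQ').differentiableAt (by simp))
    ((h.contDiffAt_lam e (by change ‖c.cX Q.1‖ < ρ; rwa [c.norm_X])).differentiableAt (by simp))
    (by
      filter_upwards [(isOpen_lt (continuous_fst.norm) continuous_const).mem_nhds hQ'] with y hy
      rw [c.lam_conj h hN he hy]; rfl) v
  simp only [dlam, smul_apply, e1, this, smul_eq_mul, star_mul']
  simp

include h hN in
theorem oldCoord_conj {Q : X × V} (hQ : ‖Q.1‖ < ρ) :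
    d.oldCoord ε N (c.conj Q) = c.conj (d.oldCoord ε N Q) := by
  have e1 : d.hat (c.conj Q) = c.conjHat (d.hat Q) := Prod.ext rfl (c.inc Q.2).symm
  have hQ' : ‖(d.hat Q).1‖ < ρ := hQ
  simp only [oldCoord, e1, c.lam_conj h hN c.e₁ hQ']
  refine Prod.ext ?_ ?_
  · simp [conj, c.smul_X, c.e₂]
  · simp [conj]

include h hN in
theorem newCoord_conj {Q : X × V} (hQ : ‖Q.1‖ < ρ) :
    d.newCoord ε N (c.conj Q) = c.conj (d.newCoord ε N Q) := by
  have e1 : d.hat (c.conj Q) = c.conjHat (d.hat Q) := Prod.ext rfl (c.inc Q.2).symm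
  have hQ' : ‖(d.hat Q).1‖ < ρ := hQ
  have e2 : (c.conj Q).1 = c.cX Q.1 := rfl
  simp only [newCoord, e1, c.lam_conj h hN c.e₂ hQ', e2, c.gam_conj hN hQ]
  refine Prod.ext ?_ ?_
  · simp [conj, c.smul_X, c.e₁]
  · simp [conj, c.S, c.ofReal_smul_V, -Complex.coe_smul]

include hN in
theorem vel_conj {Z : X × V} (hZ : Z ∈ sumBall X V ρ) :
    d.vel ε N (c.conj Z) = c.conjHat (d.vel ε N Z) := by
  simp only [vel, hN Z hZ]
  refine Prod.ext ?_ ?_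
  · simp [conj, conjHat, c.A]
  · simp [conj, conjHat, c.J, c.inc, c.smul_U]

include h hN in
theorem mixedVel_conj {Q : X × V} (hQ : Q ∈ dom X V ρ (K₁ * ε)) :
    d.mixedVel ε N (c.conj Q) = c.conjHat (d.mixedVel ε N Q) := by
  have hq := h.dom_fst_lt hQ
  have hP : d.oldCoord ε N Q ∈ sumBall X V ρ :=
    h.oldCoord_mem hQ (by linarith [h.δ_pos]) (by linarith [h.δ_pos])
  have e1 : ((d.e₂, 0) : X × U) = c.conjHat (d.e₂, 0) := by simp [conjHat, c.e₂]
  have e2 : ∀ a : ℂ, c.conjHat (a • (d.e₂, 0)) = star a • ((d.e₂, 0) : X × U) := by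
    intro a; simp [conjHat, c.smul_X, c.e₂]
  simp only [mixedVel, c.oldCoord_conj h hN hq, c.vel_conj hN hP, c.dlam_conj h hN c.e₁ hq]
  have e3 := c.dlam_conj h hN c.e₁ hq (d.e₂, 0)
  rw [← e1] at e3
  rw [e3, map_add, e2]
  simp

include h hN in
theorem mixedNonlinearity_conj {Q : X × V} (hQ : Q ∈ dom X V ρ (K₁ * ε)) :
    d.mixedNonlinearity ε N (c.conj Q) = c.conj (d.mixedNonlinearity ε N Q) := by
  have hq := h.dom_fst_lt hQ
  have hP : d.oldCoord ε N Q ∈ sumBall X V ρ :=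
    h.oldCoord_mem hQ (by linarith [h.δ_pos]) (by linarith [h.δ_pos])
  have e2 : (c.conj Q).1 = c.cX Q.1 := rfl
  have e3 : (c.conjHat (d.mixedVel ε N Q)).1 = c.cX (d.mixedVel ε N Q).1 := rfl
  simp only [mixedNonlinearity, c.mixedVel_conj h hN hQ, c.dlam_conj h hN c.e₂ hq,
    c.newCoord_conj h hN hq, c.oldCoord_conj h hN hq, hN _ hP, e2, c.gam_conj hN hq, e3,
    c.fderiv_gam_conj h hN hq]
  refine Prod.ext ?_ ?_
  · simp [conj, c.smul_X, c.e₁, c.A]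
  · simp [conj, c.S, c.ofReal_smul_V, -Complex.coe_smul]

include h hN in
theorem newNonlinearity_conj {W : X × V} (hW : W ∈ sumBall X V (ρ - K₁ * ε)) :
    d.newNonlinearity ε N ρ (K₁ * ε) (c.conj W) = c.conj (d.newNonlinearity ε N ρ (K₁ * ε) W) := by
  obtain ⟨Q, hQ, -, rfl, -⟩ := h.exists_mixed_of_new (by linarith [h.δ_pos]) hW
  rw [← c.newCoord_conj h hN (h.dom_fst_lt hQ), h.newNonlinearity_newCoord hQ,
    h.newNonlinearity_newCoord (c.conj_mem hQ), c.mixedNonlinearity_conj h hN hQ]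

include h hN in
theorem trans_conj {Z : X × V} (hZ : Z ∈ sumBall X V (ρ - K₁ * ε / 4)) :
    d.trans ε N ρ (K₁ * ε) (c.conj Z) = c.conj (d.trans ε N ρ (K₁ * ε) Z) := by
  obtain ⟨Q, hQ, -, rfl, -⟩ := h.exists_mixed_of_old le_rfl hZ
  rw [← c.oldCoord_conj h hN (h.dom_fst_lt hQ), h.trans_oldCoord hQ,
    h.trans_oldCoord (c.conj_mem hQ), c.newCoord_conj h hN (h.dom_fst_lt hQ)]

include h hN in
-- A mixed point and its conjugate have the same real old point, and `oldCoord` is injective.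
theorem oldCoord_real {Q : X × V} (hQ : Q ∈ dom X V ρ (K₁ * ε))
    (hP : c.conj (d.oldCoord ε N Q) = d.oldCoord ε N Q) : c.conj Q = Q := by
  refine h.oldCoord_inverse.1 (c.conj_mem hQ) hQ ?_
  rw [c.oldCoord_conj h hN (h.dom_fst_lt hQ), hP]

include h hN in
theorem newCoord_real {Q : X × V} (hQ : Q ∈ dom X V ρ (K₁ * ε))
    (hP : c.conj (d.newCoord ε N Q) = d.newCoord ε N Q) : c.conj Q = Q := by
  refine h.newCoord_inverse.1 (c.conj_mem hQ) hQ ?_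
  rw [c.newCoord_conj h hN (h.dom_fst_lt hQ), hP]

end NFData.Conj

end
end KleinGordon

namespace KleinGordon
noncomputable section

/-! ### Complexification of the phase space -/

/-- The complexification of `X`. -/
abbrev CX : Type := EuclideanSpace ℂ (Fin 2)

/-- The complexification of `Y` and of `Y₁`. -/
abbrev CV : Type := lp (fun _ : ℕ => CX) 2

/-- The inclusion of the real plane. -/
def toCX : X →L[ℝ] CX :=
  LinearMap.toContinuousLinearMap
    { toFun := fun x => WithLp.toLp 2 fun i => (x i : ℂ)
      map_add' := fun x y => by ext i; simp
      map_smul' := fun a x => by ext i; simp }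

/-- The real part. -/
def reX : CX →L[ℝ] X :=
  LinearMap.toContinuousLinearMap
    { toFun := fun x => WithLp.toLp 2 fun i => (x i).re
      map_add' := fun x y => by ext i; simp
      map_smul' := fun a x => by ext i; simp }

/-- The complex conjugation. -/
def conjX : CX →L[ℝ] CX :=
  LinearMap.toContinuousLinearMap
    { toFun := fun x => WithLp.toLp 2 fun i => star (x i)
      map_add' := fun x y => by ext i; simp
      map_smul' := fun a x => by ext i; simp }

@[simp] theorem toCX_apply (x : X) (i : Fin 2) : toCX x i = (x i : ℂ) := rfl
@[simp] theorem reX_apply (x : CX) (i : Fin 2) : reX x i = (x i).re := rfl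
@[simp] theorem conjX_apply (x : CX) (i : Fin 2) : conjX x i = star (x i) := rfl

theorem norm_toCX (x : X) : ‖toCX x‖ = ‖x‖ := by
  simp [EuclideanSpace.norm_eq]

theorem norm_conjX (x : CX) : ‖conjX x‖ = ‖x‖ := by
  simp only [EuclideanSpace.norm_eq, conjX_apply, norm_star]

theorem norm_reX_le (x : CX) : ‖reX x‖ ≤ ‖x‖ := by
  simp only [EuclideanSpace.norm_eq, reX_apply, Real.norm_eq_abs]
  gcongr with i
  exact Complex.abs_re_le_norm _

theorem opNorm_toCX_le : ‖toCX‖ ≤ 1 :=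
  toCX.opNorm_le_bound zero_le_one fun x => by rw [norm_toCX, one_mul]

theorem opNorm_reX_le : ‖reX‖ ≤ 1 :=
  reX.opNorm_le_bound zero_le_one fun x => by rw [one_mul]; exact norm_reX_le x

theorem opNorm_conjX_le : ‖conjX‖ ≤ 1 :=
  conjX.opNorm_le_bound zero_le_one fun x => by rw [norm_conjX, one_mul]

def toCV : Y₁ →L[ℝ] CV := lp.mapCLM 2 (fun _ => toCX) zero_le_one fun _ => opNorm_toCX_le
def reV : CV →L[ℝ] Y₁ := lp.mapCLM 2 (fun _ => reX) zero_le_one fun _ => opNorm_reX_le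
def conjV : CV →L[ℝ] CV := lp.mapCLM 2 (fun _ => conjX) zero_le_one fun _ => opNorm_conjX_le

@[simp] theorem toCV_apply (y : Y₁) (n : ℕ) (i : Fin 2) : toCV y n i = (y n i : ℂ) := rfl
@[simp] theorem reV_apply (y : CV) (n : ℕ) (i : Fin 2) : reV y n i = (y n i).re := rfl
@[simp] theorem conjV_apply (y : CV) (n : ℕ) (i : Fin 2) : conjV y n i = star (y n i) := rfl

theorem CV_ext {x y : CV} (h : ∀ n i, x n i = y n i) : x = y := by
  ext n i; exact h n i

theorem Y_ext {x y : Y₁} (h : ∀ n i, x n i = y n i) : x = y := by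
  ext n i; exact h n i

theorem CX_ext {x y : CX} (h : ∀ i, x i = y i) : x = y := by
  ext i; exact h i

theorem reX_toCX (x : X) : reX (toCX x) = x := by ext i; simp
theorem reV_toCV (x : Y₁) : reV (toCV x) = x := Y_ext fun n i => by simp
theorem conjV_conjV (x : CV) : conjV (conjV x) = x := CV_ext fun n i => by simp
theorem conjX_toCX (x : X) : conjX (toCX x) = toCX x := by ext i; simp
theorem conjV_toCV (x : Y₁) : conjV (toCV x) = toCV x := CV_ext fun n i => by simp

theorem toCX_reX {x : CX} (h : conjX x = x) : toCX (reX x) = x := by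
  ext i
  have := congrArg (fun z : CX => z i) h
  exact Complex.conj_eq_iff_re.mp this

theorem toCV_reV {x : CV} (h : conjV x = x) : toCV (reV x) = x := by
  refine CV_ext fun n i => ?_
  have := congrArg (fun z : CV => z n i) h
  exact Complex.conj_eq_iff_re.mp this

theorem norm_reV_le (x : CV) : ‖reV x‖ ≤ ‖x‖ := by
  have := reV.le_of_opNorm_le (lp.norm_mapCLM_le 2 _ zero_le_one fun _ => opNorm_reX_le) x
  rwa [one_mul] at this

theorem norm_toCV (x : Y₁) : ‖toCV x‖ = ‖x‖ := by
  refine le_antisymm ?_ ?_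
  · have := toCV.le_of_opNorm_le (lp.norm_mapCLM_le 2 _ zero_le_one fun _ => opNorm_toCX_le) x
    rwa [one_mul] at this
  · simpa [reV_toCV] using norm_reV_le (toCV x)

theorem norm_conjV (x : CV) : ‖conjV x‖ = ‖x‖ := by
  have h : ∀ x : CV, ‖conjV x‖ ≤ ‖x‖ := fun x => by
    have := conjV.le_of_opNorm_le (lp.norm_mapCLM_le 2 _ zero_le_one fun _ => opNorm_conjX_le) x
    rwa [one_mul] at this
  refine le_antisymm (h x) ?_
  simpa [conjV_conjV] using h (conjV x)

theorem conjX_smul (a : ℂ) (x : CX) : conjX (a • x) = star a • conjX x := by ext i; simp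
theorem conjV_smul (a : ℂ) (x : CV) : conjV (a • x) = star a • conjV x :=
  CV_ext fun n i => by simp

/-! ### The operators -/

/-- The operator on `CV` that acts on the `n`-th mode by `a n • R`. -/
def diagOp (a : ℕ → ℝ) {C : ℝ} (ha : ∀ n, |a n| ≤ C) (R : CX →L[ℂ] CX) : CV →L[ℂ] CV :=
  lp.mapCLM 2 (fun n => (a n : ℂ) • R)
    (mul_nonneg ((abs_nonneg _).trans (ha 0)) (norm_nonneg R))
    (fun n => by
      rw [norm_smul, Complex.norm_real]
      exact mul_le_mul_of_nonneg_right (ha n) (norm_nonneg R))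

@[simp] theorem diagOp_apply (a : ℕ → ℝ) {C : ℝ} (ha : ∀ n, |a n| ≤ C) (R : CX →L[ℂ] CX) (y : CV)
    (n : ℕ) (i : Fin 2) : diagOp a ha R y n i = a n * R (y n) i := rfl

theorem two_le_waveNumber (n : ℕ) : 2 ≤ waveNumber n := by
  unfold waveNumber; linarith [(Nat.cast_nonneg n : (0 : ℝ) ≤ n)]

theorem symbolL_sq (n : ℕ) : symbolL n ^ 2 = waveNumber n ^ 2 - 1 := by
  rw [symbolL, Real.sq_sqrt]
  nlinarith [two_le_waveNumber n]

theorem symbolL_nonneg (n : ℕ) : 0 ≤ symbolL n := Real.sqrt_nonneg _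

theorem waveNumber_le_two_mul_symbolL (n : ℕ) : waveNumber n ≤ 2 * symbolL n := by
  nlinarith [two_le_waveNumber n, symbolL_sq n, symbolL_nonneg n]

theorem one_le_symbolL (n : ℕ) : 1 ≤ symbolL n := by
  linarith [waveNumber_le_two_mul_symbolL n, two_le_waveNumber n]

theorem inv_symbolL_le (n : ℕ) : |(symbolL n)⁻¹| ≤ 1 := by
  rw [abs_of_nonneg (inv_nonneg.mpr (symbolL_nonneg n))]
  exact inv_le_one_of_one_le₀ (one_le_symbolL n)

/-- The weight `(1 + k²) / (k √(k² - 1))` of the pairing in `H¹`. -/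
def pairWeight (n : ℕ) : ℝ := (1 + waveNumber n ^ 2) / (waveNumber n * symbolL n)

theorem pairWeight_le (n : ℕ) : |pairWeight n| ≤ 4 := by
  have h1 := two_le_waveNumber n
  have h2 := waveNumber_le_two_mul_symbolL n
  have h3 := symbolL_nonneg n
  have h4 := one_le_symbolL n
  have h5 : 0 < waveNumber n * symbolL n := by positivity
  rw [pairWeight, abs_of_nonneg (by positivity), div_le_iff₀ h5]
  nlinarith

/-- A complex `2 × 2` matrix as an operator. -/
def matOp (m : Matrix (Fin 2) (Fin 2) ℂ) : CX →L[ℂ] CX := Matrix.toEuclideanCLM (n := Fin 2) (𝕜 := ℂ) m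

theorem matOp_apply (m : Matrix (Fin 2) (Fin 2) ℂ) (x : CX) (i : Fin 2) :
    matOp m x i = m i 0 * x 0 + m i 1 * x 1 := by
  simp [matOp, Matrix.ofLp_toEuclideanCLM, Matrix.mulVec, dotProduct, Fin.sum_univ_two]

theorem A_apply (x : X) (i : Fin 2) : A x i = ![x 1, x 0] i := by
  fin_cases i <;>
  simp [A, Matrix.ofLp_toEuclideanCLM, Matrix.mulVec, dotProduct, Fin.sum_univ_two]

theorem rot_apply (x : X) (i : Fin 2) : rot x i = ![x 1, - x 0] i := by
  fin_cases i <;>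
  simp [rot, Matrix.ofLp_toEuclideanCLM, Matrix.mulVec, dotProduct, Fin.sum_univ_two]

theorem J_apply (y : Y₁) (n : ℕ) (i : Fin 2) :
    J y n i = symbolL n / waveNumber n * ![y n 1, - y n 0] i := by
  rw [← rot_apply]; rfl

theorem incl_apply (y : Y₁) (n : ℕ) (i : Fin 2) : incl y n i = (waveNumber n)⁻¹ * y n i := rfl

/-- The bilinear pairing in `H¹`. -/
def pairC : CV →L[ℂ] CV →L[ℂ] ℂ :=
  LinearMap.mkContinuous₂
    -- Conjugating the first argument turns the sesquilinear inner product into a complex bilinear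
    -- form, as holomorphy requires.
    (LinearMap.mk₂ ℂ (fun v w : CV => inner ℂ (conjV (diagOp pairWeight pairWeight_le
        (ContinuousLinearMap.id ℂ CX) v)) w)
      (fun v v' w => by rw [map_add, map_add]; exact inner_add_left (𝕜 := ℂ) _ _ _)
      (fun a v w => by
        rw [map_smul, conjV_smul]
        refine (inner_smul_left (𝕜 := ℂ) _ _ _).trans ?_
        simp)
      (fun v w w' => inner_add_right (𝕜 := ℂ) _ _ _)
      (fun a v w => inner_smul_right (𝕜 := ℂ) _ _ _))
    ‖diagOp pairWeight pairWeight_le (ContinuousLinearMap.id ℂ CX)‖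
    (fun v w => by
      refine (norm_inner_le_norm (𝕜 := ℂ) (conjV (diagOp pairWeight pairWeight_le
        (ContinuousLinearMap.id ℂ CX) v)) w).trans ?_
      rw [norm_conjV]
      exact mul_le_mul_of_nonneg_right (ContinuousLinearMap.le_opNorm _ _) (norm_nonneg _))

theorem pairC_apply (v w : CV) : pairC v w
    = inner ℂ (conjV (diagOp pairWeight pairWeight_le (ContinuousLinearMap.id ℂ CX) v)) w := rfl

theorem pairC_hasSum (v w : CV) :
    HasSum (fun n => (pairWeight n : ℂ) * (v n 0 * w n 0 + v n 1 * w n 1)) (pairC v w) := by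
  have := lp.hasSum_inner (𝕜 := ℂ)
    (conjV (diagOp pairWeight pairWeight_le (ContinuousLinearMap.id ℂ CX) v)) w
  rw [← pairC_apply] at this
  refine this.congr_fun ?_
  intro n
  simp [PiLp.inner_apply, Fin.sum_univ_two]
  ring

theorem pairC_conj (v w : CV) : pairC (conjV v) (conjV w) = star (pairC v w) := by
  refine (pairC_hasSum _ _).unique ?_
  have := (pairC_hasSum v w).star
  refine this.congr_fun ?_
  intro n
  simp

/-- The operators of the normal form steps of the Klein-Gordon system. -/
def nfData : NFData CX CV CV where
  A := matOp !![0, 1; 1, 0]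
  J := diagOp (fun n => symbolL n / waveNumber n) symbolL_div_le (matOp !![0, 1; -1, 0])
  inc := diagOp (fun n => (waveNumber n)⁻¹) inv_waveNumber_le (ContinuousLinearMap.id ℂ CX)
  S := diagOp (fun n => (symbolL n)⁻¹) inv_symbolL_le (matOp !![0, -1; 1, 0])
  -- The lower row of `S`: adding `ε S₁ γ` replaces `ζ₁` by `ζ₁⁺` and keeps `ζ`, the combination
  -- that occurs in the generating function.
  S₁ := diagOp (fun n => (symbolL n)⁻¹) inv_symbolL_le (matOp !![0, 0; 1, 0])
  b := pairC
  e₁ := EuclideanSpace.single 0 1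
  e₂ := EuclideanSpace.single 1 1
  J_S v := CV_ext fun n i => by
    have h1 := one_le_symbolL n
    have h2 := two_le_waveNumber n
    have h1' : (symbolL n : ℂ) ≠ 0 := by exact_mod_cast (by linarith : symbolL n ≠ 0)
    fin_cases i <;> simp [matOp_apply] <;> field_simp

def nfConj : nfData.Conj where
  cX := conjX
  cV := conjV
  cU := conjV
  smul_X := conjX_smul
  smul_V := conjV_smul
  smul_U := conjV_smul
  norm_X := norm_conjX
  norm_V := norm_conjV
  A x := by ext i; fin_cases i <;> simp [nfData, matOp_apply]
  J v := CV_ext fun n i => by fin_cases i <;> simp [nfData, matOp_apply]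
  inc v := CV_ext fun n i => by fin_cases i <;> simp [nfData]
  S v := CV_ext fun n i => by fin_cases i <;> simp [nfData, matOp_apply]
  S₁ v := CV_ext fun n i => by fin_cases i <;> simp [nfData, matOp_apply]
  b := pairC_conj
  e₁ := by ext i; fin_cases i <;> simp [nfData]
  e₂ := by ext i; fin_cases i <;> simp [nfData]

theorem exists_boundedBy : ∃ M, 1 ≤ M ∧ nfData.BoundedBy M := by
  refine ⟨1 + (‖nfData.A‖ + ‖nfData.J‖ + ‖nfData.inc‖ + ‖nfData.S‖ + ‖nfData.S₁‖ + ‖nfData.b‖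
    + ‖nfData.e₁‖ + ‖nfData.e₂‖), ?_, ?_⟩
  · have : 0 ≤ ‖nfData.A‖ + ‖nfData.J‖ + ‖nfData.inc‖ + ‖nfData.S‖ + ‖nfData.S₁‖ + ‖nfData.b‖
      + ‖nfData.e₁‖ + ‖nfData.e₂‖ := by positivity
    linarith
  · have h1 := norm_nonneg nfData.A
    have h2 := norm_nonneg nfData.J
    have h3 := norm_nonneg nfData.inc
    have h4 := norm_nonneg nfData.S
    have h5 := norm_nonneg nfData.S₁
    have h6 := norm_nonneg nfData.b
    have h7 := norm_nonneg nfData.e₁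
    have h8 := norm_nonneg nfData.e₂
    constructor <;> linarith

/-! ### Real maps from complex ones -/

def toC : Phase →L[ℝ] CX × CV := toCX.prodMap toCV
def reC : CX × CV →L[ℝ] Phase := reX.prodMap reV

/-- The real map given by a map of the complexification. -/
def realMap (N : CX × CV → CX × CV) (Z : Phase) : Phase := reC (N (toC Z))

theorem toC_mem {ρ : ℝ} {Z : Phase} : toC Z ∈ sumBall CX CV ρ ↔ Z ∈ phaseBall ρ := by
  change ‖toCX Z.1‖ + ‖toCV Z.2‖ < ρ ↔ _
  rw [norm_toCX, norm_toCV]; rfl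

theorem reC_toC (Z : Phase) : reC (toC Z) = Z := Prod.ext (reX_toCX _) (reV_toCV _)

theorem toC_reC {Z : CX × CV} (h : nfConj.conj Z = Z) : toC (reC Z) = Z :=
  Prod.ext (toCX_reX (congrArg Prod.fst h)) (toCV_reV (congrArg Prod.snd h))

theorem conj_toC (Z : Phase) : nfConj.conj (toC Z) = toC Z :=
  Prod.ext (conjX_toCX _) (conjV_toCV _)

theorem reC_mem {ρ : ℝ} {Z : CX × CV} (h : Z ∈ sumBall CX CV ρ) : reC Z ∈ phaseBall ρ := by
  have h' : ‖Z.1‖ + ‖Z.2‖ < ρ := h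
  change ‖reX Z.1‖ + ‖reV Z.2‖ < ρ
  linarith [norm_reX_le Z.1, norm_reV_le Z.2]

theorem norm_toC (Z : Phase) : ‖toC Z‖ = ‖Z‖ := by
  change max ‖toCX Z.1‖ ‖toCV Z.2‖ = _
  rw [norm_toCX, norm_toCV]; rfl

theorem norm_reC_le (Z : CX × CV) : ‖reC Z‖ ≤ ‖Z‖ :=
  max_le_max (norm_reX_le _) (norm_reV_le _)

end
end KleinGordon

namespace KleinGordon
noncomputable section

/-! ### The normal form step for the real system -/

open scoped ContDiff Topology

theorem matOp_incl (y : Y₁) : nfData.inc (toCV y) = toCV (incl y) :=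
  CV_ext fun n i => by simp [nfData, incl_apply]

theorem reV_inc (y : CV) : reV (nfData.inc y) = incl (reV y) :=
  Y_ext fun n i => by simp [nfData, incl_apply]

theorem nfData_J_toCV (y : Y₁) : nfData.J (toCV y) = toCV (J y) :=
  CV_ext fun n i => by fin_cases i <;> simp [nfData, J_apply, matOp_apply]

theorem reV_J (y : CV) : reV (nfData.J y) = J (reV y) :=
  Y_ext fun n i => by
    fin_cases i <;> simp [nfData, J_apply, matOp_apply, -Complex.ofReal_div]

theorem nfData_A_toCX (x : X) : nfData.A (toCX x) = toCX (A x) :=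
  CX_ext fun i => by fin_cases i <;> simp [nfData, A_apply, matOp_apply]

theorem reX_A (x : CX) : reX (nfData.A x) = A (reX x) := by
  ext i; fin_cases i <;> simp [nfData, A_apply, matOp_apply]

theorem toCV_ofReal_smul (a : ℝ) (y : Y₁) : toCV (a • y) = (a : ℂ) • toCV y :=
  CV_ext fun n i => by simp [-Complex.coe_smul]

theorem reV_ofReal_smul (a : ℝ) (y : CV) : reV ((a : ℂ) • y) = a • reV y :=
  Y_ext fun n i => by simp [-Complex.coe_smul]

theorem CV_add_smul_apply (x y : CV) (a : ℂ) (n : ℕ) (i : Fin 2) :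
    (x + a • y : CV) n i = x n i + a * y n i := rfl

/-- Two points `z`, `z'` occur because the first component of `w` comes from the old point and the
second from the new one. The factors `1 / k` in `w` are those of the inclusion into `Y`; with them
`pairWeight` reproduces the `H¹` weight `1 + k²`. -/
theorem pairC_eq_pairLinv (y z z' : Y₁) (w : CV) (h₀ : ∀ n, w n 0 = ((waveNumber n)⁻¹ * z n 0 : ℝ))
    (h₁ : ∀ n, w n 1 = ((waveNumber n)⁻¹ * z' n 1 : ℝ)) :
    pairC (toCV y) w = ((pairLinv y 1 z' 1 + pairLinv y 0 z 0 : ℝ) : ℂ) := by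
  -- Splitting the series needs summability of each component separately, obtained by pairing with
  -- the projection onto that component.
  have hs : ∀ i : Fin 2, ∀ v : CV, HasSum (fun n => (pairWeight n : ℂ) * (v n i * w n i))
      (pairC (diagOp (C := 1) (fun _ => 1) (fun _ => by simp) (matOp (Matrix.single i i 1)) v) w) := by
    intro i v
    refine (pairC_hasSum _ _).congr_fun fun n => ?_
    fin_cases i <;> simp [matOp_apply]
  have hsum : ∀ i, Summable fun n => (pairWeight n : ℂ) * (toCV y n i * w n i) :=
    fun i => (hs i (toCV y)).summable
  have e : ∀ (z : Y₁) (i : Fin 2), (∀ n, w n i = ((waveNumber n)⁻¹ * z n i : ℝ)) →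
      ∑' n, (pairWeight n : ℂ) * (toCV y n i * w n i) = (pairLinv y i z i : ℝ) := by
    intro z i hz
    rw [pairLinv, Complex.ofReal_mul, Complex.ofReal_tsum, ← tsum_mul_left]
    refine tsum_congr fun n => ?_
    rw [hz n, toCV_apply, pairWeight, coef, coef]
    have h1 := one_le_symbolL n
    have h2 := two_le_waveNumber n
    have h3 : symbolL n ≠ 0 := by linarith
    have h4 : waveNumber n ≠ 0 := by linarith
    have h5 := Real.sq_sqrt Real.pi_pos.le
    have h6 : √Real.pi ≠ 0 := (Real.sqrt_pos.mpr Real.pi_pos).ne'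
    simp only [← Complex.ofReal_mul]
    congr 1
    field_simp
    rw [h5]
  rw [(pairC_hasSum (toCV y) w).tsum_eq.symm, Complex.ofReal_add, ← e z' 1 h₁, ← e z 0 h₀,
    ← (hsum 1).tsum_add (hsum 0)]
  exact tsum_congr fun n => by ring

/-- Real solutions, seen in the complexified phase space. -/
theorem hasDerivWithinAt_toC {ε : ℝ} {N : Phase → Phase} {Nc : CX × CV → CX × CV} {I : Set ℝ}
    {u : ℝ → Phase} {t : ℝ} (hN : Nc (toC (u t)) = toC (N (u t)))
    (h : HasDerivWithinAt (fun s => (((u s).1, incl (u s).2) : X × Y))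
        (A (u t).1 + (N (u t)).1, ε⁻¹ • J (u t).2 + incl (N (u t)).2) I t) :
    HasDerivWithinAt (fun s => nfData.hat (toC (u s))) (nfData.vel ε Nc (toC (u t))) I t := by
  have h1 := ((toCX.prodMap toCV).hasFDerivAt (x := ((u t).1, incl (u t).2))).comp_hasDerivWithinAt
    t h
  have e : (fun s => nfData.hat (toC (u s)))
      = (toCX.prodMap toCV) ∘ fun s => (((u s).1, incl (u s).2) : X × Y) := by
    funext s
    exact Prod.ext rfl (matOp_incl _)
  rw [e]
  refine h1.congr_deriv ?_
  · refine Prod.ext ?_ ?_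
    · change toCX (A (u t).1 + (N (u t)).1) = nfData.A (toCX (u t).1) + (Nc (toC (u t))).1
      rw [hN, map_add, nfData_A_toCX]; rfl
    · change toCV (ε⁻¹ • J (u t).2 + incl (N (u t)).2)
        = (ε : ℂ)⁻¹ • nfData.J (toCV (u t).2) + nfData.inc (Nc (toC (u t))).2
      rw [hN, map_add, toCV_ofReal_smul, nfData_J_toCV, ← matOp_incl, Complex.ofReal_inv]; rfl

theorem hasDerivWithinAt_reC {ε : ℝ} {N : Phase → Phase} {Nc : CX × CV → CX × CV} {I : Set ℝ}
    {u : ℝ → CX × CV} {t : ℝ} (hN : reC (Nc (u t)) = N (reC (u t)))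
    (h : HasDerivWithinAt (fun s => nfData.hat (u s)) (nfData.vel ε Nc (u t)) I t) :
    HasDerivWithinAt (fun s => (((reC (u s)).1, incl (reC (u s)).2) : X × Y))
      (A (reC (u t)).1 + (N (reC (u t))).1, ε⁻¹ • J (reC (u t)).2 + incl (N (reC (u t))).2) I t := by
  have h1 := ((reX.prodMap reV).hasFDerivAt (x := nfData.hat (u t))).comp_hasDerivWithinAt t h
  have e : (fun s => (((reC (u s)).1, incl (reC (u s)).2) : X × Y))
      = (reX.prodMap reV) ∘ fun s => nfData.hat (u s) := by
    funext s
    exact Prod.ext rfl (reV_inc _).symm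
  rw [e]
  refine h1.congr_deriv ?_
  refine Prod.ext ?_ ?_
  · change reX (nfData.A (u t).1 + (Nc (u t)).1) = _
    rw [← hN, map_add, reX_A]; rfl
  · change reV ((ε : ℂ)⁻¹ • nfData.J (u t).2 + nfData.inc (Nc (u t)).2) = _
    rw [← hN, map_add, ← Complex.ofReal_inv, reV_ofReal_smul, reV_J, reV_inc]; rfl

theorem analyticAt_realMap {N : CX × CV → CX × CV} {Z : Phase} (h : ContDiffAt ℂ ω N (toC Z)) :
    AnalyticAt ℝ (realMap N) Z := by
  have h1 : AnalyticAt ℝ N (toC Z) := (h.analyticAt).restrictScalars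
  exact (reC.analyticAt _).comp (h1.comp (toC.analyticAt Z))

theorem realMap_toC {ρ : ℝ} {N : CX × CV → CX × CV}
    (hN : ∀ Z ∈ sumBall CX CV ρ, N (nfConj.conj Z) = nfConj.conj (N Z)) {Z : Phase}
    (hZ : Z ∈ phaseBall ρ) : toC (realMap N Z) = N (toC Z) := by
  refine toC_reC ?_
  have := hN _ (toC_mem.mpr hZ)
  rwa [conj_toC, eq_comm] at this

section Step

variable {M K₁ ε ρ Γ : ℝ} {Nc : CX × CV → CX × CV} {N : Phase → Phase}

/-- `γ` commutes with conjugation, so it and its derivative take real values at real arguments, and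
no information is lost in the real part. -/
theorem fderiv_realMap_gam (h : nfData.StepHyp M K₁ ε ρ Γ Nc)
    (hN : ∀ Z ∈ sumBall CX CV ρ, Nc (nfConj.conj Z) = nfConj.conj (Nc Z))
    (hNr : ∀ Z ∈ phaseBall ρ, N Z = realMap Nc Z) {q : X} (hq : ‖q‖ < ρ) (v : X) :
    toCV (N (q, 0)).2 = NFData.gam Nc (toCX q) ∧
    toCV (fderiv ℝ (fun v => (N (v, 0)).2) q v) = fderiv ℂ (NFData.gam Nc) (toCX q) (toCX v) := by
  have hm : ∀ q : X, ‖q‖ < ρ → ((q, 0) : Phase) ∈ phaseBall ρ := by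
    intro q hq; simpa [phaseBall] using hq
  have hq' : ‖toCX q‖ < ρ := by rwa [norm_toCX]
  have e0 : ∀ q : X, toC (q, 0) = (toCX q, 0) := fun q => Prod.ext rfl (map_zero toCV)
  have e1 : ∀ q : X, ‖q‖ < ρ → (N (q, 0)).2 = reV (NFData.gam Nc (toCX q)) := by
    intro q hq
    rw [hNr _ (hm q hq), realMap, e0]; rfl
  constructor
  · rw [e1 q hq, toCV_reV]
    have := nfConj.gam_conj hN hq'
    change NFData.gam Nc (conjX (toCX q)) = conjV _ at this
    rw [conjX_toCX] at this
    exact this.symm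
  · have h1 : HasFDerivAt (NFData.gam Nc) (fderiv ℂ (NFData.gam Nc) (toCX q)) (toCX q) :=
      ((h.contDiffAt_gam hq').differentiableAt (by simp)).hasFDerivAt
    have h2 := reV.hasFDerivAt.comp q ((h1.restrictScalars ℝ).comp q toCX.hasFDerivAt)
    have h3 : HasFDerivAt (fun v => (N (v, 0)).2) _ q := h2.congr_of_eventuallyEq (by
      filter_upwards [(isOpen_lt continuous_norm continuous_const).mem_nhds hq] with y hy
        using e1 y hy)
    rw [h3.fderiv]
    change toCV (reV (fderiv ℂ (NFData.gam Nc) (toCX q) (toCX v))) = _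
    refine toCV_reV ?_
    have := nfConj.fderiv_gam_conj h hN hq' (toCX v)
    change fderiv ℂ (NFData.gam Nc) (conjX (toCX q)) (conjX (toCX v)) = conjV _ at this
    rw [conjX_toCX, conjX_toCX] at this
    exact this.symm

theorem generatingRelation_realMap (h : nfData.StepHyp M K₁ ε ρ Γ Nc)
    (hN : ∀ Z ∈ sumBall CX CV ρ, Nc (nfConj.conj Z) = nfConj.conj (Nc Z))
    (hNr : ∀ Z ∈ phaseBall ρ, N Z = realMap Nc Z) {Z : Phase}
    (hZ : Z ∈ phaseBall (ρ - K₁ * ε / 4)) :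
    GeneratingRelation ε N Z (realMap (nfData.trans ε Nc ρ (K₁ * ε)) Z) := by
  obtain ⟨Q, hQ, -, hQZ, -⟩ := h.exists_mixed_of_old le_rfl (toC_mem.mpr hZ)
  have hQr : nfConj.conj Q = Q := nfConj.oldCoord_real h hN hQ (by rw [hQZ, conj_toC])
  have hW : toC (realMap (nfData.trans ε Nc ρ (K₁ * ε)) Z) = nfData.newCoord ε Nc Q := by
    rw [← h.trans_oldCoord hQ, hQZ]
    exact realMap_toC (fun Z hZ => nfConj.trans_conj h hN hZ) hZ
  set W := realMap (nfData.trans ε Nc ρ (K₁ * ε)) Z with hWdef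
  set q : X := !₂[Z.1 0, W.1 1] with hq
  have c0 := congrArg (fun z : CX × CV => z.1 0) hQZ
  have c1 := congrArg (fun z : CX × CV => z.1 1) hQZ
  have c2 : Q.2 = toCV Z.2 := by
    have := congrArg Prod.snd hQZ
    rwa [NFData.StepHyp.oldCoord_snd] at this
  have w0 := congrArg (fun z : CX × CV => z.1 0) hW
  have w1 := congrArg (fun z : CX × CV => z.1 1) hW
  have w2 : toCV W.2 = Q.2 + (ε : ℂ) • nfData.S (NFData.gam Nc Q.1) := by
    refine (congrArg (fun z : CX × CV => z.2) hW).trans ?_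
    simp [NFData.newCoord, -Complex.coe_smul]
  have t0 : (toC Z).1 = toCX Z.1 := rfl
  have t1 : (toC W).1 = toCX W.1 := rfl
  simp only [t0, t1, toCX_apply, NFData.oldCoord, NFData.newCoord] at c0 c1 w0 w1
  simp [nfData] at c0 w1
  -- `oldCoord` leaves the coordinate `0` unchanged and `newCoord` the coordinate `1`, so the
  -- hyperbolic part of `Q` is the mixed point `(z, z₁⁺)` of the generating relation.
  have hQq : Q.1 = toCX q := by
    refine CX_ext fun i => ?_
    fin_cases i
    · simpa [hq] using c0
    · simpa [hq] using w1.symm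
  have hqρ : ‖q‖ < ρ := by
    rw [← norm_toCX, ← hQq]; exact h.dom_fst_lt hQ
  have hg : toCV (N (q, 0)).2 = NFData.gam Nc Q.1 := by
    rw [hQq]; exact (fderiv_realMap_gam h hN hNr hqρ 0).1
  have hd : ∀ v, toCV (fderiv ℝ (fun v => (N (v, 0)).2) q v)
      = fderiv ℂ (NFData.gam Nc) Q.1 (toCX v) := by
    rw [hQq]; exact fun v => (fderiv_realMap_gam h hN hNr hqρ v).2
  have k : ∀ n i, W.2 n i = Z.2 n i + ε * ((symbolL n)⁻¹ *
      ![- (N (q, 0)).2 n 1, (N (q, 0)).2 n 0] i) := by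
    intro n i
    have := congrArg (fun z : CV => z n i) w2
    rw [c2, ← hg, CV_add_smul_apply] at this
    rw [← Complex.ofReal_inj]
    fin_cases i <;> simpa [nfData, matOp_apply, -Complex.coe_smul] using this
  have hl : ∀ i : Fin 2, nfData.lam ε Nc (toCX (EuclideanSpace.single i 1)) (nfData.hat Q)
      = ((pairLinv (fderiv ℝ (fun v => (N (v, 0)).2) q (EuclideanSpace.single i 1)) 1 W.2 1
        + pairLinv (fderiv ℝ (fun v => (N (v, 0)).2) q (EuclideanSpace.single i 1)) 0 Z.2 0 : ℝ) :
        ℂ) := by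
    intro i
    refine Eq.trans ?_ (pairC_eq_pairLinv _ Z.2 W.2 (nfData.inc Q.2 + (ε : ℂ) •
      nfData.inc (nfData.S₁ (NFData.gam Nc Q.1))) ?_ ?_)
    · rw [hd]; rfl
    · intro n
      rw [c2, ← hg, CV_add_smul_apply]
      simp [nfData, matOp_apply, -Complex.coe_smul]
    · intro n
      rw [c2, ← hg, k, CV_add_smul_apply]
      simp [nfData, matOp_apply, -Complex.coe_smul]
      ring
  have s1 : nfData.e₁ = toCX (EuclideanSpace.single 0 1) := by
    refine CX_ext fun i => ?_
    fin_cases i <;> simp [nfData]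
  have s2 : nfData.e₂ = toCX (EuclideanSpace.single 1 1) := by
    refine CX_ext fun i => ?_
    fin_cases i <;> simp [nfData]
  have hπ : √Real.pi ≠ 0 := (Real.sqrt_pos.mpr Real.pi_pos).ne'
  refine ⟨?_, ?_, ?_, ?_⟩
  · rw [s1, s2, hl] at w0
    rw [← Complex.ofReal_inj]
    simpa [hQq, hq] using w0
  · rw [s1, s2, hl] at c1
    rw [← Complex.ofReal_inj]
    simp [hQq, hq] at c1
    push_cast
    rw [← c1]
    ring
  · intro n
    have h2 := two_le_waveNumber n
    have h4 : waveNumber n ≠ 0 := by linarith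
    have h3 : symbolL n ≠ 0 := by linarith [one_le_symbolL n]
    change _ = _ - ε * (coef (N (q, 0)).2 1 n / symbolL n)
    simp only [coef, k n 0]
    simp
    field_simp
    ring
  · intro n
    have h2 := two_le_waveNumber n
    have h4 : waveNumber n ≠ 0 := by linarith
    have h3 : symbolL n ≠ 0 := by linarith [one_le_symbolL n]
    change _ = _ + ε * (coef (N (q, 0)).2 0 n / symbolL n)
    simp only [coef, k n 1]
    simp
    field_simp

theorem isNormalFormStep_realMap (h : nfData.StepHyp M K₁ ε ρ Γ Nc)
    (hN : ∀ Z ∈ sumBall CX CV ρ, Nc (nfConj.conj Z) = nfConj.conj (Nc Z))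
    (hNr : ∀ Z ∈ phaseBall ρ, N Z = realMap Nc Z) :
    IsNormalFormStep ε ρ (K₁ * ε) N (realMap (nfData.newNonlinearity ε Nc ρ (K₁ * ε)))
      (realMap (nfData.trans ε Nc ρ (K₁ * ε))) := by
  have hδ := h.δ_pos
  have mono : ∀ {a b : ℝ}, a ≤ b → phaseBall a ⊆ phaseBall b := fun hab Z hZ => lt_of_lt_of_le hZ hab
  have hopen : IsOpen (phaseBall ρ) := isOpen_sumBall X Y₁ ρ
  have hT : ∀ Z ∈ phaseBall (ρ - K₁ * ε / 2), toC (realMap (nfData.trans ε Nc ρ (K₁ * ε)) Z)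
      = nfData.trans ε Nc ρ (K₁ * ε) (toC Z) := fun Z hZ =>
    realMap_toC (fun Z hZ => nfConj.trans_conj h hN hZ) (mono (by linarith) hZ)
  have han : AnalyticOnNhd ℝ (realMap (nfData.trans ε Nc ρ (K₁ * ε)))
      (phaseBall (ρ - K₁ * ε / 2)) := fun Z hZ =>
    analyticAt_realMap (h.contDiffAt_trans (toC_mem.mpr (mono (by linarith) hZ)))
  constructor
  · intro Z hZ
    refine (analyticAt_realMap (h.smooth _ (toC_mem.mpr hZ))).congr ?_
    filter_upwards [hopen.mem_nhds hZ] with W hW using (hNr W hW).symm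
  · exact fun Z hZ => analyticAt_realMap (h.contDiffAt_newNonlinearity (toC_mem.mpr hZ))
  · exact han
  · intro Z hZ W hW e
    have := congrArg toC e
    rw [hT Z hZ, hT W hW] at this
    have := h.injOn_trans (toC_mem.mpr (mono (by linarith) hZ))
      (toC_mem.mpr (mono (by linarith) hW)) this
    rw [← reC_toC Z, this, reC_toC]
  · intro Z hZ
    have hd : HasFDerivAt (nfData.trans ε Nc ρ (K₁ * ε))
        (fderiv ℂ (nfData.trans ε Nc ρ (K₁ * ε)) (toC Z)) (toC Z) :=
      ((h.contDiffAt_trans (toC_mem.mpr (mono (by linarith) hZ))).differentiableAt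
        (by simp)).hasFDerivAt
    have hd' := reC.hasFDerivAt.comp Z ((hd.restrictScalars ℝ).comp Z toC.hasFDerivAt)
    set T : Phase →L[ℝ] Phase := reC ∘L
      ((fderiv ℂ (nfData.trans ε Nc ρ (K₁ * ε)) (toC Z)).restrictScalars ℝ) ∘L toC
    -- The complex derivative is within `1 / 2` of the identity; restriction to real vectors keeps
    -- this, and a Neumann series inverts the real derivative.
    have hn : ‖(1 : Phase →L[ℝ] Phase) - T‖ < 1 := by
      refine lt_of_le_of_lt (ContinuousLinearMap.opNorm_le_bound _ (by norm_num : (0 : ℝ) ≤ 1 / 2)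
        fun v => ?_) (by norm_num : (1 / 2 : ℝ) < 1)
      have e : (1 - T) v = - reC ((fderiv ℂ (nfData.trans ε Nc ρ (K₁ * ε)) (toC Z)
          - ContinuousLinearMap.id ℂ (CX × CV)) (toC v)) := by
        change v - reC (fderiv ℂ (nfData.trans ε Nc ρ (K₁ * ε)) (toC Z) (toC v))
          = - reC (fderiv ℂ (nfData.trans ε Nc ρ (K₁ * ε)) (toC Z) (toC v) - toC v)
        rw [map_sub, reC_toC, neg_sub]
      rw [e, norm_neg]
      refine (norm_reC_le _).trans ?_
      rw [← norm_toC v]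
      exact ContinuousLinearMap.le_of_opNorm_le _ (h.norm_fderiv_trans_sub_lt (toC_mem.mpr hZ)) _
    refine ⟨ContinuousLinearEquiv.ofUnit (Units.oneSub _ hn), ?_⟩
    have e : ((ContinuousLinearEquiv.ofUnit (Units.oneSub _ hn) : Phase ≃L[ℝ] Phase) :
        Phase →L[ℝ] Phase) = T := by
      change (1 : Phase →L[ℝ] Phase) - (1 - T) = T
      exact sub_sub_cancel _ _
    rw [e]
    exact hd'
  · intro Z hZ
    obtain ⟨n1, n2⟩ := h.norm_trans_sub_le (toC_mem.mpr (mono (by linarith) hZ))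
    have e : realMap (nfData.trans ε Nc ρ (K₁ * ε)) Z - Z
        = reC (nfData.trans ε Nc ρ (K₁ * ε) (toC Z) - toC Z) := by
      rw [map_sub, reC_toC]; rfl
    rw [e]
    refine reC_mem ?_
    change ‖(nfData.trans ε Nc ρ (K₁ * ε) (toC Z) - toC Z).1‖
      + ‖(nfData.trans ε Nc ρ (K₁ * ε) (toC Z) - toC Z).2‖ < _
    linarith
  · intro W hW
    obtain ⟨Q, hQ, -, hQW, hP, hPW, -⟩ := h.exists_mixed_of_new_old (toC_mem.mpr hW)
    have hQr : nfConj.conj Q = Q := nfConj.newCoord_real h hN hQ (by rw [hQW, conj_toC])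
    have hPr : nfConj.conj (nfData.oldCoord ε Nc Q) = nfData.oldCoord ε Nc Q := by
      rw [← nfConj.oldCoord_conj h hN (h.dom_fst_lt hQ), hQr]
    refine ⟨reC (nfData.oldCoord ε Nc Q), reC_mem hP, ?_⟩
    rw [realMap, toC_reC hPr, hPW, reC_toC]
  · exact fun Z hZ => generatingRelation_realMap h hN hNr (mono (by linarith) hZ)
  · intro I u _ hu hm
    refine ⟨fun t ht => ?_, fun t ht => ?_⟩
    · exact (han _ (hm t ht).1).continuousAt.comp_continuousWithinAt (hu.1 t ht)
    · have hNt : Nc (toC (u t)) = toC (N (u t)) := by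
        have : u t ∈ phaseBall ρ := mono (by linarith) (hm t ht).1
        rw [hNr _ this, realMap_toC hN this]
      have hd := hasDerivWithinAt_toC hNt (hu.2 t ht)
      have hc : ContinuousWithinAt (fun s => toC (u s)) I t :=
        toC.continuous.continuousAt.comp_continuousWithinAt (hu.1 t ht)
      have := h.hasDerivWithinAt_trans (fun s hs => toC_mem.mpr (hm s hs).1) ht hc hd
      refine hasDerivWithinAt_reC (u := fun s => nfData.trans ε Nc ρ (K₁ * ε) (toC (u s))) ?_ this
      rw [← hT _ (hm t ht).1, reC_toC]
      rfl

end Step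

end
end KleinGordon

namespace KleinGordon
noncomputable section

/-! ### The Klein-Gordon nonlinearity on the complexified phase space -/

open scoped ContDiff Topology

/-- Odd functions that are analytic and vanish to second order at the origin have a factor `u³`. -/
theorem exists_cubic_series {f : ℝ → ℝ} (hodd : ∀ u, f (-u) = -f u) (han : AnalyticAt ℝ f 0)
    (hf1 : deriv f 0 = 0) :
    ∃ (c : ℕ → ℝ) (R C : ℝ), 0 < R ∧ 0 < C ∧ (∀ n, |c n| * R ^ n ≤ C) ∧
      ∀ u, |u| < R → HasSum (fun n => c n * u ^ (n + 3)) (f u) := by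
  obtain ⟨p, hp⟩ := han
  have hp' := hp
  obtain ⟨r, hr⟩ := hp'
  obtain ⟨R, hR0, hRr⟩ := ENNReal.lt_iff_exists_nnreal_btwn.mp hr.r_pos
  have hRp : (R : ℝ≥0∞) < p.radius := hRr.trans_le hr.r_le
  obtain ⟨C, hC, hpC⟩ := p.norm_mul_pow_le_of_lt_radius hRp
  have hR : (0 : ℝ) < R := by exact_mod_cast hR0
  -- The odd part of the coefficient sequence still sums to the odd function `f`, and its even
  -- coefficients vanish by construction.
  let a : ℕ → ℝ := fun n => (p.coeff n - (-1) ^ n * p.coeff n) / 2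
  have ha : ∀ u : ℝ, |u| < R → HasSum (fun n => a n * u ^ n) (f u) := by
    have h1 : ∀ u : ℝ, |u| < R → HasSum (fun n => p.coeff n * u ^ n) (f u) := by
      intro u hu
      have hu' : u ∈ Metric.eball (0 : ℝ) r := by
        rw [Metric.mem_eball, edist_zero_right]
        refine lt_trans ?_ hRr
        rw [enorm_eq_nnnorm, ENNReal.coe_lt_coe, ← NNReal.coe_lt_coe]
        simpa using hu
      have := hr.hasSum hu'
      rw [zero_add] at this
      refine this.congr_fun fun n => ?_
      rw [p.apply_eq_pow_smul_coeff]
      simp [mul_comm]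
    intro u hu
    have h2 := ((h1 u hu).sub (h1 (-u) (by rwa [abs_neg]))).div_const 2
    rw [hodd, sub_neg_eq_add, add_self_div_two] at h2
    refine h2.congr_fun fun n => ?_
    simp only [a]
    rw [neg_pow u n]
    ring
  have ha0 : a 0 = 0 := by simp [a]
  have ha2 : a 2 = 0 := by simp [a]
  have ha1 : a 1 = 0 := by
    have : p.coeff 1 = 0 := by
      rw [← hf1, hp.deriv]
      rfl
    simp [a, this]
  have hab : ∀ n, |a n| * R ^ n ≤ C := by
    intro n
    have h1 : |a n| ≤ |p.coeff n| := by
      simp only [a]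
      rw [abs_div, abs_two, div_le_iff₀ (by norm_num)]
      refine (abs_sub _ _).trans ?_
      rw [abs_mul, abs_pow, abs_neg, abs_one, one_pow]
      linarith
    have h2 := hpC n
    rw [p.norm_apply_eq_norm_coef, Real.norm_eq_abs] at h2
    exact (mul_le_mul_of_nonneg_right h1 (by positivity)).trans h2
  refine ⟨fun n => a (n + 3), R, C / R ^ 3, hR, by positivity, fun n => ?_, fun u hu => ?_⟩
  · rw [le_div_iff₀ (by positivity)]
    have := hab (n + 3)
    rwa [pow_add, ← mul_assoc] at this
  · have := (hasSum_nat_add_iff' 3).mpr (ha u hu)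
    simpa [Finset.sum_range_succ, ha0, ha1, ha2] using this

/-- Bounded continuous functions on the line. -/
abbrev BC : Type := BoundedContinuousFunction ℝ ℂ

/-- The function `sin (k x)`. -/
def sinB (k : ℝ) : BC :=
  BoundedContinuousFunction.ofNormedAddCommGroup (fun x => ((Real.sin (k * x) : ℝ) : ℂ))
    (by fun_prop) 1 (fun x => by
      rw [Complex.norm_real]; exact Real.abs_sin_le_one _)

@[simp] theorem sinB_apply (k x : ℝ) : sinB k x = ((Real.sin (k * x) : ℝ) : ℂ) := rfl

theorem norm_sinB_le (k : ℝ) : ‖sinB k‖ ≤ 1 :=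
  BoundedContinuousFunction.norm_ofNormedAddCommGroup_le _ zero_le_one _

theorem summable_inv_waveNumber_sq : Summable fun n : ℕ => ((waveNumber n)⁻¹) ^ 2 := by
  have h := (Real.summable_one_div_nat_pow (p := 2)).mpr (by norm_num)
  have h2 := (summable_nat_add_iff 2).mpr h
  refine h2.congr fun n => ?_
  simp [waveNumber]

/-- The weights `(√π k)⁻¹` of the modes. -/
def modeWeight : lp (fun _ : ℕ => ℂ) 2 :=
  ⟨fun n => (((√Real.pi * waveNumber n)⁻¹ : ℝ) : ℂ), by
    refine memℓp_gen ?_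
    refine (summable_inv_waveNumber_sq.mul_left ((√Real.pi)⁻¹ ^ 2)).congr fun n => ?_
    rw [ENNReal.toReal_ofNat, Real.rpow_ofNat, Complex.norm_real, Real.norm_eq_abs, sq_abs, mul_inv,
      mul_pow]⟩

/-- Pairing the square summable weights with the square summable coordinates makes the sine series
converge absolutely in the sup norm: this is the embedding of `Y₁` into bounded continuous
functions. -/
def modeMap (n : ℕ) : ℂ →L[ℂ] CX →L[ℂ] BC :=
  ContinuousLinearMap.toSpanSingleton ℂ
    ((EuclideanSpace.proj 0 : CX →L[ℂ] ℂ).smulRight (sinB (waveNumber n)))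

theorem modeMap_apply (n : ℕ) (a : ℂ) (v : CX) :
    modeMap n a v = a • (v 0) • sinB (waveNumber n) := rfl

theorem norm_modeMap_le (n : ℕ) : ‖modeMap n‖ ≤ (1 : NNReal) := by
  rw [modeMap, ContinuousLinearMap.norm_toSpanSingleton]
  refine ContinuousLinearMap.opNorm_le_bound _ zero_le_one fun v => ?_
  rw [ContinuousLinearMap.smulRight_apply, norm_smul, NNReal.coe_one, one_mul]
  exact (mul_le_of_le_one_right (norm_nonneg _) (norm_sinB_le _)).trans (PiLp.norm_apply_le v 0)

/-- The function `w^h sin x + w^c(x)`. -/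
def profileC : CX × CV →L[ℂ] BC :=
  ((EuclideanSpace.proj 0 : CX →L[ℂ] ℂ).smulRight (sinB 1)).coprod
    (lp.dualPairing 2 2 modeMap norm_modeMap_le modeWeight)

theorem profileC_hasSum (Z : CX × CV) (x : ℝ) :
    HasSum (fun n => (((√Real.pi * waveNumber n)⁻¹ : ℝ) : ℂ) * (Z.2 n 0 *
      ((Real.sin (waveNumber n * x) : ℝ) : ℂ)))
      (profileC Z x - Z.1 0 * ((Real.sin x : ℝ) : ℂ)) := by
  have hs : Summable fun n => modeMap n (modeWeight n) (Z.2 n) :=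
    Summable.of_norm (by simpa using (lp.holder 1 modeMap norm_modeMap_le modeWeight Z.2).2.summable)
  have h := (BoundedContinuousFunction.evalCLM ℂ x).hasSum hs.hasSum
  have e : profileC Z = Z.1 0 • sinB 1 + ∑' n, modeMap n (modeWeight n) (Z.2 n) := rfl
  rw [e]
  simpa [modeMap_apply, modeWeight] using h

theorem profileC_toC (Z : Phase) (x : ℝ) : profileC (toC Z) x = (profile Z x : ℝ) := by
  have h := (profileC_hasSum (toC Z) x).tsum_eq
  rw [eq_sub_iff_add_eq] at h
  rw [← h, profile, Complex.ofReal_add, Complex.ofReal_tsum, add_comm]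
  congr 1
  · simp [toC]
  · refine tsum_congr fun n => ?_
    simp only [coef, toC]
    change _ * (((Z.2 n 0 : ℝ) : ℂ) * _) = _
    rw [← Complex.ofReal_mul, ← Complex.ofReal_mul]
    congr 1
    rw [div_eq_inv_mul]; ring

theorem profileC_conj (Z : CX × CV) : profileC (nfConj.conj Z) = star (profileC Z) := by
  ext x
  have h1 := profileC_hasSum (nfConj.conj Z) x
  have h2 := (profileC_hasSum Z x).star
  have h3 := h1.unique (h2.congr_fun fun n => by
    change _ * (star (Z.2 n 0) * _) = _
    simp [-Complex.ofReal_sin])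
  have e : (nfConj.conj Z).1 0 = star (Z.1 0) := rfl
  rw [e] at h3
  simpa [-Complex.ofReal_sin] using h3

section Cubic

variable {c : ℕ → ℝ} {R C : ℝ}

/-- The map `p ↦ p³ ∑ₙ cₙ (ε p)ⁿ`. -/
def cubic (c : ℕ → ℝ) (ε : ℝ) (p : BC) : BC :=
  p ^ 3 * FormalMultilinearSeries.ofScalarsSum (E := BC) (fun n => (c n : ℂ)) ((ε : ℂ) • p)

/-- Bounded continuous functions form a Banach algebra, so composition with a power series is itself
a convergent power series in that algebra. -/
theorem contDiffAt_cubic (hR : 0 < R) (hc : ∀ n, |c n| * R ^ n ≤ C) {ε : ℝ} {p : BC}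
    (hp : ‖(ε : ℂ) • p‖ < R) : ContDiffAt ℂ ω (cubic c ε) p := by
  let q := FormalMultilinearSeries.ofScalars BC fun n => (c n : ℂ)
  have hr : ((Real.toNNReal R : NNReal) : ℝ≥0∞) ≤ q.radius := by
    refine q.le_radius_of_bound C fun n => ?_
    rw [FormalMultilinearSeries.ofScalars_norm, Complex.norm_real, Real.coe_toNNReal R hR.le]
    exact hc n
  have hpos : 0 < q.radius := lt_of_lt_of_le (by
    rw [ENNReal.coe_pos, Real.toNNReal_pos]; exact hR) hr
  have h1 : AnalyticAt ℂ q.sum ((ε : ℂ) • p) := by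
    refine (q.hasFPowerSeriesOnBall hpos).analyticAt_of_mem ?_
    rw [Metric.mem_eball, edist_zero_right]
    refine lt_of_lt_of_le ?_ hr
    rw [enorm_eq_nnnorm, ENNReal.coe_lt_coe, ← NNReal.coe_lt_coe, Real.coe_toNNReal R hR.le]
    exact hp
  have h2 : ContDiffAt ℂ ω (fun p : BC => q.sum ((ε : ℂ) • p)) p :=
    (h1.contDiffAt (n := ω)).comp p (contDiffAt_id.const_smul _)
  exact (contDiffAt_id.pow 3).mul h2

theorem summable_scalars (hc : ∀ n, |c n| * R ^ n ≤ C) {x : ℝ}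
    (hx : 0 ≤ x) (hxR : 2 * x ≤ R) :
    Summable (fun n => |c n| * x ^ n) ∧ ∑' n, |c n| * x ^ n ≤ 2 * C := by
  have hg : HasSum (fun n : ℕ => C * (1 / 2 : ℝ) ^ n) (C * 2) := hasSum_geometric_two.mul_left C
  have hb : ∀ n, |c n| * x ^ n ≤ C * (1 / 2) ^ n := by
    intro n
    have : x ^ n ≤ R ^ n * (1 / 2) ^ n := by
      rw [← mul_pow]; exact pow_le_pow_left₀ hx (by linarith) n
    calc _ ≤ |c n| * (R ^ n * (1 / 2) ^ n) := by gcongr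
      _ = |c n| * R ^ n * (1 / 2) ^ n := by ring
      _ ≤ _ := by have := hc n; gcongr
  have hs : Summable (fun n => |c n| * x ^ n) :=
    Summable.of_nonneg_of_le (fun n => by positivity) hb hg.summable
  refine ⟨hs, (hs.tsum_le_tsum hb hg.summable).trans (le_of_eq ?_)⟩
  rw [hg.tsum_eq, mul_comm]

theorem norm_cubic_le (hC : 0 < C) (hc : ∀ n, |c n| * R ^ n ≤ C) {ε : ℝ} {p : BC}
    (hp : 2 * ‖(ε : ℂ) • p‖ ≤ R) : ‖cubic c ε p‖ ≤ 2 * C * ‖p‖ ^ 3 := by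
  obtain ⟨hs, hb⟩ := summable_scalars hc (norm_nonneg ((ε : ℂ) • p)) hp
  have h1 : ‖FormalMultilinearSeries.ofScalarsSum (E := BC) (fun n => (c n : ℂ)) ((ε : ℂ) • p)‖
      ≤ 2 * C := by
    rw [FormalMultilinearSeries.ofScalarsSum_eq_tsum]
    refine (tsum_of_norm_bounded hs.hasSum fun n => ?_).trans hb
    rw [norm_smul, Complex.norm_real]
    exact mul_le_mul_of_nonneg_left (norm_pow_le _ n) (norm_nonneg _)
  refine (norm_mul_le _ _).trans ?_
  rw [mul_comm]
  exact mul_le_mul h1 (norm_pow_le _ 3) (norm_nonneg _) (by positivity)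

theorem cubic_star (c : ℕ → ℝ) (ε : ℝ) (p : BC) : cubic c ε (star p) = star (cubic c ε p) := by
  simp only [cubic, FormalMultilinearSeries.ofScalarsSum_eq_tsum, star_mul', star_pow, tsum_star,
    star_smul]
  simp

/-- Evaluation at a point is continuous and multiplicative. The factor `ε³` in the series of `f (ε
y)`, which starts at order three, cancels the prefactor `ε⁻³`. -/
theorem cubic_apply {f : ℝ → ℝ} (hf : ∀ u, |u| < R → HasSum (fun n => c n * u ^ (n + 3)) (f u))
    (hR : 0 < R) (hc : ∀ n, |c n| * R ^ n ≤ C) {ε : ℝ} (hε : 0 < ε) {p : BC}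
    (hp : 2 * ‖(ε : ℂ) • p‖ ≤ R) {x y : ℝ} (hxy : p x = y) :
    cubic c ε p x = ((1 / ε ^ 3 * f (ε * y) : ℝ) : ℂ) := by
  obtain ⟨hs, -⟩ := summable_scalars hc (norm_nonneg ((ε : ℂ) • p)) hp
  have hs' : Summable fun n => (c n : ℂ) • ((ε : ℂ) • p) ^ n := by
    refine Summable.of_norm_bounded hs fun n => ?_
    rw [norm_smul, Complex.norm_real]
    exact mul_le_mul_of_nonneg_left (norm_pow_le _ n) (norm_nonneg _)
  have h := (BoundedContinuousFunction.evalCLM ℂ x).hasSum hs'.hasSum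
  have hy : |ε * y| < R := by
    have := ((ε : ℂ) • p).norm_coe_le_norm x
    have e : ((ε : ℂ) • p) x = ((ε * y : ℝ) : ℂ) := by simp [hxy]
    rw [e, Complex.norm_real, Real.norm_eq_abs] at this
    linarith
  have h2 : HasSum (fun n => (c n : ℂ) * ((ε * y : ℝ) : ℂ) ^ n)
      ((∑' n, (c n : ℂ) • ((ε : ℂ) • p) ^ n : BC) x) := by
    refine h.congr_fun fun n => ?_
    simp [hxy, mul_pow]
  have h3 := h2.mul_left (((y ^ 3 : ℝ)) : ℂ)
  have h4 : HasSum (fun n => ((y ^ 3 : ℝ) : ℂ) * ((c n : ℂ) * ((ε * y : ℝ) : ℂ) ^ n))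
      ((1 / ε ^ 3 * f (ε * y) : ℝ) : ℂ) := by
    refine (Complex.hasSum_ofReal.mpr ((hf _ hy).mul_left (1 / ε ^ 3))).congr_fun fun n => ?_
    push_cast
    have : (ε : ℂ) ≠ 0 := by exact_mod_cast hε.ne'
    field_simp
    ring
  rw [← h3.unique h4, cubic, FormalMultilinearSeries.ofScalarsSum_eq_tsum]
  simp [hxy]

end Cubic

/-! ### Sine coefficients -/

/-- The integral `∫ g sin (k x)`. -/
def sineInt (k : ℝ) : BC →L[ℂ] ℂ :=
  LinearMap.mkContinuous
    { toFun := fun g => ∫ x in (-Real.pi)..Real.pi, g x * ((Real.sin (k * x) : ℝ) : ℂ)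
      map_add' := fun g h => by
        rw [← intervalIntegral.integral_add
          (Continuous.intervalIntegrable (by fun_prop) _ _)
          (Continuous.intervalIntegrable (by fun_prop) _ _)]
        simp [add_mul]
      map_smul' := fun a g => by
        rw [RingHom.id_apply, smul_eq_mul, ← intervalIntegral.integral_const_mul]
        simp [mul_assoc] }
    (2 * Real.pi) (fun g => by
      have := intervalIntegral.norm_integral_le_of_norm_le_const (a := -Real.pi) (b := Real.pi)
        (C := ‖g‖) (f := fun x => g x * ((Real.sin (k * x) : ℝ) : ℂ)) (fun x _ => by
          rw [norm_mul, Complex.norm_real]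
          exact mul_le_of_le_one_right (norm_nonneg _) (Real.abs_sin_le_one _) |>.trans
            (g.norm_coe_le_norm x))
      rw [sub_neg_eq_add, ← two_mul, abs_of_pos (by positivity), mul_comm] at this
      exact this)

theorem sineInt_apply (k : ℝ) (g : BC) :
    sineInt k g = ∫ x in (-Real.pi)..Real.pi, g x * ((Real.sin (k * x) : ℝ) : ℂ) := rfl

theorem sineInt_star (k : ℝ) (g : BC) : sineInt k (star g) = star (sineInt k g) := by
  rw [sineInt_apply, sineInt_apply, intervalIntegral.integral_of_le (by linarith [Real.pi_pos]),
    intervalIntegral.integral_of_le (by linarith [Real.pi_pos])]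
  refine Eq.trans ?_ integral_conj
  refine MeasureTheory.integral_congr_ae (Filter.Eventually.of_forall fun x => ?_)
  simp [-Complex.ofReal_sin]

theorem sineInt_eq_fourierCoeffOn (g : BC) (n : ℕ) :
    sineInt (waveNumber n) g = -(Complex.I * Real.pi) *
      (fourierCoeffOn (neg_lt_self Real.pi_pos) g (-((n : ℤ) + 2))
        - fourierCoeffOn (neg_lt_self Real.pi_pos) g ((n : ℤ) + 2)) := by
  have hπ : (Real.pi : ℂ) ≠ 0 := by exact_mod_cast Real.pi_ne_zero
  have hc : ∀ m : ℤ, IntervalIntegrable (fun x : ℝ => Complex.exp (Complex.I * m * x) * g x)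
      MeasureTheory.volume (-Real.pi) Real.pi :=
    fun m => Continuous.intervalIntegrable (by fun_prop) _ _
  have he : ∀ m : ℤ, fourierCoeffOn (neg_lt_self Real.pi_pos) g m
      = (1 / (2 * Real.pi) : ℂ) * ∫ x in (-Real.pi)..Real.pi,
        Complex.exp (Complex.I * ((-m : ℤ) : ℂ) * x) * g x := by
    intro m
    rw [fourierCoeffOn_eq_integral, sub_neg_eq_add, ← two_mul]
    rw [Complex.real_smul]
    push_cast
    congr 1
    refine intervalIntegral.integral_congr fun x _ => ?_
    rw [fourier_coe_apply, smul_eq_mul]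
    congr 2
    push_cast
    field_simp
  rw [he, he, ← mul_sub, ← intervalIntegral.integral_sub (hc _) (hc _), sineInt_apply,
    ← intervalIntegral.integral_const_mul, ← intervalIntegral.integral_const_mul]
  refine intervalIntegral.integral_congr fun x _ => ?_
  simp only [waveNumber]
  rw [Complex.ofReal_sin, Complex.sin]
  push_cast
  have e1 : (-((n : ℂ) + 2)  * x * Complex.I) = Complex.I * (-((n : ℂ) + 2)) * x := by ring
  have e2 : (((n : ℂ) + 2)  * x * Complex.I) = Complex.I * (((n : ℂ) + 2)) * x := by ring
  have e3 : -(((n : ℂ) + 2) * x) * Complex.I = Complex.I * (-((n : ℂ) + 2)) * x := by ring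
  have e4 : Complex.I * (- -((n : ℂ) + 2)) * x = Complex.I * (((n : ℂ) + 2)) * x := by ring
  rw [e3, e2, e4]
  field_simp
  ring

/-- A Bessel inequality: sine coefficients are differences of Fourier coefficients at `±(n + 2)`,
and each choice of sign gives an injective family of indices, so Parseval's identity applies to
both. -/
theorem sum_sineInt_sq_le (g : BC) (s : Finset ℕ) :
    ∑ n ∈ s, ‖sineInt (waveNumber n) g‖ ^ 2 ≤ 4 * Real.pi ^ 2 * ‖g‖ ^ 2 := by
  have hπ := Real.pi_pos
  have hmem : MeasureTheory.MemLp (fun x => g x) 2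
      (MeasureTheory.volume.restrict (Set.Ioc (-Real.pi) Real.pi)) :=
    MeasureTheory.MemLp.of_bound g.continuous.aestronglyMeasurable ‖g‖
      (Filter.Eventually.of_forall g.norm_coe_le_norm)
  have hF := hasSum_sq_fourierCoeffOn (neg_lt_self hπ) hmem
  have htot : (Real.pi - -Real.pi)⁻¹ • ∫ x in (-Real.pi)..Real.pi, ‖g x‖ ^ 2 ≤ ‖g‖ ^ 2 := by
    have h1 := intervalIntegral.norm_integral_le_of_norm_le_const (a := -Real.pi) (b := Real.pi)
      (C := ‖g‖ ^ 2) (f := fun x => ‖g x‖ ^ 2) (fun x _ => by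
        rw [Real.norm_of_nonneg (by positivity)]
        exact pow_le_pow_left₀ (norm_nonneg _) (g.norm_coe_le_norm x) 2)
    have h2 := (Real.le_norm_self _).trans h1
    rw [abs_of_pos (by linarith)] at h2
    rw [smul_eq_mul, inv_mul_le_iff₀ (by linarith), mul_comm]
    exact h2
  set c : ℤ → ℝ := fun i => ‖fourierCoeffOn (neg_lt_self hπ) (fun x => g x) i‖ ^ 2 with hcdef
  have hc0 : ∀ i, 0 ≤ c i := fun i => by positivity
  have hsub : ∀ j : ℕ → ℤ, Function.Injective j → ∑ n ∈ s, c (j n) ≤ ‖g‖ ^ 2 := by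
    intro j hj
    have : ∑ n ∈ s, c (j n) = ∑ i ∈ s.map ⟨j, hj⟩, c i := by simp
    rw [this]
    exact (sum_le_hasSum _ (fun i _ => hc0 i) hF).trans htot
  have hj1 := hsub (fun n => (n : ℤ) + 2) (fun a b h => by simpa using h)
  have hj2 := hsub (fun n => -((n : ℤ) + 2)) (fun a b h => by simpa using h)
  calc ∑ n ∈ s, ‖sineInt (waveNumber n) g‖ ^ 2
      ≤ ∑ n ∈ s, 2 * Real.pi ^ 2 * (c (-((n : ℤ) + 2)) + c ((n : ℤ) + 2)) := by
        refine Finset.sum_le_sum fun n _ => ?_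
        rw [sineInt_eq_fourierCoeffOn, norm_mul, norm_neg, norm_mul, Complex.norm_I, one_mul,
          Complex.norm_real, Real.norm_of_nonneg hπ.le, mul_pow]
        have h1 := norm_sub_le (fourierCoeffOn (neg_lt_self hπ) (fun x => g x) (-((n : ℤ) + 2)))
          (fourierCoeffOn (neg_lt_self hπ) (fun x => g x) ((n : ℤ) + 2))
        have h2 := pow_le_pow_left₀ (norm_nonneg _) h1 2
        have h3 : Real.pi ^ 2 * ‖fourierCoeffOn (neg_lt_self hπ) (fun x => g x) (-((n : ℤ) + 2))
          - fourierCoeffOn (neg_lt_self hπ) (fun x => g x) ((n : ℤ) + 2)‖ ^ 2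
          ≤ Real.pi ^ 2 * (2 * (c (-((n : ℤ) + 2)) + c ((n : ℤ) + 2))) := by
          refine mul_le_mul_of_nonneg_left (h2.trans ?_) (by positivity)
          simp only [hcdef]
          nlinarith [sq_nonneg (‖fourierCoeffOn (neg_lt_self hπ) (fun x => g x) (-((n : ℤ) + 2))‖
            - ‖fourierCoeffOn (neg_lt_self hπ) (fun x => g x) ((n : ℤ) + 2)‖)]
        refine h3.trans (le_of_eq (by ring))
    _ = 2 * Real.pi ^ 2 * (∑ n ∈ s, c (-((n : ℤ) + 2)) + ∑ n ∈ s, c ((n : ℤ) + 2)) := by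
        rw [← Finset.mul_sum, Finset.sum_add_distrib]
    _ ≤ _ := by nlinarith [sq_nonneg Real.pi]

theorem CV_add_apply (x y : CV) (n : ℕ) (i : Fin 2) : (x + y : CV) n i = x n i + y n i := rfl

theorem CV_smul_apply (a : ℂ) (x : CV) (n : ℕ) (i : Fin 2) : (a • x : CV) n i = a * x n i := rfl

/-- The elliptic component `L⁻¹ (0, P_c g)`. -/
def sineProj : BC →L[ℂ] CV :=
  -- `L⁻¹` gains the derivative measured by the graph norm of `Y₁`: the multiplier `k / √(k² - 1)`
  -- is at most `2`. The constant `8` covers `√(16 π)`.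
  have key : ∀ (g : BC) (s : Finset ℕ), ∑ n ∈ s, ‖(WithLp.toLp 2 ![0,
      (((symbolL n)⁻¹ * waveNumber n * (√Real.pi)⁻¹ : ℝ) : ℂ) * sineInt (waveNumber n) g] : CX)‖ ^
      (2 : ℝ≥0∞).toReal ≤ (8 * ‖g‖) ^ (2 : ℝ≥0∞).toReal := by
    intro g s
    rw [ENNReal.toReal_ofNat, Real.rpow_ofNat]
    calc _ ≤ ∑ n ∈ s, 4 / Real.pi * ‖sineInt (waveNumber n) g‖ ^ 2 := by
          refine Finset.sum_le_sum fun n _ => ?_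
          rw [Real.rpow_ofNat, EuclideanSpace.norm_sq_eq]
          have h1 := one_le_symbolL n
          have h2 := waveNumber_le_two_mul_symbolL n
          have h3 := two_le_waveNumber n
          have h4 : ((symbolL n)⁻¹ * waveNumber n) ^ 2 ≤ 4 := by
            have : (symbolL n)⁻¹ * waveNumber n ≤ 2 := by
              rw [inv_mul_le_iff₀ (by linarith)]; linarith
            have h0 : 0 ≤ (symbolL n)⁻¹ * waveNumber n := by positivity
            nlinarith
          simp only [Fin.sum_univ_two, Matrix.cons_val_zero, Matrix.cons_val_one, norm_zero,
            norm_mul, Complex.norm_real, Real.norm_eq_abs, mul_pow, sq_abs]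
          rw [← mul_pow, inv_pow, Real.sq_sqrt Real.pi_pos.le, zero_pow two_ne_zero, zero_add,
            div_eq_mul_inv]
          gcongr
      _ ≤ 4 / Real.pi * (4 * Real.pi ^ 2 * ‖g‖ ^ 2) := by
          rw [← Finset.mul_sum]
          have := sum_sineInt_sq_le g s
          have := Real.pi_pos
          gcongr
      _ = 16 * Real.pi * ‖g‖ ^ 2 := by field_simp; ring
      _ ≤ _ := by
          rw [mul_pow]
          have := Real.pi_le_four
          have : 0 ≤ ‖g‖ ^ 2 := by positivity
          nlinarith
  LinearMap.mkContinuous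
    { toFun := fun g => ⟨fun n => WithLp.toLp 2 ![0,
        (((symbolL n)⁻¹ * waveNumber n * (√Real.pi)⁻¹ : ℝ) : ℂ) * sineInt (waveNumber n) g],
        memℓp_gen' (key g)⟩
      map_add' := fun g h => CV_ext fun n i => by
        rw [CV_add_apply]
        fin_cases i <;> simp [mul_add]
      map_smul' := fun a g => CV_ext fun n i => by
        rw [RingHom.id_apply, CV_smul_apply]
        fin_cases i
        · simp
        · simp; ring }
    8 (fun g => lp.norm_le_of_forall_sum_le (by simp) (by positivity) (key g))

theorem sineProj_apply (g : BC) (n : ℕ) (i : Fin 2) : sineProj g n i = ![0,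
    (((symbolL n)⁻¹ * waveNumber n * (√Real.pi)⁻¹ : ℝ) : ℂ) * sineInt (waveNumber n) g] i := rfl

theorem sineProj_star (g : BC) : sineProj (star g) = conjV (sineProj g) :=
  CV_ext fun n i => by
    rw [conjV_apply, sineProj_apply, sineProj_apply, sineInt_star]
    fin_cases i <;> simp

end
end KleinGordon

/-! ### Holomorphic extension and bounds of the rescaled Klein-Gordon nonlinearity. -/

namespace KleinGordon
noncomputable section

open scoped ContDiff Topology

/-- The rescaled Klein-Gordon nonlinearity on the complexified phase space. -/
def kgC (c : ℕ → ℝ) (ε : ℝ) (Z : CX × CV) : CX × CV :=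
  (((1 / √(1 - ε ^ 2) - 1 : ℝ) : ℂ) • nfData.A Z.1
      - (((1 / √(1 - ε ^ 2) * (1 / Real.pi) : ℝ) : ℂ) * sineInt 1 (cubic c ε (profileC Z))) •
        nfData.e₂,
    ((ε / (1 - ε ^ 2) : ℝ) : ℂ) • (nfData.S₁ Z.2 - sineProj (cubic c ε (profileC Z))))

theorem kgC_conj (c : ℕ → ℝ) (ε : ℝ) (Z : CX × CV) :
    kgC c ε (nfConj.conj Z) = nfConj.conj (kgC c ε Z) := by
  refine Prod.ext ?_ ?_
  · change (kgC c ε (nfConj.conj Z)).1 = conjX (kgC c ε Z).1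
    have h1 : (nfConj.conj Z).1 = conjX Z.1 := rfl
    have h2 : ∀ x, conjX (nfData.A x) = nfData.A (conjX x) := nfConj.A
    have h3 : conjX nfData.e₂ = nfData.e₂ := nfConj.e₂
    simp only [kgC, profileC_conj, cubic_star, sineInt_star]
    rw [map_sub, conjX_smul, conjX_smul, h2, h3, h1]
    simp [-Complex.coe_smul]
  · change (kgC c ε (nfConj.conj Z)).2 = conjV (kgC c ε Z).2
    have h1 : (nfConj.conj Z).2 = conjV Z.2 := rfl
    have h2 : ∀ x, conjV (nfData.S₁ x) = nfData.S₁ (conjV x) := nfConj.S₁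
    simp only [kgC, profileC_conj, cubic_star, sineProj_star]
    rw [conjV_smul, map_sub, h2, h1]
    simp [-Complex.coe_smul]

theorem kgC_zero (c : ℕ → ℝ) (ε : ℝ) : kgC c ε 0 = 0 := by
  have : cubic c ε 0 = 0 := by simp [cubic]
  simp [kgC, this]

theorem contDiffAt_kgC {c : ℕ → ℝ} {R C ε : ℝ} (hR : 0 < R) (hc : ∀ n, |c n| * R ^ n ≤ C)
    {Z : CX × CV} (hZ : ‖(ε : ℂ) • profileC Z‖ < R) : ContDiffAt ℂ ω (kgC c ε) Z := by
  have h : ContDiffAt ℂ ω (fun Z => cubic c ε (profileC Z)) Z :=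
    (contDiffAt_cubic hR hc hZ).comp Z profileC.contDiff.contDiffAt
  refine ContDiffAt.prodMk ?_ ?_
  · exact ((nfData.A.contDiff.contDiffAt.comp Z contDiffAt_fst).const_smul _).sub
      ((contDiffAt_const.mul ((sineInt 1).contDiff.contDiffAt.comp Z h)).smul contDiffAt_const)
  · exact ((nfData.S₁.contDiff.contDiffAt.comp Z contDiffAt_snd).sub
      (sineProj.contDiff.contDiffAt.comp Z h)).const_smul _

theorem rescaling_bounds {ε : ℝ} (h0 : 0 < ε) (h1 : ε ≤ 1 / 2) :
    0 ≤ 1 / √(1 - ε ^ 2) - 1 ∧ 1 / √(1 - ε ^ 2) - 1 ≤ ε ∧ 0 ≤ ε / (1 - ε ^ 2) ∧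
      ε / (1 - ε ^ 2) ≤ 2 * ε := by
  have h2 : ε ^ 2 ≤ 1 / 4 := by nlinarith
  have h3 : 0 < 1 - ε ^ 2 := by linarith
  have h4 : 0 < √(1 - ε ^ 2) := Real.sqrt_pos.mpr h3
  have h5 : √(1 - ε ^ 2) ≤ 1 := Real.sqrt_le_one.mpr (by nlinarith)
  have h6 : (1 + ε)⁻¹ ≤ √(1 - ε ^ 2) := by
    refine Real.le_sqrt_of_sq_le ?_
    rw [inv_pow, inv_le_comm₀ (by positivity) h3, inv_le_iff_one_le_mul₀ h3]
    have : 0 ≤ ε * (2 - 2 * ε ^ 2 - ε ^ 3) := by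
      have : ε ^ 3 ≤ 1 / 8 := by
        calc ε ^ 3 ≤ (1 / 2) ^ 3 := pow_le_pow_left₀ h0.le h1 3
          _ = 1 / 8 := by norm_num
      exact mul_nonneg h0.le (by linarith)
    nlinarith
  refine ⟨?_, ?_, by positivity, ?_⟩
  · rw [sub_nonneg, le_div_iff₀ h4, one_mul]; exact h5
  · rw [sub_le_iff_le_add, one_div, inv_le_comm₀ h4 (by linarith), add_comm]; exact h6
  · rw [div_le_iff₀ h3]; nlinarith

theorem ofCoef_eq {a : Fin 2 → ℕ → ℝ} {y : Y₁}
    (h : ∀ n i, y n i = √Real.pi * waveNumber n * a i n) : ofCoef a = y := by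
  have e : (fun n : ℕ => (WithLp.toLp 2 (fun i => √Real.pi * waveNumber n * a i n) :
      EuclideanSpace ℝ (Fin 2))) = fun n => y n := by
    funext n
    ext i
    exact (h n i).symm
  have hm : Memℓp (fun n : ℕ => (WithLp.toLp 2 (fun i => √Real.pi * waveNumber n * a i n) :
      EuclideanSpace ℝ (Fin 2))) 2 := by
    rw [e]; exact y.2
  unfold ofCoef
  rw [dif_pos hm]
  exact Y_ext fun n i => (h n i).symm

theorem realMap_kgC {f : ℝ → ℝ} {c : ℕ → ℝ} {R C ε : ℝ}
    (hf : ∀ u, |u| < R → HasSum (fun n => c n * u ^ (n + 3)) (f u))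
    (hR : 0 < R) (hc : ∀ n, |c n| * R ^ n ≤ C) (hε : 0 < ε) (hε' : ε ≤ 1 / 2)
    {Z : Phase} (hZ : 2 * ‖(ε : ℂ) • profileC (toC Z)‖ ≤ R) :
    realMap (kgC c ε) Z = kgNonlinearity f ε Z := by
  have hg : ∀ k, sineInt k (cubic c ε (profileC (toC Z)))
      = ((Real.pi / ε ^ 3 * sineCoef f ε Z k : ℝ) : ℂ) := by
    intro k
    rw [sineInt_apply, sineCoef]
    have : ∀ x, cubic c ε (profileC (toC Z)) x * ((Real.sin (k * x) : ℝ) : ℂ)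
        = ((1 / ε ^ 3 * (f (ε * profile Z x) * Real.sin (k * x)) : ℝ) : ℂ) := by
      intro x
      rw [cubic_apply hf hR hc hε hZ (profileC_toC Z x)]
      push_cast; ring
    simp only [this]
    rw [intervalIntegral.integral_ofReal, intervalIntegral.integral_const_mul]
    congr 1
    field_simp
  have hs : √(1 - ε ^ 2) ≠ 0 := (Real.sqrt_pos.mpr (by nlinarith)).ne'
  have h3 : (1 - ε ^ 2) ≠ 0 := by nlinarith
  have hπ := Real.pi_ne_zero
  have hε0 := hε.ne'
  refine Prod.ext ?_ ?_
  · change reX (kgC c ε (toC Z)).1 = F f ε Z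
    have hA : (toC Z).1 = toCX Z.1 := rfl
    simp only [kgC, hg, F, hA, nfData_A_toCX]
    ext i
    rw [reX_apply, PiLp.sub_apply, PiLp.smul_apply, PiLp.smul_apply, PiLp.add_apply,
      PiLp.smul_apply, ← Complex.ofReal_mul, toCX_apply]
    fin_cases i
    · simp [nfData, -Complex.ofReal_mul, -Complex.coe_smul]
    · simp [nfData, -Complex.coe_smul]
      norm_cast
      field_simp
      ring
  · change reV (kgC c ε (toC Z)).2 = ε • G f ε Z
    rw [G, ← inv_smul_eq_iff₀ hε0]
    refine (ofCoef_eq fun n i => ?_).symm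
    have h1 := one_le_symbolL n
    have h2 := two_le_waveNumber n
    have h4 : symbolL n ≠ 0 := by linarith
    have h5 : waveNumber n ≠ 0 := by linarith
    have h6 : √Real.pi ≠ 0 := (Real.sqrt_pos.mpr Real.pi_pos).ne'
    have h7 := Real.sq_sqrt Real.pi_pos.le
    change ε⁻¹ * ((((ε / (1 - ε ^ 2) : ℝ) : ℂ) * (nfData.S₁ (toCV Z.2) n i
      - sineProj (cubic c ε (profileC (toC Z))) n i)).re) = _
    rw [sineProj_apply, hg, Complex.re_ofReal_mul, Complex.sub_re]
    fin_cases i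
    · simp [nfData, matOp_apply]
    · simp [nfData, matOp_apply, -Complex.ofReal_mul, -Complex.ofReal_div, -Complex.ofReal_inv,
        coef]
      norm_cast
      field_simp
      linear_combination (waveNumber n * sineCoef f ε Z (waveNumber n)) * h7

/-- The properties of an extension of a nonlinearity to the complexified phase space. -/
structure IsGoodExtension (ρ M₀ ε : ℝ) (Nc : CX × CV → CX × CV) : Prop where
  smooth : ∀ Z ∈ sumBall CX CV ρ, ContDiffAt ℂ ω Nc Z
  le : ∀ Z ∈ sumBall CX CV ρ, ‖Nc Z‖ ≤ M₀
  gam_le : ∀ q : CX, ‖q‖ < ρ → ‖NFData.gam Nc q‖ ≤ M₀ * ε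
  conj : ∀ Z ∈ sumBall CX CV ρ, Nc (nfConj.conj Z) = nfConj.conj (Nc Z)
  zero : Nc 0 = 0
  fderiv_le : ‖fderiv ℂ Nc 0‖ ≤ M₀ * ε

-- Everything follows from `‖kgC c ε Z‖ ≤ D (ε ‖Z‖ + ‖Z‖³)` with `D` independent of `ε`: the linear
-- part carries a factor `ε` from the rescaling and the rest is cubic. The elliptic component has an
-- overall factor `ε`, which makes the initial `γ` of order `ε`.
set_option maxHeartbeats 1000000 in
theorem exists_kg_extension {f : ℝ → ℝ} (hodd : ∀ u, f (-u) = -f u) (han : AnalyticAt ℝ f 0)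
    (hf1 : deriv f 0 = 0) {K : ℝ} (hK : 0 < K) :
    ∃ (M₀ ε₁ : ℝ) (Nc : ℝ → CX × CV → CX × CV), 1 ≤ M₀ ∧ 0 < ε₁ ∧ ∀ ε ∈ Ioo 0 ε₁,
      IsGoodExtension (2 * K) M₀ ε (Nc ε) ∧
      ∀ Z ∈ phaseBall (2 * K), kgNonlinearity f ε Z = realMap (Nc ε) Z := by
  obtain ⟨c, R, C, hR, hC, hc, hf⟩ := exists_cubic_series hodd han hf1
  set P := ‖profileC‖ with hP
  have hP0 : 0 ≤ P := norm_nonneg _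
  set κ := ‖nfData.A‖ + ‖sineInt 1‖ * ‖nfData.e₂‖ + ‖nfData.S₁‖ + ‖sineProj‖ with hκ
  have a1 := norm_nonneg nfData.A
  have a2 : 0 ≤ ‖sineInt 1‖ * ‖nfData.e₂‖ := by positivity
  have a3 := norm_nonneg nfData.S₁
  have a4 := norm_nonneg sineProj
  have hκ0 : 0 ≤ κ := by positivity
  set B := 2 * C * P ^ 3 with hB
  have hB0 : 0 ≤ B := by positivity
  set D := 2 * κ * (1 + B) with hD
  have hD0 : 0 ≤ D := by positivity
  have hmem : ∀ Z ∈ sumBall CX CV (2 * K), ‖Z‖ ≤ 2 * K := by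
    intro Z hZ
    have hZ' : ‖Z.1‖ + ‖Z.2‖ < 2 * K := hZ
    exact max_le (by linarith [norm_nonneg Z.2]) (by linarith [norm_nonneg Z.1])
  -- The three bounds serve `rescaling_bounds`, keep `ε` times the profile within half the radius of
  -- convergence, and give `√ε ≤ 2 K`.
  set ε₁ := min (1 / 2) (min (R / (4 * K * P + 1)) (K ^ 2 / 4)) with hε₁
  have hε₁0 : 0 < ε₁ := by positivity
  refine ⟨1 + D * (2 * K + (2 * K) ^ 3) + D * (2 * K) ^ 3 + 2 * D, ε₁, kgC c, ?_, hε₁0, ?_⟩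
  · have : 0 ≤ D * (2 * K + (2 * K) ^ 3) + D * (2 * K) ^ 3 + 2 * D := by positivity
    linarith
  intro ε hε
  have hε0 : 0 < ε := hε.1
  have hε2 : ε ≤ 1 / 2 := hε.2.le.trans (min_le_left _ _)
  have hεR : ε ≤ R / (4 * K * P + 1) := hε.2.le.trans ((min_le_right _ _).trans (min_le_left _ _))
  have hεK : ε ≤ K ^ 2 / 4 := hε.2.le.trans ((min_le_right _ _).trans (min_le_right _ _))
  obtain ⟨b1, b2, b3, b4⟩ := rescaling_bounds hε0 hε2
  have hpZ : ∀ Z : CX × CV, ‖Z‖ ≤ 2 * K → 2 * ‖(ε : ℂ) • profileC Z‖ ≤ R := by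
    intro Z hZ
    rw [norm_smul, Complex.norm_real, Real.norm_of_nonneg hε0.le]
    have h1 : ‖profileC Z‖ ≤ P * (2 * K) := profileC.le_of_opNorm_le_of_le le_rfl hZ
    calc 2 * (ε * ‖profileC Z‖) ≤ 2 * (ε * (P * (2 * K))) := by gcongr
      _ = ε * (4 * K * P) := by ring
      _ ≤ ε * (4 * K * P + 1) := by gcongr; linarith
      _ ≤ R := (le_div_iff₀ (by positivity)).mp hεR
  have hpZ' : ∀ Z : CX × CV, ‖Z‖ ≤ 2 * K → ‖(ε : ℂ) • profileC Z‖ < R := by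
    intro Z hZ
    linarith [hpZ Z hZ, norm_nonneg ((ε : ℂ) • profileC Z)]
  have hg : ∀ Z : CX × CV, ‖Z‖ ≤ 2 * K → ‖cubic c ε (profileC Z)‖ ≤ B * ‖Z‖ ^ 3 := by
    intro Z hZ
    refine (norm_cubic_le hC hc (hpZ Z hZ)).trans ?_
    calc 2 * C * ‖profileC Z‖ ^ 3 ≤ 2 * C * (P * ‖Z‖) ^ 3 := by
          gcongr; exact profileC.le_opNorm Z
      _ = _ := by rw [hB]; ring
  have h2 : ∀ Z : CX × CV, ‖Z‖ ≤ 2 * K →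
      ‖(kgC c ε Z).2‖ ≤ 2 * ε * (κ * ‖Z.2‖ + κ * (B * ‖Z‖ ^ 3)) := by
    intro Z hZ
    change ‖((ε / (1 - ε ^ 2) : ℝ) : ℂ) • (nfData.S₁ Z.2 - sineProj (cubic c ε (profileC Z)))‖ ≤ _
    rw [norm_smul, Complex.norm_real, Real.norm_of_nonneg b3]
    have e1 : ‖nfData.S₁ Z.2‖ ≤ κ * ‖Z.2‖ :=
      ContinuousLinearMap.le_of_opNorm_le _ (by linarith) _
    have e2 : ‖sineProj (cubic c ε (profileC Z))‖ ≤ κ * (B * ‖Z‖ ^ 3) :=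
      ContinuousLinearMap.le_of_opNorm_le_of_le _ (by linarith) (hg Z hZ)
    exact mul_le_mul b4 ((norm_sub_le _ _).trans (add_le_add e1 e2)) (norm_nonneg _) (by positivity)
  have h1 : ∀ Z : CX × CV, ‖Z‖ ≤ 2 * K → ‖(kgC c ε Z).1‖ ≤ ε * (κ * ‖Z‖) + 2 * κ * (B * ‖Z‖ ^ 3) := by
    intro Z hZ
    refine (norm_sub_le _ _).trans (add_le_add ?_ ?_)
    · rw [norm_smul, Complex.norm_real, Real.norm_of_nonneg b1]
      refine mul_le_mul b2 ?_ (norm_nonneg _) hε0.le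
      exact ContinuousLinearMap.le_of_opNorm_le_of_le _ (by linarith) (norm_fst_le Z)
    · rw [norm_smul, norm_mul, Complex.norm_real, Real.norm_of_nonneg
        (mul_nonneg (by linarith) (by positivity))]
      have e1 : 1 / √(1 - ε ^ 2) * (1 / Real.pi) ≤ 2 * 1 := by
        refine mul_le_mul (by linarith) ?_ (by positivity) (by norm_num)
        rw [div_le_one Real.pi_pos]; linarith [Real.pi_gt_three]
      have e2 : ‖sineInt 1 (cubic c ε (profileC Z))‖ ≤ ‖sineInt 1‖ * (B * ‖Z‖ ^ 3) :=
        ContinuousLinearMap.le_of_opNorm_le_of_le _ le_rfl (hg Z hZ)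
      calc _ ≤ 2 * 1 * (‖sineInt 1‖ * (B * ‖Z‖ ^ 3)) * ‖nfData.e₂‖ := by gcongr
        _ = 2 * (‖sineInt 1‖ * ‖nfData.e₂‖) * (B * ‖Z‖ ^ 3) := by ring
        _ ≤ _ := by gcongr; linarith
  have hall : ∀ Z : CX × CV, ‖Z‖ ≤ 2 * K → ‖kgC c ε Z‖ ≤ D * (ε * ‖Z‖ + ‖Z‖ ^ 3) := by
    intro Z hZ
    have z3 : 0 ≤ ‖Z‖ ^ 3 := by positivity
    have z1 : 0 ≤ ε * ‖Z‖ := by positivity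
    have p1 : 0 ≤ κ * B * (ε * ‖Z‖) := by positivity
    have p2 : 0 ≤ κ * ‖Z‖ ^ 3 := by positivity
    have p3 : 0 ≤ κ * (ε * ‖Z‖) := by positivity
    have p4 : 0 ≤ κ * B * ‖Z‖ ^ 3 := by positivity
    have hDe : D * (ε * ‖Z‖ + ‖Z‖ ^ 3) = 2 * (κ * (ε * ‖Z‖)) + 2 * (κ * ‖Z‖ ^ 3)
        + 2 * (κ * B * (ε * ‖Z‖)) + 2 * (κ * B * ‖Z‖ ^ 3) := by rw [hD]; ring
    rw [hDe]
    refine max_le ((h1 Z hZ).trans ?_) ((h2 Z hZ).trans ?_)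
    · have e : ε * (κ * ‖Z‖) + 2 * κ * (B * ‖Z‖ ^ 3)
          = κ * (ε * ‖Z‖) + 2 * (κ * B * ‖Z‖ ^ 3) := by ring
      rw [e]
      linarith only [p1, p2, p3, p4]
    · have e : 2 * ε * (κ * ‖Z.2‖ + κ * (B * ‖Z‖ ^ 3))
          = 2 * (ε * (κ * ‖Z.2‖)) + 2 * (ε * (κ * B * ‖Z‖ ^ 3)) := by ring
      have := norm_snd_le Z
      have r1 : ε * (κ * ‖Z.2‖) ≤ κ * (ε * ‖Z‖) := by
        calc ε * (κ * ‖Z.2‖) = κ * (ε * ‖Z.2‖) := by ring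
          _ ≤ _ := by gcongr
      have r2 : ε * (κ * B * ‖Z‖ ^ 3) ≤ 1 * (κ * B * ‖Z‖ ^ 3) := by gcongr; linarith only [hε2]
      rw [e]
      linarith only [r1, r2, p1, p2, p3, p4]
  have hK3 : 0 ≤ D * (2 * K + (2 * K) ^ 3) := by positivity
  have hK4 : 0 ≤ D * (2 * K) ^ 3 := by positivity
  refine ⟨⟨?_, ?_, ?_, ?_, kgC_zero c ε, ?_⟩, ?_⟩
  · exact fun Z hZ => contDiffAt_kgC hR hc (hpZ' Z (hmem Z hZ))
  · intro Z hZ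
    have hZ' := hmem Z hZ
    refine (hall Z hZ').trans ?_
    have : D * (ε * ‖Z‖ + ‖Z‖ ^ 3) ≤ D * (2 * K + (2 * K) ^ 3) := by
      have e : ε * ‖Z‖ ≤ 1 * (2 * K) :=
        mul_le_mul (by linarith only [hε2]) hZ' (norm_nonneg _) zero_le_one
      have e' : ‖Z‖ ^ 3 ≤ (2 * K) ^ 3 := pow_le_pow_left₀ (norm_nonneg _) hZ' 3
      exact mul_le_mul_of_nonneg_left (add_le_add (e.trans_eq (one_mul _)) e') hD0
    linarith
  · intro q hq
    have hZ : ‖((q, 0) : CX × CV)‖ ≤ 2 * K := by simpa [Prod.norm_def] using hq.le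
    have hn : ‖((q, 0) : CX × CV)‖ ^ 3 ≤ (2 * K) ^ 3 := by gcongr
    have h := h2 (q, 0) hZ
    refine h.trans ?_
    rw [norm_zero, mul_zero, zero_add]
    have e1 : 2 * ε * (κ * (B * ‖((q, 0) : CX × CV)‖ ^ 3)) ≤ D * (2 * K) ^ 3 * ε := by
      calc 2 * ε * (κ * (B * ‖((q, 0) : CX × CV)‖ ^ 3)) ≤ 2 * ε * (κ * (B * (2 * K) ^ 3)) := by
            gcongr
        _ = 2 * κ * B * (2 * K) ^ 3 * ε := by ring
        _ ≤ 2 * κ * (1 + B) * (2 * K) ^ 3 * ε := by gcongr; linarith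
    refine e1.trans ?_
    gcongr
    linarith
  · exact fun Z _ => kgC_conj c ε Z
  -- Cauchy's estimate on the ball of radius `√ε`, where the linear and the cubic bound balance: `D
  -- (ε √ε + √ε³) / √ε = 2 D ε`.
  · have hs0 : 0 < √ε := Real.sqrt_pos.mpr hε0
    have hs2 : √ε * √ε = ε := Real.mul_self_sqrt hε0.le
    have hsK : √ε ≤ 2 * K := by
      refine (Real.sqrt_le_sqrt hεK).trans ?_
      rw [show K ^ 2 / 4 = (K / 2) ^ 2 by ring, Real.sqrt_sq (by positivity)]
      linarith
    have hin : ∀ y ∈ Metric.closedBall (0 : CX × CV) (√ε), ‖y‖ ≤ √ε := fun y hy => by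
      simpa using hy
    have := norm_fderiv_le_of_closedBall (f := kgC c ε) (x := 0) (τ := √ε)
      (C := D * (ε * √ε + √ε ^ 3)) hs0
      (fun y hy => (contDiffAt_kgC hR hc (hpZ' y ((hin y hy).trans hsK))).differentiableAt (by simp))
      (fun y hy => (hall y ((hin y hy).trans hsK)).trans (by
        have := hin y hy
        gcongr))
    refine this.trans ?_
    rw [div_le_iff₀ hs0]
    have e : D * (ε * √ε + √ε ^ 3) = 2 * D * ε * √ε := by
      rw [pow_succ, pow_two, hs2]; ring
    rw [e]
    gcongr
    linarith
  · intro Z hZ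
    refine (realMap_kgC hf hR hc hε0 hε2 (hpZ _ ?_)).symm
    exact hmem _ (toC_mem.mpr hZ)

end
end KleinGordon

/-! ### Iteration of the normal form step. -/

namespace KleinGordon
noncomputable section

open scoped ContDiff Topology
open NFData.StepHyp (sumBall_mono)

/-- The holomorphic extensions of the nonlinearities of the successive systems. -/
def nfSeq (K K₁ ε : ℝ) (Nc : CX × CV → CX × CV) : ℕ → CX × CV → CX × CV
  | 0 => Nc
  | j + 1 => nfData.newNonlinearity ε (nfSeq K K₁ ε Nc j) (nfRadius K K₁ ε (j + 1)) (K₁ * ε)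

/-- `nfSeq` counts completed steps from `0`, while systems are numbered from `1`: the map with index
`j` belongs to the radius with index `j + 1`. -/
theorem nfRadius_succ (K K₁ ε : ℝ) (j : ℕ) : nfRadius K K₁ ε (j + 1) = 2 * K - j * (K₁ * ε) := by
  simp only [nfRadius]; push_cast; ring

section Chain

variable {K K₁ ε M M₀ : ℝ} {Nc : CX × CV → CX × CV}

/-- Induction on the number of steps. As `γ` is halved each time, the changes `6 M² Γ` of the
nonlinearity form a geometric series with sum at most `12 M² M₀ ε ≤ 1`, so the single bound `M ≥ M₀
+ 1` survives all steps. No limit on `j` is needed: once the radius is not positive, the balls are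
empty. -/
theorem stepHyp_nfSeq (hM : nfData.BoundedBy M) (hM0 : 1 ≤ M₀) (hM₀ : M₀ + 1 ≤ M)
    (hK₁ : 2 ^ 14 * M ^ 5 ≤ K₁) (hKM : 2 * K ≤ M) (hε : 0 < ε) (hεM : 12 * M ^ 2 * M₀ * ε ≤ 1)
    (hN : IsGoodExtension (2 * K) M₀ ε Nc) (j : ℕ) :
    nfData.StepHyp M K₁ ε (nfRadius K K₁ ε (j + 1)) (M₀ * ε / 2 ^ j) (nfSeq K K₁ ε Nc j) ∧
      (∀ Z ∈ sumBall CX CV (nfRadius K K₁ ε (j + 1)),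
        nfSeq K K₁ ε Nc j (nfConj.conj Z) = nfConj.conj (nfSeq K K₁ ε Nc j Z)) ∧
      (∀ Z ∈ sumBall CX CV (nfRadius K K₁ ε (j + 1)),
        ‖nfSeq K K₁ ε Nc j Z - Nc Z‖ ≤ 12 * M ^ 2 * M₀ * ε * (1 - 1 / 2 ^ j)) := by
  have hM1 : 1 ≤ M := by linarith
  have hM2 : 1 ≤ M ^ 2 := one_le_pow₀ hM1
  have hK₁0 : 0 < K₁ := lt_of_lt_of_le (by positivity) hK₁
  have hMε : M₀ * ε ≤ 1 := by
    refine le_trans ?_ hεM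
    have : 0 ≤ M₀ * ε := by positivity
    nlinarith
  have hε1 : ε ≤ 1 := le_trans (le_mul_of_one_le_left hε.le hM0) hMε
  have hr : ∀ i : ℕ, nfRadius K K₁ ε (i + 1) ≤ 2 * K := fun i => by
    rw [nfRadius_succ]
    have : 0 ≤ (i : ℝ) * (K₁ * ε) := by positivity
    linarith
  have key : ∀ i : ℕ, (∀ Z ∈ sumBall CX CV (nfRadius K K₁ ε (i + 1)),
      ContDiffAt ℂ ω (nfSeq K K₁ ε Nc i) Z) →
      (∀ Z ∈ sumBall CX CV (nfRadius K K₁ ε (i + 1)),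
        ‖nfSeq K K₁ ε Nc i Z - Nc Z‖ ≤ 12 * M ^ 2 * M₀ * ε * (1 - 1 / 2 ^ i)) →
      (∀ q : CX, ‖q‖ < nfRadius K K₁ ε (i + 1) →
        ‖NFData.gam (nfSeq K K₁ ε Nc i) q‖ ≤ M₀ * ε / 2 ^ i) →
      nfData.StepHyp M K₁ ε (nfRadius K K₁ ε (i + 1)) (M₀ * ε / 2 ^ i) (nfSeq K K₁ ε Nc i) := by
    intro i h1 h2 h3
    refine ⟨hM, hM1, hK₁, hε, hε1, (hr i).trans hKM, by positivity, ?_, h1, ?_, h3⟩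
    · exact (div_le_self (by positivity) (one_le_pow₀ (by norm_num))).trans hMε
    · intro Z hZ
      have e1 := h2 Z hZ
      have e2 := hN.le Z (sumBall_mono (hr i) hZ)
      have e3 : 12 * M ^ 2 * M₀ * ε * (1 - 1 / 2 ^ i) ≤ 1 := by
        refine le_trans (mul_le_of_le_one_right (by positivity) ?_) hεM
        have : (0 : ℝ) ≤ 1 / 2 ^ i := by positivity
        linarith
      have := norm_add_le (nfSeq K K₁ ε Nc i Z - Nc Z) (Nc Z)
      rw [sub_add_cancel] at this
      linarith
  induction j with
  | zero =>
    have e : nfRadius K K₁ ε (0 + 1) = 2 * K := by rw [nfRadius_succ]; simp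
    have h2 : ∀ Z ∈ sumBall CX CV (nfRadius K K₁ ε (0 + 1)),
        ‖nfSeq K K₁ ε Nc 0 Z - Nc Z‖ ≤ 12 * M ^ 2 * M₀ * ε * (1 - 1 / 2 ^ 0) := by
      intro Z _
      simp [nfSeq]
    refine ⟨key 0 ?_ h2 ?_, ?_, h2⟩
    · rw [e]; exact hN.smooth
    · rw [e, pow_zero, div_one]; exact hN.gam_le
    · rw [e]; exact hN.conj
  | succ j ih =>
    obtain ⟨h, hc, hd⟩ := ih
    have e : nfRadius K K₁ ε (j + 1 + 1) = nfRadius K K₁ ε (j + 1) - K₁ * ε := by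
      rw [nfRadius_succ, nfRadius_succ]; push_cast; ring
    have h2 : ∀ Z ∈ sumBall CX CV (nfRadius K K₁ ε (j + 1 + 1)),
        ‖nfSeq K K₁ ε Nc (j + 1) Z - Nc Z‖ ≤ 12 * M ^ 2 * M₀ * ε * (1 - 1 / 2 ^ (j + 1)) := by
      rw [e]
      intro Z hZ
      have e1 := h.norm_newNonlinearity_sub_le hZ
      have e2 := hd Z (sumBall_mono (by linarith [h.δ_pos]) hZ)
      have := norm_add_le (nfSeq K K₁ ε Nc (j + 1) Z - nfSeq K K₁ ε Nc j Z)
        (nfSeq K K₁ ε Nc j Z - Nc Z)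
      rw [sub_add_sub_cancel] at this
      refine this.trans ((add_le_add e1 e2).trans_eq ?_)
      rw [pow_succ]
      field_simp
      ring
    refine ⟨key (j + 1) ?_ h2 ?_, ?_, h2⟩
    · rw [e]; exact fun Z hZ => h.contDiffAt_newNonlinearity hZ
    · rw [e]
      intro q hq
      refine (h.norm_gam_newNonlinearity_le hq).trans_eq ?_
      rw [pow_succ, div_div]
    · rw [e]; exact fun Z hZ => nfConj.newNonlinearity_conj h hc hZ

/-- Here `j` must be limited, since the origin has to lie in the domain of every step. -/
theorem nfSeq_zero (hM : nfData.BoundedBy M) (hM0 : 1 ≤ M₀) (hM₀ : M₀ + 1 ≤ M)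
    (hK₁ : 2 ^ 14 * M ^ 5 ≤ K₁) (hKM : 2 * K ≤ M) (hε : 0 < ε) (hεM : 12 * M ^ 2 * M₀ * ε ≤ 1)
    (hN : IsGoodExtension (2 * K) M₀ ε Nc) (j : ℕ) (hj : j * (K₁ * ε) < 2 * K) :
    nfSeq K K₁ ε Nc j 0 = 0 := by
  induction j with
  | zero => exact hN.zero
  | succ j ih =>
    have h := (stepHyp_nfSeq hM hM0 hM₀ hK₁ hKM hε hεM hN j).1
    have hp := h.δ_pos
    push_cast at hj
    refine (h.map_zero' ?_ (ih (by linarith))).2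
    rw [nfRadius_succ]
    linarith

end Chain

/-- The nonlinearity `N` extends holomorphically to the ball of radius `ρ`, and its elliptic part
is exponentially small on `W^c = 0`. -/
structure IsAlmostInvariant (ρ M ε α : ℝ) (N : CX × CV → CX × CV) : Prop where
  smooth : ∀ Z ∈ sumBall CX CV ρ, ContDiffAt ℂ ω N Z
  le : ∀ Z ∈ sumBall CX CV ρ, ‖N Z‖ ≤ M
  gam_le : ∀ q : CX, ‖q‖ < ρ → ‖NFData.gam N q‖ ≤ M * ε * Real.exp α
  zero : N 0 = 0
  fderiv_le : ‖fderiv ℂ N 0‖ ≤ M * ε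

/-- `j` may be smaller than `c / ε` by the integer part and by one step less than `m`, whence the
factor `4 = 2²`. As `log √2` is half of `log 2`, the exponent asks for only half of the decay
available. -/
theorem half_pow_le_exp {c ε : ℝ} (hc : 0 < c) (hε : 0 < ε) {j : ℕ} (hj : c / ε - 2 ≤ j) :
    1 / 2 ^ j ≤ 4 * Real.exp (-(c * Real.log √2) / ε) := by
  have h2 : (2 : ℝ) ^ j = Real.exp (j * Real.log 2) := by
    rw [← Real.log_pow, Real.exp_log (by positivity)]
  have h4 : (4 : ℝ) = Real.exp (2 * Real.log 2) := by
    rw [show (2 : ℝ) * Real.log 2 = ((2 : ℕ) : ℝ) * Real.log 2 by norm_num, ← Real.log_pow,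
      Real.exp_log (by positivity)]
    norm_num
  rw [h2, h4, one_div, ← Real.exp_neg, ← Real.exp_add, Real.exp_le_exp, Real.log_sqrt zero_le_two]
  have hl : 0 < Real.log 2 := Real.log_pos one_lt_two
  have hq : 0 < c / ε := by positivity
  rw [show 2 * Real.log 2 + -(c * (Real.log 2 / 2)) / ε = (2 - c / ε / 2) * Real.log 2 by
    field_simp; ring, ← neg_mul]
  refine mul_le_mul_of_nonneg_right ?_ hl.le
  linarith

/-- The steps consume at most `K / 2` of the initial radius `2 K`. The final system lives on the
radius `3 K / 2`, which leaves room for Cauchy estimates on the ball of radius `K`. -/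
theorem exists_normalFormChain {f : ℝ → ℝ} (hodd : ∀ u, f (-u) = -f u) (han : AnalyticAt ℝ f 0)
    (hf1 : deriv f 0 = 0) {K : ℝ} (hK : 0 < K) :
    ∃ (K₁ c ε₀ M : ℝ) (N Φ : ℝ → ℕ → Phase → Phase) (n : ℝ → CX × CV → CX × CV),
      0 < K₁ ∧ 0 < c ∧ 0 < ε₀ ∧ 2 * ε₀ ≤ c ∧ 1 ≤ M ∧ ε₀ ≤ 1 ∧ ∀ ε ∈ Ioo 0 ε₀,
        IsNormalFormChain f K K₁ ε ⌊c / ε⌋₊ (N ε) (Φ ε) ∧ K < nfRadius K K₁ ε ⌊c / ε⌋₊ ∧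
        N ε ⌊c / ε⌋₊ = realMap (n ε) ∧
        IsAlmostInvariant (3 * K / 2) M ε (-(c * Real.log √2) / ε) (n ε) := by
  obtain ⟨M₀, ε₁, Nc, hM₀, hε₁, hNc⟩ := exists_kg_extension hodd han hf1 hK
  obtain ⟨M₂, hM₂, hbdd⟩ := exists_boundedBy
  set M := max M₂ (max (2 * K) (M₀ + 1)) with hMdef
  have hM₂M : M₂ ≤ M := le_max_left _ _
  have hKM : 2 * K ≤ M := (le_max_left _ _).trans (le_max_right _ _)
  have hM₀M : M₀ + 1 ≤ M := (le_max_right _ _).trans (le_max_right _ _)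
  have hM1 : 1 ≤ M := by linarith
  have hbd : nfData.BoundedBy M := ⟨hbdd.A.trans hM₂M, hbdd.J.trans hM₂M, hbdd.inc.trans hM₂M,
    hbdd.S.trans hM₂M, hbdd.S₁.trans hM₂M, hbdd.b.trans hM₂M, hbdd.e₁.trans hM₂M,
    hbdd.e₂.trans hM₂M⟩
  set K₁ := 2 ^ 14 * M ^ 5 with hK₁
  have hK₁0 : 0 < K₁ := by positivity
  -- With this choice `c / ε` losses of size `K₁ ε` add up to `K / 2`.
  set c := K / (2 * K₁) with hc
  have hc0 : 0 < c := by positivity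
  have hcK : c * K₁ = K / 2 := by rw [hc]; field_simp
  set D := 12 * M ^ 2 * M₀ with hD
  have hD1 : 1 ≤ D := by
    have : 1 ≤ M ^ 2 := one_le_pow₀ hM1
    nlinarith
  -- `1 / D` keeps the accumulated change of the nonlinearity below one; `c / 2` makes `⌊c / ε⌋₊` at
  -- least `2`, so at least one step is carried out.
  set ε₀ := min ε₁ (min (1 / D) (c / 2)) with hε₀
  refine ⟨K₁, c, ε₀, max M (max (4 * M₀) (M₀ + 2 * D / K)),
    -- The first system must be the given nonlinearity itself, which agrees with its extension only
    -- on the ball of radius `2 K`.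
    fun ε k => if k ≤ 1 then kgNonlinearity f ε else realMap (nfSeq K K₁ ε (Nc ε) (k - 1)),
    fun ε k => realMap (nfData.trans ε (nfSeq K K₁ ε (Nc ε) (k - 1)) (nfRadius K K₁ ε k) (K₁ * ε)),
    fun ε => nfSeq K K₁ ε (Nc ε) (⌊c / ε⌋₊ - 1), hK₁0, hc0, by positivity, ?_,
    hM1.trans (le_max_left _ _), ?_, ?_⟩
  · have : ε₀ ≤ c / 2 := (min_le_right _ _).trans (min_le_right _ _)
    linarith
  · refine ((min_le_right _ _).trans (min_le_left _ _)).trans ?_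
    rw [div_le_one (by linarith)]; exact hD1
  intro ε hε
  have hε0 : 0 < ε := hε.1
  have hεε₁ : ε ∈ Ioo 0 ε₁ := ⟨hε0, hε.2.trans_le (min_le_left _ _)⟩
  have hεD : D * ε ≤ 1 := by
    have : ε ≤ 1 / D := (hε.2.trans_le ((min_le_right _ _).trans (min_le_left _ _))).le
    rw [le_div_iff₀ (by linarith)] at this
    linarith
  have hεc : ε ≤ c / 2 := (hε.2.trans_le ((min_le_right _ _).trans (min_le_right _ _))).le
  obtain ⟨hgood, hkg⟩ := hNc ε hεε₁
  have hstep := stepHyp_nfSeq hbd hM₀ hM₀M hK₁.ge hKM hε0 hεD hgood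
  have h2c : 2 ≤ c / ε := by rw [le_div_iff₀ hε0]; linarith
  set m := ⌊c / ε⌋₊ with hm
  have hm2 : 2 ≤ m := Nat.le_floor (by exact_mod_cast h2c)
  have hmc : (m : ℝ) ≤ c / ε := Nat.floor_le (by positivity)
  have hmc' : c / ε < m + 1 := Nat.lt_floor_add_one _
  have hm1 : ((m - 1 : ℕ) : ℝ) = m - 1 := by push_cast [Nat.cast_sub (by omega : 1 ≤ m)]; ring
  have hmK : (m : ℝ) * (K₁ * ε) ≤ K / 2 := by
    calc (m : ℝ) * (K₁ * ε) ≤ c / ε * (K₁ * ε) := by gcongr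
      _ = K / 2 := by rw [← hcK]; field_simp
  have hKε : 0 < K₁ * ε := by positivity
  have hmK' : ((m - 1 : ℕ) : ℝ) * (K₁ * ε) ≤ K / 2 := by rw [hm1]; linarith
  have hr : nfRadius K K₁ ε m = nfRadius K K₁ ε (m - 1 + 1) := by
    rw [Nat.sub_add_cancel (by omega : 1 ≤ m)]
  have hrm : 3 * K / 2 ≤ nfRadius K K₁ ε (m - 1 + 1) := by
    rw [nfRadius_succ]; linarith
  refine ⟨⟨rfl, ?_⟩, by rw [hr]; linarith, if_neg (by omega : ¬ m ≤ 1), ?_⟩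
  · intro k hk _
    obtain ⟨j, rfl⟩ : ∃ j, k = j + 1 := ⟨k - 1, by omega⟩
    obtain ⟨h, hcj, -⟩ := hstep j
    have := isNormalFormStep_realMap
      (N := if j + 1 ≤ 1 then kgNonlinearity f ε else realMap (nfSeq K K₁ ε (Nc ε) (j + 1 - 1)))
      h hcj ?_
    · beta_reduce
      rw [if_neg (by omega : ¬ j + 1 + 1 ≤ 1)]
      exact this
    · intro Z hZ
      split_ifs with hj
      · obtain rfl : j = 0 := by omega
        refine hkg Z ?_
        rw [nfRadius_succ] at hZ
        simpa using hZ
      · rfl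
  · obtain ⟨h, -, hd⟩ := hstep (m - 1)
    have hsub : sumBall CX CV (3 * K / 2) ⊆ sumBall CX CV (nfRadius K K₁ ε (m - 1 + 1)) :=
      sumBall_mono hrm
    have hz : nfSeq K K₁ ε (Nc ε) (m - 1) 0 = 0 :=
      nfSeq_zero hbd hM₀ hM₀M hK₁.ge hKM hε0 hεD hgood (m - 1) (by linarith)
    refine ⟨fun Z hZ => h.smooth Z (hsub hZ),
      fun Z hZ => (h.le_M Z (hsub hZ)).trans (le_max_left _ _), fun q hq => ?_, hz, ?_⟩
    · refine (h.le_Γ q (hq.trans_le hrm)).trans ?_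
      have := half_pow_le_exp hc0 hε0 (j := m - 1) (by rw [hm1]; linarith)
      calc M₀ * ε / 2 ^ (m - 1) = M₀ * ε * (1 / 2 ^ (m - 1)) := by ring
        _ ≤ M₀ * ε * (4 * Real.exp (-(c * Real.log √2) / ε)) := by gcongr
        _ = 4 * M₀ * ε * Real.exp (-(c * Real.log √2) / ε) := by ring
        _ ≤ _ := by
          gcongr
          exact (le_max_left _ _).trans (le_max_right _ _)
    · have hin : ∀ y ∈ Metric.closedBall (0 : CX × CV) (K / 2), y ∈ sumBall CX CV (3 * K / 2) := by
        intro y hy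
        have hy' : ‖y‖ ≤ K / 2 := by simpa using hy
        change ‖y.1‖ + ‖y.2‖ < 3 * K / 2
        linarith [norm_fst_le y, norm_snd_le y]
      have hd1 : ∀ y ∈ Metric.closedBall (0 : CX × CV) (K / 2),
          DifferentiableAt ℂ (nfSeq K K₁ ε (Nc ε) (m - 1)) y := fun y hy =>
        (h.smooth y (hsub (hin y hy))).differentiableAt (by simp)
      have hd2 : ∀ y ∈ Metric.closedBall (0 : CX × CV) (K / 2), DifferentiableAt ℂ (Nc ε) y :=
        fun y hy => (hgood.smooth y
          (sumBall_mono (by linarith) (hin y hy))).differentiableAt (by simp)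
      have e0 : (0 : CX × CV) ∈ Metric.closedBall (0 : CX × CV) (K / 2) := by
        simp; positivity
      -- The final and the initial nonlinearity differ by `D ε` on a fixed ball, hence their
      -- derivatives at the origin by a multiple of `ε`.
      have e1 := norm_fderiv_le_of_closedBall (f := nfSeq K K₁ ε (Nc ε) (m - 1) - Nc ε) (x := 0)
        (τ := K / 2) (C := D * ε) (by positivity) (fun y hy => (hd1 y hy).sub (hd2 y hy))
        (fun y hy => (hd y (hsub (hin y hy))).trans
          (mul_le_of_le_one_right (by positivity) (by
            have : (0 : ℝ) ≤ 1 / 2 ^ (m - 1) := by positivity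
            linarith)))
      rw [fderiv_sub (hd1 0 e0) (hd2 0 e0)] at e1
      have e2 := norm_add_le (fderiv ℂ (nfSeq K K₁ ε (Nc ε) (m - 1)) 0 - fderiv ℂ (Nc ε) 0)
        (fderiv ℂ (Nc ε) 0)
      rw [sub_add_cancel] at e2
      have e3 : D * ε / (K / 2) + M₀ * ε = (M₀ + 2 * D / K) * ε := by field_simp; ring
      calc _ ≤ D * ε / (K / 2) + M₀ * ε := e2.trans (add_le_add e1 hgood.fderiv_le)
        _ = (M₀ + 2 * D / K) * ε := e3
        _ ≤ _ := by
          gcongr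
          exact (le_max_right _ _).trans (le_max_right _ _)

end
end KleinGordon

namespace KleinGordon
noncomputable section

open scoped ContDiff Topology
open MeasureTheory

/-! ### Bounds of real derivatives of holomorphic maps -/

section CauchyBounds

universe u v

variable {E : Type u} [NormedAddCommGroup E] [NormedSpace ℂ E] [NormedSpace ℝ E]
  [IsScalarTower ℝ ℂ E] {V : Type v} [NormedAddCommGroup V] [NormedSpace ℝ V]

/-- The map `A ↦ T ∘ A ∘ ι` from complex linear to real linear maps. -/
def sandwich {F : Type*} [NormedAddCommGroup F] [NormedSpace ℂ F] [NormedSpace ℝ F]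
    [IsScalarTower ℝ ℂ F] {W : Type*} [NormedAddCommGroup W] [NormedSpace ℝ W] (ι : V →L[ℝ] E)
    (T : F →L[ℝ] W) : (E →L[ℂ] F) →L[ℝ] V →L[ℝ] W :=
  ContinuousLinearMap.compL ℝ V F W T ∘L
    (ContinuousLinearMap.compL ℝ V E F).flip ι ∘L ContinuousLinearMap.restrictScalarsL ℂ E F ℝ ℝ

section

variable {F : Type*} [NormedAddCommGroup F] [NormedSpace ℂ F] [NormedSpace ℝ F]
    [IsScalarTower ℝ ℂ F] {W : Type*} [NormedAddCommGroup W] [NormedSpace ℝ W]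

theorem sandwich_apply (ι : V →L[ℝ] E) (T : F →L[ℝ] W) (B : E →L[ℂ] F) (v : V) :
    sandwich ι T B v = T (B (ι v)) := rfl

theorem norm_sandwich_le {ι : V →L[ℝ] E} {T : F →L[ℝ] W} (hι : ‖ι‖ ≤ 1) (hT : ‖T‖ ≤ 1) :
    ‖sandwich ι T‖ ≤ 1 := by
  refine ContinuousLinearMap.opNorm_le_bound _ zero_le_one fun B => ?_
  refine ContinuousLinearMap.opNorm_le_bound _ (by positivity) fun v => ?_
  rw [sandwich_apply, one_mul]
  calc ‖T (B (ι v))‖ ≤ 1 * ‖B (ι v)‖ := T.le_of_opNorm_le hT _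
    _ = ‖B (ι v)‖ := one_mul _
    _ ≤ ‖B‖ * ‖ι v‖ := B.le_opNorm _
    _ ≤ ‖B‖ * (1 * ‖v‖) := by gcongr; exact ι.le_of_opNorm_le hι _
    _ = ‖B‖ * ‖v‖ := by rw [one_mul]

theorem hasFDerivAt_sandwich {ι : V →L[ℝ] E} {T : F →L[ℝ] W} {f : E → F} {x : V}
    (hf : DifferentiableAt ℂ f (ι x)) :
    HasFDerivAt (fun z => T (f (ι z))) (sandwich ι T (fderiv ℂ f (ι x))) x :=
  T.hasFDerivAt.comp x ((hf.hasFDerivAt.restrictScalars ℝ).comp x ι.hasFDerivAt)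

theorem contDiffAt_sandwich {ι : V →L[ℝ] E} {T : F →L[ℝ] W} {f : E → F} {x : V}
    (hf : ContDiffAt ℂ ω f (ι x)) : ContDiffAt ℝ ω (fun z => T (f (ι z))) x :=
  T.contDiff.contDiffAt.comp x ((hf.restrict_scalars ℝ).comp x ι.contDiff.contDiffAt)

end

/-- Induction over all target spaces at once: differentiating replaces `f` by its complex derivative
and `T` by `sandwich ι T`, shrinks the ball by `τ` and costs a factor `1 / τ`. The spaces of linear
maps stay in the universes of `E` and `V`, which keeps the induction hypothesis applicable. -/
theorem norm_iteratedFDeriv_sandwich_le {τ : ℝ} (hτ : 0 < τ) {ι : V →L[ℝ] E} (hι : ‖ι‖ ≤ 1) (x : V)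
    (i : ℕ) : ∀ {F : Type u} [NormedAddCommGroup F] [NormedSpace ℂ F] [NormedSpace ℝ F]
    [IsScalarTower ℝ ℂ F] {W : Type v} [NormedAddCommGroup W] [NormedSpace ℝ W] {T : F →L[ℝ] W}
    (_ : ‖T‖ ≤ 1) {f : E → F} {M : ℝ}
    (_ : ∀ y ∈ Metric.closedBall (ι x) (i * τ), ContDiffAt ℂ ω f y)
    (_ : ∀ y ∈ Metric.closedBall (ι x) (i * τ), ‖f y‖ ≤ M),
    ‖iteratedFDeriv ℝ i (fun z => T (f (ι z))) x‖ ≤ M / τ ^ i := by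
  induction i with
  | zero =>
    intro F _ _ _ _ W _ _ T hT f M _ hM
    rw [norm_iteratedFDeriv_zero, pow_zero, div_one]
    refine (T.le_of_opNorm_le hT _).trans ?_
    rw [one_mul]
    exact hM _ (by simp)
  | succ i ih =>
    intro F _ _ _ _ W _ _ T hT f M hf hM
    rw [← norm_iteratedFDeriv_fderiv]
    have hsub : ∀ {y}, y ∈ Metric.closedBall (ι x) (i * τ) → ∀ {w}, w ∈ Metric.closedBall y τ →
        w ∈ Metric.closedBall (ι x) ((i + 1 : ℕ) * τ) := by
      intro y hy w hw
      rw [Metric.mem_closedBall] at *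
      have := dist_triangle w y (ι x)
      push_cast
      linarith
    have e : fderiv ℝ (fun z => T (f (ι z))) =ᶠ[𝓝 x]
        fun z => sandwich ι T (fderiv ℂ f (ι z)) := by
      have : ι ⁻¹' Metric.ball (ι x) ((i + 1 : ℕ) * τ) ∈ 𝓝 x :=
        ι.continuous.continuousAt.preimage_mem_nhds (Metric.ball_mem_nhds _ (by positivity))
      filter_upwards [this] with z hz
      exact (hasFDerivAt_sandwich
        ((hf _ (Metric.ball_subset_closedBall hz)).differentiableAt (by simp))).fderiv
    rw [(Filter.EventuallyEq.iteratedFDeriv ℝ e i).eq_of_nhds, pow_succ', ← div_div]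
    refine ih (norm_sandwich_le hι hT) (fun y hy => ?_) (fun y hy => ?_)
    · exact (hf y (hsub hy (Metric.mem_closedBall_self hτ.le))).fderiv_right (by simp)
    · exact norm_fderiv_le_of_closedBall hτ
        (fun w hw => (hf w (hsub hy hw)).differentiableAt (by simp)) (fun w hw => hM w (hsub hy hw))

end CauchyBounds

/-! ### Integrals depending on a parameter -/

section ParametricIntegral

variable {V W : Type*} [NormedAddCommGroup V] [NormedSpace ℝ V] [NormedAddCommGroup W]
  [NormedSpace ℝ W]

theorem contDiffAt_fderiv_param {g : ℝ → V → W} {s : ℝ} {z : V}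
    (h : ContDiffAt ℝ ω (fun p : ℝ × V => g p.1 p.2) (s, z)) :
    ContDiffAt ℝ ω (fun p : ℝ × V => fderiv ℝ (g p.1) p.2) (s, z) := by
  refine ContDiffAt.fderiv (n := ω) (f := fun (p : ℝ × V) w => g p.1 w) ?_ contDiffAt_snd (by simp)
  exact ContDiffAt.comp (𝕜 := ℝ) ((s, z), z) (g := fun p : ℝ × V => g p.1 p.2)
    (f := fun q : (ℝ × V) × V => (q.1.1, q.2)) h (by fun_prop)

theorem aestronglyMeasurable_of_Icc {W : Type*} [NormedAddCommGroup W] {φ : ℝ → W} (hφ : ContinuousOn φ (Icc 0 1)) :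
    AEStronglyMeasurable φ (volume.restrict (uIoc (0 : ℝ) 1)) := by
  rw [uIoc_of_le zero_le_one]
  exact (hφ.mono Ioc_subset_Icc_self).aestronglyMeasurable measurableSet_Ioc

theorem norm_integral_le_of_Icc {φ : ℝ → W} {C : ℝ} (h : ∀ s ∈ Icc (0 : ℝ) 1, ‖φ s‖ ≤ C) :
    ‖∫ s in (0 : ℝ)..1, φ s‖ ≤ C := by
  have := intervalIntegral.norm_integral_le_of_norm_le_const (a := 0) (b := 1) (f := φ) (C := C)
    fun s hs => by
      rw [uIoc_of_le zero_le_one] at hs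
      exact h s ⟨hs.1.le, hs.2⟩
  simpa using this

theorem hasFDerivAt_integral_param [CompleteSpace W] {g : ℝ → V → W} {U : Set V} (hU : IsOpen U)
    (hg : ∀ s ∈ Icc (0 : ℝ) 1, ∀ z ∈ U, ContDiffAt ℝ ω (fun p : ℝ × V => g p.1 p.2) (s, z)) {C : ℝ}
    (hC : ∀ s ∈ Icc (0 : ℝ) 1, ∀ z ∈ U, ‖fderiv ℝ (g s) z‖ ≤ C) {x : V} (hx : x ∈ U) :
    HasFDerivAt (fun z => ∫ s in (0 : ℝ)..1, g s z) (∫ s in (0 : ℝ)..1, fderiv ℝ (g s) x) x := by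
  have hI : ∀ s ∈ uIoc (0 : ℝ) 1, s ∈ Icc (0 : ℝ) 1 := fun s hs => by
    rw [uIoc_of_le zero_le_one] at hs
    exact ⟨hs.1.le, hs.2⟩
  have hsl : ∀ (s : ℝ) (z : V), ContDiffAt ℝ ω (fun s : ℝ => (s, z)) s := fun s z => by fun_prop
  have hcont : ∀ z ∈ U, ContinuousOn (fun s => g s z) (Icc 0 1) := fun z hz s hs =>
    ((hg s hs z hz).continuousAt.comp (f := fun s : ℝ => (s, z))
      (hsl s z).continuousAt).continuousWithinAt
  have hcont' : ContinuousOn (fun s => fderiv ℝ (g s) x) (Icc 0 1) := fun s hs =>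
    ((contDiffAt_fderiv_param (hg s hs x hx)).continuousAt.comp (f := fun s : ℝ => (s, x))
      (hsl s x).continuousAt).continuousWithinAt
  refine intervalIntegral.hasFDerivAt_integral_of_dominated_of_fderiv_le
    (F' := fun z s => fderiv ℝ (g s) z) (bound := fun _ => C) (s := U) (hU.mem_nhds hx) ?_ ?_ ?_ ?_
    ?_ ?_
  · filter_upwards [hU.mem_nhds hx] with z hz using aestronglyMeasurable_of_Icc (hcont z hz)
  · refine ContinuousOn.intervalIntegrable ?_
    rw [uIcc_of_le zero_le_one]
    exact hcont x hx
  · exact aestronglyMeasurable_of_Icc hcont'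
  · exact Filter.Eventually.of_forall fun s hs z hz => hC s (hI s hs) z hz
  · exact intervalIntegrable_const
  · refine Filter.Eventually.of_forall fun s hs z hz => ?_
    have : ContDiffAt ℝ ω (g s) z :=
      (hg s (hI s hs) z hz).comp (f := fun z : V => (s, z)) z (by fun_prop)
    exact (this.differentiableAt (by simp)).hasFDerivAt

-- The third order bound is used to differentiate the second derivative under the integral, which
-- yields its continuity.
set_option maxSynthPendingDepth 4 in
theorem c2BoundedOn_integral [CompleteSpace W] {g : ℝ → V → W} {U : Set V} (hU : IsOpen U)
    (hg : ∀ s ∈ Icc (0 : ℝ) 1, ∀ z ∈ U, ContDiffAt ℝ ω (fun p : ℝ × V => g p.1 p.2) (s, z)) {C : ℝ}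
    (hC : ∀ s ∈ Icc (0 : ℝ) 1, ∀ z ∈ U, ∀ i ≤ 3, ‖iteratedFDeriv ℝ i (g s) z‖ ≤ C) :
    C2BoundedOn (fun z => ∫ s in (0 : ℝ)..1, g s z) U C := by
  have hg₁ := fun s hs z hz => contDiffAt_fderiv_param (hg s hs z hz)
  have hg₂ := fun s hs z hz =>
    contDiffAt_fderiv_param (g := fun s z => fderiv ℝ (g s) z) (hg₁ s hs z hz)
  have b0 : ∀ s ∈ Icc (0 : ℝ) 1, ∀ z ∈ U, ‖g s z‖ ≤ C := fun s hs z hz => by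
    simpa using hC s hs z hz 0 (by norm_num)
  have b1 : ∀ s ∈ Icc (0 : ℝ) 1, ∀ z ∈ U, ‖fderiv ℝ (g s) z‖ ≤ C := fun s hs z hz => by
    have := hC s hs z hz 1 (by norm_num)
    rwa [← norm_iteratedFDeriv_fderiv, norm_iteratedFDeriv_zero] at this
  have b2 : ∀ s ∈ Icc (0 : ℝ) 1, ∀ z ∈ U, ‖fderiv ℝ (fderiv ℝ (g s)) z‖ ≤ C := fun s hs z hz => by
    have := hC s hs z hz 2 (by norm_num)
    rwa [← norm_iteratedFDeriv_fderiv, ← norm_iteratedFDeriv_fderiv,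
      norm_iteratedFDeriv_zero] at this
  have b3 : ∀ s ∈ Icc (0 : ℝ) 1, ∀ z ∈ U, ‖fderiv ℝ (fderiv ℝ (fderiv ℝ (g s))) z‖ ≤ C :=
    fun s hs z hz => by
    have := hC s hs z hz 3 (by norm_num)
    rwa [← norm_iteratedFDeriv_fderiv, ← norm_iteratedFDeriv_fderiv, ← norm_iteratedFDeriv_fderiv,
      norm_iteratedFDeriv_zero] at this
  refine c2BoundedOn_of_hasFDerivAt hU
    (fun x hx => hasFDerivAt_integral_param hU hg b1 hx)
    (fun x hx => hasFDerivAt_integral_param hU hg₁ b2 hx)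
    (fun x hx => (hasFDerivAt_integral_param hU hg₂ b3 hx).continuousAt.continuousWithinAt)
    (fun x hx => norm_integral_le_of_Icc fun s hs => b0 s hs x hx) (fun x hx => norm_integral_le_of_Icc fun s hs => b1 s hs x hx)
    (fun x hx => norm_integral_le_of_Icc fun s hs => b2 s hs x hx)

end ParametricIntegral

end
end KleinGordon

/-! ### The almost invariant form of the final system. -/

namespace KleinGordon
noncomputable section

open scoped ContDiff Topology
open NFData.StepHyp (sumBall_mono)

theorem norm_toC_le : ‖toC‖ ≤ 1 :=
  toC.opNorm_le_bound zero_le_one fun Z => by rw [norm_toC, one_mul]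

theorem norm_reC_opNorm_le : ‖reC‖ ≤ 1 :=
  reC.opNorm_le_bound zero_le_one fun Z => by rw [one_mul]; exact norm_reC_le Z

theorem isOpen_phaseBall (ρ : ℝ) : IsOpen (phaseBall ρ) := isOpen_sumBall X Y₁ ρ

section

variable {K M ε α : ℝ} {n : CX × CV → CX × CV}

theorem closedBall_subset_sumBall {Z W : CX × CV} {a b ρ : ℝ} (hZ : Z ∈ sumBall CX CV a)
    (hW : W ∈ Metric.closedBall Z b) (h : a + 2 * b ≤ ρ) : W ∈ sumBall CX CV ρ := by
  have hW' : ‖W - Z‖ ≤ b := mem_closedBall_iff_norm.mp hW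
  exact mem_sumBall_of_norm_sub_le hZ ((norm_fst_le (W - Z)).trans hW')
    ((norm_snd_le (W - Z)).trans hW') (by linarith)

/-- The bound for the first three derivatives of the system in the almost invariant form. -/
def derivBound (K M : ℝ) : ℝ := M * (1 + 20 / K) ^ 4

/-- Four Cauchy estimates are the worst case: three derivatives of a map which is itself a
derivative. -/
theorem div_pow_le_derivBound (hK : 0 < K) (hM : 0 ≤ M) {i : ℕ} (hi : i ≤ 4) :
    M / (K / 20) ^ i ≤ derivBound K M := by
  have h0 : 0 ≤ 20 / K := by positivity
  rw [derivBound, div_eq_mul_inv, ← inv_pow, inv_div]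
  gcongr
  calc (20 / K) ^ i ≤ (1 + 20 / K) ^ i := by gcongr; linarith
    _ ≤ (1 + 20 / K) ^ 4 := pow_le_pow_right₀ (by linarith) hi

/-- Cauchy balls of radius `K / 20` in succession reach at most `K / 4` in the maximum norm, hence
`K / 2` in the sum norm: from the ball of radius `K` they stay within `3 K / 2`. -/
theorem mul_pow_le {K : ℝ} (hK : 0 < K) {i : ℕ} (hi : i ≤ 5) : i * (K / 20) ≤ K / 4 := by
  have : (i : ℝ) ≤ 5 := by exact_mod_cast hi
  nlinarith

theorem IsAlmostInvariant.contDiffAt_realMap (h : IsAlmostInvariant (3 * K / 2) M ε α n) (hK : 0 < K)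
    {Z : Phase} (hZ : Z ∈ phaseBall K) : ContDiffAt ℝ ω (realMap n) Z :=
  contDiffAt_sandwich (ι := toC) (T := reC)
    (h.smooth _ (sumBall_mono (by linarith) (toC_mem.mpr hZ)))

theorem IsAlmostInvariant.norm_iteratedFDeriv_realMap_le (h : IsAlmostInvariant (3 * K / 2) M ε α n)
    (hK : 0 < K) (hM : 0 ≤ M) {Z : Phase} (hZ : Z ∈ phaseBall K) {i : ℕ} (hi : i ≤ 3) :
    ‖iteratedFDeriv ℝ i (realMap n) Z‖ ≤ derivBound K M := by
  have hsub : ∀ y ∈ Metric.closedBall (toC Z) (i * (K / 20)), y ∈ sumBall CX CV (3 * K / 2) :=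
    fun y hy => closedBall_subset_sumBall (toC_mem.mpr hZ) hy
      (by linarith [mul_pow_le hK (hi.trans (by norm_num : 3 ≤ 5))])
  refine (norm_iteratedFDeriv_sandwich_le (ι := toC) (T := reC) (τ := K / 20) (by positivity)
    norm_toC_le Z i norm_reC_opNorm_le (fun y hy => h.smooth y (hsub y hy))
    (fun y hy => h.le y (hsub y hy))).trans (div_pow_le_derivBound hK hM (by omega))

theorem IsAlmostInvariant.realMap_zero (h : IsAlmostInvariant (3 * K / 2) M ε α n) :
    realMap n 0 = 0 := by
  simp [realMap, h.zero]

theorem zero_mem_sumBall (hK : 0 < K) : (0 : CX × CV) ∈ sumBall CX CV K := by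
  simpa [sumBall] using hK

theorem IsAlmostInvariant.norm_fderiv_realMap_le (h : IsAlmostInvariant (3 * K / 2) M ε α n)
    (hK : 0 < K) : ‖fderiv ℝ (realMap n) 0‖ ≤ M * ε := by
  have hd : DifferentiableAt ℂ n (toC 0) := by
    rw [map_zero]
    exact (h.smooth 0 (zero_mem_sumBall (by positivity))).differentiableAt (by simp)
  have := hasFDerivAt_sandwich (ι := toC) (T := reC) hd
  rw [show realMap n = fun z => reC (n (toC z)) from rfl, this.fderiv, map_zero]
  refine ((sandwich toC reC).le_of_opNorm_le (norm_sandwich_le norm_toC_le norm_reC_opNorm_le)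
    _).trans ?_
  rw [one_mul]
  exact h.fderiv_le

/-- The map `(W^h, W^c) ↦ (W^h, s W^c)`. -/
def scaleC (s : ℝ) : Phase →L[ℝ] Phase :=
  (ContinuousLinearMap.fst ℝ X Y₁).prod (s • ContinuousLinearMap.snd ℝ X Y₁)

theorem scaleC_apply (s : ℝ) (Z : Phase) : scaleC s Z = (Z.1, s • Z.2) := rfl

theorem norm_toC_scaleC_le {s : ℝ} (hs : s ∈ Icc (0 : ℝ) 1) : ‖toC ∘L scaleC s‖ ≤ 1 := by
  refine ContinuousLinearMap.opNorm_le_bound _ zero_le_one fun Z => ?_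
  rw [ContinuousLinearMap.comp_apply, norm_toC, one_mul, scaleC_apply]
  refine max_le (norm_fst_le Z) ?_
  rw [norm_smul, Real.norm_of_nonneg hs.1]
  exact (mul_le_of_le_one_left (norm_nonneg _) hs.2).trans (norm_snd_le Z)

theorem scaleC_mem {ρ s : ℝ} (hs : s ∈ Icc (0 : ℝ) 1) {Z : Phase} (hZ : Z ∈ phaseBall ρ) :
    scaleC s Z ∈ phaseBall ρ := by
  change ‖Z.1‖ + ‖s • Z.2‖ < ρ
  rw [norm_smul, Real.norm_of_nonneg hs.1]
  have hZ' : ‖Z.1‖ + ‖Z.2‖ < ρ := hZ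
  linarith [mul_le_of_le_one_left (norm_nonneg Z.2) hs.2]

/-- The elliptic block `A ↦ P_c A |_{W^c}` of a linear map. -/
def ellipticBlock : (CX × CV →L[ℂ] CX × CV) →L[ℝ] Y₁ →L[ℝ] Y₁ :=
  sandwich (toC ∘L ContinuousLinearMap.inr ℝ X Y₁) (ContinuousLinearMap.snd ℝ X Y₁ ∘L reC)

theorem norm_snd_reC_le : ‖ContinuousLinearMap.snd ℝ X Y₁ ∘L reC‖ ≤ 1 :=
  ContinuousLinearMap.opNorm_le_bound _ zero_le_one fun Z => by
    rw [one_mul]; exact (norm_snd_le (reC Z)).trans (norm_reC_le Z)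

theorem norm_fst_reC_le : ‖ContinuousLinearMap.fst ℝ X Y₁ ∘L reC‖ ≤ 1 :=
  ContinuousLinearMap.opNorm_le_bound _ zero_le_one fun Z => by
    rw [one_mul]; exact (norm_fst_le (reC Z)).trans (norm_reC_le Z)

theorem norm_ellipticBlock_le : ‖ellipticBlock‖ ≤ 1 := by
  refine norm_sandwich_le ?_ norm_snd_reC_le
  refine ContinuousLinearMap.opNorm_le_bound _ zero_le_one fun y => ?_
  rw [ContinuousLinearMap.comp_apply, norm_toC, one_mul]
  simp [Prod.norm_def]

/-- The elliptic block of the derivative of `n` at `(W^h, s W^c)`. -/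
def blockDeriv (n : CX × CV → CX × CV) (s : ℝ) (Z : Phase) : Y₁ →L[ℝ] Y₁ :=
  ellipticBlock (fderiv ℂ n ((toC ∘L scaleC s) Z))

theorem toC_scaleC_mem {s : ℝ} (hs : s ∈ Icc (0 : ℝ) 1) {Z : Phase}
    (hZ : Z ∈ phaseBall K) : (toC ∘L scaleC s) Z ∈ sumBall CX CV K :=
  toC_mem.mpr (scaleC_mem hs hZ)

theorem IsAlmostInvariant.norm_iteratedFDeriv_blockDeriv_le
    (h : IsAlmostInvariant (3 * K / 2) M ε α n) (hK : 0 < K) (hM : 0 ≤ M) {s : ℝ}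
    (hs : s ∈ Icc (0 : ℝ) 1) {Z : Phase} (hZ : Z ∈ phaseBall K) {i : ℕ} (hi : i ≤ 3) :
    ‖iteratedFDeriv ℝ i (blockDeriv n s) Z‖ ≤ derivBound K M := by
  have hK' : 0 < K / 20 := by positivity
  have hin := toC_scaleC_mem hs hZ
  have hsub : ∀ y ∈ Metric.closedBall ((toC ∘L scaleC s) Z) (i * (K / 20)),
      ∀ w ∈ Metric.closedBall y (K / 20), w ∈ sumBall CX CV (3 * K / 2) := by
    intro y hy w hw
    refine closedBall_subset_sumBall (b := (i + 1 : ℕ) * (K / 20)) hin ?_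
      (by linarith [mul_pow_le hK (by omega : i + 1 ≤ 5)])
    rw [Metric.mem_closedBall] at *
    have := dist_triangle w y ((toC ∘L scaleC s) Z)
    rw [Nat.cast_add_one]
    linarith
  have key := norm_iteratedFDeriv_sandwich_le (ι := toC ∘L scaleC s) (T := ellipticBlock)
    (f := fderiv ℂ n) (M := M / (K / 20)) hK' (norm_toC_scaleC_le hs) Z i norm_ellipticBlock_le
    (fun y hy => (h.smooth y (hsub y hy y (Metric.mem_closedBall_self hK'.le))).fderiv_right
      (by simp))
    (fun y hy => norm_fderiv_le_of_closedBall hK'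
        (fun w hw => (h.smooth w (hsub y hy w hw)).differentiableAt (by simp))
        (fun w hw => h.le w (hsub y hy w hw)))
  rw [div_div, ← pow_succ'] at key
  exact key.trans (div_pow_le_derivBound hK hM (by omega))

theorem IsAlmostInvariant.contDiffAt_blockDeriv
    (h : IsAlmostInvariant (3 * K / 2) M ε α n) (hK : 0 < K) {s : ℝ}
    (hs : s ∈ Icc (0 : ℝ) 1) {Z : Phase} (hZ : Z ∈ phaseBall K) :
    ContDiffAt ℝ ω (fun p : ℝ × Phase => blockDeriv n p.1 p.2) (s, Z) := by
  have h1 : ContDiffAt ℝ ω (fderiv ℂ n) ((toC ∘L scaleC s) Z) :=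
    ((h.smooth _ (sumBall_mono (by linarith) (toC_scaleC_mem hs hZ))).fderiv_right
      (m := ω) (by simp)).restrict_scalars ℝ
  have h2 : ContDiff ℝ ω (fun p : ℝ × Phase => (toC ∘L scaleC p.1) p.2) := by
    change ContDiff ℝ ω (fun p : ℝ × Phase => toC (p.2.1, p.1 • p.2.2))
    fun_prop
  exact ellipticBlock.contDiff.contDiffAt.comp (s, Z)
    (ContDiffAt.comp (𝕜 := ℝ) (s, Z) (g := fderiv ℂ n)
      (f := fun p : ℝ × Phase => (toC ∘L scaleC p.1) p.2) h1 h2.contDiffAt)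

/-- Fundamental theorem of calculus along `s ↦ (W^h, s W^c)`: the integral of the elliptic block is
`Ḡ`, and the value at `s = 0` is `γ`. -/
theorem IsAlmostInvariant.realMap_snd_eq
    (h : IsAlmostInvariant (3 * K / 2) M ε α n) (hK : 0 < K) {Z : Phase} (hZ : Z ∈ phaseBall K) :
    (realMap n Z).2 = (∫ s in (0 : ℝ)..1, blockDeriv n s Z) Z.2
      + (ContinuousLinearMap.snd ℝ X Y₁ ∘L reC) (n (toC (Z.1, 0))) := by
  have hsl : ∀ s : ℝ, ContDiffAt ℝ ω (fun s : ℝ => (s, Z)) s := fun s => by fun_prop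
  have hcont : ContinuousOn (fun s => blockDeriv n s Z) (uIcc 0 1) := by
    rw [uIcc_of_le zero_le_one]
    exact fun s hs => ((h.contDiffAt_blockDeriv hK hs hZ).continuousAt.comp
      (f := fun s : ℝ => (s, Z)) (hsl s).continuousAt).continuousWithinAt
  have hint : IntervalIntegrable (fun s => blockDeriv n s Z) MeasureTheory.volume 0 1 :=
    hcont.intervalIntegrable
  rw [ContinuousLinearMap.intervalIntegral_apply hint]
  have hder : ∀ s ∈ uIcc (0 : ℝ) 1, HasDerivAt
      (fun s : ℝ => (ContinuousLinearMap.snd ℝ X Y₁ ∘L reC) (n (toC (scaleC s Z))))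
      (blockDeriv n s Z Z.2) s := by
    intro s hs
    rw [uIcc_of_le zero_le_one] at hs
    have hd : DifferentiableAt ℂ n (toC (scaleC s Z)) :=
      (h.smooth _ (sumBall_mono (by linarith) (toC_scaleC_mem hs hZ))).differentiableAt (by simp)
    have h1 : HasDerivAt (fun s : ℝ => scaleC s Z) (0, Z.2) s := by
      have := (hasDerivAt_const s Z.1).prodMk ((hasDerivAt_id s).smul_const Z.2)
      simpa [scaleC_apply] using this
    exact (hasFDerivAt_sandwich (ι := toC) (T := ContinuousLinearMap.snd ℝ X Y₁ ∘L reC)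
      hd).comp_hasDerivAt s h1
  rw [intervalIntegral.integral_eq_sub_of_hasDerivAt hder
    (hcont.clm_apply continuousOn_const).intervalIntegrable]
  simp [scaleC_apply, realMap]

theorem norm_toCX_fst_le : ‖toCX ∘L ContinuousLinearMap.fst ℝ X Y₁‖ ≤ 1 :=
  ContinuousLinearMap.opNorm_le_bound _ zero_le_one fun Z => by
    have := norm_toC (Z.1, 0)
    rw [one_mul]
    refine (norm_fst_le (toC (Z.1, 0))).trans (this.le.trans ?_)
    simp [Prod.norm_def]

theorem norm_reV_opNorm_le : ‖reV‖ ≤ 1 :=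
  ContinuousLinearMap.opNorm_le_bound _ zero_le_one fun y => by
    have := norm_reC_le (0, y)
    rw [one_mul]
    refine (norm_snd_le (reC (0, y))).trans (this.trans ?_)
    simp [Prod.norm_def]

/-- The exponentially small bound on `γ` holds on a larger ball, so Cauchy's estimates pass it on to
the derivatives; the factor `e^{-α}` then cancels it. -/
theorem IsAlmostInvariant.c2BoundedOn_gam (h : IsAlmostInvariant (3 * K / 2) M ε α n) (hK : 0 < K)
    (hM : 0 ≤ M) (hε : 0 < ε) :
    C2BoundedOn (fun Z : Phase => Real.exp (-α) •
      reV (NFData.gam n ((toCX ∘L ContinuousLinearMap.fst ℝ X Y₁) Z))) (phaseBall K)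
      (derivBound K M * ε) := by
  have hK' : 0 < K / 20 := by positivity
  set ι := toCX ∘L ContinuousLinearMap.fst ℝ X Y₁ with hι
  have hsm : ∀ q : CX, ‖q‖ < 3 * K / 2 → ContDiffAt ℂ ω (NFData.gam n) q := by
    intro q hq
    have h1 : ContDiffAt ℂ ω n (q, 0) := h.smooth _ (by simpa [sumBall] using hq)
    exact contDiffAt_snd.comp q (ContDiffAt.comp (𝕜 := ℂ) q (g := n) (f := fun q : CX => (q, 0)) h1
      (by fun_prop))
  have hsub : ∀ Z ∈ phaseBall K, ∀ i : ℕ, i ≤ 2 → ∀ q ∈ Metric.closedBall (ι Z) (i * (K / 20)),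
      ‖q‖ < 3 * K / 2 := by
    intro Z hZ i hi q hq
    have h1 : ‖q - ι Z‖ ≤ i * (K / 20) := mem_closedBall_iff_norm.mp hq
    have h2 : ‖Z.1‖ + ‖Z.2‖ < K := hZ
    have h3 : ‖ι Z‖ ≤ ‖Z.1‖ := by
      have := norm_toC (Z.1, 0)
      refine (norm_fst_le (toC (Z.1, 0))).trans (this.le.trans ?_)
      simp [Prod.norm_def]
    have h4 := norm_add_le (q - ι Z) (ι Z)
    rw [sub_add_cancel] at h4
    linarith [mul_pow_le hK (hi.trans (by norm_num : 2 ≤ 5)), norm_nonneg Z.2]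
  have hcd : ∀ Z ∈ phaseBall K, ContDiffAt ℝ ω (fun Z => reV (NFData.gam n (ι Z))) Z :=
    fun Z hZ => contDiffAt_sandwich (hsm _ (hsub Z hZ 0 (by norm_num) _ (by simp)))
  refine ⟨fun Z hZ => (((hcd Z hZ).of_le le_top).const_smul _).contDiffWithinAt,
    fun Z hZ i hi => ?_⟩
  have key := norm_iteratedFDeriv_sandwich_le (ι := ι) (T := reV) hK' norm_toCX_fst_le Z i
    norm_reV_opNorm_le (fun q hq => hsm q (hsub Z hZ i hi q hq))
    (fun q hq => h.gam_le q (hsub Z hZ i hi q hq))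
  have e := iteratedFDeriv_const_smul_apply (i := i) (a := Real.exp (-α))
    (f := fun Z => reV (NFData.gam n (ι Z))) ((hcd Z hZ).of_le le_top)
  have e' : (Real.exp (-α) • fun Z => reV (NFData.gam n (ι Z)))
      = fun Z => Real.exp (-α) • reV (NFData.gam n (ι Z)) := rfl
  rw [e'] at e
  rw [e, norm_smul, Real.norm_of_nonneg (Real.exp_pos _).le]
  calc _ ≤ Real.exp (-α) * (M * ε * Real.exp α / (K / 20) ^ i) := by gcongr
    _ = Real.exp (-α) * Real.exp α * (M / (K / 20) ^ i * ε) := by ring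
    _ = M / (K / 20) ^ i * ε := by
      rw [← Real.exp_add, neg_add_cancel, Real.exp_zero, one_mul]
    _ ≤ _ := by
      gcongr
      exact div_pow_le_derivBound hK hM (by omega)

theorem IsAlmostInvariant.c2BoundedOn_fst (h : IsAlmostInvariant (3 * K / 2) M ε α n) (hK : 0 < K)
    (hM : 0 ≤ M) :
    C2BoundedOn (fun Z => (ContinuousLinearMap.fst ℝ X Y₁ ∘L reC) (n (toC Z))) (phaseBall K)
      (derivBound K M) := by
  have hK' : 0 < K / 20 := by positivity
  refine ⟨fun Z hZ => ?_, fun Z hZ i hi => ?_⟩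
  · exact ((contDiffAt_sandwich (ι := toC) (T := ContinuousLinearMap.fst ℝ X Y₁ ∘L reC)
      (h.smooth _ (sumBall_mono (by linarith) (toC_mem.mpr hZ)))).of_le le_top).contDiffWithinAt
  · have hsub : ∀ y ∈ Metric.closedBall (toC Z) (i * (K / 20)), y ∈ sumBall CX CV (3 * K / 2) :=
      fun y hy => closedBall_subset_sumBall (toC_mem.mpr hZ) hy
        (by linarith [mul_pow_le hK (hi.trans (by norm_num : 2 ≤ 5))])
    exact (norm_iteratedFDeriv_sandwich_le (ι := toC)
      (T := ContinuousLinearMap.fst ℝ X Y₁ ∘L reC) hK' norm_toC_le Z i norm_fst_reC_le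
      (fun y hy => h.smooth y (hsub y hy))
      (fun y hy => h.le y (hsub y hy))).trans (div_pow_le_derivBound hK hM (by omega))

theorem IsAlmostInvariant.norm_fderiv_fst_le (h : IsAlmostInvariant (3 * K / 2) M ε α n)
    (hK : 0 < K) :
    ‖fderiv ℝ (fun Z => (ContinuousLinearMap.fst ℝ X Y₁ ∘L reC) (n (toC Z))) 0‖ ≤ M * ε := by
  have hd : DifferentiableAt ℂ n (toC 0) := by
    rw [map_zero]
    exact (h.smooth 0 (zero_mem_sumBall (by positivity))).differentiableAt (by simp)
  have e := (hasFDerivAt_sandwich (ι := toC) (T := ContinuousLinearMap.fst ℝ X Y₁ ∘L reC) hd).fderiv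
  have b := ContinuousLinearMap.le_of_opNorm_le _ (norm_sandwich_le norm_toC_le norm_fst_reC_le)
    (fderiv ℂ n (toC 0))
  rw [one_mul] at b
  have hz : toC 0 = 0 := map_zero toC
  rw [hz] at b e
  exact (congrArg norm e).le.trans (b.trans h.fderiv_le)

theorem IsAlmostInvariant.norm_blockDeriv_zero_le (h : IsAlmostInvariant (3 * K / 2) M ε α n)
    (s : ℝ) : ‖blockDeriv n s 0‖ ≤ M * ε := by
  rw [blockDeriv, map_zero]
  refine (ellipticBlock.le_of_opNorm_le norm_ellipticBlock_le _).trans ?_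
  rw [one_mul]
  exact h.fderiv_le

/-- The almost invariant form of the transformed system. -/
theorem IsAlmostInvariant.hasAlmostInvariantForm
    (h : IsAlmostInvariant (3 * K / 2) M ε α n) (hK : 0 < K) (hM : 0 ≤ M) (hε : 0 < ε) :
    HasAlmostInvariantForm K (derivBound K M) ε α (realMap n) := by
  have hMd : M * ε ≤ derivBound K M * ε := by
    have := div_pow_le_derivBound hK hM (i := 0) (by norm_num)
    rw [pow_zero, div_one] at this
    gcongr
  refine ⟨fun Z => (ContinuousLinearMap.fst ℝ X Y₁ ∘L reC) (n (toC Z)),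
    fun Z => ∫ s in (0 : ℝ)..1, blockDeriv n s Z,
    fun Z => Real.exp (-α) • reV (NFData.gam n ((toCX ∘L ContinuousLinearMap.fst ℝ X Y₁) Z)),
    ?_, h.c2BoundedOn_fst hK hM, ?_, h.c2BoundedOn_gam hK hM hε, ?_, ?_,
    (h.norm_fderiv_fst_le hK).trans hMd, norm_integral_le_of_Icc fun s _ =>
      (h.norm_blockDeriv_zero_le s).trans hMd⟩
  · intro Z hZ
    refine Prod.ext rfl ?_
    change (realMap n Z).2 = (∫ s in (0 : ℝ)..1, blockDeriv n s Z) Z.2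
      + Real.exp α • Real.exp (-α) • reV (n (toCX Z.1, 0)).2
    have e : toC (Z.1, 0) = (toCX Z.1, 0) := Prod.ext rfl (map_zero toCV)
    rw [h.realMap_snd_eq hK hZ, smul_smul, ← Real.exp_add, add_neg_cancel, Real.exp_zero, one_smul,
      e]
    rfl
  · exact c2BoundedOn_integral (isOpen_phaseBall K)
      (fun s hs Z hZ => h.contDiffAt_blockDeriv hK hs hZ)
      (fun s hs Z hZ i hi => h.norm_iteratedFDeriv_blockDeriv_le hK hM hs hZ hi)
  · change (ContinuousLinearMap.fst ℝ X Y₁ ∘L reC) (n (toC 0)) = 0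
    rw [map_zero, h.zero, map_zero]
  · change Real.exp (-α) • reV (n ((toCX ∘L ContinuousLinearMap.fst ℝ X Y₁) 0, 0)).2 = 0
    rw [map_zero, show ((0, 0) : CX × CV) = 0 from rfl, h.zero, Prod.snd_zero, map_zero, smul_zero]

end

end
end KleinGordon

namespace KleinGordon
noncomputable section

open scoped ContDiff Topology

/-! ### The rotation group on `Y₁` -/

theorem rot_rot (x : X) : rot (rot x) = -x := by
  ext i; fin_cases i <;> simp [rot_apply]

/-- The plane rotation by the angle `θ`. -/
def planeRot (θ : ℝ) : X →L[ℝ] X := Real.cos θ • ContinuousLinearMap.id ℝ X + Real.sin θ • rot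

theorem planeRot_apply (θ : ℝ) (x : X) : planeRot θ x = Real.cos θ • x + Real.sin θ • rot x := rfl

theorem norm_planeRot (θ : ℝ) (x : X) : ‖planeRot θ x‖ = ‖x‖ := by
  rw [EuclideanSpace.norm_eq, EuclideanSpace.norm_eq]
  congr 1
  simp only [Fin.sum_univ_two, planeRot_apply, PiLp.add_apply, PiLp.smul_apply, rot_apply,
    Real.norm_eq_abs, sq_abs, smul_eq_mul, Matrix.cons_val_zero, Matrix.cons_val_one]
  linear_combination (x 0 ^ 2 + x 1 ^ 2) * Real.sin_sq_add_cos_sq θ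

theorem planeRot_add (θ θ' : ℝ) (x : X) : planeRot (θ + θ') x = planeRot θ (planeRot θ' x) := by
  simp only [planeRot_apply, map_add, map_smul, rot_rot, Real.cos_add, Real.sin_add]
  module

theorem opNorm_planeRot_le (θ : ℝ) : ‖planeRot θ‖ ≤ 1 :=
  (planeRot θ).opNorm_le_bound zero_le_one fun x => by rw [norm_planeRot, one_mul]

/-- The group generated by `ε⁻¹ J`, on `Y₁`. -/
def rotGroup (ε t : ℝ) : Y₁ →L[ℝ] Y₁ :=
  lp.mapCLM 2 (fun n => planeRot (t * (ε⁻¹ * symbolL n))) zero_le_one fun _ => opNorm_planeRot_le _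

theorem rotGroup_apply (ε t : ℝ) (y : Y₁) (n : ℕ) :
    rotGroup ε t y n = planeRot (t * (ε⁻¹ * symbolL n)) (y n) := rfl

theorem Y_ext' {x y : Y₁} (h : ∀ n, x n = y n) : x = y := by
  ext1; funext n; exact h n

theorem rotGroup_zero (ε : ℝ) (y : Y₁) : rotGroup ε 0 y = y :=
  Y_ext' fun n => by simp [rotGroup_apply, planeRot_apply]

theorem rotGroup_add (ε s t : ℝ) (y : Y₁) :
    rotGroup ε (s + t) y = rotGroup ε s (rotGroup ε t y) :=
  Y_ext' fun n => by simp only [rotGroup_apply, add_mul, planeRot_add]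

theorem norm_rotGroup_le (ε t : ℝ) (y : Y₁) : ‖rotGroup ε t y‖ ≤ ‖y‖ := by
  have := (rotGroup ε t).le_of_opNorm_le
    (lp.norm_mapCLM_le 2 _ zero_le_one fun _ => opNorm_planeRot_le _) y
  rwa [one_mul] at this

theorem rotGroup_single (ε t : ℝ) (n : ℕ) (x : X) :
    rotGroup ε t (lp.single 2 n x) = lp.single 2 n (planeRot (t * (ε⁻¹ * symbolL n)) x) := by
  refine Y_ext' fun m => ?_
  rw [rotGroup_apply]
  by_cases h : m = n
  · subst h; simp
  · simp [lp.single_apply, Pi.single_eq_of_ne h]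

/-- The frequencies are unbounded, so continuity is only strong. Finite sums of modes are continuous
in `t`, and they converge uniformly in `t` because every rotation is a contraction. -/
theorem continuous_rotGroup (ε : ℝ) (y : Y₁) : Continuous fun t => rotGroup ε t y := by
  have hs := lp.hasSum_single (by norm_num) y
  have key : TendstoUniformly (fun (s : Finset ℕ) t => rotGroup ε t (∑ n ∈ s, lp.single 2 n (y n)))
      (fun t => rotGroup ε t y) Filter.atTop := by
    rw [Metric.tendstoUniformly_iff]
    intro δ hδ
    filter_upwards [Metric.tendsto_nhds.mp hs δ hδ] with s h t
    rw [dist_eq_norm, ← map_sub]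
    rw [dist_comm, dist_eq_norm] at h
    exact (norm_rotGroup_le _ _ _).trans_lt h
  refine key.continuous (Filter.Eventually.frequently (Filter.Eventually.of_forall fun s => ?_))
  simp only [map_sum, rotGroup_single]
  refine continuous_finsetSum _ fun n _ => ?_
  refine (lp.singleContinuousLinearMap ℝ (fun _ : ℕ => X) 2 n).continuous.comp ?_
  simp only [planeRot_apply]
  fun_prop

/-- The group of the stable and elliptic variables: `σ = -1` stands for reversed time. -/
def csGroup (ε σ t : ℝ) : ℝ × Y₁ →L[ℝ] ℝ × Y₁ :=
  (Real.exp (-t) • ContinuousLinearMap.id ℝ ℝ).prodMap (rotGroup ε (σ * t))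

theorem csGroup_apply (ε σ t : ℝ) (x : ℝ × Y₁) :
    csGroup ε σ t x = (Real.exp (-t) * x.1, rotGroup ε (σ * t) x.2) := rfl

/-- The norm bound does not depend on `ε`; this is why all constants of the manifolds are uniform.
Joint continuity combines strong continuity with the uniform bound. -/
theorem isContractiveGroup_csGroup (ε σ : ℝ) : IsContractiveGroup (csGroup ε σ) where
  zero x := by simp [csGroup_apply, rotGroup_zero]
  add s t x := by
    simp only [csGroup_apply, mul_add, rotGroup_add, neg_add, Real.exp_add, mul_assoc]
  cont := by
    refine Continuous.prodMk (f := fun p : ℝ × ℝ × Y₁ => Real.exp (-p.1) * p.2.1) (by fun_prop) ?_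
    change Continuous fun p : ℝ × ℝ × Y₁ => rotGroup ε (σ * p.1) p.2.2
    rw [continuous_iff_continuousAt]
    intro p
    rw [ContinuousAt, tendsto_iff_dist_tendsto_zero]
    have h1 : ContinuousAt (fun q : ℝ × ℝ × Y₁ => rotGroup ε (σ * q.1) p.2.2) p :=
      ((continuous_rotGroup ε p.2.2).comp (by fun_prop : Continuous fun q : ℝ × ℝ × Y₁ =>
        σ * q.1)).continuousAt
    rw [ContinuousAt, tendsto_iff_dist_tendsto_zero] at h1
    have h2 : Filter.Tendsto (fun q : ℝ × ℝ × Y₁ => ‖q.2.2 - p.2.2‖) (𝓝 p) (𝓝 0) := by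
      have : Continuous fun q : ℝ × ℝ × Y₁ => ‖q.2.2 - p.2.2‖ := by fun_prop
      simpa using this.tendsto p
    have h3 := h2.add h1
    rw [add_zero] at h3
    refine squeeze_zero (fun _ => dist_nonneg) (fun q => ?_) h3
    refine (dist_triangle _ (rotGroup ε (σ * q.1) p.2.2) _).trans (add_le_add_left ?_ _)
    rw [dist_eq_norm, ← map_sub]
    exact norm_rotGroup_le _ _ _
  norm_le t ht x := by
    rw [csGroup_apply]
    refine max_le ?_ ((norm_rotGroup_le _ _ _).trans (norm_snd_le x))
    rw [norm_mul, Real.norm_of_nonneg (Real.exp_pos _).le]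
    exact (mul_le_of_le_one_left (norm_nonneg _) (Real.exp_le_one_iff.mpr (by linarith))).trans
      (norm_fst_le x)

/-! ### Stable and unstable coordinates -/

/-- The coordinate of the eigenvector `(1, σ) / √2` of `A`. -/
def eigCoord (σ : ℝ) : X →L[ℝ] ℝ :=
  (√2)⁻¹ • (EuclideanSpace.proj (0 : Fin 2) + σ • EuclideanSpace.proj (1 : Fin 2))

theorem eigCoord_apply (σ : ℝ) (x : X) : eigCoord σ x = (√2)⁻¹ * (x 0 + σ * x 1) := rfl

/-- The eigenvector `(1, σ) / √2` of `A`. -/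
def eigVec (σ : ℝ) : X := !₂[(√2)⁻¹, (√2)⁻¹ * σ]

theorem inv_sqrt_two_mul_self : (√2)⁻¹ * (√2)⁻¹ = (2 : ℝ)⁻¹ := by
  rw [← mul_inv, Real.mul_self_sqrt zero_le_two]

section Chart

variable {σ : ℝ}

theorem eigCoord_A (hσ : σ * σ = 1) (x : X) : eigCoord σ (A x) = σ * eigCoord σ x := by
  simp only [eigCoord_apply, A_apply, Matrix.cons_val_zero, Matrix.cons_val_one]
  linear_combination -((√2)⁻¹ * x 1) * hσ

theorem eigCoord_eigVec (hσ : σ * σ = 1) : eigCoord σ (eigVec σ) = 1 := by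
  simp only [eigCoord_apply, eigVec, Matrix.cons_val_zero, Matrix.cons_val_one]
  linear_combination (1 + σ * σ) * inv_sqrt_two_mul_self + (2 : ℝ)⁻¹ * hσ

theorem eigCoord_neg_eigVec (hσ : σ * σ = 1) : eigCoord (-σ) (eigVec σ) = 0 := by
  simp only [eigCoord_apply, eigVec, Matrix.cons_val_zero, Matrix.cons_val_one]
  linear_combination -(√2)⁻¹ * (√2)⁻¹ * hσ

theorem eig_decomp (hσ : σ * σ = 1) (x : X) :
    eigCoord (-σ) x • eigVec (-σ) + eigCoord σ x • eigVec σ = x := by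
  ext i
  fin_cases i
  · simp only [eigCoord_apply, eigVec, PiLp.add_apply, PiLp.smul_apply,
      smul_eq_mul, Fin.zero_eta, Matrix.cons_val_zero]
    linear_combination (2 * x 0) * inv_sqrt_two_mul_self
  · simp only [eigCoord_apply, eigVec, PiLp.add_apply, PiLp.smul_apply,
      smul_eq_mul, Fin.mk_one, Matrix.cons_val_one, Matrix.cons_val_zero]
    linear_combination (2 * σ * σ * x 1) * inv_sqrt_two_mul_self + x 1 * hσ

theorem norm_sq_eq_eigCoord (hσ : σ * σ = 1) (x : X) :
    ‖x‖ ^ 2 = eigCoord (-σ) x ^ 2 + eigCoord σ x ^ 2 := by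
  rw [EuclideanSpace.norm_sq_eq]
  simp only [Fin.sum_univ_two, eigCoord_apply, Real.norm_eq_abs, sq_abs]
  linear_combination -(2 * (x 0 ^ 2 + σ * σ * x 1 ^ 2)) * inv_sqrt_two_mul_self - x 1 ^ 2 * hσ

theorem abs_eigCoord_le (hσ : σ * σ = 1) (x : X) : |eigCoord σ x| ≤ ‖x‖ := by
  refine abs_le_of_sq_le_sq ?_ (norm_nonneg x)
  rw [norm_sq_eq_eigCoord hσ]
  nlinarith [sq_nonneg (eigCoord (-σ) x)]

theorem norm_le_eigCoord (hσ : σ * σ = 1) (x : X) : ‖x‖ ≤ |eigCoord (-σ) x| + |eigCoord σ x| := by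
  refine abs_le_of_sq_le_sq' ?_ (by positivity) |>.2
  rw [norm_sq_eq_eigCoord hσ, ← sq_abs (eigCoord (-σ) x), ← sq_abs (eigCoord σ x)]
  nlinarith [abs_nonneg (eigCoord (-σ) x), abs_nonneg (eigCoord σ x)]

theorem norm_eigVec_le (hσ : σ * σ = 1) : ‖eigVec σ‖ ≤ 1 := by
  have := norm_le_eigCoord hσ (eigVec σ)
  rwa [eigCoord_eigVec hσ, eigCoord_neg_eigVec hσ, abs_zero, abs_one, zero_add] at this

/-- The stable, elliptic and unstable coordinates for the time direction `σ`. -/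
def chart (σ : ℝ) : Phase →L[ℝ] (ℝ × Y₁) × ℝ :=
  ((eigCoord (-σ) ∘L ContinuousLinearMap.fst ℝ X Y₁).prod (ContinuousLinearMap.snd ℝ X Y₁)).prod
    (eigCoord σ ∘L ContinuousLinearMap.fst ℝ X Y₁)

theorem chart_apply (σ : ℝ) (Z : Phase) :
    chart σ Z = ((eigCoord (-σ) Z.1, Z.2), eigCoord σ Z.1) := rfl

/-- The inverse of `chart`. -/
def unchart (σ : ℝ) : (ℝ × Y₁) × ℝ →L[ℝ] Phase :=
  ((ContinuousLinearMap.fst ℝ ℝ Y₁ ∘L ContinuousLinearMap.fst ℝ (ℝ × Y₁) ℝ).smulRight (eigVec (-σ))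
    + (ContinuousLinearMap.snd ℝ (ℝ × Y₁) ℝ).smulRight (eigVec σ)).prod
    (ContinuousLinearMap.snd ℝ ℝ Y₁ ∘L ContinuousLinearMap.fst ℝ (ℝ × Y₁) ℝ)

theorem unchart_apply (σ : ℝ) (z : (ℝ × Y₁) × ℝ) :
    unchart σ z = (z.1.1 • eigVec (-σ) + z.2 • eigVec σ, z.1.2) := rfl

theorem unchart_chart (hσ : σ * σ = 1) (Z : Phase) : unchart σ (chart σ Z) = Z :=
  Prod.ext (eig_decomp hσ Z.1) rfl

theorem norm_chart_le (hσ : σ * σ = 1) (Z : Phase) : ‖chart σ Z‖ ≤ ‖Z‖ := by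
  have hσ' : -σ * -σ = 1 := by rw [neg_mul_neg, hσ]
  exact max_le (max_le ((abs_eigCoord_le hσ' Z.1).trans (norm_fst_le Z)) (norm_snd_le Z))
    ((abs_eigCoord_le hσ Z.1).trans (norm_fst_le Z))

theorem norm_unchart_le (hσ : σ * σ = 1) (z : (ℝ × Y₁) × ℝ) : ‖unchart σ z‖ ≤ 2 * ‖z‖ := by
  have hσ' : -σ * -σ = 1 := by rw [neg_mul_neg, hσ]
  have h1 : ‖z.1.1‖ ≤ ‖z‖ := (norm_fst_le z.1).trans (norm_fst_le z)
  have h2 : ‖z.2‖ ≤ ‖z‖ := norm_snd_le z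
  have h3 : ‖z.1.2‖ ≤ ‖z‖ := (norm_snd_le z.1).trans (norm_fst_le z)
  rw [unchart_apply]
  refine max_le ((norm_add_le _ _).trans ?_) (h3.trans (by linarith [norm_nonneg z]))
  rw [norm_smul, norm_smul]
  have := mul_le_mul h1 (norm_eigVec_le hσ') (norm_nonneg _) (norm_nonneg z)
  have := mul_le_mul h2 (norm_eigVec_le hσ) (norm_nonneg _) (norm_nonneg z)
  linarith

end Chart

end
end KleinGordon

namespace KleinGordon
noncomputable section

open scoped ContDiff Topology

/-! ### Solutions are mild solutions -/

/-- The nonlinearity in the coordinates of `chart`. -/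
def chartNonlinearity (σ : ℝ) (N : Phase → Phase) (z : (ℝ × Y₁) × ℝ) : (ℝ × Y₁) × ℝ :=
  σ • chart σ (N (unchart σ z))

section Mild

variable {ε σ : ℝ} {N : Phase → Phase} {I : Set ℝ} {u : ℝ → Phase}

theorem IsSolution.hasDerivWithinAt_eigCoord (h : IsSolution ε N I u) (hσ : σ * σ = 1) {t : ℝ}
    (ht : t ∈ I) :
    HasDerivWithinAt (fun s => Real.exp (-(σ * s)) * eigCoord σ (u s).1)
      (Real.exp (-(σ * t)) * eigCoord σ (N (u t)).1) I t := by
  have h1 : HasDerivWithinAt (fun s => eigCoord σ (u s).1)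
      (eigCoord σ (A (u t).1 + (N (u t)).1)) I t :=
    (eigCoord σ ∘L ContinuousLinearMap.fst ℝ X Y).hasFDerivAt.comp_hasDerivWithinAt t (h.2 t ht)
  have h2 : HasDerivAt (fun s => Real.exp (-(σ * s))) (Real.exp (-(σ * t)) * -σ) t := by
    have := ((hasDerivAt_id t).const_mul σ).neg.exp
    simpa using this
  refine (h2.hasDerivWithinAt.mul h1).congr_deriv ?_
  rw [map_add, eigCoord_A hσ]
  ring

/-- On a single mode `J` is bounded, and multiplication by the wave number undoes `incl`. The
equation in `Y` becomes an ordinary differential equation for the stored coordinates. -/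
theorem IsSolution.hasDerivWithinAt_mode (h : IsSolution ε N I u) {t : ℝ} (ht : t ∈ I) (n : ℕ) :
    HasDerivWithinAt (fun s => (u s).2 n)
      ((ε⁻¹ * symbolL n) • rot ((u t).2 n) + (N (u t)).2 n) I t := by
  have h1 := (lp.evalCLM ℝ (fun _ : ℕ => X) 2 n ∘L
    ContinuousLinearMap.snd ℝ X Y).hasFDerivAt.comp_hasDerivWithinAt t (h.2 t ht)
  have h2 := h1.const_smul (waveNumber n)
  have hk : waveNumber n ≠ 0 := by linarith [two_le_waveNumber n]
  have e : ∀ x : X, waveNumber n • (waveNumber n)⁻¹ • x = x := fun x => by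
    rw [smul_smul, mul_inv_cancel₀ hk, one_smul]
  have e1 : (fun s => (u s).2 n) = fun s => waveNumber n •
      (lp.evalCLM ℝ (fun _ : ℕ => X) 2 n ∘L ContinuousLinearMap.snd ℝ X Y)
        ((u s).1, incl (u s).2) := by
    funext s
    exact (e _).symm
  rw [e1]
  refine h2.congr_deriv ?_
  change waveNumber n • (ε⁻¹ • (symbolL n / waveNumber n) • rot ((u t).2 n)
    + (waveNumber n)⁻¹ • (N (u t)).2 n) = _
  rw [smul_add, e, smul_smul, smul_smul]
  congr 2
  field_simp

theorem IsSolution.hasDerivWithinAt_planeRot (h : IsSolution ε N I u) {t : ℝ} (ht : t ∈ I)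
    (n : ℕ) :
    HasDerivWithinAt (fun s => planeRot (-s * (ε⁻¹ * symbolL n)) ((u s).2 n))
      (planeRot (-t * (ε⁻¹ * symbolL n)) ((N (u t)).2 n)) I t := by
  set w := ε⁻¹ * symbolL n with hw
  have h1 := h.hasDerivWithinAt_mode ht n
  have h2 : HasDerivWithinAt (fun s => rot ((u s).2 n))
      (rot (w • rot ((u t).2 n) + (N (u t)).2 n)) I t :=
    rot.hasFDerivAt.comp_hasDerivWithinAt t h1
  have ha : HasDerivAt (fun s : ℝ => -s * w) (-w) t := by
    simpa using (hasDerivAt_id t).neg.mul_const w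
  have h3 := (ha.cos.hasDerivWithinAt.smul h1).add (ha.sin.hasDerivWithinAt.smul h2)
  refine h3.congr_deriv ?_
  rw [map_add, map_smul, rot_rot, planeRot_apply]
  module

/-- The chart of the curve `t ↦ u (σ t)`, in the moving frame. -/
theorem IsSolution.isMild (h : IsSolution ε N I u) (hσ : σ * σ = 1) (hI : I.OrdConnected)
    (hN : ContinuousOn N (u '' I)) :
    IsMild (csGroup ε σ) (chartNonlinearity σ N) {t | σ * t ∈ I} (fun t => chart σ (u (σ * t))) := by
  have hσ' : -σ * -σ = 1 := by rw [neg_mul_neg, hσ]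
  have hσ0 : σ ≠ 0 := by rintro rfl; simp at hσ
  set I' := {t | σ * t ∈ I} with hI'
  have hI'c : I'.OrdConnected := by
    rcases mul_self_eq_one_iff.mp hσ with rfl | rfl
    · exact hI.preimage_mono fun a b hab => by linarith
    · exact hI.preimage_anti fun a b hab => by linarith
  have hc : ContinuousOn (fun t => u (σ * t)) I' := h.1.comp (by fun_prop) fun t ht => ht
  have hNc : ContinuousOn (fun t => N (u (σ * t))) I' :=
    hN.comp hc fun t ht => mem_image_of_mem u ht
  have hgc : ContinuousOn (fun t => chartNonlinearity σ N (chart σ (u (σ * t)))) I' := by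
    simp only [chartNonlinearity, unchart_chart hσ]
    exact ((chart σ).continuous.comp_continuousOn hNc).const_smul σ
  refine ⟨(chart σ).continuous.comp_continuousOn hc, fun s hs t ht => ?_⟩
  have hT := isContractiveGroup_csGroup ε σ
  have hint : ∀ a ∈ I', ∀ b ∈ I', ContinuousOn (fun τ => linFlow (csGroup ε σ) (-τ)
      (chartNonlinearity σ N (chart σ (u (σ * τ))))) (uIcc a b) := fun a ha b hb =>
    continuousOn_linFlow hT (hgc.mono (hI'c.uIcc_subset ha hb))
  -- The curve in the moving frame need not be differentiable in `Y₁`, but its image under each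
  -- coordinate map `P` is. The integral identity is therefore tested on the stable coordinate,
  -- every elliptic mode, and the unstable coordinate.
  have key : ∀ {G : Type} [NormedAddCommGroup G] [NormedSpace ℝ G] [CompleteSpace G]
      (P : (ℝ × Y₁) × ℝ →L[ℝ] G), (∀ τ ∈ I', HasDerivWithinAt
        (fun τ => P (linFlow (csGroup ε σ) (-τ) (chart σ (u (σ * τ)))))
        (P (linFlow (csGroup ε σ) (-τ) (chartNonlinearity σ N (chart σ (u (σ * τ)))))) I' τ) →
      P (linFlow (csGroup ε σ) (-t) (chart σ (u (σ * t)))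
        - linFlow (csGroup ε σ) (-s) (chart σ (u (σ * s))))
      = P (∫ τ in s..t, linFlow (csGroup ε σ) (-τ)
          (chartNonlinearity σ N (chart σ (u (σ * τ))))) := by
    intro G _ _ _ P hP
    have hsub := hI'c.uIcc_subset hs ht
    rw [← P.intervalIntegral_comp_comm (hint s hs t ht).intervalIntegrable, map_sub]
    refine (intervalIntegral.integral_eq_sub_of_hasDeriv_right
      (fun τ hτ => (hP τ (hsub hτ)).continuousWithinAt.mono hsub) (fun τ hτ => ?_)
      (P.continuous.comp_continuousOn (hint s hs t ht)).intervalIntegrable).symm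
    have hn : I' ∈ 𝓝 τ := Filter.mem_of_superset (Ioo_mem_nhds hτ.1 hτ.2)
      (Ioo_subset_Icc_self.trans hsub)
    exact ((hP τ (mem_of_mem_nhds hn)).hasDerivAt hn).hasDerivWithinAt
  have hcomp : ∀ {G : Type} [NormedAddCommGroup G] [NormedSpace ℝ G] {φ : ℝ → G} {φ' : G} {τ : ℝ},
      HasDerivWithinAt φ φ' I (σ * τ) →
      HasDerivWithinAt (fun τ => φ (σ * τ)) (σ • φ') I' τ := by
    intro G _ _ φ φ' τ hφ
    have h1 : HasDerivWithinAt (fun τ : ℝ => σ * τ) σ I' τ := by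
      simpa using ((hasDerivAt_id τ).const_mul σ).hasDerivWithinAt
    exact hφ.scomp τ h1 fun x hx => hx
  have hστ : ∀ τ, σ * (σ * τ) = τ := fun τ => by rw [← mul_assoc, hσ, one_mul]
  refine Prod.ext (Prod.ext ?_ (Y_ext' fun n => ?_)) ?_
  · refine key (ContinuousLinearMap.fst ℝ ℝ Y₁ ∘L ContinuousLinearMap.fst ℝ (ℝ × Y₁) ℝ)
      fun τ hτ => ?_
    have := hcomp (h.hasDerivWithinAt_eigCoord hσ' (t := σ * τ) hτ)
    simp only [neg_mul, neg_neg, hστ] at this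
    have e : ∀ τ z, (ContinuousLinearMap.fst ℝ ℝ Y₁ ∘L ContinuousLinearMap.fst ℝ (ℝ × Y₁) ℝ)
        (linFlow (csGroup ε σ) (-τ) z) = Real.exp τ * z.1.1 := fun τ z => by
      change Real.exp (- -τ) * z.1.1 = _
      rw [neg_neg]
    simp only [e, chartNonlinearity, unchart_chart hσ]
    refine this.congr_deriv ?_
    change σ * _ = Real.exp τ * (σ * _)
    rw [chart_apply]
    ring
  · refine key (lp.evalCLM ℝ (fun _ : ℕ => X) 2 n ∘L ContinuousLinearMap.snd ℝ ℝ Y₁ ∘L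
      ContinuousLinearMap.fst ℝ (ℝ × Y₁) ℝ) fun τ hτ => ?_
    have := hcomp (h.hasDerivWithinAt_planeRot (t := σ * τ) hτ n)
    have e : ∀ τ z, (lp.evalCLM ℝ (fun _ : ℕ => X) 2 n ∘L ContinuousLinearMap.snd ℝ ℝ Y₁ ∘L
        ContinuousLinearMap.fst ℝ (ℝ × Y₁) ℝ) (linFlow (csGroup ε σ) (-τ) z)
        = planeRot (-(σ * τ) * (ε⁻¹ * symbolL n)) (z.1.2 n) := fun τ z => by
      change planeRot (σ * -τ * _) (z.1.2 n) = _
      rw [mul_neg]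
    simp only [e, chartNonlinearity, unchart_chart hσ]
    refine this.congr_deriv ?_
    rw [← map_smul]
    rfl
  · refine key (ContinuousLinearMap.snd ℝ (ℝ × Y₁) ℝ) fun τ hτ => ?_
    have := hcomp (h.hasDerivWithinAt_eigCoord hσ (t := σ * τ) hτ)
    simp only [hστ] at this
    have e : ∀ τ z, (ContinuousLinearMap.snd ℝ (ℝ × Y₁) ℝ)
        (linFlow (csGroup ε σ) (-τ) z) = Real.exp (-τ) * z.2 := fun τ z => rfl
    simp only [e, chartNonlinearity, unchart_chart hσ]
    refine this.congr_deriv ?_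
    change σ * _ = Real.exp (-τ) * (σ * _)
    rw [chart_apply]
    ring

end Mild

end
end KleinGordon

namespace KleinGordon
noncomputable section

open scoped ContDiff Topology

/-! ### Smooth cutoff in Hilbert spaces -/

theorem norm_iteratedFDeriv_clm_comp_le {D E F G : Type*} [NormedAddCommGroup D] [NormedSpace ℝ D]
    [NormedAddCommGroup E] [NormedSpace ℝ E] [NormedAddCommGroup F] [NormedSpace ℝ F]
    [NormedAddCommGroup G] [NormedSpace ℝ G] (S : F →L[ℝ] G) (T : D →L[ℝ] E) {f : E → F}
    (hf : ContDiff ℝ ∞ f) (i : ℕ) (x : D) :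
    ‖iteratedFDeriv ℝ i (fun z => S (f (T z))) x‖
      ≤ ‖S‖ * (‖iteratedFDeriv ℝ i f (T x)‖ * ‖T‖ ^ i) := by
  have hi : (i : WithTop ℕ∞) ≤ (∞ : WithTop ℕ∞) := mod_cast le_top
  have hfT : ContDiff ℝ ∞ (f ∘ T) := hf.comp T.contDiff
  refine (S.norm_iteratedFDeriv_comp_left (f := f ∘ T) (x := x) (n := i)
    hfT.contDiffAt hi).trans ?_
  refine mul_le_mul_of_nonneg_left ?_ (norm_nonneg _)
  rw [T.iteratedFDeriv_comp_right hf x hi]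
  refine (ContinuousMultilinearMap.norm_compContinuousLinearMap_le _ _).trans_eq ?_
  simp

/-- A smooth function of one variable with value `1` near `[0, 1]` and `0` beyond `2`. -/
def cutoffBump : ContDiffBump (0 : ℝ) := ⟨1, 2, one_pos, one_lt_two⟩

/-- A smooth map which is the identity on the unit ball and has bounded support. -/
def unitCutoff (H : Type*) [NormedAddCommGroup H] [InnerProductSpace ℝ H] (v : H) : H :=
  cutoffBump (‖v‖ ^ 2) • v

section UnitCutoff

variable {H : Type*} [NormedAddCommGroup H] [InnerProductSpace ℝ H]

theorem unitCutoff_of_norm_le {v : H} (hv : ‖v‖ ≤ 1) : unitCutoff H v = v := by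
  have : cutoffBump (‖v‖ ^ 2) = 1 := by
    refine cutoffBump.one_of_mem_closedBall ?_
    rw [mem_closedBall_zero_iff, Real.norm_of_nonneg (by positivity)]
    exact pow_le_one₀ (norm_nonneg v) hv
  rw [unitCutoff, this, one_smul]

theorem unitCutoff_of_lt_norm {v : H} (hv : 2 ≤ ‖v‖) : unitCutoff H v = 0 := by
  have : cutoffBump (‖v‖ ^ 2) = 0 := by
    refine cutoffBump.zero_of_le_dist ?_
    rw [dist_zero_right, Real.norm_of_nonneg (by positivity)]
    change 2 ≤ ‖v‖ ^ 2
    nlinarith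
  rw [unitCutoff, this, zero_smul]

theorem norm_unitCutoff_le (v : H) : ‖unitCutoff H v‖ ≤ 2 := by
  rcases le_total 2 ‖v‖ with hv | hv
  · rw [unitCutoff_of_lt_norm hv, norm_zero]; norm_num
  · rw [unitCutoff, norm_smul, Real.norm_of_nonneg cutoffBump.nonneg]
    exact (mul_le_of_le_one_left (norm_nonneg _) cutoffBump.le_one).trans hv

theorem hasTemperateGrowth_unitCutoff : (unitCutoff H).HasTemperateGrowth := by
  have h1 : Function.HasTemperateGrowth (cutoffBump : ℝ → ℝ) :=
    cutoffBump.hasCompactSupport.hasTemperateGrowth cutoffBump.contDiff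
  have h2 := h1.comp (Function.hasTemperateGrowth_norm_sq H)
  exact h2.smul Function.HasTemperateGrowth.id

/-- The squared norm of a Hilbert space is smooth with derivatives of polynomial growth, and the
cutoff vanishes where the norm exceeds `2`. No compactness is needed, so `Y₁` is covered. -/
theorem exists_unitCutoff_bound (H : Type*) [NormedAddCommGroup H] [InnerProductSpace ℝ H] :
    ∃ B : ℝ, 0 ≤ B ∧ ∀ i ≤ 3, ∀ v, ‖iteratedFDeriv ℝ i (unitCutoff H) v‖ ≤ B := by
  obtain ⟨k, C, hC, hb⟩ := (hasTemperateGrowth_unitCutoff (H := H)).norm_iteratedFDeriv_le_uniform 3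
  refine ⟨C * (1 + 2) ^ k, by positivity, fun i hi v => ?_⟩
  rcases le_or_gt ‖v‖ 2 with hv | hv
  · refine (hb i hi v).trans ?_
    gcongr
  · have e : unitCutoff H =ᶠ[𝓝 v] fun _ => 0 := by
      filter_upwards [(isOpen_lt continuous_const continuous_norm).mem_nhds hv] with w hw
      exact unitCutoff_of_lt_norm (le_of_lt hw)
    rw [(Filter.EventuallyEq.iteratedFDeriv ℝ e i).eq_of_nhds]
    have : iteratedFDeriv ℝ i (fun _ : H => (0 : H)) v = 0 := by
      rw [iteratedFDeriv_fun_zero]; rfl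
    rw [this, norm_zero]
    positivity

end UnitCutoff

/-- The cutoff of radius `R` in the phase space. -/
def phaseCutoff (R : ℝ) (Z : Phase) : Phase :=
  (R • unitCutoff X (R⁻¹ • Z.1), R • unitCutoff Y₁ (R⁻¹ • Z.2))

theorem phaseCutoff_of_le {R : ℝ} (hR : 0 < R) {Z : Phase} (h₁ : ‖Z.1‖ ≤ R) (h₂ : ‖Z.2‖ ≤ R) :
    phaseCutoff R Z = Z := by
  have key : ∀ {H : Type} [NormedAddCommGroup H] [InnerProductSpace ℝ H] {v : H}, ‖v‖ ≤ R →
      R • unitCutoff H (R⁻¹ • v) = v := by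
    intro H _ _ v hv
    rw [unitCutoff_of_norm_le, smul_smul, mul_inv_cancel₀ hR.ne', one_smul]
    rw [norm_smul, norm_inv, Real.norm_of_nonneg hR.le, inv_mul_le_one₀ hR]
    exact hv
  exact Prod.ext (key h₁) (key h₂)

theorem phaseCutoff_mem {R K : ℝ} (hR : 0 < R) (hK : 4 * R < K) (Z : Phase) :
    phaseCutoff R Z ∈ phaseBall K := by
  have h1 := norm_unitCutoff_le (R⁻¹ • Z.1)
  have h2 := norm_unitCutoff_le (R⁻¹ • Z.2)
  change ‖R • _‖ + ‖R • _‖ < K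
  rw [norm_smul, norm_smul, Real.norm_of_nonneg hR.le]
  nlinarith

theorem norm_phaseCutoff_le {R : ℝ} (hR : 0 < R) (Z : Phase) : ‖phaseCutoff R Z‖ ≤ 2 * R := by
  have h1 := norm_unitCutoff_le (R⁻¹ • Z.1)
  have h2 := norm_unitCutoff_le (R⁻¹ • Z.2)
  refine max_le ?_ ?_
  · change ‖R • _‖ ≤ _
    rw [norm_smul, Real.norm_of_nonneg hR.le]; nlinarith
  · change ‖R • _‖ ≤ _
    rw [norm_smul, Real.norm_of_nonneg hR.le]; nlinarith

theorem phaseCutoff_eq (R : ℝ) : phaseCutoff R =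
    (fun Z => (R • ContinuousLinearMap.inl ℝ X Y₁)
      (unitCutoff X ((R⁻¹ • ContinuousLinearMap.fst ℝ X Y₁) Z)))
    + fun Z => (R • ContinuousLinearMap.inr ℝ X Y₁)
      (unitCutoff Y₁ ((R⁻¹ • ContinuousLinearMap.snd ℝ X Y₁) Z)) := by
  funext Z
  simp [phaseCutoff]

theorem contDiff_phaseCutoff (R : ℝ) : ContDiff ℝ ∞ (phaseCutoff R) := by
  rw [phaseCutoff_eq]
  exact (ContinuousLinearMap.contDiff _ |>.comp ((hasTemperateGrowth_unitCutoff (H := X)).1.comp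
    (ContinuousLinearMap.contDiff _))).add
    (ContinuousLinearMap.contDiff _ |>.comp ((hasTemperateGrowth_unitCutoff (H := Y₁)).1.comp
    (ContinuousLinearMap.contDiff _)))

/-- Scaling. `B` does not depend on `R`, and for `i = 1` the powers of `R` cancel: shrinking the
cutoff radius does not spoil its Lipschitz constant. -/
theorem exists_phaseCutoff_bound : ∃ B : ℝ, 1 ≤ B ∧ ∀ R > 0, ∀ i ≤ 3, ∀ Z,
    ‖iteratedFDeriv ℝ i (phaseCutoff R) Z‖ ≤ R * (B * R⁻¹ ^ i) := by
  obtain ⟨B₁, h₁, hb₁⟩ := exists_unitCutoff_bound X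
  obtain ⟨B₂, h₂, hb₂⟩ := exists_unitCutoff_bound Y₁
  refine ⟨1 + B₁ + B₂, by linarith, fun R hR i hi Z => ?_⟩
  have hR0 : 0 ≤ R⁻¹ := by positivity
  have key : ∀ {H : Type} [NormedAddCommGroup H] [InnerProductSpace ℝ H] {B : ℝ}
      (S : H →L[ℝ] Phase) (T : Phase →L[ℝ] H), ‖S‖ ≤ 1 → ‖T‖ ≤ 1 →
      (∀ v, ‖iteratedFDeriv ℝ i (unitCutoff H) v‖ ≤ B) → ContDiff ℝ ∞ (unitCutoff H) →
      ‖iteratedFDeriv ℝ i (fun Z => (R • S) (unitCutoff H ((R⁻¹ • T) Z))) Z‖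
        ≤ R * (B * R⁻¹ ^ i) := by
    intro H _ _ B S T hS hT hB hc
    have hB0 : 0 ≤ B := (norm_nonneg _).trans (hB 0)
    refine (norm_iteratedFDeriv_clm_comp_le (R • S) (R⁻¹ • T) hc i Z).trans ?_
    rw [norm_smul, norm_smul, Real.norm_of_nonneg hR.le, Real.norm_of_nonneg hR0]
    calc R * ‖S‖ * (‖iteratedFDeriv ℝ i (unitCutoff H) ((R⁻¹ • T) Z)‖ * (R⁻¹ * ‖T‖) ^ i)
        ≤ R * 1 * (B * (R⁻¹ * 1) ^ i) := by gcongr; exact hB _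
      _ = _ := by rw [mul_one, mul_one]
  have k1 := key (ContinuousLinearMap.inl ℝ X Y₁) (ContinuousLinearMap.fst ℝ X Y₁)
    (ContinuousLinearMap.opNorm_le_bound _ zero_le_one fun x => by simp [Prod.norm_def])
    (ContinuousLinearMap.norm_fst_le ..) (hb₁ i hi) hasTemperateGrowth_unitCutoff.1
  have k2 := key (ContinuousLinearMap.inr ℝ X Y₁) (ContinuousLinearMap.snd ℝ X Y₁)
    (ContinuousLinearMap.opNorm_le_bound _ zero_le_one fun x => by simp [Prod.norm_def])
    (ContinuousLinearMap.norm_snd_le ..) (hb₂ i hi) hasTemperateGrowth_unitCutoff.1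
  have c1 : ContDiff ℝ i (fun Z => (R • ContinuousLinearMap.inl ℝ X Y₁)
      (unitCutoff X ((R⁻¹ • ContinuousLinearMap.fst ℝ X Y₁) Z))) :=
    (ContinuousLinearMap.contDiff _ |>.comp ((hasTemperateGrowth_unitCutoff (H := X)).1.comp
      (ContinuousLinearMap.contDiff _))).of_le (mod_cast le_top)
  have c2 : ContDiff ℝ i (fun Z => (R • ContinuousLinearMap.inr ℝ X Y₁)
      (unitCutoff Y₁ ((R⁻¹ • ContinuousLinearMap.snd ℝ X Y₁) Z))) :=
    (ContinuousLinearMap.contDiff _ |>.comp ((hasTemperateGrowth_unitCutoff (H := Y₁)).1.comp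
      (ContinuousLinearMap.contDiff _))).of_le (mod_cast le_top)
  rw [phaseCutoff_eq, iteratedFDeriv_add_apply c1.contDiffAt c2.contDiffAt]
  refine (norm_add_le _ _).trans ((add_le_add k1 k2).trans ?_)
  have : 0 ≤ R * R⁻¹ ^ i := by positivity
  linarith

/-! ### Global extension of a local nonlinearity -/

section Extension

variable {K D δ R B : ℝ} {N : Phase → Phase}

theorem convex_phaseBall (K : ℝ) : Convex ℝ (phaseBall K) := convex_sumBall X Y₁ K

/-- A `C³` vector field near the origin which is small in `C¹`. -/
structure SmoothField (K D δ : ℝ) (N : Phase → Phase) : Prop where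
  K_pos : 0 < K
  D_nonneg : 0 ≤ D
  smooth : ∀ Z ∈ phaseBall K, ContDiffAt ℝ ω N Z
  bound : ∀ Z ∈ phaseBall K, ∀ i ≤ 3, ‖iteratedFDeriv ℝ i N Z‖ ≤ D
  zero : N 0 = 0
  fderiv_le : ‖fderiv ℝ N 0‖ ≤ δ

theorem SmoothField.norm_fderiv_le (h : SmoothField K D δ N) {Z : Phase} (hZ : Z ∈ phaseBall K) :
    ‖fderiv ℝ N Z‖ ≤ δ + D * ‖Z‖ := by
  have hd : ∀ W ∈ phaseBall K, DifferentiableAt ℝ (fderiv ℝ N) W := fun W hW =>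
    ((h.smooth W hW).fderiv_right (m := ω) (by simp)).differentiableAt (by simp)
  have hb : ∀ W ∈ phaseBall K, ‖fderiv ℝ (fderiv ℝ N) W‖ ≤ D := fun W hW => by
    have := h.bound W hW 2 (by norm_num)
    rwa [← norm_iteratedFDeriv_fderiv, ← norm_iteratedFDeriv_fderiv,
      norm_iteratedFDeriv_zero] at this
  have h0 : (0 : Phase) ∈ phaseBall K := by simpa [phaseBall] using h.K_pos
  have := (convex_phaseBall K).norm_image_sub_le_of_norm_fderiv_le hd hb h0 hZ
  rw [sub_zero] at this
  have e := norm_add_le (fderiv ℝ N 0) (fderiv ℝ N Z - fderiv ℝ N 0)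
  rw [add_sub_cancel] at e
  linarith [h.fderiv_le]

theorem SmoothField.contDiff_cutoff (h : SmoothField K D δ N) (hR : 0 < R) (hRK : 4 * R < K) :
    ContDiff ℝ ∞ (N ∘ phaseCutoff R) := by
  rw [contDiff_iff_contDiffAt]
  intro Z
  exact ((h.smooth _ (phaseCutoff_mem hR hRK Z)).of_le le_top).comp Z
    (contDiff_phaseCutoff R).contDiffAt

theorem SmoothField.norm_iteratedFDeriv_cutoff_le (h : SmoothField K D δ N) (hR : 0 < R)
    (hRK : 4 * R < K) (hB : 1 ≤ B)
    (hBb : ∀ i ≤ 3, ∀ Z, ‖iteratedFDeriv ℝ i (phaseCutoff R) Z‖ ≤ R * (B * R⁻¹ ^ i)) {i : ℕ}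
    (hi : i ≤ 3) (Z : Phase) :
    ‖iteratedFDeriv ℝ i (N ∘ phaseCutoff R) Z‖ ≤ 6 * D * (B * (1 + R⁻¹)) ^ 3 := by
  have hR0 : 0 < R⁻¹ := by positivity
  have hopen := isOpen_phaseBall K
  have h1 : 1 ≤ B * (1 + R⁻¹) := by nlinarith
  have hi' : (i : WithTop ℕ∞) ≤ (∞ : WithTop ℕ∞) := mod_cast le_top
  have key := norm_iteratedFDerivWithin_comp_le (𝕜 := ℝ) (g := N) (f := phaseCutoff R) (n := i)
    (s := univ) (t := phaseBall K) (x := Z) (N := ∞) (C := D) (D := B * (1 + R⁻¹))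
    (fun W hW => ((h.smooth W hW).of_le le_top).contDiffWithinAt) (contDiff_phaseCutoff R).contDiffOn
    hi' hopen.uniqueDiffOn uniqueDiffOn_univ (fun W _ => phaseCutoff_mem hR hRK W) (mem_univ Z)
    (fun j hj => by
      rw [iteratedFDerivWithin_of_isOpen j hopen (phaseCutoff_mem hR hRK Z)]
      exact h.bound _ (phaseCutoff_mem hR hRK Z) j (hj.trans hi))
    (fun j hj hj' => by
      rw [iteratedFDerivWithin_univ]
      refine (hBb j (hj'.trans hi) Z).trans ?_
      obtain ⟨k, rfl⟩ : ∃ k, j = k + 1 := ⟨j - 1, by omega⟩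
      calc R * (B * R⁻¹ ^ (k + 1)) = B * R⁻¹ ^ k := by rw [pow_succ]; field_simp
        _ ≤ B ^ (k + 1) * (1 + R⁻¹) ^ (k + 1) := by
          refine mul_le_mul (le_self_pow₀ hB (by omega)) ?_ (by positivity) (by positivity)
          calc R⁻¹ ^ k ≤ (1 + R⁻¹) ^ k := by gcongr; linarith
            _ ≤ (1 + R⁻¹) ^ (k + 1) := pow_le_pow_right₀ (by linarith) (by omega)
        _ = _ := (mul_pow _ _ _).symm)
  rw [iteratedFDerivWithin_univ] at key
  refine key.trans ?_
  have hf : ((Nat.factorial i : ℕ) : ℝ) ≤ 6 := by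
    exact_mod_cast (Nat.factorial_le hi).trans_eq (by rfl)
  have := h.D_nonneg
  have h3 := pow_le_pow_right₀ h1 hi
  gcongr

/-- The cutoff takes values of norm at most `2 R`, where `DN` is at most `δ + 2 D R`. This is the
only bound that must be small; the higher ones may blow up as `R` decreases. -/
theorem SmoothField.diffBound₁_cutoff (h : SmoothField K D δ N) (hR : 0 < R)
    (hRK : 4 * R < K)
    (hBb : ∀ i ≤ 3, ∀ Z, ‖iteratedFDeriv ℝ i (phaseCutoff R) Z‖ ≤ R * (B * R⁻¹ ^ i)) :
    DiffBound₁ ((δ + D * (2 * R)) * B) (N ∘ phaseCutoff R) := by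
  refine diffBound₁_of_fderiv ((h.contDiff_cutoff hR hRK).differentiable (by simp)) fun Z => ?_
  have hm := phaseCutoff_mem hR hRK Z
  have h1 : ‖fderiv ℝ (phaseCutoff R) Z‖ ≤ B := by
    have := hBb 1 (by norm_num) Z
    rw [← norm_iteratedFDeriv_fderiv, norm_iteratedFDeriv_zero, pow_one] at this
    refine this.trans_eq ?_
    field_simp
  have h2 : ‖fderiv ℝ N (phaseCutoff R Z)‖ ≤ δ + D * (2 * R) :=
    (h.norm_fderiv_le hm).trans (by
      have := h.D_nonneg
      have := norm_phaseCutoff_le hR Z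
      gcongr)
  rw [fderiv_comp Z ((h.smooth _ hm).differentiableAt (by simp))
    ((contDiff_phaseCutoff R).differentiable (by simp) Z)]
  refine (ContinuousLinearMap.opNorm_comp_le _ _).trans ?_
  exact mul_le_mul h2 h1 (norm_nonneg _) ((norm_nonneg _).trans h2)

theorem SmoothField.cutoff_zero (h : SmoothField K D δ N) (hR : 0 < R) :
    (N ∘ phaseCutoff R) 0 = 0 := by
  rw [Function.comp_apply, phaseCutoff_of_le hR (by simpa using hR.le) (by simpa using hR.le),
    h.zero]

/-- Taylor's formula at the origin, where the cutoff is inactive and the derivative is that of `N`.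
-/
theorem SmoothField.norm_cutoff_le (h : SmoothField K D δ N) (hR : 0 < R)
    {C₁ C : ℝ} (hC₁ : 0 ≤ C₁) (hC : 0 ≤ C) (h₁ : DiffBound₁ C₁ (N ∘ phaseCutoff R))
    (h₂ : DiffBound₂ C (N ∘ phaseCutoff R)) (Z : Phase) :
    ‖(N ∘ phaseCutoff R) Z‖ ≤ δ * ‖Z‖ + C * ‖Z‖ ^ 2 := by
  obtain ⟨f', -, -, hq⟩ := exists_hasFDerivAt_of_diffBound hC hC₁ h₁ h₂ 0
  have e : N ∘ phaseCutoff R =ᶠ[𝓝 0] N := by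
    filter_upwards [Metric.ball_mem_nhds (0 : Phase) hR] with W hW
    have hW' : ‖W‖ < R := by simpa using hW
    rw [Function.comp_apply, phaseCutoff_of_le hR ((norm_fst_le W).trans hW'.le)
      ((norm_snd_le W).trans hW'.le)]
  have hf : f' = fderiv ℝ N 0 :=
    (hasFDerivAt_of_quadratic hq).fderiv.symm.trans e.fderiv_eq
  have := hq Z
  rw [zero_add, h.cutoff_zero hR, sub_zero, hf] at this
  have e2 := norm_add_le ((N ∘ phaseCutoff R) Z - fderiv ℝ N 0 Z) (fderiv ℝ N 0 Z)
  rw [sub_add_cancel] at e2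
  have e3 := (fderiv ℝ N 0).le_of_opNorm_le h.fderiv_le Z
  linarith

end Extension

end
end KleinGordon

namespace KleinGordon
noncomputable section

open scoped ContDiff Topology

/-! ### The global center-stable graph -/

section DiffBoundComp

set_option linter.unusedSectionVars false

variable {E F G : Type*} [NormedAddCommGroup E] [NormedSpace ℝ E] [NormedAddCommGroup F]
  [NormedSpace ℝ F] [NormedAddCommGroup G] [NormedSpace ℝ G] {f : E → F} {C a b : ℝ}

theorem DiffBound₁.clm_comp (h : DiffBound₁ C f) (hC : 0 ≤ C) (T : G →L[ℝ] E) (hT : ‖T‖ ≤ a) :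
    DiffBound₁ (C * a) (fun z => f (T z)) := by
  intro x p
  have := h (T x) (T p)
  simp only [map_add]
  refine this.trans ?_
  rw [mul_assoc]
  gcongr
  exact T.le_of_opNorm_le hT p

theorem DiffBound₂.clm_comp (h : DiffBound₂ C f) (hC : 0 ≤ C) (T : G →L[ℝ] E) (hT : ‖T‖ ≤ a) :
    DiffBound₂ (C * a ^ 2) (fun z => f (T z)) := by
  have ha : 0 ≤ a := (norm_nonneg _).trans hT
  intro x p q
  have := h (T x) (T p) (T q)
  simp only [map_add]
  refine this.trans ?_
  have hp := T.le_of_opNorm_le hT p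
  have hq := T.le_of_opNorm_le hT q
  calc C * ‖T p‖ * ‖T q‖ ≤ C * (a * ‖p‖) * (a * ‖q‖) := by gcongr
    _ = _ := by ring

theorem DiffBound₃.clm_comp (h : DiffBound₃ C f) (hC : 0 ≤ C) (T : G →L[ℝ] E) (hT : ‖T‖ ≤ a) :
    DiffBound₃ (C * a ^ 3) (fun z => f (T z)) := by
  have ha : 0 ≤ a := (norm_nonneg _).trans hT
  intro x p q r
  have := h (T x) (T p) (T q) (T r)
  simp only [map_add]
  refine this.trans ?_
  have hp := T.le_of_opNorm_le hT p
  have hq := T.le_of_opNorm_le hT q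
  have hr := T.le_of_opNorm_le hT r
  calc C * ‖T p‖ * ‖T q‖ * ‖T r‖ ≤ C * (a * ‖p‖) * (a * ‖q‖) * (a * ‖r‖) := by gcongr
    _ = _ := by ring

theorem DiffBound₁.comp_clm (h : DiffBound₁ C f) (S : F →L[ℝ] G) (hS : ‖S‖ ≤ 1) :
    DiffBound₁ C (fun z => S (f z)) := by
  intro x p
  rw [← map_sub]
  exact (S.le_of_opNorm_le hS _).trans (by rw [one_mul]; exact h x p)

theorem DiffBound₂.comp_clm (h : DiffBound₂ C f) (S : F →L[ℝ] G) (hS : ‖S‖ ≤ 1) :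
    DiffBound₂ C (fun z => S (f z)) := by
  intro x p q
  simp only [← map_sub, ← map_add]
  exact (S.le_of_opNorm_le hS _).trans (by rw [one_mul]; exact h x p q)

theorem DiffBound₃.comp_clm (h : DiffBound₃ C f) (S : F →L[ℝ] G) (hS : ‖S‖ ≤ 1) :
    DiffBound₃ C (fun z => S (f z)) := by
  intro x p q r
  simp only [← map_sub, ← map_add]
  exact (S.le_of_opNorm_le hS _).trans (by rw [one_mul]; exact h x p q r)

theorem DiffBound₁.const_smul (h : DiffBound₁ C f) (ha : ‖a‖ = 1) :
    DiffBound₁ C (fun z => a • f z) := by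
  intro x p
  rw [← smul_sub, norm_smul, ha, one_mul]
  exact h x p

theorem DiffBound₂.const_smul (h : DiffBound₂ C f) (ha : ‖a‖ = 1) :
    DiffBound₂ C (fun z => a • f z) := by
  intro x p q
  simp only [← smul_sub, ← smul_add]
  rw [norm_smul, ha, one_mul]
  exact h x p q

theorem DiffBound₃.const_smul (h : DiffBound₃ C f) (ha : ‖a‖ = 1) :
    DiffBound₃ C (fun z => a • f z) := by
  intro x p q r
  simp only [← smul_sub, ← smul_add]
  rw [norm_smul, ha, one_mul]
  exact h x p q r

theorem DiffBound₁.mono (h : DiffBound₁ C f) (hb : C ≤ b) : DiffBound₁ b f := fun x p =>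
  (h x p).trans (by gcongr)

theorem DiffBound₂.mono (h : DiffBound₂ C f) (hb : C ≤ b) : DiffBound₂ b f := fun x p q =>
  (h x p q).trans (by gcongr)

theorem DiffBound₃.mono (h : DiffBound₃ C f) (hb : C ≤ b) : DiffBound₃ b f := fun x p q r =>
  (h x p q r).trans (by gcongr)

end DiffBoundComp

/-- The graph of `h` in the coordinates of `chart`. -/
def globalGraph (σ : ℝ) (h : ℝ × Y₁ → ℝ) : Set Phase :=
  {Z | eigCoord σ Z.1 = h (eigCoord (-σ) Z.1, Z.2)}

/-- The region in which the cutoff is inactive. -/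
def core (R : ℝ) : Set Phase := {Z | ‖Z.1‖ ≤ R ∧ ‖Z.2‖ ≤ R}

/-- The graph of `h` is a center-stable manifold of the system for the time direction `σ`, within
the region `core R`. -/
structure IsGlobalGraph (ε σ R C δ : ℝ) (N : Phase → Phase) (h : ℝ × Y₁ → ℝ) : Prop where
  zero : h 0 = 0
  diff₁ : DiffBound₁ (1 / 4) h
  diff₂ : DiffBound₂ C h
  diff₃ : DiffBound₃ C h
  quad : ∀ x, |h x| ≤ C * δ * ‖x‖ + C * ‖x‖ ^ 2
  contains : ∀ u, IsSolution ε N {t | 0 ≤ σ * t} u → (∀ t, 0 ≤ σ * t → u t ∈ core R) →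
    u 0 ∈ globalGraph σ h
  invariant : ∀ J u, J.OrdConnected → IsSolution ε N J u → (∀ t ∈ J, u t ∈ core R) →
    ∀ s ∈ J, u s ∈ globalGraph σ h → ∀ t ∈ J, u t ∈ globalGraph σ h

theorem opNorm_unchart_le {σ : ℝ} (hσ : σ * σ = 1) : ‖unchart σ‖ ≤ 2 :=
  ContinuousLinearMap.opNorm_le_bound _ (by norm_num) (norm_unchart_le hσ)

theorem opNorm_chart_le {σ : ℝ} (hσ : σ * σ = 1) : ‖chart σ‖ ≤ 1 :=
  ContinuousLinearMap.opNorm_le_bound _ zero_le_one fun Z => by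
    rw [one_mul]; exact norm_chart_le hσ Z

theorem norm_of_mul_self {σ : ℝ} (hσ : σ * σ = 1) : ‖σ‖ = 1 := by
  rw [Real.norm_eq_abs]
  rcases mul_self_eq_one_iff.mp hσ with rfl | rfl <;> norm_num

/-- The bound for the second and third derivatives of the center-stable graphs. -/
def graphBound (C : ℝ) : ℝ := 128 * C + 8 * (576 * (4 * C) ^ 2 + 8 * (8 * C))

theorem graphBound_nonneg {C : ℝ} (hC : 0 ≤ C) : 0 ≤ graphBound C := by
  unfold graphBound; positivity

/-- `exists_centerStable_graph` in the coordinates of `chart`; the factor `2` lost in `unchart`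
turns `1 / 64` into `1 / 32`. Inside `core R` the solutions for `N` and for its modification `G` are
the same. -/
theorem exists_isGlobalGraph {ε σ R C₁ C δ : ℝ} {N G : Phase → Phase} (hσ : σ * σ = 1)
    (h0 : G 0 = 0) (hC₁ : 0 ≤ C₁) (hC₁' : C₁ ≤ 1 / 64) (hC : 0 ≤ C) (hδ : 0 ≤ δ)
    (h₁ : DiffBound₁ C₁ G) (h₂ : DiffBound₂ C G) (h₃ : DiffBound₃ C G)
    (hq : ∀ Z, ‖G Z‖ ≤ δ * ‖Z‖ + C * ‖Z‖ ^ 2) (hNG : ∀ Z ∈ core R, N Z = G Z) :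
    ∃ h, IsGlobalGraph ε σ R (graphBound C + 16) δ N h := by
  have hT := isContractiveGroup_csGroup ε σ
  have hu := opNorm_unchart_le hσ
  have hc := opNorm_chart_le hσ
  have hn := norm_of_mul_self hσ
  have g₁ : DiffBound₁ (C₁ * 2) (chartNonlinearity σ G) :=
    ((h₁.clm_comp hC₁ _ hu).comp_clm _ hc).const_smul hn
  have g₂ : DiffBound₂ (C * 2 ^ 2) (chartNonlinearity σ G) :=
    ((h₂.clm_comp hC _ hu).comp_clm _ hc).const_smul hn
  have g₃ : DiffBound₃ (C * 2 ^ 3) (chartNonlinearity σ G) :=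
    ((h₃.clm_comp hC _ hu).comp_clm _ hc).const_smul hn
  have g0 : chartNonlinearity σ G 0 = 0 := by
    rw [chartNonlinearity, map_zero, h0, map_zero, smul_zero]
  have gq : ∀ z, ‖chartNonlinearity σ G z‖ ≤ 2 * δ * ‖z‖ + 4 * C * ‖z‖ ^ 2 := by
    intro z
    have e1 : ‖chartNonlinearity σ G z‖ ≤ ‖G (unchart σ z)‖ := by
      rw [chartNonlinearity, norm_smul, hn, one_mul]
      exact norm_chart_le hσ _
    have e2 := hq (unchart σ z)
    have e3 := norm_unchart_le hσ z
    have e4 : δ * ‖unchart σ z‖ ≤ δ * (2 * ‖z‖) := by gcongr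
    have e5 : C * ‖unchart σ z‖ ^ 2 ≤ C * (2 * ‖z‖) ^ 2 := by gcongr
    linarith
  obtain ⟨h, z, d₁, d₂, d₃, q, con, inv⟩ := exists_centerStable_graph hT g0 g₁ (by positivity)
    (by linarith) g₂ (by positivity) g₃ (by positivity) (by positivity : 0 ≤ 2 * δ)
    (by positivity : 0 ≤ 4 * C) gq
  have hgb : 0 ≤ 8 * (576 * (4 * C) ^ 2 + 8 * (8 * C)) := by positivity
  have hmild : ∀ {J : Set ℝ} {u : ℝ → Phase}, J.OrdConnected → IsSolution ε N J u →
      (∀ t ∈ J, u t ∈ core R) → IsMild (csGroup ε σ) (chartNonlinearity σ G) {t | σ * t ∈ J}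
        (fun t => chart σ (u (σ * t))) := by
    intro J u hJ hu hcore
    have hG : IsSolution ε G J u := by
      refine ⟨hu.1, fun t ht => ?_⟩
      rw [← hNG _ (hcore t ht)]
      exact hu.2 t ht
    exact hG.isMild hσ hJ h₁.continuous.continuousOn
  have hord : ∀ {J : Set ℝ}, J.OrdConnected → {t | σ * t ∈ J}.OrdConnected := by
    intro J hJ
    rcases mul_self_eq_one_iff.mp hσ with rfl | rfl
    · exact hJ.preimage_mono fun a b hab => by linarith
    · exact hJ.preimage_anti fun a b hab => by linarith
  have hστ : ∀ τ, σ * (σ * τ) = τ := fun τ => by rw [← mul_assoc, hσ, one_mul]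
  have b₂ : 32 * (C * 2 ^ 2) ≤ graphBound C + 16 := by
    unfold graphBound; linarith
  have b₃ : 8 * (576 * (C * 2 ^ 2) ^ 2 + 8 * (C * 2 ^ 3)) ≤ graphBound C + 16 := by
    unfold graphBound
    have : 0 ≤ 128 * C := by positivity
    rw [show C * 2 ^ 2 = 4 * C by ring, show C * 2 ^ 3 = 8 * C by ring]; linarith
  have bq : ∀ x : ℝ × Y₁, |h x| ≤ (graphBound C + 16) * δ * ‖x‖ + (graphBound C + 16) * ‖x‖ ^ 2 := by
    intro x
    refine (q x).trans ?_
    have : 0 ≤ δ * ‖x‖ := by positivity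
    have e1 : 8 * (2 * δ) * ‖x‖ ≤ (graphBound C + 16) * δ * ‖x‖ := by
      have := mul_nonneg (graphBound_nonneg hC) this
      linarith
    have e2 : 16 * (4 * C) * ‖x‖ ^ 2 ≤ (graphBound C + 16) * ‖x‖ ^ 2 := by
      unfold graphBound
      gcongr
      linarith
    exact add_le_add e1 e2
  have hcon : ∀ u : ℝ → Phase, IsSolution ε N {t | 0 ≤ σ * t} u →
      (∀ t, 0 ≤ σ * t → u t ∈ core R) → u 0 ∈ globalGraph σ h := by
    intro u hu hcore
    have hJ : {t | 0 ≤ σ * t}.OrdConnected := hord (J := Ici 0) ordConnected_Ici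
    have hm := hmild hJ hu hcore
    have e : {t | σ * t ∈ {t | 0 ≤ σ * t}} = Ici 0 := by
      ext t
      change 0 ≤ σ * (σ * t) ↔ 0 ≤ t
      rw [hστ]
    rw [e] at hm
    have hb : ∀ t, 0 ≤ t → ‖chart σ (u (σ * t))‖ ≤ R := fun t ht => by
      have := hcore (σ * t) (by rw [hστ]; exact ht)
      exact (norm_chart_le hσ _).trans (max_le this.1 this.2)
    have := con _ hm ⟨R, hb⟩
    rw [mul_zero] at this
    exact this
  have hinv : ∀ (J : Set ℝ) (u : ℝ → Phase), J.OrdConnected → IsSolution ε N J u →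
      (∀ t ∈ J, u t ∈ core R) → ∀ s ∈ J, u s ∈ globalGraph σ h →
      ∀ t ∈ J, u t ∈ globalGraph σ h := by
    intro J u hJ hu hcore s hs hgs t ht
    have hmem : ∀ τ ∈ J, σ * τ ∈ {t | σ * t ∈ J} := fun τ hτ => by
      change σ * (σ * τ) ∈ J
      rwa [hστ]
    have := inv _ _ (hord hJ) (hmild hJ hu hcore) (σ * s) (hmem s hs)
      (by rw [hστ]; exact hgs) (σ * t) (hmem t ht)
    rw [hστ] at this
    exact this
  exact ⟨h, z, d₁, d₂.mono b₂, d₃.mono b₃, bq, hcon, hinv⟩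

/-- A closed set which propagates along a curve inside an open region propagates along the curve,
if the curve cannot leave the region through it. -/
theorem propagate_of_local {P : Type*} [TopologicalSpace P] {I : Set ℝ} (hI : I.OrdConnected)
    {u : ℝ → P} (hu : ContinuousOn u I) {U M : Set P} (hU : IsOpen U) (hM : IsClosed M)
    (hMU : ∀ t ∈ I, u t ∈ M → u t ∈ U)
    (hloc : ∀ J ⊆ I, J.OrdConnected → (∀ t ∈ J, u t ∈ U) → ∀ s ∈ J, u s ∈ M → ∀ t ∈ J, u t ∈ M)
    {s : ℝ} (hs : s ∈ I) (hsM : u s ∈ M) : ∀ t ∈ I, u t ∈ M := by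
  have : PreconnectedSpace I := Subtype.preconnectedSpace hI.isPreconnected
  have hc : Continuous (fun t : I => u t) := continuousOn_iff_continuous_domRestrict.mp hu
  have hcl : IsClosed {t : I | u t ∈ M} := hM.preimage hc
  -- Around a time when the curve is on `M` it stays in `U` for a short while, and there `hloc`
  -- keeps it on `M`. The set of such times is thus open and closed.
  have hop : IsOpen {t : I | u t ∈ M} := by
    rw [isOpen_iff_mem_nhds]
    intro t ht
    have h1 : {x : I | u x ∈ U} ∈ 𝓝 t := (hU.preimage hc).mem_nhds (hMU t t.2 ht)
    rw [nhds_subtype_eq_comap, Filter.mem_comap] at h1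
    obtain ⟨V, hV, hVU⟩ := h1
    obtain ⟨r, hr, hrV⟩ := Metric.mem_nhds_iff.mp hV
    rw [nhds_subtype_eq_comap, Filter.mem_comap]
    refine ⟨Metric.ball t r, Metric.ball_mem_nhds _ hr, fun x hx => ?_⟩
    refine hloc (I ∩ Metric.ball (t : ℝ) r) inter_subset_left ?_ (fun y hy => ?_) t
      ⟨t.2, Metric.mem_ball_self hr⟩ ht x ⟨x.2, hx⟩
    · rw [Real.ball_eq_Ioo]; exact hI.inter ordConnected_Ioo
    · exact hVU (show (⟨y, hy.1⟩ : I) ∈ _ from hrV hy.2)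
  have huniv := IsClopen.eq_univ ⟨hcl, hop⟩ ⟨⟨s, hs⟩, hsM⟩
  intro t ht
  have : (⟨t, ht⟩ : I) ∈ {t : I | u t ∈ M} := by rw [huniv]; trivial
  exact this

end
end KleinGordon

namespace KleinGordon
noncomputable section

open scoped ContDiff Topology

/-! ### Implicit functions with bounded differences -/

section Implicit

variable {P V : Type*} [NormedAddCommGroup P] [NormedSpace ℝ P] [NormedAddCommGroup V]
  [NormedSpace ℝ V]

theorem le_of_le_quarter_max {a b c : ℝ} (hb : 0 ≤ b) (h : a ≤ 1 / 4 * max a b + c) (hc : 0 ≤ c) :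
    a ≤ 1 / 4 * b + 4 / 3 * c := by
  rcases max_cases a b with ⟨e, h'⟩ | ⟨e, h'⟩ <;> rw [e] at h <;> linarith

/-- `p ↦ H (p, y)` is a contraction with constant `1 / 4`. Differences of its fixed point obey the
discrete chain rules for `H`, and the term with the highest difference is absorbed by the factor `1
/ 4`. -/
theorem exists_implicit [CompleteSpace P] {H : P × V → P} {C : ℝ} (hC : 0 ≤ C)
    (h₁ : DiffBound₁ (1 / 4) H) (h₂ : DiffBound₂ C H) (h₃ : DiffBound₃ C H) :
    ∃ ψ : V → P, (∀ y, H (ψ y, y) = ψ y) ∧ (∀ y p, H (p, y) = p → p = ψ y) ∧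
      DiffBound₁ (1 / 4) ψ ∧ DiffBound₂ (2 * C) ψ ∧ DiffBound₃ (24 * C ^ 2 + 2 * C) ψ := by
  have hd : ∀ z w, ‖H z - H w‖ ≤ 1 / 4 * ‖z - w‖ := fun z w => by
    have := h₁ w (z - w)
    rwa [add_sub_cancel] at this
  have hcon : ∀ y, ContractingWith (1 / 4 : NNReal) fun p => H (p, y) := by
    intro y
    refine ⟨by rw [← NNReal.coe_lt_coe]; norm_num, LipschitzWith.of_dist_le_mul fun p q => ?_⟩
    rw [dist_eq_norm, dist_eq_norm]
    refine (hd _ _).trans_eq ?_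
    rw [Prod.mk_sub_mk, sub_self, Prod.norm_def, norm_zero, max_eq_left (norm_nonneg _)]
    norm_num
  set ψ : V → P := fun y => (hcon y).fixedPoint with hψ
  have hfix : ∀ y, H (ψ y, y) = ψ y := fun y => (hcon y).fixedPoint_isFixedPt
  have d₁ : DiffBound₁ (1 / 4) ψ := by
    intro y a
    have := hd (ψ (y + a), y + a) (ψ y, y)
    rw [hfix, hfix, Prod.mk_sub_mk, add_sub_cancel_left, Prod.norm_def] at this
    have := le_of_le_quarter_max (norm_nonneg a) (c := 0) (by rwa [add_zero]) le_rfl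
    simpa using this
  have dU : ∀ y a, ‖((ψ (y + a), y + a) : P × V) - (ψ y, y)‖ ≤ ‖a‖ := by
    intro y a
    rw [Prod.mk_sub_mk, add_sub_cancel_left]
    exact max_le ((d₁ y a).trans (by linarith [norm_nonneg a])) le_rfl
  have d₂' : ∀ y a b, ‖ψ (y + a + b) - ψ (y + a) - ψ (y + b) + ψ y‖ ≤ 4 / 3 * C * ‖a‖ * ‖b‖ := by
    intro y a b
    have key := norm_secondDiff_comp_le h₁ h₂ (ψ y, y) (ψ (y + a), y + a) (ψ (y + b), y + b)
      (ψ (y + a + b), y + a + b)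
    rw [hfix, hfix, hfix, hfix] at key
    have e : ((ψ (y + a + b), y + a + b) : P × V) - (ψ (y + a), y + a) - (ψ (y + b), y + b)
        + (ψ y, y) = (ψ (y + a + b) - ψ (y + a) - ψ (y + b) + ψ y, 0) :=
      Prod.ext rfl (by simp only [Prod.mk_sub_mk, Prod.mk_add_mk]; abel)
    rw [e, Prod.norm_def, norm_zero] at key
    have hab : C * ‖((ψ (y + a), y + a) : P × V) - (ψ y, y)‖
        * ‖((ψ (y + b), y + b) : P × V) - (ψ y, y)‖ ≤ C * ‖a‖ * ‖b‖ := by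
      have := dU y a
      have := dU y b
      gcongr
    have := le_of_le_quarter_max le_rfl (key.trans (add_le_add_right hab _)) (by positivity)
    linarith
  have d₂ : DiffBound₂ (2 * C) ψ := by
    intro y a b
    refine (d₂' y a b).trans ?_
    gcongr
    linarith
  have dU₂ : ∀ y a b, ‖((ψ (y + a + b), y + a + b) : P × V) - (ψ (y + a), y + a)
      - (ψ (y + b), y + b) + (ψ y, y)‖ ≤ 2 * C * ‖a‖ * ‖b‖ := by
    intro y a b
    have e : ((ψ (y + a + b), y + a + b) : P × V) - (ψ (y + a), y + a) - (ψ (y + b), y + b)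
        + (ψ y, y) = (ψ (y + a + b) - ψ (y + a) - ψ (y + b) + ψ y, 0) :=
      Prod.ext rfl (by simp only [Prod.mk_sub_mk, Prod.mk_add_mk]; abel)
    rw [e, Prod.norm_def, norm_zero, max_eq_left (norm_nonneg _)]
    exact d₂ y a b
  refine ⟨ψ, hfix, fun y p hp => (hcon y).fixedPoint_unique hp, d₁, d₂, fun y a b c => ?_⟩
  have sw : ∀ y a b : V, y + a + b = y + b + a := fun y a b => add_right_comm y a b
  have key := norm_thirdDiff_comp_le hC hC h₁ h₂ h₃ (ψ y, y) (ψ (y + a), y + a) (ψ (y + b), y + b)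
    (ψ (y + c), y + c) (ψ (y + a + b), y + a + b) (ψ (y + a + c), y + a + c)
    (ψ (y + b + c), y + b + c) (ψ (y + a + b + c), y + a + b + c) (dU y a) (dU y b) (dU y c)
    (dU (y + b) c) (dU (y + a) c) (by rw [sw y b c]; exact dU (y + c) b) (dU₂ y a b) (dU₂ y a c)
    (dU₂ y b c)
  simp only [hfix] at key
  have e : ((ψ (y + a + b + c), y + a + b + c) : P × V) - (ψ (y + a + b), y + a + b)
      - (ψ (y + a + c), y + a + c) - (ψ (y + b + c), y + b + c) + (ψ (y + a), y + a)
      + (ψ (y + b), y + b) + (ψ (y + c), y + c) - (ψ y, y)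
      = (ψ (y + a + b + c) - ψ (y + a + b) - ψ (y + a + c) - ψ (y + b + c) + ψ (y + a) + ψ (y + b)
        + ψ (y + c) - ψ y, 0) :=
    Prod.ext rfl (by simp only [Prod.mk_sub_mk, Prod.mk_add_mk]; abel)
  rw [e, Prod.norm_def, norm_zero] at key
  -- The chain rule yields `18 C² + C`, and absorption multiplies by `4 / 3`.
  have key' := le_of_le_quarter_max le_rfl (key.trans_eq (add_assoc _ _ _)) (by positivity)
  refine key'.trans ?_
  have h1 : 0 ≤ C * (‖a‖ * ‖b‖ * ‖c‖) := by positivity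
  linarith

end Implicit

/-! ### Stable and unstable subspaces -/

theorem mem_Xs {x : X} : x ∈ Xs ↔ A x = (-1 : ℝ) • x := Module.End.mem_eigenspace_iff

theorem mem_Xu {x : X} : x ∈ Xu ↔ A x = (1 : ℝ) • x := Module.End.mem_eigenspace_iff

theorem A_eigVec {σ : ℝ} (hσ : σ * σ = 1) : A (eigVec σ) = σ • eigVec σ := by
  ext i
  rw [A_apply]
  fin_cases i
  · simp [eigVec, mul_comm]
  · simp only [eigVec, PiLp.smul_apply, smul_eq_mul, Fin.mk_one, Matrix.cons_val_one,
      Matrix.cons_val_zero]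
    linear_combination -(√2)⁻¹ * hσ

/-- The unit vector of `Xs`. -/
def es : Xs := ⟨eigVec (-1), mem_Xs.mpr (A_eigVec (by norm_num))⟩

/-- The unit vector of `Xu`. -/
def eu : Xu := ⟨eigVec 1, mem_Xu.mpr (A_eigVec (by norm_num))⟩

theorem eigCoord_Xs (a : Xs) : eigCoord 1 a = 0 := by
  have h := eigCoord_A (σ := 1) (by norm_num) a
  rw [mem_Xs.mp a.2, map_smul, smul_eq_mul] at h
  linarith

theorem eigCoord_Xu (b : Xu) : eigCoord (-1) b = 0 := by
  have h := eigCoord_A (σ := -1) (by norm_num) b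
  rw [mem_Xu.mp b.2, map_smul, smul_eq_mul] at h
  linarith

theorem norm_Xs (a : Xs) : ‖a‖ = |eigCoord (-1) (a : X)| := by
  have := norm_sq_eq_eigCoord (σ := 1) (by norm_num) (a : X)
  rw [eigCoord_Xs] at this
  rw [← abs_norm a, ← sq_eq_sq_iff_abs_eq_abs]
  change ‖(a : X)‖ ^ 2 = _
  linarith

theorem norm_Xu (b : Xu) : ‖b‖ = |eigCoord 1 (b : X)| := by
  have := norm_sq_eq_eigCoord (σ := 1) (by norm_num) (b : X)
  rw [eigCoord_Xu] at this
  rw [← abs_norm b, ← sq_eq_sq_iff_abs_eq_abs]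
  change ‖(b : X)‖ ^ 2 = _
  linarith

theorem norm_es_le : ‖es‖ ≤ 1 := norm_eigVec_le (by norm_num)

theorem norm_eu_le : ‖eu‖ ≤ 1 := norm_eigVec_le (by norm_num)

theorem eigCoord_pt_s (a : Xs) (b : Xu) (y : Y₁) :
    eigCoord (-1) (pt a b y).1 = eigCoord (-1) (a : X) := by
  change eigCoord (-1) ((a : X) + b) = _
  rw [map_add, eigCoord_Xu, add_zero]

theorem eigCoord_pt_u (a : Xs) (b : Xu) (y : Y₁) :
    eigCoord 1 (pt a b y).1 = eigCoord 1 (b : X) := by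
  change eigCoord 1 ((a : X) + b) = _
  rw [map_add, eigCoord_Xs, zero_add]

theorem eigCoord_smul_es (t : ℝ) : eigCoord (-1) ((t • es : Xs) : X) = t := by
  change eigCoord (-1) (t • eigVec (-1)) = t
  rw [map_smul, eigCoord_eigVec (by norm_num), smul_eq_mul, mul_one]

theorem eigCoord_smul_eu (t : ℝ) : eigCoord 1 ((t • eu : Xu) : X) = t := by
  change eigCoord 1 (t • eigVec 1) = t
  rw [map_smul, eigCoord_eigVec (by norm_num), smul_eq_mul, mul_one]

theorem pt_coords (Z : Phase) : pt (eigCoord (-1) Z.1 • es) (eigCoord 1 Z.1 • eu) Z.2 = Z :=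
  Prod.ext (eig_decomp (σ := 1) (by norm_num) Z.1) rfl

/-- The part of the phase space over the domain of a center-stable graph. -/
def cyl (σ r : ℝ) : Set Phase := {Z | |eigCoord (-σ) Z.1| + ‖Z.2‖ < r}

/-- The center-stable graph as a map between the invariant subspaces. -/
def liftU (h : ℝ × Y₁ → ℝ) (p : Xs × Y₁) : Xu := h (eigCoord (-1) (p.1 : X), p.2) • eu

/-- The center-unstable graph as a map between the invariant subspaces. -/
def liftS (h : ℝ × Y₁ → ℝ) (p : Xu × Y₁) : Xs := h (eigCoord 1 (p.1 : X), p.2) • es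

theorem graphCS_liftU (r : ℝ) (h : ℝ × Y₁ → ℝ) :
    graphCS r (liftU h) = globalGraph 1 h ∩ cyl 1 r := by
  ext Z
  constructor
  · rintro ⟨a, y, hr, rfl⟩
    refine ⟨?_, ?_⟩
    · change eigCoord 1 _ = h (eigCoord (-1) _, y)
      rw [eigCoord_pt_s, eigCoord_pt_u, liftU, eigCoord_smul_eu]
    · change |eigCoord (-1) _| + ‖y‖ < r
      rwa [eigCoord_pt_s, ← norm_Xs]
  · rintro ⟨h1, h2⟩
    refine ⟨eigCoord (-1) Z.1 • es, Z.2, ?_, ?_⟩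
    · rw [norm_Xs, eigCoord_smul_es]; exact h2
    · rw [liftU]
      simp only [eigCoord_smul_es]
      rw [← show eigCoord 1 Z.1 = h (eigCoord (-1) Z.1, Z.2) from h1, pt_coords]

theorem graphCU_liftS (r : ℝ) (h : ℝ × Y₁ → ℝ) :
    graphCU r (liftS h) = globalGraph (-1) h ∩ cyl (-1) r := by
  ext Z
  constructor
  · rintro ⟨b, y, hr, rfl⟩
    refine ⟨?_, ?_⟩
    · change eigCoord (-1) _ = h (eigCoord (- -1) _, y)
      rw [neg_neg, eigCoord_pt_s, eigCoord_pt_u, liftS, eigCoord_smul_es]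
    · change |eigCoord (- -1) _| + ‖y‖ < r
      rwa [neg_neg, eigCoord_pt_u, ← norm_Xu]
  · rintro ⟨h1, h2⟩
    have h2' : |eigCoord (- -1) Z.1| + ‖Z.2‖ < r := h2
    have h1' : eigCoord (-1) Z.1 = h (eigCoord (- -1) Z.1, Z.2) := h1
    rw [neg_neg] at h1' h2'
    refine ⟨eigCoord 1 Z.1 • eu, Z.2, ?_, ?_⟩
    · rw [norm_Xu, eigCoord_smul_eu]; exact h2'
    · rw [liftS]
      simp only [eigCoord_smul_eu]
      rw [← h1', pt_coords]

theorem setOf_pt_s (r : ℝ) : {Z | ∃ a b y, Z = pt a b y ∧ ‖a‖ + ‖y‖ < r} = cyl 1 r := by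
  ext Z
  constructor
  · rintro ⟨a, b, y, rfl, hr⟩
    change |eigCoord (-1) _| + ‖y‖ < r
    rwa [eigCoord_pt_s, ← norm_Xs]
  · intro hZ
    refine ⟨_, _, _, (pt_coords Z).symm, ?_⟩
    rw [norm_Xs, eigCoord_smul_es]; exact hZ

theorem setOf_pt_u (r : ℝ) : {Z | ∃ a b y, Z = pt a b y ∧ ‖b‖ + ‖y‖ < r} = cyl (-1) r := by
  ext Z
  constructor
  · rintro ⟨a, b, y, rfl, hr⟩
    change |eigCoord (- -1) _| + ‖y‖ < r
    rwa [neg_neg, eigCoord_pt_u, ← norm_Xu]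
  · intro hZ
    have hZ' : |eigCoord (- -1) Z.1| + ‖Z.2‖ < r := hZ
    rw [neg_neg] at hZ'
    refine ⟨_, _, _, (pt_coords Z).symm, ?_⟩
    rw [norm_Xu, eigCoord_smul_eu]; exact hZ'

end
end KleinGordon

namespace KleinGordon
noncomputable section

open scoped Topology

/-! ### Local center-stable and center-unstable manifolds -/

section Lift

theorem norm_fderiv_zero_le_of_quad {V W : Type*} [NormedAddCommGroup V] [NormedSpace ℝ V]
    [NormedAddCommGroup W] [NormedSpace ℝ W] {φ : V → W} {a b : ℝ} (ha : 0 ≤ a)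
    (h0 : φ 0 = 0) (h : ∀ x, ‖φ x‖ ≤ a * ‖x‖ + b * ‖x‖ ^ 2) : ‖fderiv ℝ φ 0‖ ≤ a := by
  refine le_of_forall_pos_le_add fun η hη => ?_
  refine norm_fderiv_le_of_lip' ℝ (by positivity) ?_
  have : ∀ᶠ x : V in 𝓝 0, b * ‖x‖ < η := by
    have : Filter.Tendsto (fun x : V => b * ‖x‖) (𝓝 0) (𝓝 (b * ‖(0 : V)‖)) :=
      (continuous_const.mul continuous_norm).tendsto 0
    rw [norm_zero, mul_zero] at this
    exact this.eventually_lt_const hη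
  filter_upwards [this] with x hx
  rw [h0, sub_zero, sub_zero]
  have := mul_le_mul_of_nonneg_right hx.le (norm_nonneg x)
  linarith [h x]

variable {ε σ R C δ : ℝ} {N : Phase → Phase} {h : ℝ × Y₁ → ℝ} {V W : Type*}
  [NormedAddCommGroup V] [NormedSpace ℝ V] [NormedAddCommGroup W] [NormedSpace ℝ W]

theorem IsGlobalGraph.abs_le (H : IsGlobalGraph ε σ R C δ N h) (x : ℝ × Y₁) :
    |h x| ≤ 1 / 4 * ‖x‖ := by
  have := H.diff₁ 0 x
  rwa [zero_add, H.zero, sub_zero] at this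

theorem IsGlobalGraph.mono {b : ℝ} (H : IsGlobalGraph ε σ R C δ N h) (hb : C ≤ b) (hδ : 0 ≤ δ) :
    IsGlobalGraph ε σ R b δ N h :=
  { H with
    diff₂ := H.diff₂.mono hb
    diff₃ := H.diff₃.mono hb
    quad := fun x => (H.quad x).trans (by gcongr) }

theorem IsGlobalGraph.c2BoundedOn_comp [CompleteSpace W] (H : IsGlobalGraph ε σ R C δ N h)
    (hC : 1 ≤ C) {T : V →L[ℝ] ℝ × Y₁} (hT : ‖T‖ ≤ 1) {S : ℝ →L[ℝ] W} (hS : ‖S‖ ≤ 1) {s : Set V}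
    (hs : IsOpen s) (hsC : ∀ x ∈ s, ‖x‖ ≤ C) : C2BoundedOn (fun x => S (h (T x))) s C := by
  have hC0 : 0 ≤ C := zero_le_one.trans hC
  refine c2BoundedOn_of_diffBound hs hC0 (fun x hx => ?_) ?_ ?_ ?_
  · have h1 := S.le_of_opNorm_le hS (h (T x))
    have h2 := H.abs_le (T x)
    have h3 := T.le_of_opNorm_le hT x
    have h4 := hsC x hx
    rw [Real.norm_eq_abs] at h1
    linarith
  · exact ((H.diff₁.clm_comp (by norm_num) T hT).comp_clm S hS).mono (by linarith)
  · exact ((H.diff₂.clm_comp hC0 T hT).comp_clm S hS).mono (by rw [one_pow, mul_one])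
  · exact ((H.diff₃.clm_comp hC0 T hT).comp_clm S hS).mono (by rw [one_pow, mul_one])

theorem IsGlobalGraph.norm_fderiv_comp_le (H : IsGlobalGraph ε σ R C δ N h) (hC : 0 ≤ C)
    (hδ : 0 ≤ δ) {T : V →L[ℝ] ℝ × Y₁} (hT : ‖T‖ ≤ 1) {S : ℝ →L[ℝ] W} (hS : ‖S‖ ≤ 1) :
    ‖fderiv ℝ (fun x => S (h (T x))) 0‖ ≤ C * δ := by
  refine norm_fderiv_zero_le_of_quad (b := C) (mul_nonneg hC hδ) (by rw [map_zero, H.zero, map_zero])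
    fun x => ?_
  have h1 := S.le_of_opNorm_le hS (h (T x))
  have h3 := T.le_of_opNorm_le hT x
  rw [one_mul] at h1 h3
  refine (h1.trans (H.quad (T x))).trans ?_
  gcongr

/-- The linear coordinates on `Xs × Y₁`. -/
def coordS : Xs × Y₁ →L[ℝ] ℝ × Y₁ :=
  (((eigCoord (-1)).comp Xs.subtypeL).comp (ContinuousLinearMap.fst ℝ Xs Y₁)).prod
    (ContinuousLinearMap.snd ℝ Xs Y₁)

/-- The linear coordinates on `Xu × Y₁`. -/
def coordU : Xu × Y₁ →L[ℝ] ℝ × Y₁ :=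
  (((eigCoord 1).comp Xu.subtypeL).comp (ContinuousLinearMap.fst ℝ Xu Y₁)).prod
    (ContinuousLinearMap.snd ℝ Xu Y₁)

theorem norm_coordS_le : ‖coordS‖ ≤ 1 :=
  ContinuousLinearMap.opNorm_le_bound _ zero_le_one fun p => by
    rw [one_mul]
    refine max_le ?_ (le_max_right _ _)
    exact (norm_Xs p.1).symm.le.trans (le_max_left _ _)

theorem norm_coordU_le : ‖coordU‖ ≤ 1 :=
  ContinuousLinearMap.opNorm_le_bound _ zero_le_one fun p => by
    rw [one_mul]
    refine max_le ?_ (le_max_right _ _)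
    exact (norm_Xu p.1).symm.le.trans (le_max_left _ _)

theorem norm_toSpanSingleton_le {x : W} (hx : ‖x‖ ≤ 1) :
    ‖ContinuousLinearMap.toSpanSingleton ℝ x‖ ≤ 1 := by
  rwa [ContinuousLinearMap.norm_toSpanSingleton]

theorem isOpen_setOf_norm_add_lt {r : ℝ} : IsOpen {p : V × W | ‖p.1‖ + ‖p.2‖ < r} :=
  isOpen_lt (by fun_prop) continuous_const

theorem norm_le_of_norm_add_lt {r : ℝ} (hr : r ≤ C) :
    ∀ p ∈ {p : V × W | ‖p.1‖ + ‖p.2‖ < r}, ‖p‖ ≤ C := by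
  intro p hp
  have hp' : ‖p.1‖ + ‖p.2‖ < r := hp
  have h1 := norm_nonneg p.1
  have h2 := norm_nonneg p.2
  exact max_le (by linarith) (by linarith)

instance : CompleteSpace Xs := FiniteDimensional.complete ℝ Xs

instance : CompleteSpace Xu := FiniteDimensional.complete ℝ Xu

theorem IsGlobalGraph.c2BoundedOn_liftU (H : IsGlobalGraph ε σ R C δ N h) (hC : 1 ≤ C) {r : ℝ}
    (hr : r ≤ C) : C2BoundedOn (liftU h) {p | ‖p.1‖ + ‖p.2‖ < r} C :=
  H.c2BoundedOn_comp hC norm_coordS_le (norm_toSpanSingleton_le norm_eu_le) isOpen_setOf_norm_add_lt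
    (norm_le_of_norm_add_lt hr)

theorem IsGlobalGraph.c2BoundedOn_liftS (H : IsGlobalGraph ε σ R C δ N h) (hC : 1 ≤ C) {r : ℝ}
    (hr : r ≤ C) : C2BoundedOn (liftS h) {p | ‖p.1‖ + ‖p.2‖ < r} C :=
  H.c2BoundedOn_comp hC norm_coordU_le (norm_toSpanSingleton_le norm_es_le) isOpen_setOf_norm_add_lt
    (norm_le_of_norm_add_lt hr)

theorem IsGlobalGraph.norm_fderiv_liftU_le (H : IsGlobalGraph ε σ R C δ N h) (hC : 0 ≤ C)
    (hδ : 0 ≤ δ) : ‖fderiv ℝ (liftU h) 0‖ ≤ C * δ :=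
  H.norm_fderiv_comp_le hC hδ norm_coordS_le (norm_toSpanSingleton_le norm_eu_le)

theorem IsGlobalGraph.norm_fderiv_liftS_le (H : IsGlobalGraph ε σ R C δ N h) (hC : 0 ≤ C)
    (hδ : 0 ≤ δ) : ‖fderiv ℝ (liftS h) 0‖ ≤ C * δ :=
  H.norm_fderiv_comp_le hC hδ norm_coordU_le (norm_toSpanSingleton_le norm_es_le)

end Lift

section LocalManifolds

variable {ε σ R C δ r K : ℝ} {N : Phase → Phase} {h : ℝ × Y₁ → ℝ}

theorem IsSolution.mono {I J : Set ℝ} {u : ℝ → Phase} (hu : IsSolution ε N I u) (hJ : J ⊆ I) :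
    IsSolution ε N J u :=
  ⟨hu.1.mono hJ, fun t ht => (hu.2 t (hJ ht)).mono hJ⟩

theorem isClosed_globalGraph (hh : Continuous h) : IsClosed (globalGraph σ h) :=
  isClosed_eq ((eigCoord σ).continuous.comp continuous_fst)
    (hh.comp (((eigCoord (-σ)).continuous.comp continuous_fst).prodMk continuous_snd))

theorem isOpen_prodBall : IsOpen {Z : Phase | ‖Z.1‖ < R ∧ ‖Z.2‖ < R} :=
  (isOpen_lt continuous_fst.norm continuous_const).inter
    (isOpen_lt continuous_snd.norm continuous_const)

/-- On the graph the remaining coordinate is at most a quarter of the others, so a cylinder of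
radius `r` cuts out a bounded piece of it. -/
theorem IsGlobalGraph.norm_add_lt (H : IsGlobalGraph ε σ R C δ N h) (hσ : σ * σ = 1) {Z : Phase}
    (hZ : Z ∈ globalGraph σ h) (hr : Z ∈ cyl σ r) : ‖Z.1‖ + ‖Z.2‖ < 2 * r := by
  have h1 := H.abs_le (eigCoord (-σ) Z.1, Z.2)
  rw [← show eigCoord σ Z.1 = h (eigCoord (-σ) Z.1, Z.2) from hZ] at h1
  have h2 := norm_le_eigCoord hσ Z.1
  have h3 : |eigCoord (-σ) Z.1| + ‖Z.2‖ < r := hr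
  have h4 : ‖((eigCoord (-σ) Z.1, Z.2) : ℝ × Y₁)‖ ≤ |eigCoord (-σ) Z.1| + ‖Z.2‖ :=
    max_le (le_add_of_nonneg_right (norm_nonneg _)) (le_add_of_nonneg_left (abs_nonneg _))
  have h5 := norm_nonneg Z.2
  have h6 := abs_nonneg (eigCoord (-σ) Z.1)
  linarith

theorem IsGlobalGraph.subset_phaseBall (H : IsGlobalGraph ε σ R C δ N h) (hσ : σ * σ = 1)
    (hr : 2 * r ≤ K) : globalGraph σ h ∩ cyl σ r ⊆ phaseBall K :=
  fun _ hZ => (H.norm_add_lt hσ hZ.1 hZ.2).trans_le hr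

theorem mem_core_of_phaseBall (hr : r ≤ R) {Z : Phase} (hZ : Z ∈ phaseBall r) : Z ∈ core R := by
  have h : ‖Z.1‖ + ‖Z.2‖ < r := hZ
  have h1 := norm_nonneg Z.1
  have h2 := norm_nonneg Z.2
  exact ⟨by linarith, by linarith⟩

theorem mem_cyl_of_phaseBall (hσ : σ * σ = 1) {Z : Phase} (hZ : Z ∈ phaseBall r) :
    Z ∈ cyl σ r := by
  have h : ‖Z.1‖ + ‖Z.2‖ < r := hZ
  have h1 := abs_eigCoord_le (σ := -σ) (by linarith) Z.1
  change |eigCoord (-σ) Z.1| + ‖Z.2‖ < r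
  linarith

/-- The region may contain points where the cutoff is active. As long as a solution is on the graph
it lies in the open part of the core, however, so it cannot leave the core through the graph, and
`propagate_of_local` applies. -/
theorem IsGlobalGraph.locallyInvariant (H : IsGlobalGraph ε σ R C δ N h) (hσ : σ * σ = 1)
    (hr : 2 * r ≤ R) :
    LocallyInvariant ε N (phaseBall K ∩ cyl σ r) (globalGraph σ h ∩ cyl σ r) := by
  intro I u hI h0 hu hU hM t ht
  refine ⟨propagate_of_local hI hu.1 isOpen_prodBall (isClosed_globalGraph H.diff₁.continuous)
    (fun t ht hm => ?_) (fun J hJ hJc hJU s hs hsM => H.invariant J u hJc (hu.mono hJ)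
      (fun t ht => ⟨(hJU t ht).1.le, (hJU t ht).2.le⟩) s hs hsM) h0 hM.1 t ht, (hU t ht).2⟩
  have h := H.norm_add_lt hσ hm (hU t ht).2
  have h1 := norm_nonneg (u t).1
  have h2 := norm_nonneg (u t).2
  exact ⟨by linarith, by linarith⟩

theorem IsGlobalGraph.mem_of_orbit (H : IsGlobalGraph ε σ R C δ N h) (hσ : σ * σ = 1)
    (hr : r ≤ R) {u : ℝ → Phase} (hu : IsSolution ε N {t | 0 ≤ σ * t} u)
    (hub : ∀ t, 0 ≤ σ * t → u t ∈ phaseBall r) : u 0 ∈ globalGraph σ h ∩ cyl σ r :=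
  ⟨H.contains u hu fun t ht => mem_core_of_phaseBall hr (hub t ht),
    mem_cyl_of_phaseBall hσ (hub 0 (by rw [mul_zero]))⟩

theorem Ici_zero_eq : Ici (0 : ℝ) = {t | 0 ≤ (1 : ℝ) * t} := by ext t; simp

theorem Iic_zero_eq : Iic (0 : ℝ) = {t | 0 ≤ (-1 : ℝ) * t} := by ext t; simp

theorem IsGlobalGraph.isLocalCenterStable (H : IsGlobalGraph ε 1 R C δ N h) (hC : 1 ≤ C)
    (hrC : r ≤ C) (hr : 2 * r ≤ R) (hr0 : 0 ≤ r) (hRK : R ≤ K) :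
    IsLocalCenterStable K ε N r (liftU h) where
  zero := by
    change h (eigCoord (-1) ((0 : Xs) : X), (0 : Y₁)) • eu = 0
    rw [ZeroMemClass.coe_zero, map_zero, ← Prod.zero_eq_mk, H.zero, zero_smul]
  contDiffOn := (H.c2BoundedOn_liftU hC hrC).1
  subset := by
    rw [graphCS_liftU]
    exact H.subset_phaseBall (by norm_num) (hr.trans hRK)
  invariant := by
    rw [setOf_pt_s, graphCS_liftU]
    exact H.locallyInvariant (by norm_num) hr
  contains := by
    rw [graphCS_liftU, Ici_zero_eq]
    exact fun u hu hub => H.mem_of_orbit (by norm_num) (by linarith) hu hub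

theorem IsGlobalGraph.isLocalCenterUnstable (H : IsGlobalGraph ε (-1) R C δ N h) (hC : 1 ≤ C)
    (hrC : r ≤ C) (hr : 2 * r ≤ R) (hr0 : 0 ≤ r) (hRK : R ≤ K) :
    IsLocalCenterUnstable K ε N r (liftS h) where
  zero := by
    change h (eigCoord 1 ((0 : Xu) : X), (0 : Y₁)) • es = 0
    rw [ZeroMemClass.coe_zero, map_zero, ← Prod.zero_eq_mk, H.zero, zero_smul]
  contDiffOn := (H.c2BoundedOn_liftS hC hrC).1
  subset := by
    rw [graphCU_liftS]
    exact H.subset_phaseBall (by norm_num) (hr.trans hRK)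
  invariant := by
    rw [setOf_pt_u, graphCU_liftS]
    exact H.locallyInvariant (by norm_num) hr
  contains := by
    rw [graphCU_liftS, Iic_zero_eq]
    exact fun u hu hub => H.mem_of_orbit (by norm_num) (by linarith) hu hub

end LocalManifolds

/-! ### The center manifold -/

section Center

variable {V E F : Type*} [NormedAddCommGroup V] [NormedSpace ℝ V] [NormedAddCommGroup E]
  [NormedSpace ℝ E] [NormedAddCommGroup F] [NormedSpace ℝ F] {f : V → E} {g : V → F} {C : ℝ}

theorem DiffBound₁.prodMk (hf : DiffBound₁ C f) (hg : DiffBound₁ C g) :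
    DiffBound₁ C (fun x => (f x, g x)) := fun x a => max_le (hf x a) (hg x a)

theorem DiffBound₂.prodMk (hf : DiffBound₂ C f) (hg : DiffBound₂ C g) :
    DiffBound₂ C (fun x => (f x, g x)) := fun x a b => max_le (hf x a b) (hg x a b)

theorem DiffBound₃.prodMk (hf : DiffBound₃ C f) (hg : DiffBound₃ C g) :
    DiffBound₃ C (fun x => (f x, g x)) := fun x a b c => max_le (hf x a b c) (hg x a b c)

/-- The map `((a, b), y) ↦ (b, y)`. -/
def selR : (ℝ × ℝ) × Y₁ →L[ℝ] ℝ × Y₁ :=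
  ((ContinuousLinearMap.snd ℝ ℝ ℝ).comp (ContinuousLinearMap.fst ℝ (ℝ × ℝ) Y₁)).prod
    (ContinuousLinearMap.snd ℝ (ℝ × ℝ) Y₁)

/-- The map `((a, b), y) ↦ (a, y)`. -/
def selL : (ℝ × ℝ) × Y₁ →L[ℝ] ℝ × Y₁ :=
  ((ContinuousLinearMap.fst ℝ ℝ ℝ).comp (ContinuousLinearMap.fst ℝ (ℝ × ℝ) Y₁)).prod
    (ContinuousLinearMap.snd ℝ (ℝ × ℝ) Y₁)

theorem norm_selR_le : ‖selR‖ ≤ 1 :=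
  ContinuousLinearMap.opNorm_le_bound _ zero_le_one fun p => by
    rw [one_mul]
    exact max_le ((norm_snd_le p.1).trans (norm_fst_le p)) (norm_snd_le p)

theorem norm_selL_le : ‖selL‖ ≤ 1 :=
  ContinuousLinearMap.opNorm_le_bound _ zero_le_one fun p => by
    rw [one_mul]
    exact max_le ((norm_fst_le p.1).trans (norm_fst_le p)) (norm_snd_le p)

/-- The embedding of the coordinates into `Xs × Xu`. -/
def embSU : ℝ × ℝ →L[ℝ] Xs × Xu :=
  (ContinuousLinearMap.toSpanSingleton ℝ es).prodMap (ContinuousLinearMap.toSpanSingleton ℝ eu)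

theorem norm_embSU_le : ‖embSU‖ ≤ 1 :=
  ContinuousLinearMap.opNorm_le_bound _ zero_le_one fun p => by
    have h1 := (ContinuousLinearMap.toSpanSingleton ℝ es).le_of_opNorm_le
      (norm_toSpanSingleton_le norm_es_le) p.1
    have h2 := (ContinuousLinearMap.toSpanSingleton ℝ eu).le_of_opNorm_le
      (norm_toSpanSingleton_le norm_eu_le) p.2
    rw [one_mul] at h1 h2 ⊢
    exact max_le (h1.trans (norm_fst_le p)) (h2.trans (norm_snd_le p))

variable {ε R δ r K : ℝ} {N : Phase → Phase} {hu hs : ℝ × Y₁ → ℝ}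

/-- The bound for the derivatives of the center manifolds. -/
def centerBound (C : ℝ) : ℝ := 24 * C ^ 2 + 2 * C

/-- The center manifold is the intersection of the two graphs, found by solving for the stable and
unstable coordinates in terms of `y`. Both are at most `‖y‖ / 4`, so for `‖y‖ < r / 2` the point
lies over the domains of both graphs; hence the smaller radius. -/
theorem exists_isLocalCenter (Hu : IsGlobalGraph ε 1 R C δ N hu)
    (Hs : IsGlobalGraph ε (-1) R C δ N hs) (hC : 1 ≤ C) (hδ : 0 ≤ δ) (hr : 2 * r ≤ R)
    (hrC : r ≤ C) (hr0 : 0 ≤ r) (hRK : R ≤ K) :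
    ∃ Ψ : Y₁ → Xs × Xu, IsLocalCenter K ε N (r / 2) Ψ ∧
      C2BoundedOn Ψ (Metric.ball 0 (r / 2)) (centerBound C) ∧ ‖fderiv ℝ Ψ 0‖ ≤ C * δ ∧
      graphC (r / 2) Ψ = {Z ∈ graphCS r (liftU hu) ∩ graphCU r (liftS hs) | ‖Z.2‖ < r / 2} := by
  have hC0 : 0 ≤ C := zero_le_one.trans hC
  -- The stable coordinate is prescribed by the unstable one and vice versa, so a fixed point of `H
  -- (·, y)` is a point on both graphs.
  let H : (ℝ × ℝ) × Y₁ → ℝ × ℝ := fun p => (hs (selR p), hu (selL p))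
  have H₁ : DiffBound₁ (1 / 4) H :=
    ((Hs.diff₁.clm_comp (by norm_num) selR norm_selR_le).prodMk
      (Hu.diff₁.clm_comp (by norm_num) selL norm_selL_le)).mono (by norm_num)
  have H₂ : DiffBound₂ C H :=
    ((Hs.diff₂.clm_comp hC0 selR norm_selR_le).prodMk
      (Hu.diff₂.clm_comp hC0 selL norm_selL_le)).mono (by rw [one_pow, mul_one])
  have H₃ : DiffBound₃ C H :=
    ((Hs.diff₃.clm_comp hC0 selR norm_selR_le).prodMk
      (Hu.diff₃.clm_comp hC0 selL norm_selL_le)).mono (by rw [one_pow, mul_one])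
  obtain ⟨ψ, hfix, huniq, d₁, d₂, d₃⟩ := exists_implicit hC0 H₁ H₂ H₃
  have ψ0 : ψ 0 = 0 := by
    refine (huniq 0 0 ?_).symm
    change (hs (selR 0), hu (selL 0)) = 0
    rw [map_zero, map_zero, Hs.zero, Hu.zero, Prod.zero_eq_mk]
  have hψ : ∀ y, ‖ψ y‖ ≤ 1 / 4 * ‖y‖ := by
    intro y
    have := d₁ 0 y
    rwa [zero_add, ψ0, sub_zero] at this
  have hnorm : ∀ y, ‖((ψ y, y) : (ℝ × ℝ) × Y₁)‖ ≤ ‖y‖ := fun y =>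
    max_le ((hψ y).trans (by linarith [norm_nonneg y])) le_rfl
  have hquad : ∀ y, ‖ψ y‖ ≤ C * δ * ‖y‖ + C * ‖y‖ ^ 2 := by
    intro y
    rw [← hfix y]
    have n1 := (selR.le_of_opNorm_le norm_selR_le (ψ y, y)).trans
      ((one_mul _).le.trans (hnorm y))
    have n2 := (selL.le_of_opNorm_le norm_selL_le (ψ y, y)).trans
      ((one_mul _).le.trans (hnorm y))
    exact max_le ((Hs.quad _).trans (by gcongr)) ((Hu.quad _).trans (by gcongr))
  have hgraph : ∀ Z : Phase, Z ∈ globalGraph 1 hu ∩ globalGraph (-1) hs ↔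
      ψ Z.2 = (eigCoord (-1) Z.1, eigCoord 1 Z.1) := by
    intro Z
    constructor
    · rintro ⟨h1, h2⟩
      have h2' : eigCoord (-1) Z.1 = hs (eigCoord (- -1) Z.1, Z.2) := h2
      rw [neg_neg] at h2'
      have h1' : eigCoord 1 Z.1 = hu (eigCoord (-1) Z.1, Z.2) := h1
      exact (huniq Z.2 (eigCoord (-1) Z.1, eigCoord 1 Z.1) (Prod.ext h2'.symm h1'.symm)).symm
    · intro h
      have := hfix Z.2
      rw [h] at this
      refine ⟨(congrArg Prod.snd this).symm, ?_⟩
      change eigCoord (-1) Z.1 = hs (eigCoord (- -1) Z.1, Z.2)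
      rw [neg_neg]
      exact (congrArg Prod.fst this).symm
  have hcoord : ∀ Z : Phase, ψ Z.2 = (eigCoord (-1) Z.1, eigCoord 1 Z.1) →
      |eigCoord (-1) Z.1| ≤ 1 / 4 * ‖Z.2‖ ∧ |eigCoord 1 Z.1| ≤ 1 / 4 * ‖Z.2‖ := by
    intro Z h
    have := hψ Z.2
    rw [h] at this
    exact ⟨(norm_fst_le _).trans this, (norm_snd_le _).trans this⟩
  have hsmall : ∀ Z : Phase, ψ Z.2 = (eigCoord (-1) Z.1, eigCoord 1 Z.1) →
      ‖Z.1‖ ≤ 1 / 2 * ‖Z.2‖ := by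
    intro Z h
    obtain ⟨h1, h2⟩ := hcoord Z h
    have := norm_le_eigCoord (σ := 1) (by norm_num) Z.1
    linarith
  have hset : graphC (r / 2) (fun y => embSU (ψ y))
      = globalGraph 1 hu ∩ globalGraph (-1) hs ∩ {Z | ‖Z.2‖ < r / 2} := by
    ext Z
    constructor
    · rintro ⟨y, hy, rfl⟩
      refine ⟨(hgraph _).mpr ?_, hy⟩
      rw [eigCoord_pt_s, eigCoord_pt_u]
      exact Prod.ext (eigCoord_smul_es _).symm (eigCoord_smul_eu _).symm
    · rintro ⟨hZ, hy⟩
      refine ⟨Z.2, hy, ?_⟩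
      simp only [(hgraph Z).mp hZ]
      exact (pt_coords Z).symm
  have hcl : IsClosed (globalGraph 1 hu ∩ globalGraph (-1) hs) :=
    (isClosed_globalGraph Hu.diff₁.continuous).inter (isClosed_globalGraph Hs.diff₁.continuous)
  have hCC : C ≤ centerBound C := by
    have := sq_nonneg C
    rw [centerBound]; linarith
  have hreg : C2BoundedOn (fun y => embSU (ψ y)) (Metric.ball 0 (r / 2)) (centerBound C) := by
    have h0 : 0 ≤ centerBound C := hC0.trans hCC
    refine c2BoundedOn_of_diffBound Metric.isOpen_ball h0 (fun y hy => ?_)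
      ((d₁.comp_clm embSU norm_embSU_le).mono (by linarith))
      ((d₂.comp_clm embSU norm_embSU_le).mono ?_) (d₃.comp_clm embSU norm_embSU_le)
    · have h1 := embSU.le_of_opNorm_le norm_embSU_le (ψ y)
      have h2 := hψ y
      have h3 := mem_ball_zero_iff.mp hy
      linarith
    · have := sq_nonneg C
      rw [centerBound]; linarith
  refine ⟨fun y => embSU (ψ y), ⟨?_, hreg.1, ?_, ?_, ?_⟩, hreg, ?_, ?_⟩
  · simp only [ψ0, map_zero]
  · rw [hset]
    rintro Z ⟨hZ, hy⟩
    have h1 := hsmall Z ((hgraph Z).mp hZ)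
    have h2 : ‖Z.2‖ < r / 2 := hy
    change ‖Z.1‖ + ‖Z.2‖ < K
    linarith
  · rw [hset]
    intro I u hI h0 hsol hU hM t ht
    refine ⟨propagate_of_local hI hsol.1 (isOpen_prodBall (R := R)) hcl (fun t ht hm => ?_)
      (fun J hJ hJc hJU s hs hsM t ht => ?_) h0 hM.1 t ht, (hU t ht).2⟩
    · have h1 := hsmall _ ((hgraph _).mp hm)
      have h2 : ‖(u t).2‖ < r / 2 := (hU t ht).2
      exact ⟨by linarith, by linarith⟩
    · have hc : ∀ t ∈ J, u t ∈ core R := fun t ht => ⟨(hJU t ht).1.le, (hJU t ht).2.le⟩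
      exact ⟨Hu.invariant J u hJc (hsol.mono hJ) hc s hs hsM.1 t ht,
        Hs.invariant J u hJc (hsol.mono hJ) hc s hs hsM.2 t ht⟩
  · rw [hset]
    intro u hsol hub
    have hc : ∀ t, u t ∈ core R := fun t => mem_core_of_phaseBall (by linarith) (hub t)
    refine ⟨⟨Hu.contains u (hsol.mono (subset_univ _)) fun t _ => hc t,
      Hs.contains u (hsol.mono (subset_univ _)) fun t _ => hc t⟩, ?_⟩
    have h : ‖(u 0).1‖ + ‖(u 0).2‖ < r / 2 := hub 0
    change ‖(u 0).2‖ < r / 2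
    linarith [norm_nonneg (u 0).1]
  · refine norm_fderiv_zero_le_of_quad (b := C) (mul_nonneg hC0 hδ) (by rw [ψ0, map_zero]) fun y => ?_
    exact (embSU.le_of_opNorm_le norm_embSU_le (ψ y)).trans ((one_mul _).le.trans (hquad y))
  · rw [hset, graphCS_liftU, graphCU_liftS]
    ext Z
    constructor
    · rintro ⟨hZ, hy⟩
      have h2 : ‖Z.2‖ < r / 2 := hy
      obtain ⟨h3, h4⟩ := hcoord Z ((hgraph Z).mp hZ)
      refine ⟨⟨⟨hZ.1, ?_⟩, hZ.2, ?_⟩, hy⟩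
      · change |eigCoord (-1) Z.1| + ‖Z.2‖ < r
        linarith
      · change |eigCoord (- -1) Z.1| + ‖Z.2‖ < r
        rw [neg_neg]
        linarith
    · rintro ⟨⟨hZ1, hZ2⟩, hy⟩
      exact ⟨⟨hZ1.1, hZ2.1⟩, hy⟩

end Center

end
end KleinGordon

namespace KleinGordon
noncomputable section

open scoped ContDiff Topology

/-! ### Uniform existence of the local manifolds -/

theorem C2BoundedOn.mono {V W : Type*} [NormedAddCommGroup V] [NormedSpace ℝ V]
    [NormedAddCommGroup W] [NormedSpace ℝ W] {φ : V → W} {s : Set V} {a b : ℝ}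
    (h : C2BoundedOn φ s a) (hab : a ≤ b) : C2BoundedOn φ s b :=
  ⟨h.1, fun x hx i hi => (h.2 x hx i hi).trans hab⟩

theorem HasAlmostInvariantForm.mono {K a b ε α : ℝ} {N : Phase → Phase}
    (h : HasAlmostInvariantForm K a ε α N) (hab : a ≤ b) (hε : 0 ≤ ε) :
    HasAlmostInvariantForm K b ε α N := by
  have hm : a * ε ≤ b * ε := mul_le_mul_of_nonneg_right hab hε
  obtain ⟨Ft, Gbar, Gt, h1, h2, h3, h4, h5, h6, h7, h8⟩ := h
  exact ⟨Ft, Gbar, Gt, h1, h2.mono hab, h3.mono hab, h4.mono hm, h5, h6, h7.trans hm, h8.trans hm⟩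

theorem IsAlmostInvariant.smoothField {K M ε α : ℝ} {n : CX × CV → CX × CV}
    (h : IsAlmostInvariant (3 * K / 2) M ε α n) (hK : 0 < K) (hM : 0 ≤ M) :
    SmoothField K (derivBound K M) (M * ε) (realMap n) where
  K_pos := hK
  D_nonneg := by rw [derivBound]; positivity
  smooth _ hZ := h.contDiffAt_realMap hK hZ
  bound _ hZ _ hi := h.norm_iteratedFDeriv_realMap_le hK hM hZ hi
  zero := h.realMap_zero
  fderiv_le := h.norm_fderiv_realMap_le hK

theorem SmoothField.exists_isGlobalGraph {K D δ ε σ R B : ℝ} {N : Phase → Phase}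
    (h : SmoothField K D δ N) (hσ : σ * σ = 1) (hR : 0 < R) (hRK : 4 * R < K) (hB : 1 ≤ B)
    (hBb : ∀ i ≤ 3, ∀ Z, ‖iteratedFDeriv ℝ i (phaseCutoff R) Z‖ ≤ R * (B * R⁻¹ ^ i))
    (hδ : 0 ≤ δ) (hsmall : (δ + D * (2 * R)) * B ≤ 1 / 64) :
    ∃ g, IsGlobalGraph ε σ R (graphBound (6 * D * (B * (1 + R⁻¹)) ^ 3) + 16) δ N g := by
  have hD := h.D_nonneg
  have hsm := h.contDiff_cutoff hR hRK
  have h₁ := h.diffBound₁_cutoff hR hRK hBb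
  have h₂ := diffBound₂_of_iteratedFDeriv (mod_cast contDiff_infty.mp hsm 2)
    (h.norm_iteratedFDeriv_cutoff_le hR hRK hB hBb (by norm_num))
  have h₃ := diffBound₃_of_iteratedFDeriv (mod_cast contDiff_infty.mp hsm 3)
    (h.norm_iteratedFDeriv_cutoff_le hR hRK hB hBb (le_refl 3))
  have hC₁ : 0 ≤ (δ + D * (2 * R)) * B := by positivity
  have hC : 0 ≤ 6 * D * (B * (1 + R⁻¹)) ^ 3 := by positivity
  exact KleinGordon.exists_isGlobalGraph hσ (h.cutoff_zero hR) hC₁ hsmall hC hδ h₁ h₂ h₃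
    (h.norm_cutoff_le hR hC₁ hC h₁ h₂)
    fun Z hZ => by rw [Function.comp_apply, phaseCutoff_of_le hR hZ.1 hZ.2]

/-- The local center-stable, center-unstable and center manifolds of a system, with uniform
bounds. -/
structure HasLocalManifolds (K ε r r' C : ℝ) (N : Phase → Phase) (hu : Xs × Y₁ → Xu)
    (hs : Xu × Y₁ → Xs) (Ψ : Y₁ → Xs × Xu) : Prop where
  centerStable : IsLocalCenterStable K ε N r' hu
  hu_bounded : C2BoundedOn hu {p | ‖p.1‖ + ‖p.2‖ < r'} C
  hu_fderiv : ‖fderiv ℝ hu 0‖ ≤ C * ε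
  centerUnstable : IsLocalCenterUnstable K ε N r' hs
  hs_bounded : C2BoundedOn hs {p | ‖p.1‖ + ‖p.2‖ < r'} C
  hs_fderiv : ‖fderiv ℝ hs 0‖ ≤ C * ε
  center : IsLocalCenter K ε N r Ψ
  Ψ_bounded : C2BoundedOn Ψ (Metric.ball 0 r) C
  Ψ_fderiv : ‖fderiv ℝ Ψ 0‖ ≤ C * ε
  graph_eq : graphC r Ψ = {Z ∈ graphCS r' hu ∩ graphCU r' hs | ‖Z.2‖ < r}

theorem exists_hasLocalManifolds {K D M : ℝ} (hK : 0 < K) (hD : 0 ≤ D) (hM : 1 ≤ M) :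
    ∃ ε₁ r C : ℝ, 0 < ε₁ ∧ 0 < r ∧ 0 < C ∧ ∀ ε ∈ Ioo 0 ε₁, ∀ N, SmoothField K D (M * ε) N →
      ∃ hu hs Ψ, HasLocalManifolds K ε (r / 2) r C N hu hs Ψ := by
  obtain ⟨B, hB, hBb⟩ := exists_phaseCutoff_bound
  have hB0 : 0 < B := by linarith
  have hM0 : 0 < M := by linarith
  -- `R` depends only on `K`, `D` and `B`. It contributes `1 / 128` to the Lipschitz constant of the
  -- cut off field, and the smallness of `ε` contributes the other `1 / 128`.
  obtain ⟨R, hR, hRK, hRD⟩ : ∃ R : ℝ, 0 < R ∧ 4 * R < K ∧ D * (2 * R) * B ≤ 1 / 128 := by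
    refine ⟨min (K / 8) (1 / (256 * B * (D + 1))), by positivity, ?_, ?_⟩
    · linarith [min_le_left (K / 8) (1 / (256 * B * (D + 1)))]
    · have h := min_le_right (K / 8) (1 / (256 * B * (D + 1)))
      generalize min (K / 8) (1 / (256 * B * (D + 1))) = R at h
      rw [le_div_iff₀ (by positivity)] at h
      have hneg : R * B ≤ 1 / 256 / (D + 1) := by
        rw [le_div_iff₀ (by positivity)]; linarith
      have h2 : D * (1 / 256 / (D + 1)) ≤ 1 / 256 := by
        rw [mul_div_assoc', div_le_iff₀ (by positivity)]; linarith
      have := mul_le_mul_of_nonneg_left hneg hD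
      linarith
  set E := graphBound (6 * D * (B * (1 + R⁻¹)) ^ 3) + 16 with hE
  have hE1 : 16 ≤ E := by
    have := graphBound_nonneg (C := 6 * D * (B * (1 + R⁻¹)) ^ 3) (by positivity)
    linarith
  have hE' : E + R ≤ centerBound (E + R) := by
    rw [centerBound]
    linarith [sq_nonneg (E + R)]
  have hCM : E ≤ centerBound (E + R) * M := by
    have : centerBound (E + R) * 1 ≤ centerBound (E + R) * M :=
      mul_le_mul_of_nonneg_left hM (by linarith)
    linarith
  have hmul : centerBound (E + R) ≤ centerBound (E + R) * M :=
    le_mul_of_one_le_right (by linarith) hM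
  refine ⟨1 / (128 * M * B), R / 2, centerBound (E + R) * M, by positivity, by positivity,
    mul_pos (by linarith) hM0, fun ε hε N h => ?_⟩
  have hδ : 0 ≤ M * ε := mul_nonneg hM0.le hε.1.le
  have hsmall : (M * ε + D * (2 * R)) * B ≤ 1 / 64 := by
    have := hε.2.le
    rw [le_div_iff₀ (by positivity)] at this
    linarith
  obtain ⟨gu, hgu⟩ := h.exists_isGlobalGraph (ε := ε) (σ := 1) (by norm_num) hR hRK hB (hBb R hR)
    hδ hsmall
  obtain ⟨gs, hgs⟩ := h.exists_isGlobalGraph (ε := ε) (σ := -1) (by norm_num) hR hRK hB (hBb R hR)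
    hδ hsmall
  rw [← hE] at hgu hgs
  replace hgu := hgu.mono (b := E + R) (by linarith) hδ
  replace hgs := hgs.mono (b := E + R) (by linarith) hδ
  have h1 : 1 ≤ E + R := by linarith
  have h2 : 0 ≤ E + R := by linarith
  have hfd : (E + R) * (M * ε) ≤ centerBound (E + R) * M * ε := by
    rw [← mul_assoc]
    exact mul_le_mul_of_nonneg_right (mul_le_mul_of_nonneg_right hE' hM0.le) hε.1.le
  obtain ⟨Ψ, hΨ, hΨb, hΨd, hΨg⟩ := exists_isLocalCenter (r := R / 2) (K := K) hgu hgs h1 hδ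
    (by linarith) (by linarith) (by linarith) (by linarith)
  exact ⟨liftU gu, liftS gs, Ψ,
    hgu.isLocalCenterStable h1 (by linarith) (by linarith) (by linarith) (by linarith),
    (hgu.c2BoundedOn_liftU h1 (by linarith)).mono (hE'.trans hmul),
    (hgu.norm_fderiv_liftU_le h2 hδ).trans hfd,
    hgs.isLocalCenterUnstable h1 (by linarith) (by linarith) (by linarith) (by linarith),
    (hgs.c2BoundedOn_liftS h1 (by linarith)).mono (hE'.trans hmul),
    (hgs.norm_fderiv_liftS_le h2 hδ).trans hfd,
    hΨ, hΨb.mono hmul, hΨd.trans hfd, hΨg⟩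

end
end KleinGordon

/-! ### Assembly of the theorem. -/

open KleinGordon in
theorem theorem4p9 (f : ℝ → ℝ) (hodd : ∀ u, f (-u) = -f u) (han : AnalyticAt ℝ f 0)
    (hf1 : deriv f 0 = 0) (hf3 : 0 < iteratedDeriv 3 f 0) (K : ℝ) (hK : 0 < K) :
    ∃ K₁ c ε₀ r r' C : ℝ, 0 < K₁ ∧ 0 < c ∧ 0 < ε₀ ∧ 2 * ε₀ ≤ c ∧ 0 < r ∧ r ≤ r' ∧ 0 < C ∧
    ∃ (N Φ : ℝ → ℕ → Phase → Phase) (hu : ℝ → Xs × Y₁ → Xu) (hs : ℝ → Xu × Y₁ → Xs)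
      (Ψ : ℝ → Y₁ → Xs × Xu),
    ∀ ε ∈ Set.Ioo 0 ε₀,
      -- the system obtained after the normal form transformations up to order `[c / ε]`
      IsNormalFormChain f K K₁ ε ⌊c / ε⌋₊ (N ε) (Φ ε) ∧
      K < nfRadius K K₁ ε ⌊c / ε⌋₊ ∧
      HasAlmostInvariantForm K C ε (-(c * Real.log (√2)) / ε) (N ε ⌊c / ε⌋₊) ∧
      -- its local center-stable and center-unstable manifolds
      IsLocalCenterStable K ε (N ε ⌊c / ε⌋₊) r' (hu ε) ∧
      C2BoundedOn (hu ε) {p | ‖p.1‖ + ‖p.2‖ < r'} C ∧ ‖fderiv ℝ (hu ε) 0‖ ≤ C * ε ∧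
      IsLocalCenterUnstable K ε (N ε ⌊c / ε⌋₊) r' (hs ε) ∧
      C2BoundedOn (hs ε) {p | ‖p.1‖ + ‖p.2‖ < r'} C ∧ ‖fderiv ℝ (hs ε) 0‖ ≤ C * ε ∧
      -- its local center manifold
      IsLocalCenter K ε (N ε ⌊c / ε⌋₊) r (Ψ ε) ∧
      C2BoundedOn (Ψ ε) (Metric.ball 0 r) C ∧
      Ψ ε 0 = 0 ∧ ‖fderiv ℝ (Ψ ε) 0‖ ≤ C * ε ∧
      graphC r (Ψ ε) = {Z ∈ graphCS r' (hu ε) ∩ graphCU r' (hs ε) | ‖Z.2‖ < r} := by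
  obtain ⟨K₁, c, ε₀, M, N, Φ, n, hK₁, hc, hε₀, hεc, hM, -, hchain⟩ :=
    exists_normalFormChain hodd han hf1 hK
  have hM0 : 0 ≤ M := zero_le_one.trans hM
  have hD : 0 ≤ derivBound K M := by rw [derivBound]; positivity
  obtain ⟨ε₁, r, C, hε₁, hr, hC, hman⟩ := exists_hasLocalManifolds (K := K) hK hD hM
  -- The maps must be functions of every real `ε`; outside the admissible interval they are set to
  -- zero.
  have key : ∀ ε, ∃ hu hs Ψ, ε ∈ Ioo 0 (min ε₀ ε₁) →
      HasLocalManifolds K ε (r / 2) r C (N ε ⌊c / ε⌋₊) hu hs Ψ := by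
    intro ε
    by_cases hε : ε ∈ Ioo 0 (min ε₀ ε₁)
    · obtain ⟨-, -, he, hinv⟩ := hchain ε ⟨hε.1, hε.2.trans_le (min_le_left _ _)⟩
      obtain ⟨hu, hs, Ψ, h⟩ := hman ε ⟨hε.1, hε.2.trans_le (min_le_right _ _)⟩ _
        (hinv.smoothField hK hM0)
      exact ⟨hu, hs, Ψ, fun _ => he ▸ h⟩
    · exact ⟨0, 0, 0, fun h => absurd h hε⟩
  choose hu hs Ψ hfin using key
  -- The center-stable and center-unstable graphs have radius `r`, the center manifold `r / 2`. The
  -- constant `C + derivBound K M` serves the manifolds and the almost invariant form at once.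
  refine ⟨K₁, c, min ε₀ ε₁, r / 2, r, C + derivBound K M, hK₁, hc, lt_min hε₀ hε₁,
    (mul_le_mul_of_nonneg_left (min_le_left _ _) zero_le_two).trans hεc, by positivity,
    by linarith, by positivity, N, Φ, hu, hs, Ψ, fun ε hε => ?_⟩
  obtain ⟨hch, hrad, he, hinv⟩ := hchain ε ⟨hε.1, hε.2.trans_le (min_le_left _ _)⟩
  have h := hfin ε hε
  have hCC : C ≤ C + derivBound K M := le_add_of_nonneg_right hD
  have hCε : C * ε ≤ (C + derivBound K M) * ε := mul_le_mul_of_nonneg_right hCC hε.1.le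
  refine ⟨hch, hrad, ?_, h.centerStable, h.hu_bounded.mono hCC, h.hu_fderiv.trans hCε,
    h.centerUnstable, h.hs_bounded.mono hCC, h.hs_fderiv.trans hCε, h.center,
    h.Ψ_bounded.mono hCC, h.center.zero, h.Ψ_fderiv.trans hCε, h.graph_eq⟩
  rw [he]
  exact (hinv.hasAlmostInvariantForm hK hM0 hε.1).mono (le_add_of_nonneg_left hC.le) hε.1.le
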